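/- **Graphs.** A graph over alphabets $\Sigma$ (node labels) and $\Gamma$ (edge labels) is a finite directed graph without loops, with nodes labelled in $\Sigma$ and edge set $E\subseteq V\times\Gamma\times V$. A *string graph* is a graph with node labels $N$ (node-vertices) and $W$ (wire-vertices) and a single (plain) edge label, in which no edge joins two node-vertices and every wire-vertex has in-degree and out-degree at most $1$. Its *inputs* (*outputs*) are the wire-vertices without incoming (outgoing) edges; these form the boundary. A *closed wire* is a chain of vertices whose endpoints are node-vertices or boundary vertices and whose other vertices (its *interior*) are wire-vertices. A full subgraph $O$ of a string graph $G$ is *open* if $\mathrm{In}(G\setminus O)\subseteq \mathrm{In}(G)$ and $\mathrm{Out}(G\setminus O)\subseteq\mathrm{Out}(G)$. **!-graphs.** A *!-graph* $H$ is a string graph with a finite partially ordered set $!(H)$ of *!-boxes* and an open subgraph $B(b)$ for each $b\in\,!(H)$, such that $b\le b'$ ($b$ is *nested* in $b'$) implies $B(b)\subseteq B(b')$. $\mathrm{KILL}_b(H)$ removes $B(b)$ and all !-boxes $c\le b$. $\mathrm{EXPAND}_b(H)$ glues to $H$ a second copy of $H$ from which only the !-box $b$ (not its contents, nor the !-boxes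 nested in it) has been removed, identifying the two copies along $\mathrm{KILL}_b(H)$; so it adds a fresh copy of $B(b)$ together with fresh copies of the !-boxes strictly below $b$. The *language* of $H$ is the set of isomorphism classes of string graphs (!-graphs with no !-boxes) obtained from $H$ by finite sequences of these operations. $H$ has *trivial overlap* if for any two !-boxes $b_1,b_2$, neither nested in the other, $B(b_1)\cap B(b_2)$ consists only of interiors of closed wires having one endpoint a node-vertex in $B(b_1)\setminus B(b_2)$ and the other a node-vertex in $B(b_2)\setminus B(b_1)$, and no !-box with nonempty contents is nested in both $b_1$ and $b_2$. $\mathbf{BGTO}$ is the set of languages of !-graphs with trivial overlap. **Grammars.** An *edNCE grammar* $(\Sigma,\Delta,\Gamma,\Omega,P,S)$ has finite alphabets $\Delta\subseteq\Sigma$ of (terminal) node labels and $\Omega\subseteq\Gamma$ of (final) edge labels, an initial nonterminal $S\in\Sigma\setminus\Delta$ and a finite set $P$ of productions $X\to(D,C)$ with $X\in\Sigma\setminus\Delta$, $D$ a graph over $\Sigma,\Gamma$ and $C\subseteq\Sigma\times\Gamma\times\Gamma\times V_D\times\{in,out\}$ a set of connection instructions. A derivation step replaces a node $v$ labelled $X$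 by a disjoint copy of $D$; for every $(\sigma,\beta/\gamma,x,in)\in C$ and every edge $(w,\beta,v)$ with $w$ labelled $\sigma$ an edge $(w,\gamma,x)$ is created, and similarly, for instructions with $out$ and edges $(v,\beta,w)$, an edge $(x,\gamma,w)$. Sentential forms are the graphs derived from a single node labelled $S$; the language is the set of isomorphism classes of sentential forms with labels in $\Delta,\Omega$ only. The grammar is *linear* (LIN-edNCE) if every $D$ has at most one node with a nonterminal label. It is in *!-linear form* if, for a family $\alpha_1,\alpha_2,\dots$ of non-final edge labels: (1) it is linear; (2) there is exactly one final production (right-hand side without nonterminal node), and that right-hand side is the empty graph; (3) in every sentential form with a nonterminal node $x$, every terminal vertex is joined to $x$ in both directions by edges with a common label $\alpha_i$, and all edges between $x$ and terminal vertices have labels among the $\alpha_i$; (4) every production except the final one has connection instructions passing incoming and outgoing edges labelled $\alpha_i$, for each $\alpha_i\in\Gamma$, from terminal vertices on to its nonterminal node, again with some label $\alpha_j$ ($j$ the same for both directions); (5) for every $i$, at most one terminal vertex in all the productions is incident to an edge labelled $\alpha_i$. **Wire-encoding.** A graph language $L$ equals a language $L'$ of string graphs *up to wire-encoding* if, for some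 lengths $\ell_k\ge 1$ attached to special edge labels $\beta_k$, there is a bijection $f:L\to L'$ such that for every $K\in L$ all $\beta_k$-labelled edges of $K$ join node-vertices, and $f(K)$ is obtained from $K$ by replacing every $\beta_k$-labelled edge by a directed closed wire with $\ell_k$ interior wire-vertices from the source to the target of the edge. **Theorem.** There is a computable function which maps any (finite description of a) !-graph $H$ with trivial overlap to (a finite description of) a LIN-edNCE grammar $G$ in !-linear form such that the language of $G$ equals the language of $H$ up to wire-encoding. Consequently, every language in $\mathbf{BGTO}$ equals, up to wire-encoding, the language of some LIN-edNCE grammar. -/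

import Mathlib

namespace BangGraphs

/-! ### Labels -/

/-- Node labels: node-vertices `N`, wire-vertices `W`, and a supply of further labels
(used as nonterminals of grammars). -/
inductive NodeLabel where
  | N
  | W
  | other (k : ℕ)
  deriving DecidableEq

/-- Edge labels: the plain label (the label of all edges of string graphs), the labels `α i`
and the special labels `β k`. -/
inductive EdgeLabel where
  | plain
  | alpha (i : ℕ)
  | beta (k : ℕ)
  deriving DecidableEq

/-- Direction of a connection instruction. -/
inductive Dir where
  | inward
  | outward
  deriving DecidableEq

/-! ### Graphs -/

/-- A directed graph without loops, with node labels in `S` and edge labels in `Γ`; there is at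
most one edge with a given source, label and target. -/
structure LGraph (S Γ V : Type) where
  edge : V → Γ → V → Prop
  irrefl : ∀ v γ, ¬ edge v γ v
  label : V → S

namespace LGraph

variable {S Γ V V₁ V₂ : Type}

/-- Isomorphism of labelled graphs. -/
def IsIso (G : LGraph S Γ V₁) (H : LGraph S Γ V₂) : Prop :=
  ∃ e : V₁ ≃ V₂, (∀ x γ y, G.edge x γ y ↔ H.edge (e x) γ (e y)) ∧ ∀ x, G.label x = H.label (e x)

theorem IsIso.refl (G : LGraph S Γ V₁) : G.IsIso G :=
  ⟨Equiv.refl _, fun _ _ _ => Iff.rfl, fun _ => rfl⟩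

theorem IsIso.symm {G : LGraph S Γ V₁} {H : LGraph S Γ V₂} (h : G.IsIso H) : H.IsIso G := by
  obtain ⟨e, he, hl⟩ := h
  exact ⟨e.symm, fun x γ y => by simp [he], fun x => by simp [hl]⟩

theorem IsIso.trans {V₃ : Type} {G : LGraph S Γ V₁} {H : LGraph S Γ V₂} {K : LGraph S Γ V₃}
    (h : G.IsIso H) (k : H.IsIso K) : G.IsIso K := by
  obtain ⟨e, he, hl⟩ := h
  obtain ⟨d, hd, hm⟩ := k
  exact ⟨e.trans d, fun x γ y => by simp [he, hd], fun x => by simp [hl, hm]⟩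

/-- The graph belongs to `GR` over the given alphabets. -/
def IsOver (G : LGraph S Γ V) (A : Set S) (B : Set Γ) : Prop :=
  (∀ v, G.label v ∈ A) ∧ ∀ x γ y, G.edge x γ y → γ ∈ B

end LGraph

/-- A finite labelled graph. -/
structure FinGraph (S Γ : Type) where
  V : Type
  finite : Finite V
  graph : LGraph S Γ V

instance FinGraph.setoid (S Γ : Type) : Setoid (FinGraph S Γ) where
  r G H := G.graph.IsIso H.graph
  iseqv := ⟨fun G => LGraph.IsIso.refl G.graph, fun h => h.symm, fun h k => h.trans k⟩

/-- Isomorphism classes of finite labelled graphs. -/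
def IsoClass (S Γ : Type) : Type 1 := Quotient (FinGraph.setoid S Γ)

/-- `K` is the isomorphism class of `G`. -/
def IsClassOf {S Γ V : Type} (K : IsoClass S Γ) (G : LGraph S Γ V) : Prop :=
  ∃ F : FinGraph S Γ, Quotient.mk _ F = K ∧ G.IsIso F.graph

/-! ### String graphs -/

namespace LGraph

variable {V : Type}

/-- The graph `G` over `NodeLabel`, `EdgeLabel` is a string graph. -/
structure IsStringGraph (G : LGraph NodeLabel EdgeLabel V) : Prop where
  label_mem : ∀ v, G.label v = NodeLabel.N ∨ G.label v = NodeLabel.W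
  edge_plain : ∀ x γ y, G.edge x γ y → γ = EdgeLabel.plain
  not_node_node : ∀ x γ y, G.edge x γ y → ¬ (G.label x = NodeLabel.N ∧ G.label y = NodeLabel.N)
  in_degree : ∀ w, G.label w = NodeLabel.W →
    ∀ x y γ δ, G.edge x γ w → G.edge y δ w → x = y
  out_degree : ∀ w, G.label w = NodeLabel.W →
    ∀ x y γ δ, G.edge w γ x → G.edge w δ y → x = y

/-- `w` is an input of `G ∖ O`. -/
def IsInputOff (G : LGraph NodeLabel EdgeLabel V) (O : Set V) (w : V) : Prop :=
  w ∉ O ∧ G.label w = NodeLabel.W ∧ ∀ x γ, x ∉ O → ¬ G.edge x γ w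

/-- `w` is an output of `G ∖ O`. -/
def IsOutputOff (G : LGraph NodeLabel EdgeLabel V) (O : Set V) (w : V) : Prop :=
  w ∉ O ∧ G.label w = NodeLabel.W ∧ ∀ x γ, x ∉ O → ¬ G.edge w γ x

/-- `w` is an input or an output of `G`. -/
def IsBoundary (G : LGraph NodeLabel EdgeLabel V) (w : V) : Prop :=
  G.IsInputOff ∅ w ∨ G.IsOutputOff ∅ w

/-- The full subgraph on `O` is open. -/
def IsOpenSub (G : LGraph NodeLabel EdgeLabel V) (O : Set V) : Prop :=
  (∀ w, G.IsInputOff O w → G.IsInputOff ∅ w) ∧ ∀ w, G.IsOutputOff O w → G.IsOutputOff ∅ w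

/-- The chain `x, ws, y` is a closed wire with endpoints `x`, `y` and interior `ws`. By the
degree conditions on wire-vertices a wire is directed; it is traversed from source to target. -/
def IsClosedWire (G : LGraph NodeLabel EdgeLabel V) (x : V) (ws : List V) (y : V) : Prop :=
  (G.label x = NodeLabel.N ∨ G.IsBoundary x) ∧ (G.label y = NodeLabel.N ∨ G.IsBoundary y) ∧
  (∀ w ∈ ws, G.label w = NodeLabel.W) ∧ ws.Nodup ∧
  List.IsChain (fun u v => G.edge u EdgeLabel.plain v) (x :: (ws ++ [y]))

end LGraph

/-! ### !-graphs -/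

/-- The data of a !-graph with vertices `V` and !-boxes `B`: a graph, the nesting relation of the
!-boxes, and the vertex set of the full subgraph in each !-box. -/
structure BangData (V B : Type) where
  graph : LGraph NodeLabel EdgeLabel V
  le : B → B → Prop
  content : B → Set V

namespace BangData

variable {V B : Type}

/-- The data form a !-graph. -/
structure IsBangGraph (H : BangData V B) : Prop where
  string : H.graph.IsStringGraph
  le_refl : ∀ b, H.le b b
  le_trans : ∀ a b c, H.le a b → H.le b c → H.le a c
  le_antisymm : ∀ a b, H.le a b → H.le b a → a = b
  content_open : ∀ b, H.graph.IsOpenSub (H.content b)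
  content_mono : ∀ a b, H.le a b → H.content a ⊆ H.content b

/-- `KILL_b`: remove `b`, the !-boxes nested in it, and its contents. -/
def kill (H : BangData V B) (b : B) :
    BangData {v : V // v ∉ H.content b} {c : B // ¬ H.le c b} where
  graph :=
    { edge := fun x γ y => H.graph.edge x.1 γ y.1
      irrefl := fun x γ => H.graph.irrefl x.1 γ
      label := fun x => H.graph.label x.1 }
  le := fun c d => H.le c.1 d.1
  content := fun c => {v | v.1 ∈ H.content c.1}

/-- `EXPAND_b`: glue to `H` a second copy of `H` without the !-box `b`, along `KILL_b`. Thus `b`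
stays, and a fresh copy `Sum.inr` of the contents of `b` is added, together with a fresh copy of
each !-box nested in (and different from) `b`; every other !-box `d` also receives the copies of
the vertices in `d` and `b`. -/
def expand (H : BangData V B) (b : B) :
    BangData (V ⊕ {v : V // v ∈ H.content b}) (B ⊕ {c : B // H.le c b ∧ c ≠ b}) where
  graph :=
    { edge := fun x γ y =>
        match x, y with
        | .inl x, .inl y => H.graph.edge x γ y
        | .inl x, .inr y => x ∉ H.content b ∧ H.graph.edge x γ y.1
        | .inr x, .inl y => y ∉ H.content b ∧ H.graph.edge x.1 γ y
        | .inr x, .inr y => H.graph.edge x.1 γ y.1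
      irrefl := by
        rintro (x | x) γ
        · exact H.graph.irrefl x γ
        · exact H.graph.irrefl x.1 γ
      label := fun x =>
        match x with
        | .inl x => H.graph.label x
        | .inr x => H.graph.label x.1 }
  le := fun c d =>
    match c, d with
    | .inl c, .inl d => H.le c d
    | .inl _, .inr _ => False
    | .inr c, .inl d => ¬ H.le d b ∧ H.le c.1 d
    | .inr c, .inr d => H.le c.1 d.1
  content := fun c =>
    match c with
    | .inl d => {v |
        match v with
        | .inl v => v ∈ H.content d
        | .inr v => ¬ H.le d b ∧ v.1 ∈ H.content d}
    | .inr c => {v |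
        match v with
        | .inl _ => False
        | .inr v => v.1 ∈ H.content c.1}

/-- `H.Reaches K`: `K` is obtained from `H` by a finite sequence of !-box operations. -/
inductive Reaches (H : BangData V B) : {V₁ B₁ : Type} → BangData V₁ B₁ → Prop
  | refl : Reaches H H
  | kill {V₁ B₁ : Type} {K : BangData V₁ B₁} (b : B₁) : Reaches H K → Reaches H (K.kill b)
  | expand {V₁ B₁ : Type} {K : BangData V₁ B₁} (b : B₁) : Reaches H K → Reaches H (K.expand b)

/-- The language of `H`: the isomorphism classes of the concrete graphs reached from `H`. -/
def language (H : BangData V B) : Set (IsoClass NodeLabel EdgeLabel) :=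
  {C | ∃ (V₁ B₁ : Type) (K : BangData V₁ B₁), H.Reaches K ∧ IsEmpty B₁ ∧ IsClassOf C K.graph}

/-- `b₁` and `b₂` overlap trivially: what they share consists only of interiors of closed wires
from a node-vertex only in one of them to a node-vertex only in the other. In particular they do
not share a (nonempty) nested !-box. -/
def OverlapTrivially (H : BangData V B) (b₁ b₂ : B) : Prop :=
  (∀ w ∈ H.content b₁ ∩ H.content b₂, ∃ x ws y, H.graph.IsClosedWire x ws y ∧ w ∈ ws ∧
    (∀ u ∈ ws, u ∈ H.content b₁ ∩ H.content b₂) ∧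
    H.graph.label x = NodeLabel.N ∧ H.graph.label y = NodeLabel.N ∧
    ((x ∈ H.content b₁ \ H.content b₂ ∧ y ∈ H.content b₂ \ H.content b₁) ∨
      (x ∈ H.content b₂ \ H.content b₁ ∧ y ∈ H.content b₁ \ H.content b₂))) ∧
  ∀ c, H.le c b₁ → H.le c b₂ → H.content c = ∅

/-- Any two non-nested !-boxes overlap trivially. -/
def HasTrivialOverlap (H : BangData V B) : Prop :=
  ∀ b₁ b₂, ¬ H.le b₁ b₂ → ¬ H.le b₂ b₁ → H.OverlapTrivially b₁ b₂

end BangData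

/-- The set of the languages of finite !-graphs with trivial overlap. -/
def BGTO : Set (Set (IsoClass NodeLabel EdgeLabel)) :=
  {L | ∃ (V B : Type) (_ : Finite V) (_ : Finite B) (H : BangData V B),
    H.IsBangGraph ∧ H.HasTrivialOverlap ∧ L = H.language}

/-! ### edNCE grammars -/

/-- A graph with embedding; `conn σ β γ x d` is the connection instruction `(σ, β/γ, x, d)`. -/
structure EGraph (S Γ V : Type) extends LGraph S Γ V where
  conn : S → Γ → Γ → V → Dir → Prop

namespace EGraph

variable {S Γ V U : Type}

/-- The substitution of `D` for the node `v` of `H`. -/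
def subst (H : EGraph S Γ V) (v : V) (D : EGraph S Γ U) : EGraph S Γ ({x : V // x ≠ v} ⊕ U) where
  edge := fun x γ y =>
    match x, y with
    | .inl x, .inl y => H.edge x.1 γ y.1
    | .inr x, .inr y => D.edge x γ y
    | .inl w, .inr x => ∃ β, H.edge w.1 β v ∧ D.conn (H.label w.1) β γ x Dir.inward
    | .inr x, .inl w => ∃ β, H.edge v β w.1 ∧ D.conn (H.label w.1) β γ x Dir.outward
  irrefl := by
    rintro (x | x) γ
    · exact H.irrefl x.1 γ
    · exact D.irrefl x γ
  label := fun x =>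
    match x with
    | .inl x => H.label x.1
    | .inr x => D.label x
  conn := fun σ β δ x d =>
    match x with
    | .inl x => H.conn σ β δ x.1 d
    | .inr x => ∃ γ, H.conn σ β γ v d ∧ D.conn σ γ δ x d

/-- The starting graph: one node labelled `s`, no edges, no connection instructions. -/
def starting (S Γ : Type) (s : S) : EGraph S Γ Unit where
  edge := fun _ _ _ => False
  irrefl := fun _ _ h => h
  label := fun _ => s
  conn := fun _ _ _ _ _ => False

end EGraph

/-- A production `lhs → rhs`. -/
structure Production (S Γ : Type) where
  lhs : S
  size : ℕ
  rhs : EGraph S Γ (Fin size)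

/-- An edNCE grammar with finite alphabets of node labels in `S` and of edge labels in `Γ`. -/
structure EdNCE (S Γ : Type) where
  nodeLabels : Set S
  terminals : Set S
  edgeLabels : Set Γ
  finals : Set Γ
  prods : Set (Production S Γ)
  start : S
  nodeLabels_finite : nodeLabels.Finite
  edgeLabels_finite : edgeLabels.Finite
  prods_finite : prods.Finite
  terminals_subset : terminals ⊆ nodeLabels
  finals_subset : finals ⊆ edgeLabels
  start_mem : start ∈ nodeLabels \ terminals
  lhs_mem : ∀ p ∈ prods, p.lhs ∈ nodeLabels \ terminals
  rhs_over : ∀ p ∈ prods, p.rhs.IsOver nodeLabels edgeLabels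
  conn_over : ∀ p ∈ prods, ∀ σ β γ x d, p.rhs.conn σ β γ x d →
    σ ∈ nodeLabels ∧ β ∈ edgeLabels ∧ γ ∈ edgeLabels

namespace EdNCE

variable {S Γ : Type}

/-- The sentential forms: the graphs derived from the starting graph. The right-hand sides used
in a derivation are disjoint copies by construction of `EGraph.subst`. -/
inductive Sentential (G : EdNCE S Γ) : {V : Type} → EGraph S Γ V → Prop
  | start : Sentential G (EGraph.starting S Γ G.start)
  | step {V : Type} {H : EGraph S Γ V} (v : V) (p : Production S Γ) (hp : p ∈ G.prods)
      (hv : H.label v = p.lhs) : Sentential G H → Sentential G (H.subst v p.rhs)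

/-- The language of the grammar: the isomorphism classes of the derived graphs (without
connection instructions) all of whose labels are terminal, resp. final. -/
def language (G : EdNCE S Γ) : Set (IsoClass S Γ) :=
  {C | ∃ (V : Type) (H : EGraph S Γ V), G.Sentential H ∧ H.IsOver G.terminals G.finals ∧
    (∀ σ β γ x d, ¬ H.conn σ β γ x d) ∧ IsClassOf C H.toLGraph}

/-- LIN-edNCE: every right-hand side has at most one nonterminal node. -/
def IsLinear (G : EdNCE S Γ) : Prop :=
  ∀ p ∈ G.prods, ∀ x y : Fin p.size,
    p.rhs.label x ∉ G.terminals → p.rhs.label y ∉ G.terminals → x = y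

/-- A final production: its right-hand side has no nonterminal node. -/
def IsFinalProd (G : EdNCE S Γ) (p : Production S Γ) : Prop :=
  p ∈ G.prods ∧ ∀ x, p.rhs.label x ∈ G.terminals

/-- !-linear form. -/
structure IsBangLinear (G : EdNCE NodeLabel EdgeLabel) : Prop where
  alpha_not_final : ∀ i, EdgeLabel.alpha i ∉ G.finals
  linear : G.IsLinear
  /-- There is a single final production, and it is the empty graph. -/
  final_unique : ∃! p, G.IsFinalProd p
  final_empty : ∀ p, G.IsFinalProd p → p.size = 0
  /-- In a sentential form with a nonterminal node `x`, every terminal node is connected to `x`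
  in both directions with some label `α i`. -/
  connected : ∀ (V : Type) (H : EGraph NodeLabel EdgeLabel V), G.Sentential H →
    ∀ x y, H.label x ∉ G.terminals → H.label y ∈ G.terminals →
      ∃ i, H.edge x (EdgeLabel.alpha i) y ∧ H.edge y (EdgeLabel.alpha i) x
  /-- All such edges are labelled with some `α i`. -/
  connected_label : ∀ (V : Type) (H : EGraph NodeLabel EdgeLabel V), G.Sentential H →
    ∀ x y γ, H.label x ∉ G.terminals → H.label y ∈ G.terminals →
      (H.edge x γ y ∨ H.edge y γ x) → ∃ i, γ = EdgeLabel.alpha i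
  /-- Every production except the final one passes all edges labelled `α i`, in both directions,
  on to its nonterminal node, with some label `α j`. -/
  passes : ∀ p ∈ G.prods, ∀ x, p.rhs.label x ∉ G.terminals → ∀ σ ∈ G.terminals,
    ∀ i, EdgeLabel.alpha i ∈ G.edgeLabels →
      ∃ j, ∀ d, p.rhs.conn σ (EdgeLabel.alpha i) (EdgeLabel.alpha j) x d
  /-- For every `i`, at most one terminal vertex in the productions is incident to an edge
  labelled `α i`. -/
  alpha_unique : ∀ p ∈ G.prods, ∀ q ∈ G.prods, ∀ (i : ℕ) (x : Fin p.size) (y : Fin q.size),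
    p.rhs.label x ∈ G.terminals → q.rhs.label y ∈ G.terminals →
    (∃ u, p.rhs.edge x (EdgeLabel.alpha i) u ∨ p.rhs.edge u (EdgeLabel.alpha i) x) →
    (∃ u, q.rhs.edge y (EdgeLabel.alpha i) u ∨ q.rhs.edge u (EdgeLabel.alpha i) y) →
    p = q ∧ x.val = y.val

end EdNCE

/-- The set of the languages of LIN-edNCE grammars. -/
def LINedNCE : Set (Set (IsoClass NodeLabel EdgeLabel)) :=
  {L | ∃ G : EdNCE NodeLabel EdgeLabel, G.IsLinear ∧ L = G.language}

/-! ### Wire-encoding -/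

/-- The `pos`-th interior vertex of the wire that replaces the edge `src → tgt` labelled
`β idx`; the wire replacing an edge labelled `β k` has `len k` interior vertices. -/
structure WireSlot {V : Type} (len : ℕ → ℕ) (A : LGraph NodeLabel EdgeLabel V) where
  src : V
  idx : ℕ
  tgt : V
  pos : ℕ
  isEdge : A.edge src (EdgeLabel.beta idx) tgt
  pos_lt : pos < len idx

/-- Replace every edge of `A` labelled `β k` by a directed wire with `len k` interior
wire-vertices from its source to its target. -/
def wireExpand {V : Type} (len : ℕ → ℕ) (A : LGraph NodeLabel EdgeLabel V) :
    LGraph NodeLabel EdgeLabel (V ⊕ WireSlot len A) where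
  edge := fun x γ y =>
    match x, y with
    | .inl x, .inl y => A.edge x γ y ∧ ∀ k, γ ≠ EdgeLabel.beta k
    | .inl x, .inr t => γ = EdgeLabel.plain ∧ t.src = x ∧ t.pos = 0
    | .inr s, .inl y => γ = EdgeLabel.plain ∧ s.tgt = y ∧ s.pos + 1 = len s.idx
    | .inr s, .inr t => γ = EdgeLabel.plain ∧ s.src = t.src ∧ s.idx = t.idx ∧ s.tgt = t.tgt ∧
        t.pos = s.pos + 1
  irrefl := by
    rintro (x | s) γ
    · exact fun h => A.irrefl x γ h.1
    · rintro ⟨-, -, -, -, h⟩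
      omega
  label := fun x =>
    match x with
    | .inl x => A.label x
    | .inr _ => NodeLabel.W

/-- The class `D` is obtained from the class `C` by replacing every edge labelled `β k` (these
edges join node-vertices) by a closed wire with `len k` interior vertices. -/
def IsWireEncoding (len : ℕ → ℕ) (C D : IsoClass NodeLabel EdgeLabel) : Prop :=
  ∃ F : FinGraph NodeLabel EdgeLabel, Quotient.mk _ F = C ∧
    (∀ x k y, F.graph.edge x (EdgeLabel.beta k) y →
      F.graph.label x = NodeLabel.N ∧ F.graph.label y = NodeLabel.N) ∧
    IsClassOf D (wireExpand len F.graph)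

/-- `L` equals `M` up to wire-encoding, the graphs in `L` being the encoded ones. -/
def EqUpToWireEncoding (L M : Set (IsoClass NodeLabel EdgeLabel)) : Prop :=
  ∃ len : ℕ → ℕ, (∀ k, 0 < len k) ∧
    ∃ f : L ≃ M, ∀ C : L, IsWireEncoding len C.1 (f C).1

/-! ### Finite descriptions, for effectivity -/

def NodeLabel.equivSum : NodeLabel ≃ Bool ⊕ ℕ where
  toFun
    | .N => .inl false
    | .W => .inl true
    | .other k => .inr k
  invFun
    | .inl false => .N
    | .inl true => .W
    | .inr k => .other k
  left_inv := by rintro (_ | _ | _) <;> rfl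
  right_inv := by rintro ((_ | _) | _) <;> rfl

instance : Primcodable NodeLabel := Primcodable.ofEquiv _ NodeLabel.equivSum

def EdgeLabel.equivSum : EdgeLabel ≃ Unit ⊕ (ℕ ⊕ ℕ) where
  toFun
    | .plain => .inl ()
    | .alpha i => .inr (.inl i)
    | .beta k => .inr (.inr k)
  invFun
    | .inl () => .plain
    | .inr (.inl i) => .alpha i
    | .inr (.inr k) => .beta k
  left_inv := by rintro (_ | _ | _) <;> rfl
  right_inv := by rintro (_ | _ | _) <;> rfl

instance : Primcodable EdgeLabel := Primcodable.ofEquiv _ EdgeLabel.equivSum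

def Dir.equivBool : Dir ≃ Bool where
  toFun
    | .inward => false
    | .outward => true
  invFun
    | false => .inward
    | true => .outward
  left_inv := by rintro (_ | _) <;> rfl
  right_inv := by rintro (_ | _) <;> rfl

instance : Primcodable Dir := Primcodable.ofEquiv _ Dir.equivBool

/-- A finite description of a !-graph with vertices `0, …, labels.length - 1` and !-boxes
`0, …, boxes - 1`: the vertex labels, the list of edges, the list of pairs of nested !-boxes, and
the list of pairs of a !-box and a vertex in it. -/
structure BangCode where
  labels : List NodeLabel
  edges : List (ℕ × ℕ)
  boxes : ℕ
  nested : List (ℕ × ℕ)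
  inside : List (ℕ × ℕ)

def BangCode.equivProd : BangCode ≃
    List NodeLabel × List (ℕ × ℕ) × ℕ × List (ℕ × ℕ) × List (ℕ × ℕ) where
  toFun c := (c.labels, c.edges, c.boxes, c.nested, c.inside)
  invFun t := ⟨t.1, t.2.1, t.2.2.1, t.2.2.2.1, t.2.2.2.2⟩
  left_inv _ := rfl
  right_inv _ := rfl

instance : Primcodable BangCode := Primcodable.ofEquiv _ BangCode.equivProd

/-- `c` describes the !-graph `H` (up to the names of its vertices and !-boxes). -/
def BangCode.Describes (c : BangCode) {V B : Type} (H : BangData V B) : Prop :=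
  ∃ (e : V ≃ Fin c.labels.length) (d : B ≃ Fin c.boxes),
    (∀ v, H.graph.label v = c.labels.get (e v)) ∧
    (∀ x y, H.graph.edge x EdgeLabel.plain y ↔ ((e x).val, (e y).val) ∈ c.edges) ∧
    (∀ a b, H.le a b ↔ ((d a).val, (d b).val) ∈ c.nested) ∧
    ∀ b v, v ∈ H.content b ↔ ((d b).val, (e v).val) ∈ c.inside

/-- A finite description of a production: the label of the left-hand side, the node labels of the
right-hand side (whose nodes are `0, …, labels.length - 1`), its edges and its connection
instructions. -/
structure ProdCode where
  lhs : NodeLabel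
  labels : List NodeLabel
  edges : List (ℕ × EdgeLabel × ℕ)
  conn : List (NodeLabel × EdgeLabel × EdgeLabel × ℕ × Dir)

def ProdCode.equivProd : ProdCode ≃ NodeLabel × List NodeLabel × List (ℕ × EdgeLabel × ℕ) ×
    List (NodeLabel × EdgeLabel × EdgeLabel × ℕ × Dir) where
  toFun c := (c.lhs, c.labels, c.edges, c.conn)
  invFun t := ⟨t.1, t.2.1, t.2.2.1, t.2.2.2⟩
  left_inv _ := rfl
  right_inv _ := rfl

instance : Primcodable ProdCode := Primcodable.ofEquiv _ ProdCode.equivProd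

/-- The described production (loops in the list of edges are ignored). -/
def ProdCode.toProduction (c : ProdCode) : Production NodeLabel EdgeLabel where
  lhs := c.lhs
  size := c.labels.length
  rhs :=
    { edge := fun x γ y => x ≠ y ∧ (x.val, γ, y.val) ∈ c.edges
      irrefl := fun _ _ h => h.1 rfl
      label := fun x => c.labels.get x
      conn := fun σ β γ x d => (σ, β, γ, x.val, d) ∈ c.conn }

/-- A finite description of an edNCE grammar. -/
structure GrammarCode where
  nodeLabels : List NodeLabel
  terminals : List NodeLabel
  edgeLabels : List EdgeLabel
  finals : List EdgeLabel
  prods : List ProdCode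
  start : NodeLabel

def GrammarCode.equivProd : GrammarCode ≃ List NodeLabel × List NodeLabel × List EdgeLabel ×
    List EdgeLabel × List ProdCode × NodeLabel where
  toFun c := (c.nodeLabels, c.terminals, c.edgeLabels, c.finals, c.prods, c.start)
  invFun t := ⟨t.1, t.2.1, t.2.2.1, t.2.2.2.1, t.2.2.2.2.1, t.2.2.2.2.2⟩
  left_inv _ := rfl
  right_inv _ := rfl

instance : Primcodable GrammarCode := Primcodable.ofEquiv _ GrammarCode.equivProd

/-- `c` describes the grammar `G`. -/
def GrammarCode.Describes (c : GrammarCode) (G : EdNCE NodeLabel EdgeLabel) : Prop :=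
  G.nodeLabels = {s | s ∈ c.nodeLabels} ∧ G.terminals = {s | s ∈ c.terminals} ∧
  G.edgeLabels = {γ | γ ∈ c.edgeLabels} ∧ G.finals = {γ | γ ∈ c.finals} ∧
  G.prods = {p | ∃ q ∈ c.prods, q.toProduction = p} ∧ G.start = c.start

end BangGraphs

/-! Semantics. A graph in the language of a !-graph is described by a finite family of instances of
its !-boxes (`Amb`), in which the ancestors of an instance correspond one-to-one to the !-boxes
above its !-box. The vertices of the resulting graph (`conc`) are pairs of a vertex and a section:
one instance for each !-box containing the vertex, closed under ancestors. Two such pairs are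
adjacent when the vertices are and the sections agree on their common !-boxes. KILL amounts to a
!-box without instances, and EXPAND to one further instance of `b` for each choice of instances
strictly above `b`; conversely an outermost instance can be split off by an EXPAND. Hence the
language consists exactly of the concretizations (`conc_kill`, `conc_expand`, `exists_unexpand`,
`mem_language_iff`).

Encoding. A wire shared by two incomparable !-boxes is copied once for each pair of their instances.
A new instance can thus bring an unbounded number of wire-vertices, which no linear grammar creates
in one step, whereas connection instructions do create unboundedly many edges. Call a closed wire
between distinct node-vertices a link, and a link tight if it lies in no !-boxes besides those of
its endpoints, loose otherwise. Trivial overlap implies that a vertex on no tight link lies in a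
chain of !-boxes, so that it has a least one (`exists_least`) and its sections are given by single
instances. All tight links are encoded by edges `β ⟨a, t⟩`, where `a + 1` is the length and `t`
numbers parallel links.

Encoding the tight links only would not depend on the isomorphism class alone, because a loose link
may run parallel to a tight one. Therefore, with `n` the number of vertices of the !-graph, exactly
the minimum of `n` and the number of parallel links of each length is encoded (`IsCanonical`); this
includes the tight ones, of which there are at most `n`. Which loose links are taken is irrelevant,
since permutations of parallel links extend to automorphisms (`encode_iso_of_canonical`). Decoding
recovers the graph (`wireExpand_encode`), so the encoding is a bijection on classes.

Grammar. After an outermost !-box is added, the instances form a tree, which the grammar explores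
depth first, opening and closing one instance at a time. A vertex is generated with the instance of
its least !-box. The label of its edges to the nonterminal node records the vertex, its level (the
!-box of its innermost open instance) and the move that created it; the level suffices to decide
whether two sections agree (`Explores.agree_iff`). The edges encoding loose links are drawn when the
instance owning their endpoints is opened, before the loose links are met. Their number is therefore
guessed: one table of the state holds the guesses, the other the numbers still to be found. These
must be used up when the instance is closed, and a loose link may stay unencoded only if the guess
is `n`.

Soundness is `sentential_cases`, completeness `IsTarget.exists_derivation`. All searches are over
bounded lists, so the grammar is a primitive recursive function of the description. -/

namespace BangGraphs

/-! ### Families of instances and their concretizations -/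

/-- A family of box instances: the box of each instance and the relation `ile i j` that the
instance `i` is nested in, or equal to, the instance `j`. -/
structure Amb (B I : Type) where
  box : I → B
  ile : I → I → Prop

/-- The instances in `A` are closed under ancestors, and the ancestors of `i` correspond to the
boxes above the box of `i`. -/
structure Amb.WF {B I : Type} (F : Amb B I) (le : B → B → Prop) (A : Set I) : Prop where
  refl : ∀ i ∈ A, F.ile i i
  up : ∀ i ∈ A, ∀ j, F.ile i j → j ∈ A
  trans : ∀ i ∈ A, ∀ j k, F.ile i j → F.ile j k → F.ile i k
  mono : ∀ i ∈ A, ∀ j, F.ile i j → le (F.box i) (F.box j)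
  lift : ∀ i ∈ A, ∀ b, le (F.box i) b → ∃ j, F.ile i j ∧ F.box j = b
  inj : ∀ i ∈ A, ∀ j k, F.ile i j → F.ile i k → F.box j = F.box k → j = k

/-- `S` consists of one instance of each !-box containing `v`, and is closed under ancestors. -/
structure IsSec {V B I : Type} (H : BangData V B) (F : Amb B I) (A : Set I) (v : V) (S : Set I) :
    Prop where
  sub : S ⊆ A
  up : ∀ i ∈ S, ∀ j, F.ile i j → j ∈ S
  mem : ∀ i ∈ S, v ∈ H.content (F.box i)
  ex : ∀ b, v ∈ H.content b → ∃ i ∈ S, F.box i = b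
  inj : ∀ i ∈ S, ∀ j ∈ S, F.box i = F.box j → i = j

/-- Two sets of instances have the same instances of their common !-boxes. -/
def Amb.Agree {B I : Type} (F : Amb B I) (S T : Set I) : Prop :=
  ∀ i ∈ S, ∀ j ∈ T, F.box i = F.box j → i = j

/-- Vertices of the concretization. -/
abbrev CV {V B I : Type} (H : BangData V B) (F : Amb B I) (A : Set I) (D : Set V) : Type :=
  {p : V × Set I // p.1 ∈ D ∧ IsSec H F A p.1 p.2}

/-- The concrete graph given by a family of instances of the !-boxes. -/
def conc {V B I : Type} (H : BangData V B) (F : Amb B I) (A : Set I) (D : Set V) :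
    LGraph NodeLabel EdgeLabel (CV H F A D) where
  edge x γ y := H.graph.edge x.1.1 γ y.1.1 ∧ F.Agree x.1.2 y.1.2
  irrefl x γ h := H.graph.irrefl _ _ h.1
  label x := H.graph.label x.1.1

theorem isIso_of_bij {S Γ V₁ V₂ : Type} {G : LGraph S Γ V₁} {H : LGraph S Γ V₂} (f : V₁ → V₂)
    (hf : Function.Bijective f) (he : ∀ x γ y, G.edge x γ y ↔ H.edge (f x) γ (f y))
    (hl : ∀ x, G.label x = H.label (f x)) : G.IsIso H :=
  ⟨Equiv.ofBijective f hf, he, hl⟩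

/-- Transport of a concretization along an injection of instances, with a fixed set `R` of
further instances present in all sections. -/
theorem conc_iso {V B I V' B' I' : Type} {H : BangData V B} {F : Amb B I} {A : Set I} {D : Set V}
    {H' : BangData V' B'} {F' : Amb B' I'} {A' : Set I'} {D' : Set V'}
    (e : V → V') (he : Function.Injective e) (hD : ∀ v', v' ∈ D' ↔ ∃ v ∈ D, e v = v')
    (hedge : ∀ u γ v, H.graph.edge u γ v ↔ H'.graph.edge (e u) γ (e v))
    (hlab : ∀ v ∈ D, H.graph.label v = H'.graph.label (e v))
    (ι : I → I') (hι : Function.Injective ι) (R : Set I') (hR : ∀ i, ι i ∉ R)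
    (hbox : ∀ i j, F'.box (ι i) = F'.box (ι j) ↔ F.box i = F.box j)
    (hbR : ∀ i, ∀ r ∈ R, F'.box (ι i) ≠ F'.box r)
    (hRR : ∀ r ∈ R, ∀ s ∈ R, F'.box r = F'.box s → r = s)
    (hsec : ∀ v ∈ D, ∀ S', IsSec H' F' A' (e v) S' ↔ ∃ S, IsSec H F A v S ∧ S' = ι '' S ∪ R) :
    (conc H F A D).IsIso (conc H' F' A' D') := by
  have hinj : ∀ S T : Set I, ι '' S ∪ R = ι '' T ∪ R → S = T := by
    have key : ∀ S T : Set I, ι '' S ∪ R = ι '' T ∪ R → S ⊆ T := by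
      intro S T h i hi
      have : ι i ∈ ι '' T ∪ R := h ▸ Or.inl ⟨i, hi, rfl⟩
      rcases this with ⟨j, hj, hji⟩ | h
      · rwa [← hι hji]
      · exact absurd h (hR i)
    exact fun S T h => (key S T h).antisymm (key T S h.symm)
  refine isIso_of_bij (fun x => ⟨(e x.1.1, ι '' x.1.2 ∪ R), (hD _).2 ⟨_, x.2.1, rfl⟩,
    (hsec _ x.2.1 _).2 ⟨_, x.2.2, rfl⟩⟩) ⟨?_, ?_⟩ ?_ ?_
  · rintro ⟨⟨v, S⟩, hv⟩ ⟨⟨u, T⟩, hu⟩ h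
    have h1 := congrArg (fun z => z.1.1) h
    have h2 := congrArg (fun z => z.1.2) h
    have h3 := he h1
    have h4 := hinj _ _ h2
    simp only at h3 h4
    subst h3 h4
    rfl
  · rintro ⟨⟨v', S'⟩, hv'⟩
    obtain ⟨v, hv, rfl⟩ := (hD _).1 hv'.1
    obtain ⟨S, hS, rfl⟩ := (hsec v hv _).1 hv'.2
    exact ⟨⟨(v, S), hv, hS⟩, rfl⟩
  · rintro ⟨⟨v, S⟩, hv⟩ γ ⟨⟨u, T⟩, hu⟩
    refine and_congr (hedge _ _ _) ⟨?_, ?_⟩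
    · rintro h _ (⟨i, hi, rfl⟩ | hi) _ (⟨j, hj, rfl⟩ | hj) hij
      · rw [h i hi j hj ((hbox _ _).1 hij)]
      · exact absurd hij (hbR _ _ hj)
      · exact absurd hij.symm (hbR _ _ hi)
      · exact hRR _ hi _ hj hij
    · intro h i hi j hj hij
      exact hι (h _ (Or.inl ⟨i, hi, rfl⟩) _ (Or.inl ⟨j, hj, rfl⟩) ((hbox _ _).2 hij))
  · rintro ⟨⟨v, S⟩, hv⟩
    exact hlab _ hv.1

/-! ### KILL and EXPAND on families of instances -/

/-- The properties of a !-graph on which the semantics depends. -/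
structure BangData.IsNested {V B : Type} (H : BangData V B) : Prop where
  le_refl : ∀ b, H.le b b
  le_trans : ∀ a b c, H.le a b → H.le b c → H.le a c
  le_antisymm : ∀ a b, H.le a b → H.le b a → a = b
  content_mono : ∀ a b, H.le a b → H.content a ⊆ H.content b

namespace BangData

variable {V B : Type} {H : BangData V B}

theorem IsNested.kill (hH : H.IsNested) (b : B) : (H.kill b).IsNested where
  le_refl c := hH.le_refl _
  le_trans a b c := hH.le_trans _ _ _
  le_antisymm a b h k := Subtype.ext (hH.le_antisymm _ _ h k)
  content_mono a b h _ hv := hH.content_mono _ _ h hv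

theorem IsNested.expand (hH : H.IsNested) (b : B) : (H.expand b).IsNested where
  le_refl c := by
    rcases c with c | c
    · exact hH.le_refl c
    · exact hH.le_refl c.1
  le_trans x y z h k := by
    rcases x with x | x <;> rcases y with y | y <;> rcases z with z | z <;>
      simp only [BangData.expand] at h k ⊢
    · exact hH.le_trans _ _ _ h k
    · exact ⟨fun hz => h.1 (hH.le_trans _ _ _ k hz), hH.le_trans _ _ _ h.2 k⟩
    · exact ⟨k.1, hH.le_trans _ _ _ h k.2⟩
    · exact hH.le_trans _ _ _ h k
  le_antisymm x y h k := by
    rcases x with x | x <;> rcases y with y | y <;> simp only [BangData.expand] at h k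
    · rw [hH.le_antisymm _ _ h k]
    · rw [Subtype.ext (hH.le_antisymm _ _ h k)]
  content_mono x y h v hv := by
    rcases x with x | x <;> rcases y with y | y <;> rcases v with v | v <;>
      simp only [BangData.expand, Set.mem_ofPred_eq] at h hv ⊢
    · exact hH.content_mono _ _ h hv
    · exact ⟨fun hy => hv.1 (hH.le_trans _ _ _ h hy), hH.content_mono _ _ h hv.2⟩
    · exact ⟨h.1, hH.content_mono _ _ h.2 hv⟩
    · exact hH.content_mono _ _ h hv

theorem Reaches.trans {V₁ B₁ : Type} {K : BangData V₁ B₁} (h : H.Reaches K) :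
    ∀ {V₂ B₂ : Type} {L : BangData V₂ B₂}, K.Reaches L → H.Reaches L := by
  intro V₂ B₂ L hL
  induction hL with
  | refl => exact h
  | kill b _ ih => exact ih.kill b
  | expand b _ ih => exact ih.expand b

/-- Concretizations of `KILL_b H` are the concretizations of `H` without instances of `b`. -/
theorem conc_kill (hH : H.IsNested) (b : B) {I : Type} (F : Amb {c : B // ¬ H.le c b} I)
    (hF : F.WF (H.kill b).le Set.univ) :
    ∃ F' : Amb B I, F'.WF H.le Set.univ ∧
      (conc (H.kill b) F Set.univ Set.univ).IsIso (conc H F' Set.univ Set.univ) := by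
  -- A vertex in `b` would need an instance of `b` in its section, and the family has none.
  have key : ∀ v S, IsSec H ⟨fun i => (F.box i).1, F.ile⟩ Set.univ v S → v ∉ H.content b := by
    intro v S hS hv
    obtain ⟨i, hi, hib⟩ := hS.ex _ hv
    have h2 : (F.box i).1 = b := hib
    have h3 : H.le (F.box i).1 b := by rw [h2]; exact hH.le_refl b
    exact (F.box i).2 h3
  have key2 : ∀ (v : {v // v ∉ H.content b}) S,
      IsSec H ⟨fun i => (F.box i).1, F.ile⟩ Set.univ v.1 S ↔
        IsSec (H.kill b) F Set.univ v S := by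
    intro v S
    constructor
    · intro h
      refine ⟨h.sub, h.up, h.mem, fun c hc => ?_, fun i hi j hj hij => ?_⟩
      · obtain ⟨i, hi, hib⟩ := h.ex _ hc
        exact ⟨i, hi, Subtype.ext hib⟩
      · exact h.inj i hi j hj (congrArg Subtype.val hij)
    · intro h
      refine ⟨h.sub, h.up, h.mem, fun c hc => ?_, fun i hi j hj hij => ?_⟩
      · obtain ⟨i, hi, hib⟩ := h.ex ⟨c, fun hcb => v.2 (hH.content_mono _ _ hcb hc)⟩ hc
        exact ⟨i, hi, congrArg Subtype.val hib⟩
      · exact h.inj i hi j hj (Subtype.ext hij)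
  refine ⟨⟨fun i => (F.box i).1, F.ile⟩, ⟨hF.refl, hF.up, hF.trans, hF.mono, ?_, ?_⟩, ?_⟩
  · intro i hi c hc
    obtain ⟨j, hj, hjc⟩ := hF.lift i hi
      ⟨c, fun h => (F.box i).2 (hH.le_trans _ _ _ hc h)⟩ hc
    exact ⟨j, hj, congrArg Subtype.val hjc⟩
  · exact fun i hi j k hj hk h => hF.inj i hi j k hj hk (Subtype.ext h)
  · refine isIso_of_bij (fun x => ⟨(x.1.1.1, x.1.2), trivial, (key2 _ _).2 x.2.2⟩) ⟨?_, ?_⟩ ?_ ?_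
    · rintro ⟨⟨v, S⟩, hv⟩ ⟨⟨u, T⟩, hu⟩ h
      have h1 : v = u := Subtype.ext (congrArg (fun z => z.1.1) h)
      have h2 : S = T := congrArg (fun z => z.1.2) h
      subst h1 h2
      rfl
    · rintro ⟨⟨v, S⟩, hv⟩
      exact ⟨⟨(⟨v, key _ _ hv.2⟩, S), trivial, (key2 _ _).1 hv.2⟩, rfl⟩
    · rintro ⟨⟨v, S⟩, hv⟩ γ ⟨⟨u, T⟩, hu⟩
      refine and_congr Iff.rfl ?_
      simp only [Amb.Agree, ← Subtype.ext_iff]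
    · intro x
      rfl

end BangData

namespace BangData
variable {V B : Type} {H : BangData V B}

/-- A choice of instances for the !-boxes strictly above `b`. -/
structure IsAbove {I : Type} (b : B) (F : Amb (B ⊕ {c : B // H.le c b ∧ c ≠ b}) I)
    (e : Set I) : Prop where
  up : ∀ i ∈ e, ∀ j, F.ile i j → j ∈ e
  mem : ∀ i ∈ e, ∃ d, F.box i = .inl d ∧ H.le b d ∧ d ≠ b
  ex : ∀ d, H.le b d → d ≠ b → ∃ i ∈ e, F.box i = .inl d
  inj : ∀ i ∈ e, ∀ j ∈ e, F.box i = F.box j → i = j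

/-- The instances strictly above the fresh instance of `b`. -/
def above {I : Type} (b : B) (F : Amb (B ⊕ {c : B // H.le c b ∧ c ≠ b}) I) (S : Set I) : Set I :=
  {a | a ∈ S ∧ ∃ d, F.box a = .inl d ∧ H.le b d ∧ d ≠ b}

/-- Forget the distinction between the original !-boxes and their copies. -/
def origBox {b : B} : B ⊕ {c : B // H.le c b ∧ c ≠ b} → B
  | .inl d => d
  | .inr c => c.1

/-- The instances for `H` obtained from instances for `EXPAND_b H`: each choice of instances of the
!-boxes above `b` gives a further instance of `b`. -/
def expandAmb {I : Type} (b : B) (F : Amb (B ⊕ {c : B // H.le c b ∧ c ≠ b}) I) :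
    Amb B (I ⊕ {e : Set I // IsAbove b F e}) where
  box
    | .inl i => origBox (F.box i)
    | .inr _ => b
  ile
    | .inl i, .inl j => F.ile i j
    | .inl i, .inr e => (∃ c, F.box i = .inr c) ∧ e.1 = above b F {j | F.ile i j}
    | .inr e, .inl j => j ∈ e.1
    | .inr e, .inr e' => e = e'

/-- Ancestors of an instance of an original !-box are again instances of original !-boxes, so
passing to ancestors stays above `b`, and strictly above by antisymmetry. -/
theorem isAbove_above {I : Type} {b : B} {F : Amb (B ⊕ {c : B // H.le c b ∧ c ≠ b}) I}
    (hH : H.IsNested) (hF : F.WF (H.expand b).le Set.univ) {S : Set I}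
    (hup : ∀ i ∈ S, ∀ j, F.ile i j → j ∈ S)
    (hinj : ∀ i ∈ S, ∀ j ∈ S, F.box i = F.box j → i = j)
    (hex : ∀ d, H.le b d → d ≠ b → ∃ i ∈ S, F.box i = .inl d) : IsAbove b F (above b F S) where
  up := by
    rintro i ⟨hi, d, hd, hbd, hne⟩ j hij
    refine ⟨hup i hi j hij, ?_⟩
    have := hF.mono i trivial j hij
    rw [hd] at this
    rcases hj : F.box j with d' | c
    · rw [hj] at this
      exact ⟨d', rfl, hH.le_trans _ _ _ hbd this, fun h =>
        hne (hH.le_antisymm _ _ (h ▸ this) hbd)⟩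
    · rw [hj] at this
      exact this.elim
  mem := fun i hi => hi.2
  ex := by
    intro d hd hne
    obtain ⟨i, hi, hid⟩ := hex d hd hne
    exact ⟨i, ⟨hi, d, hid, hd, hne⟩, hid⟩
  inj := fun i hi j hj => hinj i hi.1 j hj.1

/-- In EXPAND_b the fresh contents of `b` lie in no copy of `b` itself, so the missing instances of
`b` have to be supplied. An instance of a copied !-box has an ancestor in every !-box strictly above
`b`; these ancestors tell which of the new instances of `b` it is nested in. -/
theorem expandAmb_wf (hH : H.IsNested) (b : B) {I : Type}
    {F : Amb (B ⊕ {c : B // H.le c b ∧ c ≠ b}) I} (hF : F.WF (H.expand b).le Set.univ) :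
    (expandAmb b F).WF H.le Set.univ where
  refl := by
    rintro (i | e) -
    · exact hF.refl i trivial
    · exact rfl
  up := fun _ _ _ _ => trivial
  trans := by
    rintro (i | e) - (j | e') (k | e'') h h' <;> simp only [expandAmb] at h h' ⊢
    · exact hF.trans i trivial _ _ h h'
    · obtain ⟨⟨c, hc⟩, h2⟩ := h'
      have hm := hF.mono i trivial _ h
      rw [hc] at hm
      rcases hi : F.box i with d | c'
      · rw [hi] at hm
        exact hm.elim
      · refine ⟨⟨c', rfl⟩, ?_⟩
        rw [h2]
        -- Both `i` and its ancestor `j` have an ancestor over each !-box strictly above `b`. By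
        -- uniqueness these are the same, so `i` and `j` determine the same choice.
        have hab := isAbove_above hH hF (S := {k | F.ile j k})
          (fun k hk l hl => hF.trans j trivial _ _ hk hl)
          (fun k hk l hl => hF.inj j trivial k l hk hl)
          (fun d hd hne => hF.lift j trivial (.inl d) (by
            rw [hc]
            exact ⟨fun h => hne (hH.le_antisymm _ _ h hd), hH.le_trans _ _ _ c.2.1 hd⟩))
        ext a
        constructor
        · rintro ⟨ha, ha2⟩
          exact ⟨hF.trans i trivial _ _ h ha, ha2⟩
        · rintro ⟨ha, d, hd, hd1, hd2⟩
          obtain ⟨a', ha', had⟩ := hab.ex d hd1 hd2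
          have : a = a' := hF.inj i trivial _ _ ha (hF.trans i trivial _ _ h ha'.1)
            (hd.trans had.symm)
          rw [this]
          exact ha'
    · rw [h.2] at h'
      exact h'.1
    · rw [← h']
      exact h
    · exact e.2.up _ h _ h'
    · obtain ⟨d, hd, -⟩ := e.2.mem _ h
      obtain ⟨⟨c, hc⟩, -⟩ := h'
      rw [hd] at hc
      exact absurd hc (by simp)
    · rw [h]
      exact h'
    · exact h.trans h'
  mono := by
    rintro (i | e) - (j | e') h <;> simp only [expandAmb] at h ⊢
    · have := hF.mono i trivial j h
      rcases hi : F.box i with d | c <;> rcases hj : F.box j with d' | c' <;>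
        rw [hi, hj] at this
      · exact this
      · exact this.elim
      · exact this.2
      · exact this
    · obtain ⟨⟨c, hc⟩, -⟩ := h
      rw [hc]
      exact c.2.1
    · obtain ⟨d, hd, hbd, -⟩ := e.2.mem _ h
      rw [hd]
      exact hbd
    · exact hH.le_refl _
  lift := by
    rintro (i | e) - d hd <;> simp only [expandAmb] at hd
    · rcases hi : F.box i with d' | c <;> rw [hi] at hd <;> simp only [origBox] at hd
      · obtain ⟨j, hj, hjd⟩ := hF.lift i trivial (.inl d) (by rw [hi]; exact hd)
        exact ⟨.inl j, hj, by simp [expandAmb, hjd, origBox]⟩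
      · by_cases hdb : H.le d b
        · by_cases hne : d = b
          · have hab := isAbove_above hH hF (S := {k | F.ile i k})
              (fun k hk l hl => hF.trans i trivial _ _ hk hl)
              (fun k hk l hl => hF.inj i trivial k l hk hl)
              (fun d hd hne => hF.lift i trivial (.inl d) (by
                rw [hi]
                exact ⟨fun h => hne (hH.le_antisymm _ _ h hd), hH.le_trans _ _ _ c.2.1 hd⟩))
            exact ⟨.inr ⟨_, hab⟩, ⟨⟨c, hi⟩, rfl⟩, hne.symm⟩
          · obtain ⟨j, hj, hjd⟩ := hF.lift i trivial (.inr ⟨d, hdb, hne⟩) (by rw [hi]; exact hd)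
            exact ⟨.inl j, hj, by simp [expandAmb, hjd, origBox]⟩
        · obtain ⟨j, hj, hjd⟩ := hF.lift i trivial (.inl d) (by rw [hi]; exact ⟨hdb, hd⟩)
          exact ⟨.inl j, hj, by simp [expandAmb, hjd, origBox]⟩
    · by_cases hne : d = b
      · exact ⟨.inr e, rfl, hne.symm⟩
      · obtain ⟨j, hj, hjd⟩ := e.2.ex d hd hne
        exact ⟨.inl j, hj, by simp [expandAmb, hjd, origBox]⟩
  inj := by
    -- Below a new instance of `b` there are only that instance and instances of copied !-boxes, and
    -- neither kind has an original instance of `b` as an ancestor.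
    have aux : ∀ i j e, (expandAmb b F).ile i (.inl j) → (expandAmb b F).ile i (.inr e) →
        origBox (F.box j) ≠ b := by
      rintro (i | e') j e hj he hb <;> simp only [expandAmb] at hj he
      · obtain ⟨⟨c, hc⟩, -⟩ := he
        have hm := hF.mono i trivial _ hj
        rw [hc] at hm
        rcases hjb : F.box j with d | c' <;> rw [hjb] at hm hb <;> simp only [origBox] at hb
        · exact hm.1 (hb ▸ hH.le_refl _)
        · exact c'.2.2 hb
      · obtain ⟨d, hd, hbd, hne⟩ := e'.2.mem _ hj
        rw [hd] at hb
        exact hne hb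
    rintro i - (j | e) (k | e') h h' hb
    · rcases i with i | e <;> simp only [expandAmb] at h h' hb
      · have m1 := hF.mono i trivial _ h
        have m2 := hF.mono i trivial _ h'
        refine congrArg _ (hF.inj i trivial _ _ h h' ?_)
        rcases hi : F.box i with d | c <;> rcases hj : F.box j with d' | c' <;>
          rcases hk : F.box k with d'' | c'' <;> rw [hi, hj] at m1 <;> rw [hi, hk] at m2 <;>
          rw [hj, hk] at hb <;> simp only [origBox] at hb
        · rw [hb]
        · exact m2.elim
        · exact m1.elim
        · exact m1.elim
        · rw [hb]
        · exact absurd c''.2.1 (hb ▸ m1.1)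
        · exact absurd c'.2.1 (hb ▸ m2.1)
        · rw [Subtype.ext hb]
      · obtain ⟨d, hd, -⟩ := e.2.mem _ h
        obtain ⟨d', hd', -⟩ := e.2.mem _ h'
        rw [hd, hd'] at hb
        simp only [origBox] at hb
        exact congrArg _ (e.2.inj _ h _ h' (by rw [hd, hd', hb]))
    · exact absurd hb (aux _ _ _ h h')
    · exact absurd hb.symm (aux _ _ _ h' h)
    · rcases i with i | e'' <;> simp only [expandAmb] at h h'
      · exact congrArg _ (Subtype.ext (h.2.trans h'.2.symm))
      · rw [← h, ← h']

end BangData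

namespace BangData
variable {V B : Type} {H : BangData V B}

/-- Original vertices are the ones whose sections avoid the new instances of `b`. Such a section
contains no instance of a copied !-box, since the ancestor of that instance in `b` would be new. -/
theorem isSec_expand_inl (hH : H.IsNested) {b : B} {I : Type}
    {F : Amb (B ⊕ {c : B // H.le c b ∧ c ≠ b}) I} (hF : F.WF (H.expand b).le Set.univ)
    (v : V) (S : Set I) :
    IsSec (H.expand b) F Set.univ (.inl v) S ↔
      IsSec H (expandAmb b F) Set.univ v (Sum.inl '' S) := by
  have hW := expandAmb_wf hH b hF
  constructor
  · intro h
    have hm : ∀ i ∈ S, ∃ d, F.box i = .inl d ∧ v ∈ H.content d := by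
      intro i hi
      have := h.mem i hi
      rcases hb : F.box i with d | c
      · rw [hb] at this
        exact ⟨d, rfl, this⟩
      · rw [hb] at this
        exact this.elim
    refine ⟨fun _ _ => trivial, ?_, ?_, ?_, ?_⟩
    · rintro _ ⟨i, hi, rfl⟩ (j | e) hij
      · exact ⟨j, h.up i hi j hij, rfl⟩
      · obtain ⟨⟨c, hc⟩, -⟩ := hij
        obtain ⟨d, hd, -⟩ := hm i hi
        rw [hc] at hd
        exact absurd hd (by simp)
    · rintro _ ⟨i, hi, rfl⟩
      obtain ⟨d, hd, hv⟩ := hm i hi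
      simpa [expandAmb, hd, origBox] using hv
    · intro d hd
      obtain ⟨i, hi, hid⟩ := h.ex (.inl d) hd
      exact ⟨.inl i, ⟨i, hi, rfl⟩, by simp [expandAmb, hid, origBox]⟩
    · rintro _ ⟨i, hi, rfl⟩ _ ⟨j, hj, rfl⟩ hij
      obtain ⟨d, hd, -⟩ := hm i hi
      obtain ⟨d', hd', -⟩ := hm j hj
      simp only [expandAmb, hd, hd', origBox] at hij
      exact congrArg _ (h.inj i hi j hj (by rw [hd, hd', hij]))
  · intro h
    have hm : ∀ i ∈ S, ∃ d, F.box i = .inl d ∧ v ∈ H.content d := by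
      intro i hi
      have hv := h.mem _ ⟨i, hi, rfl⟩
      rcases hb : F.box i with d | c
      · simp only [expandAmb, hb, origBox] at hv
        exact ⟨d, rfl, hv⟩
      · obtain ⟨j, hj, hjb⟩ := hW.lift (.inl i) trivial b (by
          simpa [expandAmb, hb, origBox] using c.2.1)
        obtain ⟨k, hk, rfl⟩ := h.up _ ⟨i, hi, rfl⟩ j hj
        have hmo := hF.mono i trivial k hj
        rw [hb] at hmo
        rcases hkb : F.box k with d | c' <;> rw [hkb] at hmo <;>
          simp only [expandAmb, hkb, origBox] at hjb
        · exact absurd (hjb ▸ hH.le_refl _) hmo.1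
        · exact absurd hjb c'.2.2
    refine ⟨fun _ _ => trivial, ?_, ?_, ?_, ?_⟩
    · intro i hi j hij
      obtain ⟨k, hk, hkj⟩ := h.up _ ⟨i, hi, rfl⟩ (.inl j) hij
      rwa [← Sum.inl_injective hkj]
    · intro i hi
      obtain ⟨d, hd, hv⟩ := hm i hi
      rw [hd]
      exact hv
    · rintro (d | c) hd
      · obtain ⟨_, ⟨i, hi, rfl⟩, hid⟩ := h.ex d hd
        obtain ⟨d', hd', -⟩ := hm i hi
        simp only [expandAmb, hd', origBox] at hid
        exact ⟨i, hi, by rw [hd', hid]⟩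
      · exact hd.elim
    · intro i hi j hj hij
      exact Sum.inl_injective (h.inj _ ⟨i, hi, rfl⟩ _ ⟨j, hj, rfl⟩ (by simp [expandAmb, hij]))

/-- In EXPAND_b a fresh vertex is not in the !-box `b`, although the vertex it copies is. Its
section is completed by the one new instance of `b` attached to the part of the section strictly
above `b`. -/
theorem isSec_expand_inr (hH : H.IsNested) {b : B} {I : Type}
    {F : Amb (B ⊕ {c : B // H.le c b ∧ c ≠ b}) I} (hF : F.WF (H.expand b).le Set.univ)
    (v : {v : V // v ∈ H.content b}) (S : Set I)
    (h : IsSec (H.expand b) F Set.univ (.inr v) S) :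
    ∃ hab : IsAbove b F (above b F S),
      IsSec H (expandAmb b F) Set.univ v.1 (Sum.inl '' S ∪ {.inr ⟨above b F S, hab⟩}) := by
  have hab : IsAbove b F (above b F S) := isAbove_above hH hF h.up h.inj (fun d hd hne =>
    h.ex (.inl d) ⟨fun hdb => hne (hH.le_antisymm _ _ hdb hd), hH.content_mono _ _ hd v.2⟩)
  refine ⟨hab, fun _ _ => trivial, ?_, ?_, ?_, ?_⟩
  · rintro _ (⟨i, hi, rfl⟩ | rfl) (j | e) hij
    · exact .inl ⟨j, h.up i hi j hij, rfl⟩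
    · right
      obtain ⟨⟨c, hc⟩, he⟩ := hij
      refine congrArg _ (Subtype.ext ?_)
      rw [he]
      ext a
      constructor
      · rintro ⟨ha, ha2⟩
        exact ⟨h.up i hi a ha, ha2⟩
      · rintro ⟨ha, d, hd, hbd, hne⟩
        obtain ⟨a', ha', had⟩ := hF.lift i trivial (.inl d) (by
          rw [hc]
          exact ⟨fun h => hne (hH.le_antisymm _ _ h hbd), hH.le_trans _ _ _ c.2.1 hbd⟩)
        have := h.inj a ha a' (h.up i hi a' ha') (hd.trans had.symm)
        exact ⟨this ▸ ha', d, hd, hbd, hne⟩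
    · exact .inl ⟨j, hij.1, rfl⟩
    · right
      exact congrArg _ (Eq.symm hij)
  · rintro _ (⟨i, hi, rfl⟩ | rfl)
    · have := h.mem i hi
      rcases hb : F.box i with d | c <;> rw [hb] at this
      · simpa [expandAmb, hb, origBox] using this.2
      · have hc : v.1 ∈ H.content c.1 := this
        simpa [expandAmb, hb, origBox] using hc
    · exact v.2
  · intro d hd
    by_cases hdb : H.le d b
    · by_cases hne : d = b
      · exact ⟨_, .inr rfl, hne.symm⟩
      · obtain ⟨i, hi, hid⟩ := h.ex (.inr ⟨d, hdb, hne⟩) hd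
        exact ⟨_, .inl ⟨i, hi, rfl⟩, by simp [expandAmb, hid, origBox]⟩
    · obtain ⟨i, hi, hid⟩ := h.ex (.inl d) ⟨hdb, hd⟩
      exact ⟨_, .inl ⟨i, hi, rfl⟩, by simp [expandAmb, hid, origBox]⟩
  · have aux : ∀ i ∈ S, origBox (F.box i) ≠ b := by
      intro i hi hib
      have := h.mem i hi
      rcases hb : F.box i with d | c <;> rw [hb] at this hib <;> simp only [origBox] at hib
      · exact this.1 (hib ▸ hH.le_refl _)
      · exact c.2.2 hib
    rintro _ (⟨i, hi, rfl⟩ | rfl) _ (⟨j, hj, rfl⟩ | rfl) hij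
    · refine congrArg _ (h.inj i hi j hj ?_)
      have m1 := h.mem i hi
      have m2 := h.mem j hj
      rcases hb : F.box i with d | c <;> rcases hb' : F.box j with d' | c' <;>
        simp only [expandAmb, hb, hb', origBox] at hij <;> rw [hb] at m1 <;> rw [hb'] at m2
      · rw [hij]
      · exact absurd c'.2.1 (hij ▸ m1.1)
      · exact absurd c.2.1 (hij ▸ m2.1)
      · rw [Subtype.ext hij]
    · exact absurd hij (aux i hi)
    · exact absurd hij.symm (aux j hj)
    · rfl

/-- A section with a new instance of `b` contains no original instance of a !-box below `b`: the
ancestor of that instance in `b` would have to be the new one, under which only copied !-boxes lie.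
-/
theorem isSec_expand_inr_inv (hH : H.IsNested) {b : B} {I : Type}
    {F : Amb (B ⊕ {c : B // H.le c b ∧ c ≠ b}) I} (hF : F.WF (H.expand b).le Set.univ)
    (v : V) (T : Set (I ⊕ {e : Set I // IsAbove b F e}))
    (h : IsSec H (expandAmb b F) Set.univ v T) (e) (he : Sum.inr e ∈ T) :
    ∃ hv : v ∈ H.content b, IsSec (H.expand b) F Set.univ (.inr ⟨v, hv⟩) (Sum.inl ⁻¹' T) ∧
      above b F (Sum.inl ⁻¹' T) = e.1 := by
  have hW := expandAmb_wf hH b hF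
  have hv : v ∈ H.content b := h.mem _ he
  have hm : ∀ i, Sum.inl i ∈ T → ∀ d, F.box i = .inl d → ¬ H.le d b := by
    intro i hi d hd hdb
    obtain ⟨j, hj, hjb⟩ := hW.lift (.inl i) trivial b (by simpa [expandAmb, hd, origBox] using hdb)
    have : j = .inr e := h.inj _ (h.up _ hi _ hj) _ he hjb
    rw [this] at hj
    obtain ⟨⟨c, hc⟩, -⟩ := hj
    rw [hd] at hc
    exact absurd hc (by simp)
  refine ⟨hv, ⟨fun _ _ => trivial, ?_, ?_, ?_, ?_⟩, ?_⟩
  · exact fun i hi j hij => h.up _ hi (.inl j) hij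
  · intro i hi
    have hvi := h.mem _ hi
    rcases hb : F.box i with d | c <;> simp only [expandAmb, hb, origBox] at hvi
    · exact ⟨hm i hi d hb, hvi⟩
    · exact hvi
  · rintro (d | c) hd
    · obtain ⟨i | e', hi, hid⟩ := h.ex d hd.2
      · refine ⟨i, hi, ?_⟩
        rcases hb : F.box i with d' | c' <;> simp only [expandAmb, hb, origBox] at hid
        · rw [hid]
        · exact absurd c'.2.1 (hid ▸ hd.1)
      · exact absurd (hid ▸ hH.le_refl _) hd.1
    · obtain ⟨i | e', hi, hid⟩ := h.ex c.1 hd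
      · refine ⟨i, hi, ?_⟩
        rcases hb : F.box i with d' | c' <;> simp only [expandAmb, hb, origBox] at hid
        · exact absurd c.2.1 (hid ▸ hm i hi d' hb)
        · rw [Subtype.ext hid]
      · exact absurd hid.symm c.2.2
  · intro i hi j hj hij
    exact Sum.inl_injective (h.inj _ hi _ hj (by simp [expandAmb, hij]))
  · ext a
    constructor
    · rintro ⟨ha, d, hd, hbd, hne⟩
      obtain ⟨a', ha', had⟩ := e.2.ex d hbd hne
      have := h.inj _ ha _ (h.up _ he (.inl a') ha') (by simp [expandAmb, hd, had])
      rw [Sum.inl_injective this]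
      exact ha'
    · intro ha
      exact ⟨h.up _ he (.inl a) ha, e.2.mem a ha⟩

/-- The vertex of the concretization of `H` corresponding to a vertex of the concretization of
`EXPAND_b H`. -/
def expandVertex (hH : H.IsNested) {b : B} {I : Type}
    {F : Amb (B ⊕ {c : B // H.le c b ∧ c ≠ b}) I} (hF : F.WF (H.expand b).le Set.univ) :
    CV (H.expand b) F Set.univ Set.univ → CV H (expandAmb b F) Set.univ Set.univ
  | ⟨(.inl v, S), h⟩ => ⟨(v, Sum.inl '' S), trivial, (isSec_expand_inl hH hF v S).1 h.2⟩
  | ⟨(.inr v, S), h⟩ => ⟨(v.1, Sum.inl '' S ∪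
      {.inr ⟨above b F S, (isSec_expand_inr hH hF v S h.2).1⟩}), trivial,
      (isSec_expand_inr hH hF v S h.2).2⟩

/-- The vertices split according to whether their section contains a new instance of `b`: those
where it does are the fresh copies, the others the original vertices. -/
theorem conc_expand (hH : H.IsNested) (b : B) {I : Type}
    {F : Amb (B ⊕ {c : B // H.le c b ∧ c ≠ b}) I} (hF : F.WF (H.expand b).le Set.univ) :
    (conc (H.expand b) F Set.univ Set.univ).IsIso (conc H (expandAmb b F) Set.univ Set.univ) := by
  have imInj : ∀ {S T : Set I}, (Sum.inl '' S : Set (I ⊕ {e : Set I // IsAbove b F e})) =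
      Sum.inl '' T → S = T := fun h => Set.image_injective.2 Sum.inl_injective h
  have pre : ∀ (S : Set I) (e : {e : Set I // IsAbove b F e}),
      (Sum.inl ⁻¹' (Sum.inl '' S ∪ {.inr e}) : Set I) = S := by
    intro S e
    ext i
    simp
  refine isIso_of_bij (expandVertex hH hF) ⟨?_, ?_⟩ ?_ ?_
  · rintro ⟨⟨v | v, S⟩, hv⟩ ⟨⟨u | u, T⟩, hu⟩ h
    · have h1 : v = u := congrArg (fun z => z.1.1) h
      have h2 := imInj (congrArg (fun z => z.1.2) h)
      subst h1 h2
      rfl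
    · have h2 : (Sum.inl '' S : Set (I ⊕ {e : Set I // IsAbove b F e})) = Sum.inl '' T ∪ {_} :=
        congrArg (fun z => z.1.2) h
      have := (Set.ext_iff.1 h2 _).2 (Or.inr rfl)
      obtain ⟨_, _, hx⟩ := this
      exact absurd hx (by simp)
    · have h2 : Sum.inl '' S ∪ {_} = (Sum.inl '' T : Set (I ⊕ {e : Set I // IsAbove b F e})) :=
        congrArg (fun z => z.1.2) h
      have := (Set.ext_iff.1 h2 _).1 (Or.inr rfl)
      obtain ⟨_, _, hx⟩ := this
      exact absurd hx (by simp)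
    · have h1 : v = u := Subtype.ext (congrArg (fun z => z.1.1) h)
      have h2 : S = T := by
        have := congrArg (fun z : CV H (expandAmb b F) Set.univ Set.univ =>
          (Sum.inl ⁻¹' z.1.2 : Set I)) h
        simpa only [expandVertex, pre] using this
      subst h1 h2
      rfl
  · rintro ⟨⟨v, T⟩, hv⟩
    by_cases hT : ∃ e, Sum.inr e ∈ T
    · obtain ⟨e, he⟩ := hT
      obtain ⟨hvb, hs, hab⟩ := isSec_expand_inr_inv hH hF v T hv.2 e he
      refine ⟨⟨(.inr ⟨v, hvb⟩, Sum.inl ⁻¹' T), trivial, hs⟩, Subtype.ext (Prod.ext rfl ?_)⟩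
      ext (i | e')
      · simp [expandVertex]
      · simp only [expandVertex, Set.mem_union, Set.mem_image, reduceCtorEq, and_false,
          exists_false, Set.mem_singleton_iff, false_or]
        constructor
        · intro h
          have he' : e' = e := (Sum.inr_injective h).trans (Subtype.ext hab)
          rw [he']
          exact he
        · intro h
          have := hv.2.inj _ h _ he rfl
          rw [this]
          exact congrArg _ (Subtype.ext hab.symm)
    · have hTi : T = Sum.inl '' (Sum.inl ⁻¹' T : Set I) := by
        ext (i | e)
        · simp
        · simpa using fun h => hT ⟨e, h⟩
      refine ⟨⟨(.inl v, Sum.inl ⁻¹' T), trivial, ?_⟩, Subtype.ext (Prod.ext rfl hTi.symm)⟩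
      exact (isSec_expand_inl hH hF v _).2 (hTi ▸ hv.2)
  · have agr : ∀ S T, (expandAmb b F).Agree (Sum.inl '' S) (Sum.inl '' T) ↔
        ∀ i ∈ S, ∀ j ∈ T, origBox (F.box i) = origBox (F.box j) → i = j := by
      intro S T
      simp [Amb.Agree, expandAmb]
    -- If the original vertex were in `b`, the two sections would contain different instances of
    -- `b`. So agreement forces it outside `b`, which is exactly the condition under which EXPAND_b
    -- draws an edge between an original and a fresh vertex.
    have hmix : ∀ v u S T, IsSec (H.expand b) F Set.univ (.inl v) S →
        ∀ hT : IsSec (H.expand b) F Set.univ (.inr u) T,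
        ((v ∉ H.content b) ∧ F.Agree S T ↔
          (expandAmb b F).Agree (Sum.inl '' S) (Sum.inl '' T ∪
            {.inr ⟨above b F T, (isSec_expand_inr hH hF u T hT).1⟩})) := by
      intro v u S T hS hT
      constructor
      · rintro ⟨hv, h⟩ _ ⟨i, hi, rfl⟩ _ (⟨j, hj, rfl⟩ | rfl) hij
        · refine congrArg _ (h i hi j hj ?_)
          have m1 := hS.mem i hi
          have m2 := hT.mem j hj
          rcases hb : F.box i with d | c <;> rcases hb' : F.box j with d' | c' <;>
            simp only [expandAmb, hb, hb', origBox] at hij <;> rw [hb] at m1 <;> rw [hb'] at m2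
          · rw [hij]
          · exact absurd (hH.content_mono _ _ c'.2.1 (hij ▸ m1)) hv
          · exact m1.elim
          · exact m1.elim
        · have m1 := ((isSec_expand_inl hH hF v S).1 hS).mem _ ⟨i, hi, rfl⟩
          rw [hij] at m1
          exact absurd m1 hv
      · intro h
        refine ⟨fun hv => ?_, fun i hi j hj hij => ?_⟩
        · obtain ⟨i, hi, hib⟩ := ((isSec_expand_inl hH hF v S).1 hS).ex b hv
          have := h i hi _ (.inr rfl) hib
          obtain ⟨_, _, rfl⟩ := hi
          exact absurd this (by simp)
        · exact Sum.inl_injective (h _ ⟨i, hi, rfl⟩ _ (.inl ⟨j, hj, rfl⟩) (by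
            simp [expandAmb, hij]))
    have symm : ∀ {B' I' : Type} (F : Amb B' I') (S T : Set I'), F.Agree S T ↔ F.Agree T S := by
      intro B' I' F S T
      exact ⟨fun h i hi j hj hij => (h j hj i hi hij.symm).symm,
        fun h i hi j hj hij => (h j hj i hi hij.symm).symm⟩
    rintro ⟨⟨v | v, S⟩, hv⟩ γ ⟨⟨u | u, T⟩, hu⟩
    · refine and_congr Iff.rfl ?_
      simp only [expandVertex, agr]
      refine forall₂_congr fun i hi => forall₂_congr fun j hj => imp_congr_left ?_
      have m1 := hv.2.mem i hi
      have m2 := hu.2.mem j hj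
      simp only at m1 m2
      rcases hb : F.box i with d | c <;> rcases hb' : F.box j with d' | c' <;>
        rw [hb] at m1 <;> rw [hb'] at m2
      · simp [origBox]
      · exact m2.elim
      · exact m1.elim
      · exact m1.elim
    · have := hmix v u S T hv.2 hu.2
      change ((v ∉ H.content b) ∧ _) ∧ _ ↔ _ ∧ _
      rw [and_right_comm, this, and_comm]
      rfl
    · have := hmix u v T S hu.2 hv.2
      change ((u ∉ H.content b) ∧ _) ∧ _ ↔ _ ∧ _
      rw [symm, and_right_comm, this, and_comm, symm]
      rfl
    · refine and_congr Iff.rfl ?_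
      constructor
      · intro h
        rintro _ (⟨i, hi, rfl⟩ | rfl) _ (⟨j, hj, rfl⟩ | rfl) hij
        · refine congrArg _ (h i hi j hj ?_)
          have m1 := hv.2.mem i hi
          have m2 := hu.2.mem j hj
          simp only at m1 m2
          rcases hb : F.box i with d | c <;> rcases hb' : F.box j with d' | c' <;>
            simp only [expandAmb, hb, hb', origBox] at hij <;> rw [hb] at m1 <;> rw [hb'] at m2
          · rw [hij]
          · exact absurd c'.2.1 (hij ▸ m1.1)
          · exact absurd c.2.1 (hij ▸ m2.1)
          · rw [Subtype.ext hij]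
        · have := (isSec_expand_inr hH hF v S hv.2).2.inj _ (.inl ⟨i, hi, rfl⟩) _ (.inr rfl) hij
          exact absurd this (by simp)
        · have := (isSec_expand_inr hH hF u T hu.2).2.inj _ (.inl ⟨j, hj, rfl⟩) _ (.inr rfl)
            hij.symm
          exact absurd this (by simp)
        -- Agreement makes the parts strictly above `b` equal, and the new instance of `b` is named
        -- by this part.
        · have hle : ∀ {S T : Set I} (hS : IsAbove b F (above b F S))
              (hT : IsAbove b F (above b F T)), F.Agree S T → above b F S ⊆ above b F T := by
            rintro S T hS hT h i ⟨hi, d, hd, hbd, hne⟩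
            obtain ⟨j, hj, hjd⟩ := hT.ex d hbd hne
            rw [h i hi j hj.1 (hd.trans hjd.symm)]
            exact hj
          have h1 := (isSec_expand_inr hH hF v S hv.2).1
          have h2 := (isSec_expand_inr hH hF u T hu.2).1
          exact congrArg _ (Subtype.ext ((hle h1 h2 h).antisymm (hle h2 h1 ((symm _ _ _).1 h))))
      · intro h i hi j hj hij
        exact Sum.inl_injective (h _ (.inl ⟨i, hi, rfl⟩) _ (.inl ⟨j, hj, rfl⟩) (by
            simp [expandAmb, hij]))
  · rintro ⟨⟨v | v, S⟩, hv⟩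
    · rfl
    · rfl

end BangData

/-! ### The language is the set of concretizations -/

theorem conc_equiv {V B I I' : Type} {H : BangData V B} {F : Amb B I} {F' : Amb B I'}
    (ι : I ≃ I') (hbox : ∀ i, F'.box (ι i) = F.box i)
    (hile : ∀ i j, F'.ile (ι i) (ι j) ↔ F.ile i j) :
    (conc H F Set.univ Set.univ).IsIso (conc H F' Set.univ Set.univ) := by
  refine conc_iso id Function.injective_id (by simp) (fun _ _ _ => Iff.rfl) (fun _ _ => rfl)
    ι ι.injective ∅ (by simp) (fun i j => by rw [hbox, hbox]) (by simp) (by simp) ?_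
  intro v _ S'
  constructor
  · intro h
    refine ⟨ι ⁻¹' S', ⟨fun _ _ => trivial, ?_, ?_, ?_, ?_⟩, ?_⟩
    · exact fun i hi j hij => h.up _ hi _ ((hile _ _).2 hij)
    · intro i hi
      rw [← hbox]
      exact h.mem _ hi
    · intro b hb
      obtain ⟨i, hi, hib⟩ := h.ex b hb
      obtain ⟨i, rfl⟩ := ι.surjective i
      exact ⟨i, hi, by rw [← hbox, hib]⟩
    · exact fun i hi j hj hij => ι.injective (h.inj _ hi _ hj (by rw [hbox, hbox, hij]))
    · rw [Set.image_preimage_eq _ ι.surjective, Set.union_empty]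
  · rintro ⟨S, h, rfl⟩
    rw [Set.union_empty]
    refine ⟨fun _ _ => trivial, ?_, ?_, ?_, ?_⟩
    · rintro _ ⟨i, hi, rfl⟩ j hij
      obtain ⟨j, rfl⟩ := ι.surjective j
      exact ⟨j, h.up i hi j ((hile _ _).1 hij), rfl⟩
    · rintro _ ⟨i, hi, rfl⟩
      rw [hbox]
      exact h.mem _ hi
    · intro b hb
      obtain ⟨i, hi, hib⟩ := h.ex b hb
      exact ⟨_, ⟨i, hi, rfl⟩, by rw [hbox, hib]⟩
    · rintro _ ⟨i, hi, rfl⟩ _ ⟨j, hj, rfl⟩ hij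
      rw [hbox, hbox] at hij
      rw [h.inj i hi j hj hij]

theorem Amb.WF.antisymm {B I : Type} {F : Amb B I} {le : B → B → Prop} {A : Set I}
    (hF : F.WF le A) (hle : ∀ a b, le a b → le b a → a = b) {i j : I} (hi : i ∈ A)
    (h : F.ile i j) (k : F.ile j i) : i = j :=
  hF.inj i hi i j (hF.refl i hi) h
    (hle _ _ (hF.mono i hi j h) (hF.mono j (hF.up i hi j h) i k))

/-- An instance with the fewest ancestors is outermost. -/
theorem Amb.WF.exists_maximal {B I : Type} [Finite I] [Nonempty I] {F : Amb B I}
    {le : B → B → Prop} (hF : F.WF le Set.univ) (hle : ∀ a b, le a b → le b a → a = b) :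
    ∃ i, ∀ j, F.ile i j → j = i := by
  obtain ⟨i, hi⟩ := Finite.exists_min (fun i => Set.ncard {j | F.ile i j})
  refine ⟨i, fun j hij => ?_⟩
  by_contra hne
  refine absurd (hi j) (not_le.2 (Set.ncard_lt_ncard ?_ (Set.toFinite _)))
  refine ⟨fun k hk => hF.trans i trivial j k hij hk, fun hsub => ?_⟩
  exact hne (hF.antisymm hle trivial (hsub (hF.refl i trivial)) hij)

namespace BangData

variable {V B : Type} {H : BangData V B}

theorem conc_of_isEmpty (F : Amb B Empty) [IsEmpty B] :
    H.graph.IsIso (conc H F Set.univ Set.univ) := by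
  refine isIso_of_bij (fun v => ⟨(v, ∅), trivial, ?_⟩) ⟨?_, ?_⟩ ?_ ?_
  · exact ⟨by simp, by simp, by simp, fun b => isEmptyElim b, by simp⟩
  · intro v u h
    exact congrArg (fun z => z.1.1) h
  · rintro ⟨⟨v, S⟩, hv⟩
    refine ⟨v, Subtype.ext (Prod.ext rfl ?_)⟩
    ext i
    exact i.elim
  · intro x γ y
    exact ⟨fun h => ⟨h, by simp [Amb.Agree]⟩, fun h => h.1⟩
  · intro x
    rfl

/-- Families of instances are carried back through the operations one at a time. A reached graph
without !-boxes is its own concretization for the empty family, so it is a concretization of `H`. -/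
theorem conc_of_reaches (hH : H.IsNested) {V₁ B₁ : Type} {K : BangData V₁ B₁} (h : H.Reaches K) :
    K.IsNested ∧ ∀ (I : Type) [Finite I] (F : Amb B₁ I), F.WF K.le Set.univ →
      ∃ (I' : Type) (_ : Finite I') (F' : Amb B I'), F'.WF H.le Set.univ ∧
        (conc K F Set.univ Set.univ).IsIso (conc H F' Set.univ Set.univ) := by
  induction h with
  | refl => exact ⟨hH, fun I _ F hF => ⟨I, inferInstance, F, hF, LGraph.IsIso.refl _⟩⟩
  | kill b _ ih =>
    refine ⟨ih.1.kill b, fun I _ F hF => ?_⟩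
    obtain ⟨F₁, hF₁, h₁⟩ := conc_kill ih.1 b F hF
    obtain ⟨I', fin, F', hF', h'⟩ := ih.2 I F₁ hF₁
    exact ⟨I', fin, F', hF', h₁.trans h'⟩
  | expand b _ ih =>
    refine ⟨ih.1.expand b, fun I _ F hF => ?_⟩
    obtain ⟨I', fin, F', hF', h'⟩ := ih.2 _ (expandAmb b F) (expandAmb_wf ih.1 b hF)
    exact ⟨I', fin, F', hF', (conc_expand ih.1 b hF).trans h'⟩

open Classical in
/-- Remove an outermost instance `i` of a !-box. -/
theorem exists_unexpand (hH : H.IsNested) {I : Type} (F : Amb B I) (hF : F.WF H.le Set.univ)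
    (i : I) (hi : ∀ j, F.ile i j → j = i) :
    ∃ F₁ : Amb (B ⊕ {c : B // H.le c (F.box i) ∧ c ≠ F.box i}) {j : I // j ≠ i},
      F₁.WF (H.expand (F.box i)).le Set.univ ∧
      (conc (H.expand (F.box i)) F₁ Set.univ Set.univ).IsIso (conc H F Set.univ Set.univ) := by
  have hne : ∀ j : {j : I // j ≠ i}, F.ile j.1 i → F.box j.1 ≠ F.box i := fun j hj h =>
    j.2 (hF.inj j.1 trivial j.1 i (hF.refl _ trivial) hj h)
  -- The ancestor of `k` over the !-box of `i` is also an ancestor of `j` over it, hence is `i`.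
  have hkey : ∀ j, ∀ k, F.ile j k → F.ile j i → H.le (F.box k) (F.box i) → F.ile k i := by
    intro j k hjk hji hk
    obtain ⟨k', hkk', hb⟩ := hF.lift k trivial _ hk
    rwa [← hF.inj j trivial k' i (hF.trans j trivial _ _ hjk hkk') hji hb]
  -- Instances nested in `i` become instances of the copied !-boxes; all others keep their !-box.
  let box₁ : {j : I // j ≠ i} → B ⊕ {c : B // H.le c (F.box i) ∧ c ≠ F.box i} := fun j =>
    if h : F.ile j.1 i then .inr ⟨F.box j.1, hF.mono _ trivial _ h, hne j h⟩ else .inl (F.box j.1)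
  have hb1 : ∀ j (h : F.ile j.1 i), box₁ j = .inr ⟨F.box j.1, hF.mono _ trivial _ h, hne j h⟩ :=
    fun j h => dif_pos h
  have hb2 : ∀ j : {j : I // j ≠ i}, ¬ F.ile j.1 i → box₁ j = .inl (F.box j.1) :=
    fun j h => dif_neg h
  have horig : ∀ j, origBox (box₁ j) = F.box j.1 := by
    intro j
    by_cases h : F.ile j.1 i
    · rw [hb1 j h]; rfl
    · rw [hb2 j h]; rfl
  let F₁ : Amb (B ⊕ {c : B // H.le c (F.box i) ∧ c ≠ F.box i}) {j : I // j ≠ i} :=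
    ⟨box₁, fun j k => F.ile j.1 k.1⟩
  have hF₁ : F₁.WF (H.expand (F.box i)).le Set.univ := by
    refine ⟨fun j _ => hF.refl _ trivial, fun _ _ _ _ => trivial,
      fun j _ k l => hF.trans j.1 trivial _ _, ?_, ?_, ?_⟩
    · intro j _ k hjk
      have hm := hF.mono _ trivial _ hjk
      change (H.expand (F.box i)).le (box₁ j) (box₁ k)
      by_cases h : F.ile j.1 i
      · rw [hb1 j h]
        by_cases h' : F.ile k.1 i
        · rw [hb1 k h']
          exact hm
        · rw [hb2 k h']
          exact ⟨fun hle => h' (hkey _ _ hjk h hle), hm⟩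
      · have h' : ¬ F.ile k.1 i := fun h' => h (hF.trans _ trivial _ _ hjk h')
        rw [hb2 j h, hb2 k h']
        exact hm
    · intro j _ d hd
      change (H.expand (F.box i)).le (box₁ j) d at hd
      by_cases h : F.ile j.1 i
      · rw [hb1 j h] at hd
        rcases d with d | c
        · obtain ⟨k, hjk, hkd⟩ := hF.lift j.1 trivial d hd.2
          have hki : ¬ F.ile k i := fun h => hd.1 (hkd ▸ hF.mono _ trivial _ h)
          exact ⟨⟨k, fun h => hki (h ▸ hF.refl _ trivial)⟩, hjk, by rw [← hkd]; exact hb2 _ hki⟩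
        · obtain ⟨k, hjk, hkd⟩ := hF.lift j.1 trivial c.1 hd
          have hki : F.ile k i := hkey _ _ hjk h (hkd ▸ c.2.1)
          refine ⟨⟨k, fun h => c.2.2 (by rw [← hkd, h])⟩, hjk, (hb1 _ hki).trans ?_⟩
          exact congrArg _ (Subtype.ext hkd)
      · rw [hb2 j h] at hd
        rcases d with d | c
        · obtain ⟨k, hjk, hkd⟩ := hF.lift j.1 trivial d hd
          have hki : ¬ F.ile k i := fun h' => h (hF.trans _ trivial _ _ hjk h')
          exact ⟨⟨k, fun h => hki (h ▸ hF.refl _ trivial)⟩, hjk, by rw [← hkd]; exact hb2 _ hki⟩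
        · exact hd.elim
    · intro j _ k l hjk hjl hkl
      have : F.box k.1 = F.box l.1 := by rw [← horig, ← horig]; exact congrArg _ hkl
      exact Subtype.ext (hF.inj j.1 trivial _ _ hjk hjl this)
  refine ⟨F₁, hF₁, (conc_expand hH _ hF₁).trans ?_⟩
  -- As `i` is outermost, its !-box is maximal. The only choice of instances strictly above it is
  -- then the empty one, so `expandAmb` adds back a single instance, which plays the role of `i`.
  have hmax : ∀ d, H.le (F.box i) d → d = F.box i := by
    intro d hd
    obtain ⟨j, hj, rfl⟩ := hF.lift i trivial d hd
    rw [hi j hj]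
  have hab : ∀ e : Set {j : I // j ≠ i}, IsAbove (F.box i) F₁ e → e = ∅ := by
    intro e he
    ext a
    constructor
    · intro ha
      obtain ⟨d, -, hd, hne⟩ := he.mem a ha
      exact absurd (hmax d hd) hne
    · exact fun h => h.elim
  have hab0 : IsAbove (F.box i) F₁ ∅ :=
    ⟨by simp, by simp, fun d hd hne => absurd (hmax d hd) hne, by simp⟩
  let ι : {j : I // j ≠ i} ⊕ {e : Set _ // IsAbove (F.box i) F₁ e} → I
    | .inl j => j.1
    | .inr _ => i
  have hι : Function.Bijective ι := by
    constructor
    · rintro (j | e) (k | e') h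
      · exact congrArg _ (Subtype.ext h)
      · exact absurd h j.2
      · exact absurd h.symm k.2
      · exact congrArg _ (Subtype.ext ((hab _ e.2).trans (hab _ e'.2).symm))
    · intro j
      by_cases h : j = i
      · exact ⟨.inr ⟨∅, hab0⟩, h.symm⟩
      · exact ⟨.inl ⟨j, h⟩, rfl⟩
  refine conc_equiv (Equiv.ofBijective ι hι) ?_ ?_
  · rintro (j | e)
    · exact (horig j).symm
    · rfl
  · rintro (j | e) (k | e')
    · exact Iff.rfl
    · constructor
      · intro h
        refine ⟨⟨_, hb1 j h⟩, ?_⟩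
        rw [hab _ e'.2]
        ext a
        constructor
        · exact fun h => h.elim
        · rintro ⟨-, d, -, hd, hne⟩
          exact absurd (hmax d hd) hne
      · rintro ⟨⟨c, hc⟩, -⟩
        by_contra h
        have := hb2 j h
        rw [show box₁ j = .inr c from hc] at this
        exact absurd this (by simp)
    · constructor
      · intro h
        exact absurd (hi _ h) k.2
      · intro h
        have h' : k ∈ e.1 := h
        rw [hab _ e.2] at h'
        exact h'.elim
    · constructor
      · intro _
        exact Subtype.ext ((hab _ e.2).trans (hab _ e'.2).symm)
      · intro _
        exact hF.refl _ trivial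

/-- Without instances every vertex lying in a !-box disappears, which is achieved by killing the
!-boxes one after another; each KILL lowers their number. -/
theorem reaches_conc_of_isEmpty (n : ℕ) : ∀ {V B : Type} [Finite B] {H : BangData V B},
    Nat.card B = n → H.IsNested → ∀ (I : Type) [IsEmpty I] (F : Amb B I),
    ∃ (V₁ B₁ : Type) (K : BangData V₁ B₁), H.Reaches K ∧ IsEmpty B₁ ∧
      K.graph.IsIso (conc H F Set.univ Set.univ) := by
  induction n using Nat.strong_induction_on with
  | _ n ih =>
    intro V B _ H hn hH I _ F
    have huniq : ∀ F F' : Amb B I, F = F' := by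
      rintro ⟨b, l⟩ ⟨b', l'⟩
      congr 1 <;> exact Subsingleton.elim _ _
    rcases isEmpty_or_nonempty B with hB | ⟨⟨b⟩⟩
    · refine ⟨V, B, H, .refl, hB, ?_⟩
      have F₀ : Amb B Empty := ⟨fun i => i.elim, fun i => i.elim⟩
      exact (conc_of_isEmpty F₀).trans
        (conc_equiv (Equiv.equivOfIsEmpty _ _) (fun i => i.elim) (fun i => i.elim))
    · have hlt : Nat.card {c : B // ¬ H.le c b} < n := by
        rw [← hn]
        exact Finite.card_subtype_lt (x := b) (by simpa using hH.le_refl b)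
      let F₁ : Amb {c : B // ¬ H.le c b} I := ⟨fun i => isEmptyElim i, fun i => isEmptyElim i⟩
      have hF₁ : F₁.WF (H.kill b).le Set.univ := by
        constructor <;> exact fun i => isEmptyElim i
      obtain ⟨V₁, B₁, K, hK, hB₁, hiso⟩ := ih _ hlt rfl (hH.kill b) I F₁
      obtain ⟨F', -, h'⟩ := conc_kill hH b F₁ hF₁
      rw [huniq F' F] at h'
      exact ⟨V₁, B₁, K, (Reaches.kill b .refl).trans hK, hB₁, hiso.trans h'⟩

/-- One EXPAND for each instance, outermost instances first; when none is left, the remaining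
!-boxes are killed. -/
theorem reaches_conc (n : ℕ) : ∀ {V B : Type} [Finite B] {H : BangData V B}, H.IsNested →
    ∀ (I : Type) [Finite I] (F : Amb B I), F.WF H.le Set.univ → Nat.card I = n →
    ∃ (V₁ B₁ : Type) (K : BangData V₁ B₁), H.Reaches K ∧ IsEmpty B₁ ∧
      K.graph.IsIso (conc H F Set.univ Set.univ) := by
  induction n with
  | zero =>
    intro V B _ H hH I _ F hF hn
    have : IsEmpty I := (Nat.card_eq_zero.1 hn).resolve_right (fun h => h.not_finite inferInstance)
    exact reaches_conc_of_isEmpty _ rfl hH I F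
  | succ n ih =>
    intro V B _ H hH I _ F hF hn
    have : Nonempty I := (Nat.card_pos_iff.1 (by omega)).1
    obtain ⟨i, hi⟩ := hF.exists_maximal hH.le_antisymm
    obtain ⟨F₁, hF₁, h₁⟩ := exists_unexpand hH F hF i hi
    have hcard : Nat.card {j : I // j ≠ i} = n := by
      classical
      have := Nat.card_congr (Equiv.sumCompl (fun j => j ≠ i))
      rw [Nat.card_sum, hn] at this
      have h1 : Nat.card {j : I // ¬ j ≠ i} = 1 := by
        rw [Nat.card_eq_one_iff_unique]
        exact ⟨⟨fun a b => Subtype.ext ((not_not.1 a.2).trans (not_not.1 b.2).symm)⟩,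
          ⟨⟨i, by simp⟩⟩⟩
      omega
    obtain ⟨V₁, B₁, K, hK, hB₁, hiso⟩ := ih (hH.expand (F.box i)) _ F₁ hF₁ hcard
    exact ⟨V₁, B₁, K, (Reaches.expand _ .refl).trans hK, hB₁, hiso.trans h₁⟩

/-- The language of a !-graph consists of its concretizations. -/
theorem mem_language_iff [Finite B] (hH : H.IsNested) (C : IsoClass NodeLabel EdgeLabel) :
    C ∈ H.language ↔ ∃ (I : Type) (_ : Finite I) (F : Amb B I), F.WF H.le Set.univ ∧
      IsClassOf C (conc H F Set.univ Set.univ) := by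
  constructor
  · rintro ⟨V₁, B₁, K, hK, hB₁, F, hF, hiso⟩
    obtain ⟨-, h⟩ := conc_of_reaches hH hK
    let F₀ : Amb B₁ Empty := ⟨fun i => i.elim, fun i => i.elim⟩
    obtain ⟨I, fin, F', hF', h'⟩ := h Empty F₀ (by constructor <;> exact fun i => i.elim)
    exact ⟨I, fin, F', hF', F, hF, (((conc_of_isEmpty F₀).trans h').symm).trans hiso⟩
  · rintro ⟨I, fin, F, hF, K, hK, hiso⟩
    obtain ⟨V₁, B₁, L, hL, hB₁, h⟩ := reaches_conc _ hH I F hF rfl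
    exact ⟨V₁, B₁, L, hL, hB₁, K, hK, h.trans hiso⟩

end BangData

/-! ### Links, their encoding as edges, and decoding -/

namespace LGraph
variable {V V' : Type} {D : LGraph NodeLabel EdgeLabel V} {D' : LGraph NodeLabel EdgeLabel V'}

/-- `v` is reached from `h` by `p` edges, through wire-vertices only. -/
inductive Run (D : LGraph NodeLabel EdgeLabel V) (h : V) : ℕ → V → Prop
  | zero : D.label h = NodeLabel.W → Run D h 0 h
  | succ {p : ℕ} {u v : V} : Run D h p u → D.edge u EdgeLabel.plain v →
      D.label v = NodeLabel.W → Run D h (p + 1) v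

/-- There is a closed wire with `a + 1` interior vertices, of which `h` is the first one, from the
node-vertex `x` to another node-vertex `y`. -/
def IsLink (D : LGraph NodeLabel EdgeLabel V) (x h : V) (a : ℕ) (y : V) : Prop :=
  D.label x = NodeLabel.N ∧ D.label y = NodeLabel.N ∧ x ≠ y ∧ D.edge x EdgeLabel.plain h ∧
    ∃ u, D.Run h a u ∧ D.edge u EdgeLabel.plain y

theorem Run.label_eq {h v : V} {p : ℕ} (r : D.Run h p v) : D.label v = NodeLabel.W := by
  cases r with
  | zero h => exact h
  | succ _ _ h => exact h

theorem Run.unique (hD : D.IsStringGraph) {h v : V} {p : ℕ} (r : D.Run h p v) :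
    ∀ {v' : V}, D.Run h p v' → v = v' := by
  induction r with
  | zero _ =>
    intro v' r'
    cases r'
    rfl
  | succ r₁ e₁ _ ih =>
    intro v' r'
    cases r' with
    | succ r₂ e₂ _ =>
      have := ih r₂
      subst this
      exact hD.out_degree _ r₁.label_eq _ _ _ _ e₁ e₂

/-- Traced backwards, a run is determined by the in-degree condition, and it can only begin where
the predecessor is a node-vertex. -/
theorem Run.head_unique (hD : D.IsStringGraph) {x h v : V} {p : ℕ} (r : D.Run h p v)
    (hx : D.label x = NodeLabel.N) (e : D.edge x EdgeLabel.plain h) :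
    ∀ {x' h' : V} {p' : ℕ}, D.Run h' p' v → D.label x' = NodeLabel.N →
      D.edge x' EdgeLabel.plain h' → h = h' ∧ p = p' := by
  induction r with
  | zero hl =>
    intro x' h' p' r' hx' e'
    cases r' with
    | zero _ => exact ⟨rfl, rfl⟩
    | succ r₂ e₂ _ =>
      have := hD.in_degree _ hl _ _ _ _ e e₂
      rw [this, r₂.label_eq] at hx
      cases hx
  | succ r₁ e₁ hl ih =>
    intro x' h' p' r' hx' e'
    cases r' with
    | zero _ =>
      have := hD.in_degree _ hl _ _ _ _ e' e₁
      rw [this, r₁.label_eq] at hx'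
      cases hx'
    | succ r₂ e₂ _ =>
      have := hD.in_degree _ hl _ _ _ _ e₁ e₂
      subst this
      obtain ⟨h1, h2⟩ := ih r₂ hx' e'
      exact ⟨h1, by rw [h2]⟩

theorem Run.exists_of_le {h v : V} {p q : ℕ} (r : D.Run h p v) (hq : q ≤ p) : ∃ u, D.Run h q u := by
  induction r with
  | zero hl => exact ⟨h, by rw [Nat.le_zero.1 hq]; exact .zero hl⟩
  | @succ p u v r₁ e₁ hl ih =>
    rcases Nat.lt_or_ge q (p + 1) with h | h
    · exact ih (by omega)
    · exact ⟨_, by rw [le_antisymm hq h]; exact .succ r₁ e₁ hl⟩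

theorem Run.exists_next {h v : V} {p q : ℕ} (r : D.Run h p v) (hq : q < p) :
    ∃ u w, D.Run h q u ∧ D.edge u EdgeLabel.plain w ∧ D.Run h (q + 1) w := by
  obtain ⟨w, hw⟩ := r.exists_of_le hq
  cases hw with
  | succ r₁ e₁ hl => exact ⟨_, w, r₁, e₁, .succ r₁ e₁ hl⟩

theorem IsLink.label_head {x h y : V} {a : ℕ} (l : D.IsLink x h a y) :
    D.label h = NodeLabel.W := by
  obtain ⟨u, r, -⟩ := l.2.2.2.2
  obtain ⟨w, hw⟩ := r.exists_of_le (Nat.zero_le _)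
  cases hw
  assumption

/-- After position `a` the only outgoing edge leads to a node-vertex, where no run continues. -/
theorem IsLink.pos_le (hD : D.IsStringGraph) {x h y v : V} {a p : ℕ} (l : D.IsLink x h a y)
    (r : D.Run h p v) : p ≤ a := by
  by_contra hlt
  obtain ⟨u, ru, eu⟩ := l.2.2.2.2
  obtain ⟨u', w, ru', e', rw'⟩ := r.exists_next (not_le.1 hlt)
  have := ru.unique hD ru'
  subst this
  have := hD.out_degree _ ru.label_eq _ _ _ _ eu e'
  have h1 := l.2.1
  rw [this, rw'.label_eq] at h1
  cases h1

theorem IsLink.unique (hD : D.IsStringGraph) {x h y x' y' : V} {a a' : ℕ} (l : D.IsLink x h a y)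
    (l' : D.IsLink x' h a' y') : x = x' ∧ a = a' ∧ y = y' := by
  obtain ⟨u, r, e⟩ := l.2.2.2.2
  obtain ⟨u', r', e'⟩ := l'.2.2.2.2
  have ha : a = a' := le_antisymm (l'.pos_le hD r) (l.pos_le hD r')
  subst ha
  have := r.unique hD r'
  subst this
  exact ⟨hD.in_degree _ l.label_head _ _ _ _ l.2.2.2.1 l'.2.2.2.1, rfl,
    hD.out_degree _ r.label_eq _ _ _ _ e e'⟩

/-- `v` lies on a link with first vertex in `O`. -/
def OnLinks (D : LGraph NodeLabel EdgeLabel V) (O : Set V) (v : V) : Prop :=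
  ∃ h ∈ O, ∃ p, D.Run h p v

/-- Replace the links with first vertex in `O` by edges: `t + 1` links from `x` to `y` of length
`a + 1` become the edges labelled `β ⟨a, 0⟩, …, β ⟨a, t⟩`. -/
def encode (D : LGraph NodeLabel EdgeLabel V) (O : Set V) :
    LGraph NodeLabel EdgeLabel {v : V // ¬ D.OnLinks O v} where
  edge x γ y := D.edge x.1 γ y.1 ∨ ∃ a t, γ = EdgeLabel.beta (Nat.pair a t) ∧
    t < Set.ncard {h | h ∈ O ∧ D.IsLink x.1 h a y.1}
  irrefl x γ := by
    rintro (h | ⟨a, t, -, ht⟩)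
    · exact D.irrefl _ _ h
    · have : {h | h ∈ O ∧ D.IsLink x.1 h a x.1} = ∅ := by
        ext h
        exact ⟨fun h => h.2.2.2.1 rfl, fun h => h.elim⟩
      rw [this, Set.ncard_empty] at ht
      omega
  label x := D.label x.1

/-- The number of interior vertices of the wires that replace edges labelled `β k`. -/
def wireLen (k : ℕ) : ℕ := k.unpair.1 + 1

/-- Numbers parallel links, so that the edge labelled `β ⟨a, t⟩` can stand for the `t`-th of them.
Values outside the range are arbitrary vertices. -/
theorem exists_enum [Finite V] [Nonempty V] (S : Set V) :
    ∃ en : ℕ → V, S.Nonempty → Set.BijOn en (Set.Iio S.ncard) S := by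
  classical
  rcases S.eq_empty_or_nonempty with rfl | ⟨s, hs⟩
  · exact ⟨fun _ => Classical.arbitrary V, by simp⟩
  · have e : Fin S.ncard ≃ S := (Finite.equivFinOfCardEq rfl).symm
    refine ⟨fun t => if h : t < S.ncard then (e ⟨t, h⟩).1 else s, fun _ => ⟨?_, ?_, ?_⟩⟩
    · intro t ht
      have ht' : t < S.ncard := ht
      simp only [dif_pos ht']
      exact (e _).2
    · intro t ht t' ht' h
      have h1 : t < S.ncard := ht
      have h2 : t' < S.ncard := ht'
      simp only [dif_pos h1, dif_pos h2] at h
      exact congrArg Fin.val (e.injective (Subtype.ext h))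
    · intro h hh
      obtain ⟨t, ht⟩ := e.surjective ⟨h, hh⟩
      exact ⟨t.1, t.2, by simp [ht]⟩

/-- Decoding recovers the string graph. -/
theorem wireExpand_encode [Finite V] (hD : D.IsStringGraph) (O : Set V)
    (hO : ∀ h ∈ O, ∃ x a y, D.IsLink x h a y) :
    (wireExpand wireLen (D.encode O)).IsIso D := by
  classical
  -- The enumerations below need a default vertex, so the empty graph is treated apart.
  rcases isEmpty_or_nonempty V with hV | hV
  · refine isIso_of_bij (fun x => x.elim (fun v => v.1) (fun s => s.src.1))
      ⟨?_, fun v => isEmptyElim v⟩ ?_ ?_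
    · rintro (x | s)
      · exact isEmptyElim x.1
      · exact isEmptyElim s.src.1
    · rintro (x | s)
      · exact isEmptyElim x.1
      · exact isEmptyElim s.src.1
    · rintro (x | s)
      · exact isEmptyElim x.1
      · exact isEmptyElim s.src.1
  have hen : ∀ x a y, ∃ en : ℕ → V, {h | h ∈ O ∧ D.IsLink x h a y}.Nonempty → Set.BijOn en
      (Set.Iio (Set.ncard {h | h ∈ O ∧ D.IsLink x h a y})) {h | h ∈ O ∧ D.IsLink x h a y} :=
    fun x a y => exists_enum _
  choose en hen using hen
  have hvx : ∀ h p, ∃ v, (∃ u, D.Run h p u) → D.Run h p v := by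
    intro h p
    by_cases hh : ∃ u, D.Run h p u
    · exact hh.imp fun v hv _ => hv
    · exact ⟨hV.some, fun h => absurd h hh⟩
  choose vx hvx using hvx
  have hedge : ∀ s : WireSlot wireLen (D.encode O), s.idx.unpair.2 <
      Set.ncard {h | h ∈ O ∧ D.IsLink s.src.1 h s.idx.unpair.1 s.tgt.1} := by
    intro s
    rcases s.isEdge with h | ⟨a, t, hk, ht⟩
    · exact absurd (hD.edge_plain _ _ _ h) (by simp)
    · have hk' : s.idx = Nat.pair a t := by simpa using hk
      rw [hk', Nat.unpair_pair]
      exact ht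
  -- A slot of the edge `β ⟨a, t⟩` goes into the `t`-th of the selected links of that length between
  -- its endpoints; `Nat.unpair` reads `a` and `t` off the label.
  let hd : WireSlot wireLen (D.encode O) → V := fun s =>
    en s.src.1 s.idx.unpair.1 s.tgt.1 s.idx.unpair.2
  have hne : ∀ s : WireSlot wireLen (D.encode O),
      {h | h ∈ O ∧ D.IsLink s.src.1 h s.idx.unpair.1 s.tgt.1}.Nonempty := fun s =>
    Set.nonempty_of_ncard_ne_zero (by have := hedge s; omega)
  have hhd : ∀ s, hd s ∈ O ∧ D.IsLink s.src.1 (hd s) s.idx.unpair.1 s.tgt.1 := fun s =>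
    (hen _ _ _ (hne s)).mapsTo (hedge s)
  have hrun : ∀ s : WireSlot wireLen (D.encode O), D.Run (hd s) s.pos (vx (hd s) s.pos) := by
    intro s
    obtain ⟨u, hu, -⟩ := (hhd s).2.2.2.2.2
    exact hvx _ _ (hu.exists_of_le (Nat.lt_succ_iff.1 s.pos_lt))
  have hon : ∀ s : WireSlot wireLen (D.encode O), D.OnLinks O (vx (hd s) s.pos) := fun s =>
    ⟨_, (hhd s).1, _, hrun s⟩
  have hinj : ∀ s s' : WireSlot wireLen (D.encode O), hd s = hd s' →
      s.src = s'.src ∧ s.idx = s'.idx ∧ s.tgt = s'.tgt := by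
    intro s s' h
    have l := (hhd s).2
    rw [h] at l
    obtain ⟨h1, h2, h3⟩ := l.unique hD (hhd s').2
    have h1' : s.src = s'.src := Subtype.ext h1
    have h3' : s.tgt = s'.tgt := Subtype.ext h3
    refine ⟨h1', ?_, h3'⟩
    have h4 : s.idx.unpair.2 = s'.idx.unpair.2 := by
      refine (hen _ _ _ (hne s')).injOn ?_ (hedge s') ?_
      · have := hedge s
        rw [h1, h2, h3] at this
        exact this
      · simp only [hd] at h
        rw [h1, h2, h3] at h
        exact h
    rw [← Nat.pair_unpair s.idx, ← Nat.pair_unpair s'.idx, h2, h4]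
  refine isIso_of_bij (fun x => x.elim (fun v => v.1) (fun s => vx (hd s) s.pos))
    ⟨?_, ?_⟩ ?_ ?_
  · rintro (v | s) (v' | s') h
    · exact congrArg _ (Subtype.ext h)
    · have h' : v.1 = vx (hd s') s'.pos := h
      exact absurd (h' ▸ hon s') v.2
    · have h' : vx (hd s) s.pos = v'.1 := h
      exact absurd (h' ▸ hon s) v'.2
    · simp only [Sum.elim_inr] at h
      have r := hrun s
      rw [h] at r
      obtain ⟨h1, h2⟩ := r.head_unique hD (hhd s).2.1 (hhd s).2.2.2.2.1 (hrun s') (hhd s').2.1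
        (hhd s').2.2.2.2.1
      obtain ⟨h3, h4, h5⟩ := hinj s s' h1
      obtain ⟨_, _, _, _, _, _⟩ := s
      obtain ⟨_, _, _, _, _, _⟩ := s'
      simp only at h2 h3 h4 h5
      subst h2 h3 h4 h5
      rfl
  · intro v
    by_cases hv : D.OnLinks O v
    · obtain ⟨h, hh, p, r⟩ := hv
      obtain ⟨x, a, y, l⟩ := hO h hh
      have hN : ∀ z, D.label z = NodeLabel.N → ¬ D.OnLinks O z := by
        rintro z hz ⟨h, -, p, r⟩
        rw [r.label_eq] at hz
        cases hz
      obtain ⟨t, ht, hth⟩ := (hen x a y ⟨h, hh, l⟩).surjOn ⟨hh, l⟩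
      refine ⟨.inr ⟨⟨x, hN x l.1⟩, Nat.pair a t, ⟨y, hN y l.2.1⟩, p, .inr ⟨a, t, rfl, ht⟩, ?_⟩, ?_⟩
      · rw [wireLen, Nat.unpair_pair]
        exact Nat.lt_succ_of_le (l.pos_le hD r)
      · simp only [Sum.elim_inr, hd, Nat.unpair_pair, hth]
        exact (hvx h p ⟨v, r⟩).unique hD r
    · exact ⟨.inl ⟨v, hv⟩, rfl⟩
  · rintro (v | s) γ (v' | s')
    · constructor
      · rintro ⟨h | ⟨a, t, hk, -⟩, h'⟩
        · exact h
        · exact absurd hk (h' _)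
      · intro h
        refine ⟨.inl h, fun k hk => ?_⟩
        rw [hD.edge_plain _ _ _ h] at hk
        cases hk
    · simp only [Sum.elim_inl, Sum.elim_inr, wireExpand]
      have r := hrun s'
      constructor
      · rintro ⟨rfl, h1, h2⟩
        rw [h2] at r ⊢
        rw [r.unique hD (.zero (hhd s').2.label_head), ← h1]
        exact (hhd s').2.2.2.2.1
      · intro h
        have := hD.edge_plain _ _ _ h
        subst this
        generalize hp : s'.pos = p at r h
        generalize hw : vx (hd s') p = w at r h
        cases r with
        | zero hl =>
          exact ⟨rfl, Subtype.ext (hD.in_degree _ hl _ _ _ _ (hhd s').2.2.2.2.1 h), rfl⟩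
        -- At a later position the predecessor lies on the encoded link itself, so it cannot be a
        -- vertex that survives the encoding.
        | succ r₁ e₁ hl =>
          have := hD.in_degree _ hl _ _ _ _ h e₁
          exact absurd ⟨_, (hhd s').1, _, r₁⟩ (this ▸ v.2)
    · simp only [Sum.elim_inl, Sum.elim_inr, wireExpand]
      have r := hrun s
      obtain ⟨u, hu, eu⟩ := (hhd s).2.2.2.2.2
      constructor
      · rintro ⟨rfl, h1, h2⟩
        have hpos : s.pos = s.idx.unpair.1 := by
          rw [wireLen] at h2
          omega
        rw [hpos] at r ⊢
        rw [r.unique hD hu, ← h1]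
        exact eu
      · intro h
        have := hD.edge_plain _ _ _ h
        subst this
        have hlt := s.pos_lt
        rw [wireLen] at hlt
        rcases Nat.lt_succ_iff_lt_or_eq.1 hlt with hlt | heq
        · obtain ⟨u', w, r1, e1, r2⟩ := hu.exists_next hlt
          have := r1.unique hD r
          subst this
          have := hD.out_degree _ r1.label_eq _ _ _ _ e1 h
          exact absurd ⟨_, (hhd s).1, _, r2⟩ (this ▸ v'.2)
        · refine ⟨rfl, ?_, by rw [wireLen, heq]⟩
          rw [heq] at r h
          have := r.unique hD hu
          rw [this] at h
          exact Subtype.ext (hD.out_degree _ hu.label_eq _ _ _ _ eu h)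
    · simp only [Sum.elim_inr, wireExpand]
      have r := hrun s
      have r' := hrun s'
      constructor
      · rintro ⟨rfl, h1, h2, h3, h4⟩
        have hh : hd s = hd s' := by simp only [hd, h1, h2, h3]
        rw [h4, ← hh] at r' ⊢
        obtain ⟨u, w, r1, e1, r2⟩ := r'.exists_next (Nat.lt_succ_self _)
        rw [r.unique hD r1, r'.unique hD r2]
        exact e1
      · intro h
        have := hD.edge_plain _ _ _ h
        subst this
        generalize hp : s'.pos = p at r' h
        generalize hw : vx (hd s') p = w at r' h
        cases r' with
        | zero hl =>
          have h1 := hD.in_degree _ hl _ _ _ _ (hhd s').2.2.2.2.1 h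
          have h2 := (hhd s').2.1
          rw [h1, r.label_eq] at h2
          cases h2
        | succ r₁ e₁ hl =>
          have := hD.in_degree _ hl _ _ _ _ h e₁
          subst this
          obtain ⟨h1, h2⟩ := r.head_unique hD (hhd s).2.1 (hhd s).2.2.2.2.1 r₁ (hhd s').2.1
            (hhd s').2.2.2.2.1
          obtain ⟨h3, h4, h5⟩ := hinj s s' h1
          exact ⟨rfl, h3, h4, h5, by rw [h2]⟩
  · rintro (v | s)
    · rfl
    · exact (hrun s).label_eq.symm

end LGraph

/-! ### Canonical selections make the encoding independent of choices -/

namespace LGraph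
variable {V V' : Type} {D : LGraph NodeLabel EdgeLabel V} {D' : LGraph NodeLabel EdgeLabel V'}

/-- Among the links between any two node-vertices and of any given length, `O` selects `J`, or all
if there are at most `J`. -/
def IsCanonical (D : LGraph NodeLabel EdgeLabel V) (J : ℕ) (O : Set V) : Prop :=
  (∀ h ∈ O, ∃ x a y, D.IsLink x h a y) ∧
    ∀ x a y, Set.ncard {h | h ∈ O ∧ D.IsLink x h a y} = min J (Set.ncard {h | D.IsLink x h a y})

theorem Run.map (e : V → V') (hlab : ∀ v, D.label v = D'.label (e v))
    (hedge : ∀ u v, D.edge u EdgeLabel.plain v → D'.edge (e u) EdgeLabel.plain (e v))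
    {h v : V} {p : ℕ} (r : D.Run h p v) : D'.Run (e h) p (e v) := by
  induction r with
  | zero hl => exact .zero (by rw [← hlab, hl])
  | succ _ e₁ hl ih => exact .succ ih (hedge _ _ e₁) (by rw [← hlab, hl])

theorem IsLink.map (e : V → V') (he : Function.Injective e) (hlab : ∀ v, D.label v = D'.label (e v))
    (hedge : ∀ u v, D.edge u EdgeLabel.plain v → D'.edge (e u) EdgeLabel.plain (e v))
    {x h y : V} {a : ℕ} (l : D.IsLink x h a y) : D'.IsLink (e x) (e h) a (e y) := by
  obtain ⟨h1, h2, h3, h4, u, h5, h6⟩ := l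
  exact ⟨by rw [← hlab, h1], by rw [← hlab, h2], fun h => h3 (he h), hedge _ _ h4, e u,
    h5.map e hlab hedge, hedge _ _ h6⟩

theorem encode_iso (e : V ≃ V') (hlab : ∀ v, D.label v = D'.label (e v))
    (hedge : ∀ u γ v, D.edge u γ v ↔ D'.edge (e u) γ (e v)) (O : Set V) :
    (D.encode O).IsIso (D'.encode (e '' O)) := by
  have hlab' : ∀ v, D'.label v = D.label (e.symm v) := fun v => by rw [hlab, e.apply_symm_apply]
  have hedge' : ∀ u γ v, D'.edge u γ v → D.edge (e.symm u) γ (e.symm v) := fun u γ v h => by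
    rw [hedge]
    simpa using h
  have hrun : ∀ h p v, D.Run h p v ↔ D'.Run (e h) p (e v) := by
    intro h p v
    refine ⟨fun r => r.map e hlab (fun _ _ => (hedge _ _ _).1), fun r => ?_⟩
    simpa using r.map e.symm hlab' (fun _ _ => hedge' _ _ _)
  have hlink : ∀ x h a y, D.IsLink x h a y ↔ D'.IsLink (e x) (e h) a (e y) := by
    intro x h a y
    refine ⟨fun r => r.map e e.injective hlab (fun _ _ => (hedge _ _ _).1), fun r => ?_⟩
    simpa using r.map e.symm e.symm.injective hlab' (fun _ _ => hedge' _ _ _)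
  refine ⟨e.subtypeEquiv fun v => not_congr ?_, ?_, fun x => hlab _⟩
  · constructor
    · rintro ⟨h, hh, p, r⟩
      exact ⟨e h, ⟨h, hh, rfl⟩, p, (hrun _ _ _).1 r⟩
    · rintro ⟨_, ⟨h, hh, rfl⟩, p, r⟩
      exact ⟨h, hh, p, (hrun _ _ _).2 r⟩
  · intro x γ y
    refine or_congr (hedge _ _ _) (exists₂_congr fun a t => and_congr_right fun _ => ?_)
    have : {h | h ∈ e '' O ∧ D'.IsLink (e x.1) h a (e y.1)} =
        e '' {h | h ∈ O ∧ D.IsLink x.1 h a y.1} := by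
      ext h
      constructor
      · rintro ⟨⟨h, hh, rfl⟩, l⟩
        exact ⟨h, ⟨hh, (hlink _ _ _ _).2 l⟩, rfl⟩
      · rintro ⟨h, ⟨hh, l⟩, rfl⟩
        exact ⟨⟨h, hh, rfl⟩, (hlink _ _ _ _).1 l⟩
    change t < _ ↔ t < Set.ncard {h | h ∈ e '' O ∧ D'.IsLink (e x.1) h a (e y.1)}
    rw [this, Set.ncard_image_of_injective _ e.injective]

/-- A permutation of the links that preserves endpoints and lengths extends to the graph. -/
theorem exists_auto_of_perm (hD : D.IsStringGraph) (π : V ≃ V)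
    (hπ : ∀ x h a y, D.IsLink x h a y ↔ D.IsLink x (π h) a y) :
    ∃ σ : V ≃ V, (∀ v, D.label v = D.label (σ v)) ∧
      (∀ u γ v, D.edge u γ v → D.edge (σ u) γ (σ v)) ∧
      ∀ x h a y, D.IsLink x h a y → σ h = π h := by
  classical
  -- The extension moves the vertex at position `p` of the link with head `h` to position `p` of the
  -- link with head `π h`, and fixes every vertex not on a link.
  have key : ∀ π : V ≃ V, (∀ x h a y, D.IsLink x h a y ↔ D.IsLink x (π h) a y) →
      ∃ f : V → V, (∀ v, (¬ ∃ x h a y p, D.IsLink x h a y ∧ D.Run h p v) → f v = v) ∧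
        ∀ x h a y p v, D.IsLink x h a y → D.Run h p v → D.Run (π h) p (f v) := by
    intro π hπ
    have : ∀ v, ∃ w, ((¬ ∃ x h a y p, D.IsLink x h a y ∧ D.Run h p v) → w = v) ∧
        ∀ x h a y p, D.IsLink x h a y → D.Run h p v → D.Run (π h) p w := by
      intro v
      by_cases hv : ∃ x h a y p, D.IsLink x h a y ∧ D.Run h p v
      · obtain ⟨x, h, a, y, p, l, r⟩ := hv
        obtain ⟨u, hu, -⟩ := ((hπ x h a y).1 l).2.2.2.2
        obtain ⟨w, hw⟩ := hu.exists_of_le (l.pos_le hD r)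
        refine ⟨w, fun hn => absurd ⟨x, h, a, y, p, l, r⟩ hn, fun x' h' a' y' p' l' r' => ?_⟩
        obtain ⟨rfl, rfl⟩ := r.head_unique hD l.1 l.2.2.2.1 r' l'.1 l'.2.2.2.1
        exact hw
      · exact ⟨v, fun _ => rfl, fun x h a y p l r => absurd ⟨x, h, a, y, p, l, r⟩ hv⟩
    choose f hf hf' using this
    exact ⟨f, hf, fun x h a y p v => hf' v x h a y p⟩
  have hπ' : ∀ x h a y, D.IsLink x h a y ↔ D.IsLink x (π.symm h) a y := by
    intro x h a y
    rw [hπ x (π.symm h), π.apply_symm_apply]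
  obtain ⟨f, hf, hfr⟩ := key π hπ
  obtain ⟨g, hg, hgr⟩ := key π.symm hπ'
  have inv : ∀ (π : V ≃ V) (f g : V → V),
      (∀ x h a y, D.IsLink x h a y ↔ D.IsLink x (π h) a y) →
      (∀ v, (¬ ∃ x h a y p, D.IsLink x h a y ∧ D.Run h p v) → f v = v) →
      (∀ v, (¬ ∃ x h a y p, D.IsLink x h a y ∧ D.Run h p v) → g v = v) →
      (∀ x h a y p v, D.IsLink x h a y → D.Run h p v → D.Run (π h) p (f v)) →
      (∀ x h a y p v, D.IsLink x h a y → D.Run h p v → D.Run (π.symm h) p (g v)) →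
      ∀ v, g (f v) = v := by
    intro π f g hπ hf hg hfr hgr v
    by_cases hv : ∃ x h a y p, D.IsLink x h a y ∧ D.Run h p v
    · obtain ⟨x, h, a, y, p, l, r⟩ := hv
      have := hgr x _ a y p _ ((hπ _ _ _ _).1 l) (hfr x h a y p v l r)
      rw [π.symm_apply_apply] at this
      exact this.unique hD r
    · rw [hf v hv, hg v hv]
  have hlabf : ∀ v, D.label v = D.label (f v) := by
    intro v
    by_cases hv : ∃ x h a y p, D.IsLink x h a y ∧ D.Run h p v
    · obtain ⟨x, h, a, y, p, l, r⟩ := hv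
      rw [r.label_eq, (hfr x h a y p v l r).label_eq]
    · rw [hf v hv]
  refine ⟨⟨f, g, inv π f g hπ hf hg hfr hgr, inv π.symm g f hπ' hg hf hgr (by simpa using hfr)⟩,
    hlabf, ?_, ?_⟩
  · intro u γ v e
    have := hD.edge_plain _ _ _ e
    subst this
    change D.edge (f u) _ (f v)
    by_cases hu : ∃ x h a y p, D.IsLink x h a y ∧ D.Run h p u
    · obtain ⟨x, h, a, y, p, l, r⟩ := hu
      have rf := hfr x h a y p u l r
      have l' := (hπ _ _ _ _).1 l
      obtain ⟨w, hw, ew⟩ := l.2.2.2.2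
      obtain ⟨w', hw', ew'⟩ := l'.2.2.2.2
      rcases (l.pos_le hD r).lt_or_eq with hp | hp
      · obtain ⟨u₁, w₁, r1, e1, r2⟩ := hw.exists_next hp
        have := r1.unique hD r
        subst this
        have := hD.out_degree _ r.label_eq _ _ _ _ e e1
        subst this
        obtain ⟨u₂, w₂, r1', e1', r2'⟩ := hw'.exists_next hp
        rw [rf.unique hD r1', (hfr x h a y _ v l r2).unique hD r2']
        exact e1'
      · subst hp
        have := r.unique hD hw
        subst this
        have := hD.out_degree _ r.label_eq _ _ _ _ e ew
        subst this
        rw [rf.unique hD hw', hf v]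
        · exact ew'
        · rintro ⟨x, h, a, y, p, l', r'⟩
          have := l.2.1
          rw [r'.label_eq] at this
          cases this
    · rw [hf u hu]
      by_cases hv : ∃ x h a y p, D.IsLink x h a y ∧ D.Run h p v
      · obtain ⟨x, h, a, y, p, l, r⟩ := hv
        have rf := hfr x h a y p v l r
        cases r with
        | zero hl =>
          have := hD.in_degree _ hl _ _ _ _ e l.2.2.2.1
          subst this
          have l' := (hπ _ _ _ _).1 l
          rw [rf.unique hD (.zero l'.label_head)]
          exact l'.2.2.2.1
        | succ r₁ e₁ hl =>
          have := hD.in_degree _ hl _ _ _ _ e e₁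
          subst this
          exact absurd ⟨x, h, a, y, _, l, r₁⟩ hu
      · rw [hf v hv]
        exact e
  · intro x h a y l
    have := hfr x h a y 0 h l (.zero l.label_head)
    exact this.unique hD (.zero ((hπ _ _ _ _).1 l).label_head)

/-- The permutation is assembled from bijections between classes of vertices: a vertex is classified
by the link it heads, if any, and by whether it is selected. Canonicity says that corresponding
classes have the same size. -/
theorem exists_perm_of_canonical [Finite V] (hD : D.IsStringGraph) {J : ℕ} {O O' : Set V}
    (hO : D.IsCanonical J O) (hO' : D.IsCanonical J O') :
    ∃ π : V ≃ V, (∀ x h a y, D.IsLink x h a y ↔ D.IsLink x (π h) a y) ∧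
      ∀ h, h ∈ O ↔ π h ∈ O' := by
  -- By uniqueness of links this set is a singleton if `h` heads a link, and empty otherwise.
  let lk : V → Set (V × ℕ × V) := fun h => {k | D.IsLink k.1 h k.2.1 k.2.2}
  have hlk : ∀ h x a y, D.IsLink x h a y ↔ lk h = {(x, a, y)} := by
    intro h x a y
    constructor
    · intro l
      ext ⟨x', a', y'⟩
      constructor
      · intro l'
        obtain ⟨rfl, rfl, rfl⟩ := l.unique hD l'
        rfl
      · rintro ⟨⟩
        exact l
    · intro hs
      have : (x, a, y) ∈ lk h := by rw [hs]; rfl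
      exact this
  have hfib : ∀ c : Set (V × ℕ × V) × Prop, Nonempty
      ({h : V // (lk h, h ∈ O) = c} ≃ {h : V // (lk h, h ∈ O') = c}) := by
    rintro ⟨s, P⟩
    suffices h : Set.ncard {h : V | (lk h, h ∈ O) = (s, P)} =
        Set.ncard {h : V | (lk h, h ∈ O') = (s, P)} from Finite.card_eq.1 h
    -- If `m` links share their endpoints and length, each selection contains `min J m` of them and
    -- so omits equally many. Vertices heading no link are in neither selection.
    by_cases hs : ∃ x a y, s = {(x, a, y)}
    · obtain ⟨x, a, y, rfl⟩ := hs
      have hset : ∀ O : Set V, D.IsCanonical J O →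
          Set.ncard {h : V | (lk h, h ∈ O) = ({(x, a, y)}, P)} =
          Set.ncard {h : V | D.IsLink x h a y ∧ ((h ∈ O) ↔ P)} := by
        intro O _
        congr 1
        ext h
        simp [← hlk]
      rw [hset O hO, hset O' hO']
      have hT : ∀ O : Set V, D.IsCanonical J O →
          Set.ncard {h : V | D.IsLink x h a y ∧ h ∈ O} = min J (Set.ncard {h | D.IsLink x h a y}) := by
        intro O h
        rw [← h.2 x a y]
        congr 1
        ext h
        exact and_comm
      have hF : ∀ O : Set V, D.IsCanonical J O →
          Set.ncard {h : V | D.IsLink x h a y ∧ h ∉ O} = Set.ncard {h | D.IsLink x h a y} -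
            min J (Set.ncard {h | D.IsLink x h a y}) := by
        intro O h
        rw [← hT O h, ← Set.ncard_sdiff (fun h hh => hh.1) (Set.toFinite _)]
        congr 1
        ext h
        constructor
        · exact fun h => ⟨h.1, fun h' => h.2 h'.2⟩
        · exact fun h => ⟨h.1, fun h' => h.2 ⟨h.1, h'⟩⟩
      by_cases hP : P
      · simp only [hP, iff_true]
        rw [hT O hO, hT O' hO']
      · simp only [hP, iff_false]
        rw [hF O hO, hF O' hO']
    · have hne : ∀ h, lk h = s → ∀ O : Set V, D.IsCanonical J O → h ∉ O := by
        rintro h rfl O hO hh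
        obtain ⟨x, a, y, l⟩ := hO.1 h hh
        exact hs ⟨x, a, y, (hlk _ _ _ _).1 l⟩
      congr 1
      ext h
      simp only [Prod.mk.injEq, Set.mem_ofPred_eq]
      refine and_congr_right fun hh => ?_
      simp [hne h hh O hO, hne h hh O' hO']
  let E := fun c => Classical.choice (hfib c)
  have hE := Equiv.ofFiberEquiv_map E
  refine ⟨Equiv.ofFiberEquiv E, fun x h a y => ?_, fun h => ?_⟩
  · rw [hlk, hlk, (Prod.mk.inj (hE h)).1]
  · have := (Prod.mk.inj (hE h)).2
    rw [this]

/-- Canonical encodings of isomorphic string graphs are isomorphic. -/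
theorem encode_iso_of_canonical [Finite V] (hD : D.IsStringGraph) (hDD : D.IsIso D') {J : ℕ}
    {O : Set V} {O' : Set V'} (hO : D.IsCanonical J O) (hO' : D'.IsCanonical J O') :
    (D.encode O).IsIso (D'.encode O') := by
  obtain ⟨e, hedge, hlab⟩ := hDD
  have hlab' : ∀ v, D'.label v = D.label (e.symm v) := fun v => by rw [hlab, e.apply_symm_apply]
  have hedge' : ∀ u γ v, D'.edge u γ v ↔ D.edge (e.symm u) γ (e.symm v) := fun u γ v => by
    rw [hedge, e.apply_symm_apply, e.apply_symm_apply]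
  have hlink : ∀ x h a y, D.IsLink x h a y ↔ D'.IsLink (e x) (e h) a (e y) := by
    intro x h a y
    refine ⟨fun r => r.map e e.injective hlab (fun _ _ => (hedge _ _ _).1), fun r => ?_⟩
    simpa using r.map e.symm e.symm.injective hlab' (fun _ _ => (hedge' _ _ _).1)
  have hO₂ : D.IsCanonical J (e.symm '' O') := by
    constructor
    · rintro _ ⟨h, hh, rfl⟩
      obtain ⟨x, a, y, l⟩ := hO'.1 h hh
      exact ⟨e.symm x, a, e.symm y, by rw [hlink]; simpa using l⟩
    · intro x a y
      have h1 : {h | D'.IsLink (e x) h a (e y)} = e '' {h | D.IsLink x h a y} := by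
        ext h
        constructor
        · exact fun l => ⟨e.symm h, by simpa [hlink] using l, by simp⟩
        · rintro ⟨h, l, rfl⟩
          exact (hlink _ _ _ _).1 l
      have h2 : {h | h ∈ O' ∧ D'.IsLink (e x) h a (e y)} =
          e '' {h | h ∈ e.symm '' O' ∧ D.IsLink x h a y} := by
        ext h
        constructor
        · rintro ⟨hh, l⟩
          exact ⟨e.symm h, ⟨⟨h, hh, rfl⟩, by simpa [hlink] using l⟩, by simp⟩
        · rintro ⟨h, ⟨⟨h', hh, rfl⟩, l⟩, rfl⟩
          exact ⟨by simpa using hh, (hlink _ _ _ _).1 l⟩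
      have := hO'.2 (e x) a (e y)
      rwa [h1, h2, Set.ncard_image_of_injective _ e.injective,
        Set.ncard_image_of_injective _ e.injective] at this
  obtain ⟨π, hπ, hπO⟩ := exists_perm_of_canonical hD hO hO₂
  obtain ⟨σ, hσl, hσe, hσ⟩ := exists_auto_of_perm hD π hπ
  have hσO : σ '' O = e.symm '' O' := by
    ext h
    constructor
    · rintro ⟨h, hh, rfl⟩
      obtain ⟨x, a, y, l⟩ := hO.1 h hh
      rw [hσ _ _ _ _ l]
      exact (hπO h).1 hh
    · intro hh
      obtain ⟨x, a, y, l⟩ := hO₂.1 h hh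
      refine ⟨π.symm h, (hπO _).2 (by simpa using hh), ?_⟩
      rw [hσ x _ a y ((hπ _ _ _ _).2 (by simpa using l)), π.apply_symm_apply]
  -- A permutation of a finite set has a power equal to its inverse, so preserving edges in one
  -- direction is enough.
  have hσe' : ∀ u γ v, D.edge u γ v ↔ D.edge (σ u) γ (σ v) := by
    intro u γ v
    refine ⟨hσe u γ v, fun h => ?_⟩
    have hpow : ∀ k : ℕ, ∀ u v, D.edge u γ v → D.edge ((σ ^ k : Equiv.Perm V) u) γ
        ((σ ^ k : Equiv.Perm V) v) := by
      intro k
      induction k with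
      | zero => exact fun u v h => h
      | succ k ih =>
        intro u v h
        rw [pow_succ', Equiv.Perm.mul_apply, Equiv.Perm.mul_apply]
        exact hσe _ _ _ (ih u v h)
    obtain ⟨k, hk, hk'⟩ := isOfFinOrder_iff_pow_eq_one.1 (isOfFinOrder_of_finite (σ : Equiv.Perm V))
    obtain ⟨m, rfl⟩ : ∃ m, k = m + 1 := ⟨k - 1, by omega⟩
    have := hpow m _ _ h
    rw [← Equiv.Perm.mul_apply, ← Equiv.Perm.mul_apply, ← pow_succ, hk'] at this
    exact this
  have h1 := encode_iso σ hσl hσe' O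
  rw [hσO] at h1
  have h2 := encode_iso e hlab hedge (e.symm '' O')
  rw [show e '' (e.symm '' O') = O' from e.symm.symm_image_image O'] at h2
  exact h1.trans h2

end LGraph

/-! ### !-graphs with an outermost !-box; tight and loose links -/

namespace BangData
variable {V B : Type}

/-- A !-graph with an outermost !-box `t` containing everything, in which incomparable !-boxes
overlap only on links between them. Only the vertices in `t` and the !-boxes below `t` matter. -/
structure IsTopped (H : BangData V B) (t : B) : Prop where
  string : H.graph.IsStringGraph
  le_refl : ∀ b, H.le b t → H.le b b
  le_dom : ∀ a b, H.le a b → H.le a t ∧ H.le b t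
  le_trans : ∀ a b c, H.le a b → H.le b c → H.le a c
  le_antisymm : ∀ a b, H.le a b → H.le b a → a = b
  finite_boxes : {b | H.le b t}.Finite
  content_mono : ∀ a b, H.le a b → H.content a ⊆ H.content b
  content_dom : ∀ b v, v ∈ H.content b → H.le b t
  finite_content : (H.content t).Finite
  edge_dom : ∀ u γ v, H.graph.edge u γ v → u ∈ H.content t ∧ v ∈ H.content t
  node_wire : ∀ u γ v b, H.graph.edge u γ v → H.graph.label u = .N →
    u ∈ H.content b → v ∈ H.content b
  wire_node : ∀ u γ v b, H.graph.edge u γ v → H.graph.label v = .N →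
    v ∈ H.content b → u ∈ H.content b
  wire_wire : ∀ u γ v b, H.graph.edge u γ v → H.graph.label u = .W → H.graph.label v = .W →
    (u ∈ H.content b ↔ v ∈ H.content b)
  nested : ∀ b₁ b₂ c, H.le c b₁ → H.le c b₂ → (H.content c).Nonempty → H.le b₁ b₂ ∨ H.le b₂ b₁
  overlap : ∀ b₁ b₂ v, v ∈ H.content b₁ → v ∈ H.content b₂ → H.le b₁ b₂ ∨ H.le b₂ b₁ ∨
    ∃ x h a y p, H.graph.IsLink x h a y ∧ H.graph.Run h p v ∧
      ((x ∈ H.content b₁ ∧ x ∉ H.content b₂ ∧ y ∈ H.content b₂ ∧ y ∉ H.content b₁) ∨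
        (x ∈ H.content b₂ ∧ x ∉ H.content b₁ ∧ y ∈ H.content b₁ ∧ y ∉ H.content b₂))

/-- The !-boxes containing `v` are those above `c`. -/
def IsLeast (H : BangData V B) (v : V) (c : B) : Prop := ∀ b, v ∈ H.content b ↔ H.le c b

/-- The !-boxes containing `x` or `y` are those above `c`. -/
def Owns (H : BangData V B) (c : B) (x y : V) : Prop :=
  ∀ b, (x ∈ H.content b ∨ y ∈ H.content b) ↔ H.le c b

/-- The link with first vertex `h` from `x` to `y` lies in no further !-boxes. -/
def IsTight (H : BangData V B) (x h y : V) : Prop :=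
  ∀ b, h ∈ H.content b ↔ x ∈ H.content b ∨ y ∈ H.content b

variable {H : BangData V B} {t : B}

namespace IsTopped

theorem content_run (hH : H.IsTopped t) {h v : V} {p : ℕ} (r : H.graph.Run h p v) (b : B) :
    v ∈ H.content b ↔ h ∈ H.content b := by
  induction r with
  | zero _ => exact Iff.rfl
  | succ r e hl ih => rw [← hH.wire_wire _ _ _ b e r.label_eq hl, ih]

/-- A !-box containing an endpoint contains the adjacent wire-vertex, and membership propagates
along the wire. -/
theorem content_link (hH : H.IsTopped t) {x h y : V} {a : ℕ} (l : H.graph.IsLink x h a y) {b : B}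
    (hb : x ∈ H.content b ∨ y ∈ H.content b) : h ∈ H.content b := by
  rcases hb with hb | hb
  · exact hH.node_wire _ _ _ b l.2.2.2.1 l.1 hb
  · obtain ⟨u, r, e⟩ := l.2.2.2.2
    exact (hH.content_run r b).1 (hH.wire_node _ _ _ b e l.2.1 hb)

/-- The least member is one with the fewest !-boxes below it: a comparable member below it has the
same !-boxes below, hence is above it as well. -/
theorem exists_least_of_chain (hH : H.IsTopped t) (S : Set B) (hS : ∀ b ∈ S, H.le b t)
    (hne : S.Nonempty) (hup : ∀ b ∈ S, ∀ d, H.le b d → d ∈ S)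
    (hch : ∀ b ∈ S, ∀ d ∈ S, H.le b d ∨ H.le d b) : ∃ c, ∀ b, b ∈ S ↔ H.le c b := by
  have hfin : S.Finite := hH.finite_boxes.subset hS
  obtain ⟨c, hc, hmin⟩ := Set.exists_min_image S (fun b => Set.ncard {d | H.le d b}) hfin hne
  refine ⟨c, fun b => ⟨fun hb => ?_, hup c hc b⟩⟩
  rcases hch c hc b hb with h | h
  · exact h
  · have hsub : {d | H.le d b} ⊆ {d | H.le d c} := fun d hd => hH.le_trans _ _ _ hd h
    have hf : {d | H.le d c}.Finite := hH.finite_boxes.subset fun d hd => (hH.le_dom _ _ hd).1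
    have := Set.eq_of_subset_of_ncard_le hsub (hmin b hb) hf
    have hcc : c ∈ {d | H.le d c} := hH.le_refl c (hS c hc)
    rw [← this] at hcc
    exact hcc

/-- If two incomparable !-boxes `b₁`, `b₂` contain `v`, then `v` lies on a link from one to the
other, and this link is tight. Indeed a further !-box `b` containing `v` is not below both, by
`nested`. If it is not below `b₁`, say, then either it contains `b₁`, hence an endpoint, or it
overlaps `b₁` on a link through `v`; that can only be the same link, which then ends in `b`. -/
theorem exists_least (hH : H.IsTopped t) {v : V} (hv : v ∈ H.content t)
    (hn : ∀ x h a y p, H.graph.IsLink x h a y → H.graph.Run h p v → ¬ H.IsTight x h y) :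
    ∃ c, H.IsLeast v c := by
  refine hH.exists_least_of_chain {b | v ∈ H.content b} (fun b hb => hH.content_dom _ _ hb)
    ⟨t, hv⟩ (fun b hb d hd => hH.content_mono _ _ hd hb) ?_
  intro b₁ h₁ b₂ h₂
  rcases hH.overlap b₁ b₂ v h₁ h₂ with h | h | ⟨x, h, a, y, p, l, r, hxy⟩
  · exact .inl h
  · exact .inr h
  · refine absurd (fun b => ⟨fun hb => ?_, hH.content_link l⟩) (hn x h a y p l r)
    have hvb := (hH.content_run r b).2 hb
    by_cases hle : H.le b b₁ ∧ H.le b b₂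
    · have hnn := hH.nested b₁ b₂ b hle.1 hle.2 ⟨v, hvb⟩
      rcases hnn with h' | h'
      · rcases hxy with hxy | hxy
        · exact absurd (hH.content_mono _ _ h' hxy.1) hxy.2.1
        · exact absurd (hH.content_mono _ _ h' hxy.2.2.1) hxy.2.2.2
      · rcases hxy with hxy | hxy
        · exact absurd (hH.content_mono _ _ h' hxy.2.2.1) hxy.2.2.2
        · exact absurd (hH.content_mono _ _ h' hxy.1) hxy.2.1
    · have key : ∀ d, v ∈ H.content d → (x ∈ H.content d ∨ y ∈ H.content d) → ¬ H.le b d →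
          x ∈ H.content b ∨ y ∈ H.content b := by
        intro d hvd hd hbd
        rcases hH.overlap d b v hvd hvb with h' | h' | ⟨x', h', a', y', p', l', r', hxy'⟩
        · exact hd.imp (fun h => hH.content_mono _ _ h' h) (fun h => hH.content_mono _ _ h' h)
        · exact absurd h' hbd
        · obtain ⟨rfl, -⟩ := r.head_unique hH.string l.1 l.2.2.2.1 r' l'.1 l'.2.2.2.1
          obtain ⟨rfl, -, rfl⟩ := l.unique hH.string l'
          rcases hxy' with h1 | h1
          · exact .inr h1.2.2.1
          · exact .inl h1.1
      rcases not_and_or.1 hle with h' | h'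
      · refine key b₁ h₁ ?_ h'
        rcases hxy with h1 | h1
        · exact .inl h1.1
        · exact .inr h1.2.2.1
      · refine key b₂ h₂ ?_ h'
        rcases hxy with h1 | h1
        · exact .inr h1.2.2.1
        · exact .inl h1.1

theorem exists_least_node (hH : H.IsTopped t) {v : V} (hv : v ∈ H.content t)
    (hl : H.graph.label v = .N) : ∃ c, H.IsLeast v c :=
  hH.exists_least hv fun x h a y p _ r => by
    rw [r.label_eq] at hl
    cases hl

/-- The head of a loose link lies on no tight link, so it has a least !-box `c`. The !-boxes of the
endpoints contain the head and hence are above `c`; as `c` is nonempty they form a chain, with least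
member `o`. Equality of `c` and `o` would make the link tight. So loose links belong to instances
nested in the one that owns the endpoints. -/
theorem exists_least_loose (hH : H.IsTopped t) {x h y : V} {a : ℕ} (l : H.graph.IsLink x h a y)
    (hn : ¬ H.IsTight x h y) :
    ∃ c o, H.IsLeast h c ∧ H.Owns o x y ∧ H.le c o ∧ c ≠ o := by
  obtain ⟨c, hc⟩ := hH.exists_least (v := h) (hH.edge_dom _ _ _ l.2.2.2.1).2 (by
    intro x' h' a' y' p' l' r'
    obtain ⟨rfl, -⟩ := (LGraph.Run.zero l.label_head).head_unique hH.string l.1 l.2.2.2.1 r' l'.1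
      l'.2.2.2.1
    obtain ⟨rfl, -, rfl⟩ := l.unique hH.string l'
    exact hn)
  have hct : H.le c t := (hc t).1 (hH.edge_dom _ _ _ l.2.2.2.1).2
  obtain ⟨o, ho⟩ := hH.exists_least_of_chain {b | x ∈ H.content b ∨ y ∈ H.content b}
    (fun b hb => hb.elim (hH.content_dom _ _) (hH.content_dom _ _))
    ⟨t, .inl (hH.edge_dom _ _ _ l.2.2.2.1).1⟩
    (fun b hb d hd => hb.imp (fun h => hH.content_mono _ _ hd h) fun h => hH.content_mono _ _ hd h)
    (fun b hb d hd => hH.nested b d c ((hc b).1 (hH.content_link l hb))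
      ((hc d).1 (hH.content_link l hd)) ⟨h, (hc c).2 (hH.le_refl c hct)⟩)
  have hot : H.le o t := (ho t).1 (.inl (hH.edge_dom _ _ _ l.2.2.2.1).1)
  refine ⟨c, o, hc, ho, (hc o).1 (hH.content_link l ((ho o).2 (hH.le_refl o hot))), ?_⟩
  rintro rfl
  exact hn fun b => (hc b).trans (ho b).symm

end IsTopped

/-! ### Sections and links in the concretization -/

section Sections

variable {I : Type} {F : Amb B I} {A : Set I}

/-- The instances in which `i` is nested, including `i` itself. -/
abbrev _root_.BangGraphs.Amb.upper (F : Amb B I) (i : I) : Set I := {j | F.ile i j}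

theorem isSec_upper (hH : H.IsTopped t) (hF : F.WF H.le A) {v : V} {i : I} (hi : i ∈ A)
    (hv : H.IsLeast v (F.box i)) : IsSec H F A v (F.upper i) where
  sub j hj := hF.up i hi j hj
  up j hj k hk := hF.trans i hi j k hj hk
  mem j hj := (hv _).2 (hF.mono i hi j hj)
  ex b hb := hF.lift i hi b ((hv b).1 hb)
  inj j hj k hk h := hF.inj i hi j k hj hk h

/-- A section contains an instance of the least !-box together with its ancestors, which already
cover all !-boxes of the vertex. Vertices with a least !-box can therefore be indexed by single
instances. -/
theorem eq_upper_of_isSec (hH : H.IsTopped t) (hF : F.WF H.le A) {v : V} {c : B} {S : Set I}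
    (hv : v ∈ H.content t) (hc : H.IsLeast v c) (hS : IsSec H F A v S) :
    ∃ i ∈ A, F.box i = c ∧ S = F.upper i := by
  obtain ⟨i, hi, rfl⟩ := hS.ex c ((hc c).2 (hH.le_refl c ((hc t).1 hv)))
  refine ⟨i, hS.sub hi, rfl, Set.Subset.antisymm (fun j hj => ?_) (fun j hj => hS.up i hi j hj)⟩
  obtain ⟨k, hk, hkb⟩ := hF.lift i (hS.sub hi) (F.box j) ((hc _).1 (hS.mem j hj))
  rw [hS.inj j hj k (hS.up i hi k hk) hkb.symm]
  exact hk

theorem upper_injective (hH : H.IsTopped t) (hF : F.WF H.le A) {i j : I} (hi : i ∈ A) (hj : j ∈ A)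
    (h : F.upper i = F.upper j) : i = j := by
  have h1 : F.ile i j := by
    have : j ∈ F.upper i := by rw [h]; exact hF.refl j hj
    exact this
  have h2 : F.ile j i := by
    have : i ∈ F.upper j := by rw [← h]; exact hF.refl i hi
    exact this
  exact hF.antisymm hH.le_antisymm hi h1 h2

/-- A section of `u` is determined by an agreeing section of a vertex in more !-boxes. -/
theorem isSec_eq_of_agree {u v : V} {S T : Set I} (hS : IsSec H F A u S) (hT : IsSec H F A v T)
    (hsub : ∀ b, u ∈ H.content b → v ∈ H.content b) (h : F.Agree S T) :
    S = {i | i ∈ T ∧ u ∈ H.content (F.box i)} := by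
  ext i
  constructor
  · intro hi
    obtain ⟨j, hj, hji⟩ := hT.ex _ (hsub _ (hS.mem i hi))
    rw [h i hi j hj hji.symm]
    refine ⟨hj, ?_⟩
    rw [hji]
    exact hS.mem i hi
  · rintro ⟨hi, hu⟩
    obtain ⟨j, hj, hji⟩ := hS.ex _ hu
    rw [← h j hj i hi hji]
    exact hj

theorem _root_.BangGraphs.Amb.Agree.symm {S T : Set I} (h : F.Agree S T) : F.Agree T S :=
  fun i hi j hj hij => (h j hj i hi hij.symm).symm

theorem _root_.BangGraphs.IsSec.congr {u v : V} {S : Set I} (hS : IsSec H F A u S)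
    (huv : ∀ b, u ∈ H.content b ↔ v ∈ H.content b) : IsSec H F A v S :=
  ⟨hS.sub, hS.up, fun i hi => (huv _).1 (hS.mem i hi), fun b hb => hS.ex b ((huv b).2 hb), hS.inj⟩

/-- The concretization of a !-graph with an outermost !-box. -/
abbrev tconc (H : BangData V B) (t : B) (F : Amb B I) (A : Set I) := conc H F A (H.content t)

theorem edge_content_subset (hH : H.IsTopped t) {u v : V} {γ : EdgeLabel}
    (e : H.graph.edge u γ v) (hl : H.graph.label v = .W) {b : B} (hb : u ∈ H.content b) :
    v ∈ H.content b := by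
  rcases hH.string.label_mem u with hu | hu
  · exact hH.node_wire _ _ _ b e hu hb
  · exact (hH.wire_wire _ _ _ b e hu hl).1 hb

theorem edge_content_subset' (hH : H.IsTopped t) {u v : V} {γ : EdgeLabel}
    (e : H.graph.edge u γ v) (hl : H.graph.label u = .W) {b : B} (hb : v ∈ H.content b) :
    u ∈ H.content b := by
  rcases hH.string.label_mem v with hv | hv
  · exact hH.wire_node _ _ _ b e hv hb
  · exact (hH.wire_wire _ _ _ b e hl hv).2 hb

/-- A neighbour of a wire-vertex lies only in !-boxes of that wire-vertex, so its section is
determined by the section of the wire-vertex; the degree conditions carry over. -/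
theorem tconc_isStringGraph (hH : H.IsTopped t) : (tconc H t F A).IsStringGraph where
  label_mem v := hH.string.label_mem _
  edge_plain x γ y h := hH.string.edge_plain _ _ _ h.1
  not_node_node x γ y h := hH.string.not_node_node _ _ _ h.1
  in_degree := by
    rintro ⟨⟨w, S⟩, hw⟩ hl ⟨⟨x, T⟩, hx⟩ ⟨⟨y, T'⟩, hy⟩ γ δ h h'
    have hxy : x = y := hH.string.in_degree w hl _ _ _ _ h.1 h'.1
    subst hxy
    have h1 := isSec_eq_of_agree hx.2 hw.2 (fun b => edge_content_subset hH h.1 hl) h.2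
    have h2 := isSec_eq_of_agree hy.2 hw.2 (fun b => edge_content_subset hH h.1 hl) h'.2
    exact Subtype.ext (Prod.ext rfl (h1.trans h2.symm))
  out_degree := by
    rintro ⟨⟨w, S⟩, hw⟩ hl ⟨⟨x, T⟩, hx⟩ ⟨⟨y, T'⟩, hy⟩ γ δ h h'
    have hxy : x = y := hH.string.out_degree w hl _ _ _ _ h.1 h'.1
    subst hxy
    have h1 := isSec_eq_of_agree hx.2 hw.2 (fun b => edge_content_subset' hH h.1 hl) h.2.symm
    have h2 := isSec_eq_of_agree hy.2 hw.2 (fun b => edge_content_subset' hH h.1 hl) h'.2.symm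
    exact Subtype.ext (Prod.ext rfl (h1.trans h2.symm))

theorem finite_tconc (hH : H.IsTopped t) (hA : A.Finite) : Finite (CV H F A (H.content t)) := by
  have h : Finite ↥((H.content t) ×ˢ (𝒫 A)) :=
    (hH.finite_content.prod hA.powerset)
  exact Finite.of_injective
    (fun x : CV H F A (H.content t) => (⟨x.1, x.2.1, x.2.2.sub⟩ : ↥((H.content t) ×ˢ (𝒫 A))))
    fun x y hxy => Subtype.ext (congrArg (fun z => z.1) hxy)

/-- Consecutive wire-vertices lie in the same !-boxes, so the section is constant along a wire. -/
theorem run_tconc (hH : H.IsTopped t) {h v : CV H F A (H.content t)} {p : ℕ} :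
    (tconc H t F A).Run h p v ↔ h.1.2 = v.1.2 ∧ H.graph.Run h.1.1 p v.1.1 := by
  constructor
  · intro r
    induction r with
    | zero hl => exact ⟨rfl, .zero hl⟩
    | @succ p u w r e hl ih =>
      refine ⟨ih.1.trans ?_, .succ ih.2 e.1 hl⟩
      have hb := fun b => hH.wire_wire _ _ _ b e.1 ih.2.label_eq hl
      rw [isSec_eq_of_agree u.2.2 w.2.2 (fun b => (hb b).1) e.2]
      ext i
      exact ⟨fun h => h.1, fun h => ⟨h, (hb _).2 (w.2.2.mem i h)⟩⟩
  · rintro ⟨hS, r⟩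
    obtain ⟨⟨h, S⟩, hh⟩ := h
    obtain ⟨⟨v, T⟩, hv⟩ := v
    simp only at hS r
    subst hS
    induction r with
    | zero hl => exact .zero hl
    | @succ p u w r e hl ih =>
      have hb := fun b => hH.wire_wire _ _ _ b e r.label_eq hl
      have hu : u ∈ H.content t ∧ IsSec H F A u S :=
        ⟨(hb t).2 hv.1, hv.2.congr fun b => (hb b).symm⟩
      exact .succ (ih hu) ⟨e, hv.2.inj⟩ hl

/-- The sections of both endpoints are restrictions of the section of the head. In particular copies
of one node-vertex joined by a link would coincide, so distinct endpoints come from distinct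
vertices. -/
theorem link_tconc (hH : H.IsTopped t) {x h y : CV H F A (H.content t)} {a : ℕ} :
    (tconc H t F A).IsLink x h a y ↔
      H.graph.IsLink x.1.1 h.1.1 a y.1.1 ∧ F.Agree x.1.2 h.1.2 ∧ F.Agree h.1.2 y.1.2 := by
  constructor
  · rintro ⟨hx, hy, hne, e, u, r, e'⟩
    rw [run_tconc hH] at r
    refine ⟨⟨hx, hy, fun hxy => hne ?_, e.1, u.1.1, r.2, e'.1⟩, e.2, r.1 ▸ e'.2⟩
    have h1 := isSec_eq_of_agree x.2.2 h.2.2 (fun b => hH.node_wire _ _ _ b e.1 hx) e.2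
    have h2 := isSec_eq_of_agree y.2.2 u.2.2 (fun b => hH.wire_node _ _ _ b e'.1 hy) e'.2.symm
    rw [← r.1] at h2
    exact Subtype.ext (Prod.ext hxy (by rw [h1, h2, hxy]))
  · rintro ⟨⟨hx, hy, hne, e, u, r, e'⟩, h1, h2⟩
    refine ⟨hx, hy, fun h => hne (by rw [h]), ⟨e, h1⟩, ⟨(u, h.1.2), ?_, ?_⟩, ?_, ⟨e', h2⟩⟩
    · exact (hH.content_run r t).2 h.2.1
    · exact h.2.2.congr fun b => (hH.content_run r b).symm
    · exact (run_tconc hH).2 ⟨rfl, r⟩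

end Sections

end BangData
-- Counting encoded links; the graph generated by a family
namespace BangData

variable {V B I : Type} {H : BangData V B} {t : B} {F : Amb B I} {A : Set I}

/-- The number of tight links. -/
noncomputable def tightCount (H : BangData V B) (x : V) (a : ℕ) (y : V) : ℕ :=
  Set.ncard {h | H.graph.IsLink x h a y ∧ H.IsTight x h y}

/-- The instances, nested in the instance `i`, of the links from `x` to `y` that lie in further
!-boxes. -/
def looseSet (H : BangData V B) (F : Amb B I) (A : Set I) (i : I) (x : V) (a : ℕ) (y : V) :
    Set (V × I) :=
  {q | q.2 ∈ A ∧ F.ile q.2 i ∧ H.graph.IsLink x q.1 a y ∧ ¬ H.IsTight x q.1 y ∧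
    H.IsLeast q.1 (F.box q.2)}

/-- The first vertices of the encoded links: those of tight links, and those selected by `P`. -/
def encodedHeads (H : BangData V B) (t : B) (F : Amb B I) (A : Set I) (P : I → V → Prop) :
    Set (CV H F A (H.content t)) :=
  {h | ∃ x a y, H.graph.IsLink x h.1.1 a y ∧
    (H.IsTight x h.1.1 y ∨ ∃ i ∈ A, h.1.2 = F.upper i ∧ P i h.1.1)}

theorem finite_looseSet (hH : H.IsTopped t) (hA : A.Finite) (i : I) (x : V) (a : ℕ) (y : V) :
    (looseSet H F A i x a y).Finite :=
  (hH.finite_content.prod hA).subset fun _ hq =>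
    ⟨(hH.edge_dom _ _ _ hq.2.2.1.2.2.2.1).2, hq.1⟩

/-- Counting the encoded links between two vertices of the concretization. -/
theorem ncard_encodedHeads (hH : H.IsTopped t) (hF : F.WF H.le A) (hA : A.Finite)
    (P : I → V → Prop) (x y : CV H F A (H.content t)) (a : ℕ) (k : I) (hk : k ∈ A)
    (hxy : x.1.2 ∪ y.1.2 = F.upper k) (ho : H.Owns (F.box k) x.1.1 y.1.1) :
    Set.ncard {h | h ∈ encodedHeads H t F A P ∧ (tconc H t F A).IsLink x h a y} =
      H.tightCount x.1.1 a y.1.1 +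
        Set.ncard {q | q ∈ looseSet H F A k x.1.1 a y.1.1 ∧ P q.2 q.1} := by
  have hagree : ∀ {S : Set I} {v : V}, IsSec H F A v S → F.upper k ⊆ S →
      F.Agree x.1.2 S ∧ F.Agree S y.1.2 := by
    intro S v hS hsub
    have h1 : x.1.2 ⊆ S := fun i hi => hsub (hxy ▸ .inl hi)
    have h2 : y.1.2 ⊆ S := fun i hi => hsub (hxy ▸ .inr hi)
    exact ⟨fun i hi j hj => hS.inj i (h1 hi) j hj, fun i hi j hj => hS.inj i hi j (h2 hj)⟩
  -- The head lies in every !-box of an endpoint and agrees with both endpoints, so its section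
  -- contains `k` and the ancestors of `k`.
  have hkS : ∀ {h : CV H F A (H.content t)}, (tconc H t F A).IsLink x h a y →
      F.upper k ⊆ h.1.2 := by
    intro h l
    rw [link_tconc hH] at l
    have hk' : k ∈ x.1.2 ∪ y.1.2 := hxy ▸ hF.refl k hk
    have : k ∈ h.1.2 := by
      rcases hk' with hk' | hk'
      · obtain ⟨j, hj, hjb⟩ := h.2.2.ex (F.box k) (hH.content_link l.1 (.inl (x.2.2.mem k hk')))
        rw [l.2.1 k hk' j hj hjb.symm]
        exact hj
      · obtain ⟨j, hj, hjb⟩ := h.2.2.ex (F.box k) (hH.content_link l.1 (.inr (y.2.2.mem k hk')))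
        rw [← l.2.2 j hj k hk' hjb]
        exact hj
    exact fun j hj => h.2.2.up k this j hj
  -- A tight link has exactly one copy between the two vertices, with section `F.upper k`. A loose
  -- link has one copy for each instance of its least !-box nested in `k`.
  have hsplit : Subtype.val '' {h | h ∈ encodedHeads H t F A P ∧ (tconc H t F A).IsLink x h a y} =
      (fun h => (h, F.upper k)) '' {h | H.graph.IsLink x.1.1 h a y.1.1 ∧ H.IsTight x.1.1 h y.1.1} ∪
      (fun q => (q.1, F.upper q.2)) ''
        {q | q ∈ looseSet H F A k x.1.1 a y.1.1 ∧ P q.2 q.1} := by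
    ext ⟨v, S⟩
    constructor
    · rintro ⟨h, ⟨⟨x', a', y', l', hP⟩, l⟩, hh⟩
      have hsub := hkS l
      have l₁ := (link_tconc hH).1 l
      obtain ⟨h1, -, h2⟩ := l₁.1.unique hH.string l'
      subst h1 h2
      by_cases ht : H.IsTight x.1.1 h.1.1 y.1.1
      · left
        refine ⟨h.1.1, ⟨l₁.1, ht⟩, ?_⟩
        rw [← hh]
        refine Prod.ext rfl (hsub.antisymm fun i hi => ?_)
        have hki : H.le (F.box k) (F.box i) := (ho _).1 ((ht _).1 (h.2.2.mem i hi))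
        obtain ⟨j, hj, hjb⟩ := hF.lift k hk _ hki
        rw [h.2.2.inj i hi j (hsub hj) hjb.symm]
        exact hj
      · right
        obtain ⟨i, hi, hiS, hPi⟩ := hP.resolve_left ht
        obtain ⟨c, o, hc, -⟩ := hH.exists_least_loose l₁.1 ht
        obtain ⟨i', hi', hib', hiS'⟩ := eq_upper_of_isSec hH hF h.2.1 hc h.2.2
        have := upper_injective hH hF hi hi' (hiS.symm.trans hiS')
        subst this
        refine ⟨(h.1.1, i), ⟨⟨hi, ?_, l₁.1, ht, by rw [hib']; exact hc⟩, hPi⟩, ?_⟩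
        · have : k ∈ h.1.2 := hsub (hF.refl k hk)
          rw [hiS] at this
          exact this
        · rw [← hh]
          exact Prod.ext rfl hiS.symm
    · rintro (⟨h, ⟨l, ht⟩, hh⟩ | ⟨⟨h, i⟩, ⟨⟨hi, hik, l, hnt, hc⟩, hPi⟩, hh⟩)
      · have hs : IsSec H F A h (F.upper k) := by
          refine isSec_upper hH hF hk fun b => ?_
          rw [ht b]
          exact ho b
        have hht : h ∈ H.content t := (hH.edge_dom _ _ _ l.2.2.2.1).2
        refine ⟨⟨(h, F.upper k), hht, hs⟩, ⟨⟨_, a, _, l, .inl ht⟩, ?_⟩, hh⟩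
        rw [link_tconc hH]
        exact ⟨l, hagree hs subset_rfl⟩
      · have hs : IsSec H F A h (F.upper i) := isSec_upper hH hF hi hc
        have hht : h ∈ H.content t := (hH.edge_dom _ _ _ l.2.2.2.1).2
        refine ⟨⟨(h, F.upper i), hht, hs⟩, ⟨⟨_, a, _, l, .inr ⟨i, hi, rfl, hPi⟩⟩, ?_⟩, hh⟩
        rw [link_tconc hH]
        exact ⟨l, hagree hs fun j hj => hF.trans i hi k j hik hj⟩
  have hdisj : Disjoint
      ((fun h => (h, F.upper k)) '' {h | H.graph.IsLink x.1.1 h a y.1.1 ∧ H.IsTight x.1.1 h y.1.1})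
      ((fun q => (q.1, F.upper q.2)) ''
        {q | q ∈ looseSet H F A k x.1.1 a y.1.1 ∧ P q.2 q.1}) := by
    rw [Set.disjoint_left]
    rintro _ ⟨h, ⟨l, ht⟩, rfl⟩ ⟨q, ⟨hq, -⟩, heq⟩
    have := (Prod.mk.inj heq).1
    subst this
    exact hq.2.2.2.1 ht
  have hfin₁ : ((fun h => (h, F.upper k)) ''
      {h | H.graph.IsLink x.1.1 h a y.1.1 ∧ H.IsTight x.1.1 h y.1.1}).Finite := by
    refine Set.Finite.image _ (hH.finite_content.subset fun h hh => ?_)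
    exact (hH.edge_dom _ _ _ hh.1.2.2.2.1).2
  have hfin₂ : ((fun q => (q.1, F.upper q.2)) ''
      {q | q ∈ looseSet H F A k x.1.1 a y.1.1 ∧ P q.2 q.1}).Finite :=
    ((finite_looseSet hH hA k x.1.1 a y.1.1).subset fun q hq => hq.1).image _
  rw [← Set.ncard_image_of_injective _ Subtype.val_injective, hsplit,
    Set.ncard_union_eq hdisj hfin₁ hfin₂,
    Set.ncard_image_of_injective _ fun h h' hh => (Prod.mk.inj hh).1, Set.InjOn.ncard_image]
  · rfl
  · rintro ⟨h, i⟩ hq ⟨h', i'⟩ hq' heq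
    have heq := Prod.mk.inj heq
    exact Prod.ext heq.1 (upper_injective hH hF hq.1.1 hq'.1.1 heq.2)

/-- Counting the encoded links between two vertices such that all links between them are tight. -/
theorem ncard_encodedHeads_of_tight (hH : H.IsTopped t) (P : I → V → Prop)
    (x y : CV H F A (H.content t)) (a : ℕ) (hag : F.Agree x.1.2 y.1.2)
    (ht : ∀ h, H.graph.IsLink x.1.1 h a y.1.1 → H.IsTight x.1.1 h y.1.1) :
    Set.ncard {h | h ∈ encodedHeads H t F A P ∧ (tconc H t F A).IsLink x h a y} =
      H.tightCount x.1.1 a y.1.1 := by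
  -- A tight link lies in no further !-boxes, so the section of its head is the union of those of
  -- the endpoints: each link of `H` has exactly one copy.
  have hsplit : Subtype.val '' {h | h ∈ encodedHeads H t F A P ∧ (tconc H t F A).IsLink x h a y} =
      (fun h => (h, x.1.2 ∪ y.1.2)) ''
        {h | H.graph.IsLink x.1.1 h a y.1.1 ∧ H.IsTight x.1.1 h y.1.1} := by
    ext ⟨v, S⟩
    constructor
    · rintro ⟨h, ⟨-, l⟩, hh⟩
      have l₁ := (link_tconc hH).1 l
      refine ⟨h.1.1, ⟨l₁.1, ht _ l₁.1⟩, ?_⟩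
      rw [← hh]
      refine Prod.ext rfl ?_
      ext i
      constructor
      · rintro (hi | hi)
        · obtain ⟨j, hj, hjb⟩ := h.2.2.ex _ (hH.content_link l₁.1 (.inl (x.2.2.mem i hi)))
          rw [l₁.2.1 i hi j hj hjb.symm]
          exact hj
        · obtain ⟨j, hj, hjb⟩ := h.2.2.ex _ (hH.content_link l₁.1 (.inr (y.2.2.mem i hi)))
          rw [← l₁.2.2 j hj i hi hjb]
          exact hj
      · intro hi
        rcases (ht _ l₁.1 _).1 (h.2.2.mem i hi) with hb | hb
        · obtain ⟨j, hj, hjb⟩ := x.2.2.ex _ hb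
          rw [← l₁.2.1 j hj i hi hjb]
          exact .inl hj
        · obtain ⟨j, hj, hjb⟩ := y.2.2.ex _ hb
          rw [l₁.2.2 i hi j hj hjb.symm]
          exact .inr hj
    · rintro ⟨h, ⟨l, ht'⟩, hh⟩
      have hs : IsSec H F A h (x.1.2 ∪ y.1.2) := by
        refine ⟨Set.union_subset x.2.2.sub y.2.2.sub, ?_, ?_, ?_, ?_⟩
        · rintro i (hi | hi) j hij
          · exact .inl (x.2.2.up i hi j hij)
          · exact .inr (y.2.2.up i hi j hij)
        · rintro i (hi | hi)
          · exact hH.content_link l (.inl (x.2.2.mem i hi))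
          · exact hH.content_link l (.inr (y.2.2.mem i hi))
        · intro b hb
          rcases (ht' b).1 hb with hb | hb
          · obtain ⟨i, hi, hib⟩ := x.2.2.ex _ hb
            exact ⟨i, .inl hi, hib⟩
          · obtain ⟨i, hi, hib⟩ := y.2.2.ex _ hb
            exact ⟨i, .inr hi, hib⟩
        · rintro i (hi | hi) j (hj | hj) hij
          · exact x.2.2.inj i hi j hj hij
          · exact hag i hi j hj hij
          · exact hag.symm i hi j hj hij
          · exact y.2.2.inj i hi j hj hij
      have hht : h ∈ H.content t := (hH.edge_dom _ _ _ l.2.2.2.1).2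
      refine ⟨⟨(h, x.1.2 ∪ y.1.2), hht, hs⟩, ⟨⟨_, a, _, l, .inl ht'⟩, ?_⟩, hh⟩
      rw [link_tconc hH]
      exact ⟨l, fun i hi j hj => hs.inj i (.inl hi) j hj, fun i hi j hj => hs.inj i hi j (.inr hj)⟩
  rw [← Set.ncard_image_of_injective _ Subtype.val_injective, hsplit,
    Set.ncard_image_of_injective]
  · rfl
  · exact fun h h' hh => (Prod.mk.inj hh).1

/-- The vertex `v` is generated together with the instance `i`: it belongs to that instance, and
is not encoded. -/
def Emitted (H : BangData V B) (F : Amb B I) (om : I → V → Prop) (v : V) (i : I) : Prop :=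
  H.IsLeast v (F.box i) ∧ ∀ x h a y p, H.graph.IsLink x h a y → H.graph.Run h p v →
    ¬ H.IsTight x h y ∧ ¬ om i h

open Classical in
/-- The number of encoded links from `x` in the instance `i` to `y` in the instance `j`. -/
noncomputable def linkCount (H : BangData V B) (F : Amb B I) (γ : I → V → ℕ → V → ℕ) (i : I) (x : V)
    (a : ℕ) (j : I) (y : V) : ℕ :=
  -- Loose links between the two vertices are nested in the instance that owns the pair, which can
  -- only be `i` or `j`. If neither owns it, all links are tight.
  if H.Owns (F.box i) x y then γ i x a y
  else if H.Owns (F.box j) x y then γ j x a y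
  else H.tightCount x a y

/-- The generated vertices. -/
abbrev GenVertex (H : BangData V B) (F : Amb B I) (A : Set I) (om : I → V → Prop) : Type :=
  {q : V × I // q.2 ∈ A ∧ Emitted H F om q.1 q.2}

/-- The generated graph. -/
def genGraph (H : BangData V B) (F : Amb B I) (A : Set I) (om : I → V → Prop)
    (γ : I → V → ℕ → V → ℕ) (n : ℕ) : LGraph NodeLabel EdgeLabel (GenVertex H F A om) where
  edge p l q := F.Agree (F.upper p.1.2) (F.upper q.1.2) ∧ (H.graph.edge p.1.1 l q.1.1 ∨
    p.1.1 ≠ q.1.1 ∧ ∃ a k, l = EdgeLabel.beta (Nat.pair a k) ∧ a < n ∧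
      k < linkCount H F γ p.1.2 p.1.1 a q.1.2 q.1.1)
  irrefl p l := by
    rintro ⟨-, h | h⟩
    · exact H.graph.irrefl _ _ h
    · exact h.1 rfl
  label p := H.graph.label p.1.1

/-- The selection of encoded links is consistent with the counts `γ`, and canonical. -/
structure IsConsistent (H : BangData V B) (F : Amb B I) (A : Set I) (om : I → V → Prop)
    (γ : I → V → ℕ → V → ℕ) (J : ℕ) : Prop where
  count : ∀ i ∈ A, ∀ x a y, H.Owns (F.box i) x y →
    γ i x a y = H.tightCount x a y + Set.ncard {q | q ∈ looseSet H F A i x a y ∧ om q.2 q.1}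
  le : ∀ i ∈ A, ∀ x a y, H.Owns (F.box i) x y → γ i x a y ≤ J
  full : ∀ i ∈ A, ∀ x a y, H.Owns (F.box i) x y →
    ∀ q ∈ looseSet H F A i x a y, ¬ om q.2 q.1 → γ i x a y = J

theorem upper_subset_of_le (hF : F.WF H.le A) {i j : I} (hi : i ∈ A) (hj : j ∈ A)
    (hag : F.Agree (F.upper i) (F.upper j)) (hle : H.le (F.box i) (F.box j)) :
    F.upper j ⊆ F.upper i := by
  obtain ⟨k, hk, hkb⟩ := hF.lift i hi _ hle
  have := hag k hk j (hF.refl j hj) hkb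
  subst this
  exact fun l hl => hF.trans i hi _ l hk hl

/-- The owner of a loose link is the least !-box of one of its endpoints, which justifies the three
cases of `linkCount`. The selection `P` is arbitrary so that the same formula also counts all links.
-/
theorem linkCount_eq (hH : H.IsTopped t) (hF : F.WF H.le A) (hA : A.Finite) (P : I → V → Prop)
    {γ : I → V → ℕ → V → ℕ} {i j : I} {x y : V} {a : ℕ} (hi : i ∈ A) (hj : j ∈ A)
    (hx : H.IsLeast x (F.box i)) (hy : H.IsLeast y (F.box j)) (hxt : x ∈ H.content t)
    (hyt : y ∈ H.content t) (hag : F.Agree (F.upper i) (F.upper j))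
    (hγ : ∀ i ∈ A, H.Owns (F.box i) x y → γ i x a y = H.tightCount x a y +
      Set.ncard {q | q ∈ looseSet H F A i x a y ∧ P q.2 q.1}) :
    linkCount H F γ i x a j y = Set.ncard {h | h ∈ encodedHeads H t F A P ∧
      (tconc H t F A).IsLink ⟨(x, F.upper i), hxt, isSec_upper hH hF hi hx⟩ h a
        ⟨(y, F.upper j), hyt, isSec_upper hH hF hj hy⟩} := by
  have hit : H.le (F.box i) t := (hx t).1 hxt
  have hjt : H.le (F.box j) t := (hy t).1 hyt
  unfold linkCount
  split_ifs with h1 h2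
  · rw [hγ i hi h1, ncard_encodedHeads hH hF hA P _ _ a i hi ?_ h1]
    refine Set.union_eq_left.2 (upper_subset_of_le hF hi hj hag ?_)
    exact (h1 _).1 (.inr ((hy _).2 (hH.le_refl _ hjt)))
  · rw [hγ j hj h2, ncard_encodedHeads hH hF hA P _ _ a j hj ?_ h2]
    refine Set.union_eq_right.2 (upper_subset_of_le hF hj hi hag.symm ?_)
    exact (h2 _).1 (.inl ((hx _).2 (hH.le_refl _ hit)))
  · rw [ncard_encodedHeads_of_tight hH P _ _ a hag]
    intro h l
    by_contra hnt
    obtain ⟨c, o, -, ho, -⟩ := hH.exists_least_loose l hnt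
    have hot : H.le o t := (ho t).1 (.inl hxt)
    rcases (ho o).2 (hH.le_refl o hot) with h' | h'
    · have := hH.le_antisymm _ _ ((hx o).1 h') ((ho _).1 (.inl ((hx _).2 (hH.le_refl _ hit))))
      exact h1 (this ▸ ho)
    · have := hH.le_antisymm _ _ ((hy o).1 h') ((ho _).1 (.inr ((hy _).2 (hH.le_refl _ hjt))))
      exact h2 (this ▸ ho)

/-- Both sections agree with that of the head, which lies in all !-boxes of either endpoint. -/
theorem eq_of_nonempty_link (hH : H.IsTopped t) (hF : F.WF H.le A) {x y h : CV H F A (H.content t)}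
    {a : ℕ} (l : (tconc H t F A).IsLink x h a y) : F.Agree x.1.2 y.1.2 := by
  rw [link_tconc hH] at l
  intro i hi j hj hij
  obtain ⟨k, hk, hkb⟩ := h.2.2.ex _ (hH.content_link l.1 (.inl (x.2.2.mem i hi)))
  exact (l.2.1 i hi k hk hkb.symm).trans (l.2.2 k hk j hj (hkb.trans hij))

/-- If some loose link is left out, the count equals `J`; otherwise all links are selected and the
count is their number. As counts never exceed `J`, this is the required minimum. Pairs without an
owner have tight links only, at most `J` of them. -/
theorem encodedHeads_isCanonical (hH : H.IsTopped t) (hF : F.WF H.le A) (hA : A.Finite)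
    {om : I → V → Prop} {γ : I → V → ℕ → V → ℕ} {J : ℕ} (hc : IsConsistent H F A om γ J)
    (hJ : ∀ x a y, H.tightCount x a y ≤ J) :
    (tconc H t F A).IsCanonical J (encodedHeads H t F A om) := by
  constructor
  · rintro h ⟨x, a, y, l, -⟩
    have hsx : ∀ z, (∀ b, z ∈ H.content b → h.1.1 ∈ H.content b) →
        IsSec H F A z {i | i ∈ h.1.2 ∧ z ∈ H.content (F.box i)} := by
      intro z hz
      refine ⟨fun i hi => h.2.2.sub hi.1, ?_, fun i hi => hi.2, ?_, ?_⟩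
      · rintro i ⟨hi, hzi⟩ j hij
        exact ⟨h.2.2.up i hi j hij, hH.content_mono _ _ (hF.mono i (h.2.2.sub hi) j hij) hzi⟩
      · intro b hb
        obtain ⟨i, hi, rfl⟩ := h.2.2.ex b (hz b hb)
        exact ⟨i, ⟨hi, hb⟩, rfl⟩
      · exact fun i hi j hj => h.2.2.inj i hi.1 j hj.1
    have hxt : x ∈ H.content t := (hH.edge_dom _ _ _ l.2.2.2.1).1
    have hyt : y ∈ H.content t := by
      obtain ⟨u, -, e⟩ := l.2.2.2.2
      exact (hH.edge_dom _ _ _ e).2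
    refine ⟨⟨(x, _), hxt, hsx x fun b hb => hH.content_link l (.inl hb)⟩, a,
      ⟨(y, _), hyt, hsx y fun b hb => hH.content_link l (.inr hb)⟩, ?_⟩
    rw [link_tconc hH]
    exact ⟨l, fun i hi j hj => h.2.2.inj i hi.1 j hj, fun i hi j hj => h.2.2.inj i hi j hj.1⟩
  · intro x a y
    by_cases hl : ∃ h, (tconc H t F A).IsLink x h a y
    swap
    · have e1 : {h | (tconc H t F A).IsLink x h a y} = ∅ := by
        ext h
        exact ⟨fun l => hl ⟨h, l⟩, fun h => h.elim⟩
      have e2 : {h | h ∈ encodedHeads H t F A om ∧ (tconc H t F A).IsLink x h a y} = ∅ := by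
        ext h
        exact ⟨fun l => hl ⟨h, l.2⟩, fun h => h.elim⟩
      rw [e1, e2, Set.ncard_empty, Nat.min_zero]
    obtain ⟨h, l⟩ := hl
    have hag := eq_of_nonempty_link hH hF l
    obtain ⟨⟨x, S⟩, hxt, hx⟩ := x
    obtain ⟨⟨y, T⟩, hyt, hy⟩ := y
    simp only at hxt hx hyt hy hag
    obtain ⟨c, hcx⟩ := hH.exists_least_node hxt l.1
    obtain ⟨d, hdy⟩ := hH.exists_least_node hyt l.2.1
    obtain ⟨i, hi, rfl, rfl⟩ := eq_upper_of_isSec hH hF hxt hcx hx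
    obtain ⟨j, hj, rfl, rfl⟩ := eq_upper_of_isSec hH hF hyt hdy hy
    -- Selecting every loose link encodes all links, so the total number of links is given by
    -- `linkCount` too.
    have hall : {h | (tconc H t F A).IsLink ⟨(x, F.upper i), hxt, hx⟩ h a
        ⟨(y, F.upper j), hyt, hy⟩} = {h | h ∈ encodedHeads H t F A (fun _ _ => True) ∧
        (tconc H t F A).IsLink ⟨(x, F.upper i), hxt, hx⟩ h a ⟨(y, F.upper j), hyt, hy⟩} := by
      ext h
      refine ⟨fun l => ⟨⟨x, a, y, ((link_tconc hH).1 l).1, ?_⟩, l⟩, fun h => h.2⟩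
      by_cases ht : H.IsTight x h.1.1 y
      · exact .inl ht
      · right
        obtain ⟨c, o, hc, -⟩ := hH.exists_least_loose ((link_tconc hH).1 l).1 ht
        obtain ⟨k, hk, -, hkS⟩ := eq_upper_of_isSec hH hF h.2.1 hc h.2.2
        exact ⟨k, hk, hkS, trivial⟩
    rw [hall, ← linkCount_eq hH hF hA om hi hj hcx hdy hxt hyt hag
        (fun i hi => hc.count i hi x a y),
      ← linkCount_eq (γ := fun i x a y => H.tightCount x a y +
          Set.ncard {q | q ∈ looseSet H F A i x a y ∧ True})
        hH hF hA (fun _ _ => True) hi hj hcx hdy hxt hyt hag (fun _ _ _ => rfl)]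
    have key : ∀ k ∈ A, H.Owns (F.box k) x y → γ k x a y = min J (H.tightCount x a y +
          Set.ncard {q | q ∈ looseSet H F A k x a y ∧ True}) := by
      intro k hk ho
      simp only [and_true, Set.ofPred_mem_eq]
      have h1 := hc.count k hk x a y ho
      have h2 := hc.le k hk x a y ho
      by_cases hfull : ∃ q ∈ looseSet H F A k x a y, ¬ om q.2 q.1
      · obtain ⟨q, hq, hom⟩ := hfull
        have h3 := hc.full k hk x a y ho q hq hom
        have h4 := Set.ncard_le_ncard (s := {q | q ∈ looseSet H F A k x a y ∧ om q.2 q.1})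
          (fun q hq => hq.1) (finite_looseSet (F := F) hH hA k x a y)
        omega
      · have : {q | q ∈ looseSet H F A k x a y ∧ om q.2 q.1} = looseSet H F A k x a y := by
          ext q
          refine ⟨fun h => h.1, fun h => ⟨h, ?_⟩⟩
          by_contra hom
          exact hfull ⟨q, h, hom⟩
        rw [this] at h1
        omega
    unfold linkCount
    split_ifs with h1 h2
    · exact key i hi h1
    · exact key j hj h2
    · exact (min_eq_right (hJ x a y)).symm

/-- The generated graph is the encoding of the concretization. -/
theorem genGraph_iso (hH : H.IsTopped t) (hF : F.WF H.le A) (hA : A.Finite)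
    (hbox : ∀ i ∈ A, H.le (F.box i) t)
    {om : I → V → Prop} {γ : I → V → ℕ → V → ℕ} {J n : ℕ} (hc : IsConsistent H F A om γ J)
    (hn : ∀ x h a y, H.graph.IsLink x h a y → a < n) :
    (genGraph H F A om γ n).IsIso ((tconc H t F A).encode (encodedHeads H t F A om)) := by
  have hdom : ∀ p : GenVertex H F A om, p.1.1 ∈ H.content t :=
    fun p => (p.2.2.1 t).2 (hbox _ p.2.1)
  -- A vertex on an encoded link carries the section of its head, so the link is tight or selected
  -- by the instance of the vertex; both are excluded for generated vertices.
  have hnot : ∀ p : GenVertex H F A om, ¬ (tconc H t F A).OnLinks (encodedHeads H t F A om)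
      ⟨(p.1.1, F.upper p.1.2), hdom p, isSec_upper hH hF p.2.1 p.2.2.1⟩ := by
    rintro p ⟨h, ⟨x, a, y, l, hl⟩, k, r⟩
    rw [run_tconc hH] at r
    obtain ⟨h1, h2⟩ := p.2.2.2 x _ a y k l r.2
    rcases hl with hl | ⟨i, hi, hS, ho⟩
    · exact h1 hl
    · rw [upper_injective hH hF hi p.2.1 (hS.symm.trans r.1)] at ho
      exact h2 ho
  refine isIso_of_bij (fun p => ⟨⟨(p.1.1, F.upper p.1.2), hdom p,
    isSec_upper hH hF p.2.1 p.2.2.1⟩, hnot p⟩) ⟨?_, ?_⟩ ?_ (fun _ => rfl)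
  · rintro ⟨⟨v, i⟩, hi, hv⟩ ⟨⟨u, j⟩, hj, hu⟩ h
    have h1 : v = u := congrArg (fun z => z.1.1.1) h
    have h2 := upper_injective hH hF hi hj (congrArg (fun z => z.1.1.2) h)
    simp only at h2
    subst h1 h2
    rfl
  · rintro ⟨⟨⟨v, S⟩, hv, hS⟩, hno⟩
    simp only at hv hS
    -- All tight links are encoded, so a remaining vertex lies on none of them and has a least
    -- !-box.
    obtain ⟨c, hcv⟩ := hH.exists_least hv (by
      intro x h a y p l r ht
      refine hno ⟨⟨(h, S), (hH.content_run r t).1 hv, hS.congr fun b => hH.content_run r b⟩,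
        ⟨x, a, y, l, .inl ht⟩, p, (run_tconc hH).2 ⟨rfl, r⟩⟩)
    obtain ⟨i, hi, rfl, rfl⟩ := eq_upper_of_isSec hH hF hv hcv hS
    refine ⟨⟨(v, i), hi, hcv, fun x h a y p l r => ?_⟩, rfl⟩
    have hsec := fun ho => hno ⟨⟨(h, F.upper i), (hH.content_run r t).1 hv,
      hS.congr fun b => hH.content_run r b⟩, ⟨x, a, y, l, ho⟩, p, (run_tconc hH).2 ⟨rfl, r⟩⟩
    exact ⟨fun ht => hsec (.inl ht), fun ho => hsec (.inr ⟨i, hi, rfl, ho⟩)⟩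
  · rintro ⟨⟨v, i⟩, hi, hv⟩ γ' ⟨⟨u, j⟩, hj, hu⟩
    have key := fun hag a => linkCount_eq (a := a) hH hF hA om hi hj hv.1 hu.1
      ((hv.1 t).2 (hbox _ hi)) ((hu.1 t).2 (hbox _ hj)) hag (fun i hi => hc.count i hi v a u)
    constructor
    · rintro ⟨hag, h | ⟨hne, a, k, rfl, ha, hk⟩⟩
      · exact .inl ⟨h, hag⟩
      · right
        refine ⟨a, k, rfl, ?_⟩
        rw [← key hag a]
        exact hk
    · rintro (⟨h, hag⟩ | ⟨a, k, rfl, hk⟩)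
      · exact ⟨hag, .inl h⟩
      · have hne := Set.nonempty_of_ncard_ne_zero (Nat.ne_of_gt (lt_of_le_of_lt (Nat.zero_le k) hk))
        obtain ⟨h, -, l⟩ := hne
        have hag := eq_of_nonempty_link hH hF l
        have l' := ((link_tconc hH).1 l).1
        refine ⟨hag, .inr ⟨l'.2.2.1, a, k, rfl, hn _ _ _ _ l', ?_⟩⟩
        rw [key hag a]
        exact hk

end BangData

/-! ### States, moves and invariants of the depth-first exploration -/

/-- A state of the exploration of a family of instances: the current !-box, and two tables. -/
abbrev ExpState : Type := ℕ × List ℕ × List ℕ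

/-- A move: whether an instance is opened or closed, the table of the links that are encoded
with the opened instance, the source and the target. -/
abbrev ExpMove : Type := (Bool × List ℕ) × ExpState × ExpState

/-- The entry of a table belonging to the links from `x` to `y` with `a + 1` interior vertices. -/
def keyAt (l : List ℕ) (x a y : ℕ) : ℕ := l.getD (Nat.pair x (Nat.pair y a)) 0

/-- The label of the edges between the nonterminal node and the vertex `u` generated by the move
with code `π`, if `d` is the !-box of its innermost open instance. -/
def alphaLabel (u d π : ℕ) : EdgeLabel := EdgeLabel.alpha (Nat.pair u (Nat.pair d π))

theorem alphaLabel_inj {u d π u' d' π' : ℕ} :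
    alphaLabel u d π = alphaLabel u' d' π' ↔ u = u' ∧ d = d' ∧ π = π' := by
  simp [alphaLabel, Nat.pair_eq_pair]

namespace BangData

variable {H : BangData ℕ ℕ} {n N : ℕ}

/-- A !-graph with outermost !-box `N`, with vertices below `n`, and !-boxes at most `N`. -/
structure IsBounded (H : BangData ℕ ℕ) (n N : ℕ) : Prop where
  topped : H.IsTopped N
  box_iff : ∀ b, H.le b N ↔ b ≤ N
  vert_lt : ∀ v ∈ H.content N, v < n

/-- The interior vertices of a link at different positions are distinct, so its length is at most
`n`. -/
theorem IsBounded.link_lt (hH : H.IsBounded n N) {x h a y : ℕ} (l : H.graph.IsLink x h a y) :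
    x < n ∧ a < n ∧ y < n := by
  have hx := (hH.topped.edge_dom _ _ _ l.2.2.2.1)
  obtain ⟨u, r, e⟩ := l.2.2.2.2
  have hy := (hH.topped.edge_dom _ _ _ e)
  refine ⟨hH.vert_lt _ hx.1, ?_, hH.vert_lt _ hy.2⟩
  have hex : ∀ p : Fin (a + 1), ∃ v : Fin n, H.graph.Run h p v := by
    intro p
    obtain ⟨v, hv⟩ := r.exists_of_le (Nat.lt_succ_iff.1 p.2)
    exact ⟨⟨v, hH.vert_lt _ ((hH.topped.content_run hv N).2 hx.2)⟩, hv⟩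
  choose f hf using hex
  have hinj : Function.Injective f := by
    intro p q hpq
    have h1 := hf p
    have h2 := hf q
    rw [← hpq] at h2
    exact Fin.ext (h1.head_unique hH.topped.string l.1 l.2.2.2.1 h2 l.1 l.2.2.2.1).2
  have := Fintype.card_le_of_injective f hinj
  simp at this
  omega

/-- The number of links from `x` to `y` lying in further !-boxes, with least !-box `c`, that are
selected by `P`. -/
noncomputable def looseCount (H : BangData ℕ ℕ) (P : ℕ → Prop) (c x a y : ℕ) : ℕ :=
  Set.ncard {h | H.graph.IsLink x h a y ∧ ¬ H.IsTight x h y ∧ H.IsLeast h c ∧ P h}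

/-- The move opens an instance. -/
structure OpenValid (H : BangData ℕ ℕ) (n N : ℕ) (om : List ℕ) (s s' : ExpState) : Prop where
  ne_end : s.1 ≠ N + 1
  cur_le : s'.1 ≤ N
  -- Together with `new`, this makes the opened !-box an immediate child of the current one. From
  -- the start state, above which there is no !-box, only `N` can be opened.
  cur : ∀ b, H.le s'.1 b ↔ b = s'.1 ∨ H.le s.1 b
  new : ¬ H.le s.1 s'.1
  -- The first table holds the guessed number of encoded links, the second the number of loose ones
  -- among them still to be met.
  own : ∀ x < n, ∀ a < n, ∀ y < n, H.Owns s'.1 x y →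
    keyAt s'.2.1 x a y = H.tightCount x a y + keyAt s'.2.2 x a y
  -- For pairs owned by open instances the guess is kept, and the links selected by the opened
  -- instance are deducted. A loose link may remain unselected only if the guess is the maximal
  -- value `n`.
  keep : ∀ b, H.le s.1 b → ∀ x < n, ∀ a < n, ∀ y < n, H.Owns b x y →
    keyAt s'.2.1 x a y = keyAt s.2.1 x a y ∧
    keyAt s'.2.2 x a y + H.looseCount (fun h => om.getD h 0 = 1) s'.1 x a y =
      keyAt s.2.2 x a y ∧
    ∀ h, H.graph.IsLink x h a y → ¬ H.IsTight x h y → H.IsLeast h s'.1 → om.getD h 0 ≠ 1 →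
      keyAt s.2.1 x a y = n

/-- The move closes an instance. -/
structure CloseValid (H : BangData ℕ ℕ) (n N : ℕ) (s s' : ExpState) : Prop where
  src_le : s.1 ≤ N
  tgt_le : s'.1 ≤ N + 1
  cur : ∀ b, H.le s'.1 b ↔ H.le s.1 b ∧ b ≠ s.1
  -- An instance may be closed only when all the encoded links it promised have been met.
  own : ∀ x < n, ∀ a < n, ∀ y < n, H.Owns s.1 x y → keyAt s.2.2 x a y = 0
  keep : ∀ b, H.le s'.1 b → ∀ x < n, ∀ a < n, ∀ y < n, H.Owns b x y →
    keyAt s'.2.1 x a y = keyAt s.2.1 x a y ∧ keyAt s'.2.2 x a y = keyAt s.2.2 x a y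

variable {I : Type}

/-- The state `s` describes the exploration of the instances in `A`, those in `Ω` being open. -/
structure Explores (H : BangData ℕ ℕ) (n N : ℕ) (F : Amb ℕ I) (om : I → ℕ → Prop)
    (γ : I → ℕ → ℕ → ℕ → ℕ) (A Ω : Set I) (lev : I → ℕ) (s : ExpState) : Prop where
  finite : A.Finite
  wf : F.WF H.le A
  dom : ∀ i ∈ A, H.le (F.box i) N
  sub : Ω ⊆ A
  up : ∀ i ∈ Ω, ∀ j, F.ile i j → j ∈ Ω
  inj : ∀ i ∈ Ω, ∀ j ∈ Ω, F.box i = F.box j → i = j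
  cur : ∀ b, H.le s.1 b ↔ ∃ i ∈ Ω, F.box i = b
  -- The level of `j` is the !-box of the innermost open instance containing `j`, or `N + 1` if
  -- there is none.
  level : ∀ j ∈ A, ∀ b, H.le (lev j) b ↔ ∃ i ∈ Ω, F.ile j i ∧ F.box i = b
  level_le : ∀ j ∈ A, lev j ≤ N + 1
  top : (s.1 = N + 2 ∧ A = ∅) ∨ (s.1 ≤ N + 1 ∧ ∃ τ ∈ A, F.box τ = N ∧ ∀ i ∈ A, F.ile i τ)
  -- Here `r` is the number of selected loose links not yet met; it is stored in the second table
  -- while `i` is open, and is `0` once `i` is closed.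
  count : ∀ i ∈ A, ∀ x < n, ∀ a < n, ∀ y < n, H.Owns (F.box i) x y → ∃ r,
    (i ∈ Ω → r = keyAt s.2.2 x a y) ∧ (i ∉ Ω → r = 0) ∧
    γ i x a y = H.tightCount x a y +
      Set.ncard {q | q ∈ looseSet H F A i x a y ∧ om q.2 q.1} + r
  guess : ∀ i ∈ Ω, ∀ x < n, ∀ a < n, ∀ y < n, H.Owns (F.box i) x y →
    γ i x a y = keyAt s.2.1 x a y
  full : ∀ i ∈ A, ∀ x < n, ∀ a < n, ∀ y < n, H.Owns (F.box i) x y →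
    ∀ q ∈ looseSet H F A i x a y, ¬ om q.2 q.1 → γ i x a y = n

variable {F : Amb ℕ I} {om : I → ℕ → Prop} {γ : I → ℕ → ℕ → ℕ → ℕ} {A Ω : Set I} {lev : I → ℕ}
  {s s' : ExpState}

theorem not_owns_of_loose (hH : H.IsBounded n N) {x h a y c : ℕ} (l : H.graph.IsLink x h a y)
    (ht : ¬ H.IsTight x h y) (hc : H.IsLeast h c) : ¬ H.Owns c x y :=
  fun ho => ht fun b => (hc b).trans (ho b).symm

theorem looseSet_insert_of_ile {i j : I} (hi : i ∉ A) (hij : F.ile i j) (x a y : ℕ) :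
    looseSet H F (insert i A) j x a y = looseSet H F A j x a y ∪
      (fun h => (h, i)) '' {h | H.graph.IsLink x h a y ∧ ¬ H.IsTight x h y ∧
        H.IsLeast h (F.box i)} := by
  ext ⟨h, k⟩
  constructor
  · rintro ⟨hk | hk, h1, h2, h3, h4⟩
    · simp only at hk
      subst hk
      exact .inr ⟨h, ⟨h2, h3, h4⟩, rfl⟩
    · exact .inl ⟨hk, h1, h2, h3, h4⟩
  · rintro (⟨hk, h1⟩ | ⟨h', ⟨h2, h3, h4⟩, heq⟩)
    · exact ⟨.inr hk, h1⟩
    · cases heq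
      exact ⟨.inl rfl, hij, h2, h3, h4⟩

theorem looseSet_insert_of_not_ile {i j : I} (hij : ¬ F.ile i j) (x a y : ℕ) :
    looseSet H F (insert i A) j x a y = looseSet H F A j x a y := by
  ext ⟨h, k⟩
  constructor
  · rintro ⟨hk | hk, h1, h2⟩
    · simp only at hk
      subst hk
      exact absurd h1 hij
    · exact ⟨hk, h1, h2⟩
  · rintro ⟨hk, h1⟩
    exact ⟨.inr hk, h1⟩

theorem ncard_looseSet_insert (hH : H.IsBounded n N) (hA : A.Finite) {i j : I} (hi : i ∉ A)
    (hij : F.ile i j) {P : ℕ → Prop} (hP : ∀ h, om i h ↔ P h) (x a y : ℕ) :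
    Set.ncard {q | q ∈ looseSet H F (insert i A) j x a y ∧ om q.2 q.1} =
      Set.ncard {q | q ∈ looseSet H F A j x a y ∧ om q.2 q.1} +
        H.looseCount P (F.box i) x a y := by
  have hfin : {h | H.graph.IsLink x h a y ∧ ¬ H.IsTight x h y ∧ H.IsLeast h (F.box i) ∧
      P h}.Finite :=
    hH.topped.finite_content.subset fun h hh => (hH.topped.edge_dom _ _ _ hh.1.2.2.2.1).2
  have hsplit : {q | q ∈ looseSet H F (insert i A) j x a y ∧ om q.2 q.1} =
      {q | q ∈ looseSet H F A j x a y ∧ om q.2 q.1} ∪ (fun h => (h, i)) ''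
        {h | H.graph.IsLink x h a y ∧ ¬ H.IsTight x h y ∧ H.IsLeast h (F.box i) ∧ P h} := by
    rw [looseSet_insert_of_ile hi hij]
    ext ⟨h, k⟩
    constructor
    · rintro ⟨h1 | ⟨h', ⟨h2, h3, h4⟩, heq⟩, h5⟩
      · exact .inl ⟨h1, h5⟩
      · cases heq
        exact .inr ⟨h, ⟨h2, h3, h4, (hP h).1 h5⟩, rfl⟩
    · rintro (⟨h1, h5⟩ | ⟨h', ⟨h2, h3, h4, h5⟩, heq⟩)
      · exact ⟨.inl h1, h5⟩
      · cases heq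
        exact ⟨.inr ⟨h, ⟨h2, h3, h4⟩, rfl⟩, (hP h).2 h5⟩
  have hdisj : Disjoint {q | q ∈ looseSet H F A j x a y ∧ om q.2 q.1} ((fun h => (h, i)) ''
        {h | H.graph.IsLink x h a y ∧ ¬ H.IsTight x h y ∧ H.IsLeast h (F.box i) ∧ P h}) := by
    rw [Set.disjoint_left]
    rintro _ ⟨h1, -⟩ ⟨h, -, rfl⟩
    exact hi h1.1
  rw [hsplit, Set.ncard_union_eq hdisj
    ((finite_looseSet hH.topped hA j x a y).subset fun q hq => hq.1) (hfin.image _),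
    Set.ncard_image_of_injective _ fun h h' hh => (Prod.mk.inj hh).1]
  rfl

/-- No older instance is nested in a new one, and a loose link between endpoints owned by `i` has
its least !-box strictly below that of `i`. So no loose link is recorded yet. -/
theorem ncard_looseSet_insert_self (hH : H.IsBounded n N) {i : I} (hi : i ∉ A)
    (hwf : F.WF H.le A) {x a y : ℕ} (ho : H.Owns (F.box i) x y) :
    looseSet H F (insert i A) i x a y = ∅ := by
  ext ⟨h, k⟩
  refine ⟨?_, fun h => h.elim⟩
  rintro ⟨hk | hk, h1, h2, h3, h4⟩
  · simp only at hk
    subst hk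
    exact not_owns_of_loose hH h2 h3 h4 ho
  · exact hi (hwf.up _ hk _ h1)

theorem Owns.unique (hH : H.IsBounded n N) {b c x y : ℕ} (hb : H.Owns b x y) (hc : H.Owns c x y)
    (hbN : H.le b N) (hcN : H.le c N) : b = c :=
  hH.topped.le_antisymm _ _ ((hb _).1 ((hc _).2 (hH.topped.le_refl _ hcN)))
    ((hc _).1 ((hb _).2 (hH.topped.le_refl _ hbN)))

/-- Hence `N + 1` and `N + 2` can serve as current !-boxes of states without open instances. -/
theorem Explores.not_le_of_lt (hH : H.IsBounded n N) {a b : ℕ} (h : N < a) : ¬ H.le a b :=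
  fun hab => absurd ((hH.box_iff _).1 (hH.topped.le_dom _ _ hab).1) (by omega)

/-- Opening an instance. -/
theorem Explores.opened (hH : H.IsBounded n N) (h : Explores H n N F om γ A Ω lev s)
    {l : List ℕ} (hm : H.OpenValid n N l s s') {i : I} (hi : i ∉ A)
    (hup : ∀ j, F.ile i j ↔ j = i ∨ j ∈ Ω) (hbox : F.box i = s'.1)
    (hom : ∀ h, om i h ↔ l.getD h 0 = 1)
    (hγ : ∀ x < n, ∀ a < n, ∀ y < n, H.Owns s'.1 x y → γ i x a y = keyAt s'.2.1 x a y)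
    {lev' : I → ℕ} (hlev : ∀ j ∈ A, lev' j = lev j) (hlev' : lev' i = s'.1) :
    Explores H n N F om γ (insert i A) (insert i Ω) lev' s' := by
  have hcc : H.le s'.1 s'.1 := (hm.cur _).2 (.inl rfl)
  have hiΩ : i ∉ Ω := fun h' => hi (h.sub h')
  have hwf : F.WF H.le (insert i A) := by
    refine ⟨?_, ?_, ?_, ?_, ?_, ?_⟩
    · rintro j (rfl | hj)
      · exact (hup j).2 (.inl rfl)
      · exact h.wf.refl j hj
    · rintro j (rfl | hj) k hk
      · exact ((hup k).1 hk).imp id (fun h' => h.sub h')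
      · exact .inr (h.wf.up j hj k hk)
    · rintro j (rfl | hj) k l hk hl
      · rcases (hup k).1 hk with rfl | hk
        · exact hl
        · exact (hup l).2 (.inr (h.up k hk l hl))
      · exact h.wf.trans j hj k l hk hl
    · rintro j (rfl | hj) k hk
      · rw [hbox, hm.cur]
        rcases (hup k).1 hk with rfl | hk
        · exact .inl hbox
        · exact .inr ((h.cur _).2 ⟨k, hk, rfl⟩)
      · exact h.wf.mono j hj k hk
    · rintro j (rfl | hj) b hb
      · rw [hbox, hm.cur] at hb
        rcases hb with rfl | hb
        · exact ⟨j, (hup j).2 (.inl rfl), hbox⟩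
        · obtain ⟨k, hk, hkb⟩ := (h.cur _).1 hb
          exact ⟨k, (hup k).2 (.inr hk), hkb⟩
      · exact h.wf.lift j hj b hb
    · rintro j (rfl | hj) k l hk hl hkl
      · rcases (hup k).1 hk with hk' | hk' <;> rcases (hup l).1 hl with hl' | hl'
        · exact hk'.trans hl'.symm
        · rw [hk', hbox] at hkl
          exact absurd ((h.cur _).2 ⟨l, hl', hkl.symm⟩) hm.new
        · rw [hl', hbox] at hkl
          exact absurd ((h.cur _).2 ⟨k, hk', hkl⟩) hm.new
        · exact h.inj k hk' l hl' hkl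
      · exact h.wf.inj j hj k l hk hl hkl
  -- `A` is closed under ancestors, so no older instance is nested in the new one.
  have hile : ∀ j ∈ A, ¬ F.ile j i := fun j hj hji => hi (h.wf.up j hj i hji)
  refine ⟨h.finite.insert i, hwf, ?_, Set.insert_subset_insert h.sub, ?_, ?_, ?_, ?_, ?_, ?_, ?_,
    ?_, ?_⟩
  · rintro j (rfl | hj)
    · rw [hbox]
      exact (hH.topped.le_dom _ _ hcc).1
    · exact h.dom j hj
  · rintro j (rfl | hj) k hk
    · exact (hup k).1 hk
    · exact .inr (h.up j hj k hk)
  · rintro j (rfl | hj) k (rfl | hk) hjk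
    · rfl
    · exact absurd ((h.cur _).2 ⟨k, hk, hjk.symm.trans hbox⟩) hm.new
    · exact absurd ((h.cur _).2 ⟨j, hj, hjk.trans hbox⟩) hm.new
    · exact h.inj j hj k hk hjk
  · intro b
    rw [hm.cur, h.cur]
    constructor
    · rintro (rfl | ⟨j, hj, hjb⟩)
      · exact ⟨i, .inl rfl, hbox⟩
      · exact ⟨j, .inr hj, hjb⟩
    · rintro ⟨j, rfl | hj, hjb⟩
      · exact .inl (hjb.symm.trans hbox)
      · exact .inr ⟨j, hj, hjb⟩
  · rintro j (rfl | hj) b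
    · rw [hlev', hm.cur, h.cur]
      constructor
      · rintro (rfl | ⟨k, hk, hkb⟩)
        · exact ⟨j, .inl rfl, (hup j).2 (.inl rfl), hbox⟩
        · exact ⟨k, .inr hk, (hup k).2 (.inr hk), hkb⟩
      · rintro ⟨k, rfl | hk, -, hkb⟩
        · exact .inl (hkb.symm.trans hbox)
        · exact .inr ⟨k, hk, hkb⟩
    · rw [hlev j hj, h.level j hj]
      constructor
      · rintro ⟨k, hk, hjk, hkb⟩
        exact ⟨k, .inr hk, hjk, hkb⟩
      · rintro ⟨k, rfl | hk, hjk, hkb⟩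
        · exact absurd hjk (hile j hj)
        · exact ⟨k, hk, hjk, hkb⟩
  · rintro j (rfl | hj)
    · rw [hlev']
      exact hm.cur_le.trans (Nat.le_succ N)
    · rw [hlev j hj]
      exact h.level_le j hj
  · right
    refine ⟨hm.cur_le.trans (Nat.le_succ N), ?_⟩
    -- The first instance opened has !-box `N` and becomes the root; later ones are opened under an
    -- open instance, and so inside the root.
    rcases h.top with ⟨h1, h2⟩ | ⟨h1, τ, hτ, hτN, hall⟩
    · subst h2
      refine ⟨i, .inl rfl, ?_, ?_⟩
      · have hN : H.le s'.1 N := (hH.topped.le_dom _ _ hcc).1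
        rw [hbox]
        rcases (hm.cur N).1 hN with h' | h'
        · exact h'.symm
        · exact absurd h' (not_le_of_lt hH (by omega))
      · rintro j (rfl | hj)
        · exact (hup j).2 (.inl rfl)
        · exact hj.elim
    · refine ⟨τ, .inr hτ, hτN, ?_⟩
      rintro j (rfl | hj)
      · have hsN : s.1 ≤ N := by have := hm.ne_end; omega
        obtain ⟨k, hk, -⟩ := (h.cur N).1 ((hH.box_iff _).2 hsN)
        have hτΩ : τ ∈ Ω := h.up k hk τ (hall k (h.sub hk))
        exact (hup τ).2 (.inr hτΩ)
      · exact hall j hj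
  · rintro j (rfl | hj) x hx a ha y hy ho
    · refine ⟨keyAt s'.2.2 x a y, fun _ => rfl, fun h' => absurd (.inl rfl) h', ?_⟩
      rw [ncard_looseSet_insert_self hH hi h.wf ho]
      rw [hbox] at ho
      rw [hγ x hx a ha y hy ho, hm.own x hx a ha y hy ho]
      simp
    · obtain ⟨r, hr, hr', hc⟩ := h.count j hj x hx a ha y hy ho
      -- The instances containing the new one are the open ones. For these, the selected links pass
      -- from the remaining number to the links already met; for closed ones nothing changes.
      by_cases hjΩ : j ∈ Ω
      · refine ⟨keyAt s'.2.2 x a y, fun _ => rfl, fun h' => absurd (.inr hjΩ) h', ?_⟩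
        rw [ncard_looseSet_insert hH h.finite hi ((hup j).2 (.inr hjΩ)) hom, hc, hr hjΩ, hbox,
          ← (hm.keep _ ((h.cur _).2 ⟨j, hjΩ, rfl⟩) x hx a ha y hy ho).2.1]
        omega
      · refine ⟨0, ?_, fun _ => rfl, ?_⟩
        · rintro (rfl | h')
          · exact absurd hj hi
          · exact absurd h' hjΩ
        · rw [looseSet_insert_of_not_ile, hc, hr' hjΩ]
          intro hij
          rcases (hup j).1 hij with rfl | h'
          · exact hi hj
          · exact hjΩ h'
  · rintro j (rfl | hj) x hx a ha y hy ho
    · rw [hbox] at ho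
      exact hγ x hx a ha y hy ho
    · rw [h.guess j hj x hx a ha y hy ho,
        (hm.keep _ ((h.cur _).2 ⟨j, hj, rfl⟩) x hx a ha y hy ho).1]
  · rintro j (rfl | hj) x hx a ha y hy ho q hq hno
    · rw [ncard_looseSet_insert_self hH hi h.wf ho] at hq
      exact hq.elim
    · by_cases hij : F.ile i j
      · rw [looseSet_insert_of_ile hi hij] at hq
        rcases hq with hq | ⟨h', ⟨h2, h3, h4⟩, rfl⟩
        · exact h.full j hj x hx a ha y hy ho q hq hno
        · have hjΩ : j ∈ Ω := by
            rcases (hup j).1 hij with rfl | h'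
            · exact absurd hj hi
            · exact h'
          rw [h.guess j hjΩ x hx a ha y hy ho]
          rw [hbox] at h4
          exact (hm.keep _ ((h.cur _).2 ⟨j, hjΩ, rfl⟩) x hx a ha y hy ho).2.2 h' h2 h3 h4
            fun h' => hno ((hom _).2 h')
      · rw [looseSet_insert_of_not_ile hij] at hq
        exact h.full j hj x hx a ha y hy ho q hq hno

/-- Closing an instance. -/
theorem Explores.closed (hH : H.IsBounded n N) (h : Explores H n N F om γ A Ω lev s)
    (hm : H.CloseValid n N s s') {i : I} (hi : i ∈ Ω) (hbox : F.box i = s.1)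
    {lev' : I → ℕ} (hlev : ∀ j ∈ A, lev' j = if lev j = s.1 then s'.1 else lev j) :
    Explores H n N F om γ A (Ω \ {i}) lev' s' := by
  have hne : ∀ j ∈ Ω, j ≠ i → F.box j ≠ s.1 :=
    fun j hj hji hb => hji (h.inj j hj i hi (hb.trans hbox.symm))
  refine ⟨h.finite, h.wf, h.dom, fun j hj => h.sub hj.1, ?_, fun j hj k hk => h.inj j hj.1 k hk.1,
    ?_, ?_, ?_, ?_, ?_, ?_, h.full⟩
  · rintro j ⟨hj, hji⟩ k hk
    refine ⟨h.up j hj k hk, ?_⟩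
    rintro rfl
    have h1 := h.wf.mono j (h.sub hj) k hk
    have h2 := (h.cur (F.box j)).2 ⟨j, hj, rfl⟩
    rw [hbox] at h1
    exact hne j hj hji (hH.topped.le_antisymm _ _ h1 h2)
  · intro b
    rw [hm.cur, h.cur]
    constructor
    · rintro ⟨⟨j, hj, rfl⟩, hb⟩
      exact ⟨j, ⟨hj, fun hji => hb (by rw [show j = i from hji, hbox])⟩, rfl⟩
    · rintro ⟨j, ⟨hj, hji⟩, rfl⟩
      exact ⟨⟨j, hj, rfl⟩, hne j hj hji⟩
  · intro j hj b
    rw [hlev j hj]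
    have hl := h.level j hj
    split_ifs with hls
    · rw [hm.cur, ← hls, hl]
      constructor
      · rintro ⟨⟨k, hk, hjk, rfl⟩, hb⟩
        exact ⟨k, ⟨hk, fun hki => hb (by rw [show k = i from hki, hbox, hls])⟩, hjk, rfl⟩
      · rintro ⟨k, ⟨hk, hki⟩, hjk, rfl⟩
        exact ⟨⟨k, hk, hjk, rfl⟩, by rw [hls]; exact hne k hk hki⟩
    · rw [hl]
      constructor
      · rintro ⟨k, hk, hjk, rfl⟩
        -- The instance being closed is the innermost open one. If it contained `j`, the level of
        -- `j` would be its !-box.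
        refine ⟨k, ⟨hk, ?_⟩, hjk, rfl⟩
        rintro rfl
        refine hls (hH.topped.le_antisymm _ _ ?_ ?_)
        · exact (hl _).2 ⟨k, hk, hjk, hbox⟩
        · have hN : H.le (lev j) (lev j) := by
            refine hH.topped.le_refl _ (hH.topped.le_dom _ _ ((hl _).2 ⟨k, hk, hjk, rfl⟩)).1
          obtain ⟨k', hk', -, hkb'⟩ := (hl _).1 hN
          rw [h.cur]
          exact ⟨k', hk', hkb'⟩
      · rintro ⟨k, ⟨hk, hki⟩, hjk, rfl⟩
        exact ⟨k, hk, hjk, rfl⟩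
  · intro j hj
    rw [hlev j hj]
    split_ifs
    · exact hm.tgt_le
    · exact h.level_le j hj
  · right
    refine ⟨hm.tgt_le, ?_⟩
    rcases h.top with ⟨h1, h2⟩ | ⟨h1, h2⟩
    · exact absurd (h.sub hi) (by rw [h2]; exact fun h => h)
    · exact h2
  · intro j hj x hx a ha y hy ho
    obtain ⟨r, hr, hr', hc⟩ := h.count j hj x hx a ha y hy ho
    refine ⟨r, ?_, ?_, hc⟩
    · rintro ⟨hjΩ, hji⟩
      have hle : H.le s'.1 (F.box j) := (hm.cur _).2 ⟨(h.cur _).2 ⟨j, hjΩ, rfl⟩, hne j hjΩ hji⟩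
      rw [hr hjΩ, (hm.keep _ hle x hx a ha y hy ho).2]
    · intro hjΩ
      by_cases hjΩ' : j ∈ Ω
      · have : j = i := by
          by_contra hji
          exact hjΩ ⟨hjΩ', hji⟩
        subst this
        rw [hbox] at ho
        rw [hr hjΩ', hm.own x hx a ha y hy ho]
      · exact hr' hjΩ'
  · rintro j ⟨hjΩ, hji⟩ x hx a ha y hy ho
    have hle : H.le s'.1 (F.box j) := (hm.cur _).2 ⟨(h.cur _).2 ⟨j, hjΩ, rfl⟩, hne j hjΩ hji⟩
    rw [h.guess j hjΩ x hx a ha y hy ho, (hm.keep _ hle x hx a ha y hy ho).1]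

/-- At the end of an exploration, the selection of encoded links is consistent. -/
theorem Explores.isConsistent (hH : H.IsBounded n N) (h : Explores H n N F om γ A Ω lev s)
    (hs : N < s.1) (hγ : ∀ i ∈ A, ∀ x a y, γ i x a y ≤ n)
    (h0 : ∀ i ∈ A, ∀ x a y, ¬ (x < n ∧ a < n ∧ y < n) → γ i x a y = 0) :
    IsConsistent H F A om γ n := by
  -- No !-box is above `s.1`, so no instance is open and nothing remains to be met.
  have hΩ : ∀ i, i ∉ Ω := fun i hi =>
    not_le_of_lt hH hs ((h.cur (F.box i)).2 ⟨i, hi, rfl⟩)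
  refine ⟨?_, fun i hi x a y _ => hγ i hi x a y, ?_⟩
  · intro i hi x a y ho
    by_cases hk : x < n ∧ a < n ∧ y < n
    · obtain ⟨r, -, hr, hc⟩ := h.count i hi x hk.1 a hk.2.1 y hk.2.2 ho
      rw [hc, hr (hΩ i), add_zero]
    · have h1 : ∀ h, ¬ H.graph.IsLink x h a y := fun h l => hk (hH.link_lt l)
      rw [h0 i hi x a y hk]
      have e1 : H.tightCount x a y = 0 := by
        rw [tightCount, show {h | H.graph.IsLink x h a y ∧ H.IsTight x h y} = ∅ from ?_]
        · exact Set.ncard_empty _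
        · ext h
          exact ⟨fun h' => h1 _ h'.1, fun h' => h'.elim⟩
      have e2 : {q | q ∈ looseSet H F A i x a y ∧ om q.2 q.1} = ∅ := by
        ext q
        exact ⟨fun h' => h1 _ h'.1.2.2.1, fun h' => h'.elim⟩
      rw [e1, e2, Set.ncard_empty]
  · intro i hi x a y ho q hq
    have hk := hH.link_lt hq.2.2.1
    exact h.full i hi x hk.1 a hk.2.1 y hk.2.2 ho q hq

end BangData

/-! ### Sentential forms and the substitution of right-hand sides -/

namespace BangData
variable {H : BangData ℕ ℕ} {n N : ℕ} {I : Type} {F : Amb ℕ I} {om : I → ℕ → Prop}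
  {γ : I → ℕ → ℕ → ℕ → ℕ} {A Ω : Set I} {lev lev' π π' : I → ℕ} {s s' : ExpState} {P : Set ℕ}

/-- The edges of a sentential form; `none` stands for the nonterminal node. -/
def sententialEdge (H : BangData ℕ ℕ) (F : Amb ℕ I) (γ : I → ℕ → ℕ → ℕ → ℕ) (n : ℕ)
    (lev π : I → ℕ) : Option (ℕ × I) → EdgeLabel → Option (ℕ × I) → Prop
  | some p, l, some q => F.Agree (F.upper p.2) (F.upper q.2) ∧ (H.graph.edge p.1 l q.1 ∨
      p.1 ≠ q.1 ∧ ∃ a k, l = EdgeLabel.beta (Nat.pair a k) ∧ a < n ∧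
        k < linkCount H F γ p.2 p.1 a q.2 q.1)
  | none, l, some q => l = alphaLabel q.1 (lev q.2) (π q.2)
  | some p, l, none => l = alphaLabel p.1 (lev p.2) (π p.2)
  | none, _, none => False

/-- The vertices of a sentential form. -/
abbrev SententialVertex (H : BangData ℕ ℕ) (F : Amb ℕ I) (A : Set I) (om : I → ℕ → Prop) : Type :=
  {o : Option (ℕ × I) // ∀ q, o = some q → q.2 ∈ A ∧ Emitted H F om q.1 q.2}

/-- The sentential form given by an exploration. -/
def sentential (H : BangData ℕ ℕ) (F : Amb ℕ I) (A : Set I) (om : I → ℕ → Prop)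
    (γ : I → ℕ → ℕ → ℕ → ℕ) (n : ℕ) (lev π : I → ℕ) (X : NodeLabel) :
    LGraph NodeLabel EdgeLabel (SententialVertex H F A om) where
  edge p l q := sententialEdge H F γ n lev π p.1 l q.1
  irrefl := by
    rintro ⟨_ | p, hp⟩ l h
    · exact h
    · rcases h.2 with h | h
      · exact H.graph.irrefl _ _ h
      · exact h.1 rfl
  label p := p.1.elim X fun q => H.graph.label q.1

/-- The number of encoded links between vertices one of which is generated by a move with
target `s`. -/
noncomputable def moveCount (H : BangData ℕ ℕ) (s : ExpState) (x a y : ℕ) : ℕ :=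
  open Classical in if H.Owns s.1 x y then keyAt s.2.1 x a y else H.tightCount x a y

/-- The edges between vertices one of which is generated by a move with target `s`. -/
def moveEdge (H : BangData ℕ ℕ) (n : ℕ) (s : ExpState) (x : ℕ) (l : EdgeLabel) (y : ℕ) : Prop :=
  H.graph.edge x l y ∨ x ≠ y ∧ ∃ a k, l = EdgeLabel.beta (Nat.pair a k) ∧ a < n ∧
    k < H.moveCount s x a y

/-- The vertex `v` is generated by a move. -/
def MoveEmits (H : BangData ℕ ℕ) (l : List ℕ) (c v : ℕ) : Prop :=
  H.IsLeast v c ∧ ∀ x h a y p, H.graph.IsLink x h a y → H.graph.Run h p v →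
    ¬ H.IsTight x h y ∧ ¬ l.getD h 0 = 1

/-- `D` is the right-hand side of the production for opening an instance. -/
structure IsOpenRhs (H : BangData ℕ ℕ) (n N : ℕ) (P : Set ℕ) (l : List ℕ) (s : ExpState) (m : ℕ)
    (X : NodeLabel) {U : Type} (D : EGraph NodeLabel EdgeLabel U) (slot : U → Option ℕ) : Prop where
  inj : Function.Injective slot
  mem : ∀ o, (∃ x, slot x = o) ↔ ∀ v, o = some v → H.MoveEmits l s.1 v
  label : ∀ x, D.label x = (slot x).elim X H.graph.label
  edge : ∀ x y v u e, slot x = some v → slot y = some u →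
    (D.edge x e y ↔ H.moveEdge n s v e u)
  edge_left : ∀ x y v e, slot x = some v → slot y = none →
    (D.edge x e y ↔ e = alphaLabel v s.1 m)
  edge_right : ∀ x y v e, slot x = none → slot y = some v →
    (D.edge x e y ↔ e = alphaLabel v s.1 m)
  conn_none : ∀ σ, σ = .N ∨ σ = .W → ∀ u < n, ∀ d ≤ N + 1, ∀ p ∈ P, ∀ e x dir, slot x = none →
    (D.conn σ (alphaLabel u d p) e x dir ↔ e = alphaLabel u d p)
  -- The condition on the level `d` expresses that the sections of the old and the new vertex agree;
  -- see `Explores.agree_iff`.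
  conn_in : ∀ σ, σ = .N ∨ σ = .W → ∀ u < n, ∀ d ≤ N + 1, ∀ p ∈ P, ∀ e x v, slot x = some v →
    (D.conn σ (alphaLabel u d p) e x .inward ↔
      (∀ b, H.le d b ↔ u ∈ H.content b ∧ v ∈ H.content b) ∧ H.moveEdge n s u e v)
  conn_out : ∀ σ, σ = .N ∨ σ = .W → ∀ u < n, ∀ d ≤ N + 1, ∀ p ∈ P, ∀ e x v, slot x = some v →
    (D.conn σ (alphaLabel u d p) e x .outward ↔
      (∀ b, H.le d b ↔ u ∈ H.content b ∧ v ∈ H.content b) ∧ H.moveEdge n s v e u)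

/-- `D` is the right-hand side of the production for closing an instance. -/
structure IsCloseRhs (n N : ℕ) (P : Set ℕ) (s s' : ExpState) (X : NodeLabel) {U : Type}
    (D : EGraph NodeLabel EdgeLabel U) : Prop where
  unique : ∃ x : U, ∀ y, y = x
  label : ∀ x, D.label x = X
  conn : ∀ σ, σ = .N ∨ σ = .W → ∀ u < n, ∀ d ≤ N + 1, ∀ p ∈ P, ∀ e x dir,
    (D.conn σ (alphaLabel u d p) e x dir ↔
      e = alphaLabel u (if d = s.1 then s'.1 else d) p)

/-- The !-boxes above the level of `j` are those of the open instances containing `j`, and these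
also contain the new instance `i`. The sections agree exactly when every !-box common to `u` and `v`
has such a shared open instance. If `u` also lies in the !-box of `i`, both sides fail: its instance
there is older than `i`, and no instance of that !-box was open. -/
theorem Explores.agree_iff (h : Explores H n N F om γ A Ω lev s)
    {i j : I} (hi : i ∉ A) (hup : ∀ j, F.ile i j ↔ j = i ∨ j ∈ Ω) (hj : j ∈ A) {u v : ℕ}
    (hu : H.IsLeast u (F.box j)) (hv : H.IsLeast v (F.box i))
    (hi' : ∀ b, H.le (F.box i) b ↔ b = F.box i ∨ H.le s.1 b) (hnew : ¬ H.le s.1 (F.box i)) :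
    (∀ b, H.le (lev j) b ↔ u ∈ H.content b ∧ v ∈ H.content b) ↔
      F.Agree (F.upper j) (F.upper i) := by
  have hl := h.level j hj
  constructor
  · intro hb k hk k' hk' hkk
    have h1 : u ∈ H.content (F.box k) := (hu _).2 (h.wf.mono j hj k hk)
    have h2 : v ∈ H.content (F.box k) := by
      rw [hkk, hv, hi']
      rcases (hup k').1 hk' with rfl | hk'
      · exact .inl rfl
      · exact .inr ((h.cur _).2 ⟨k', hk', rfl⟩)
    obtain ⟨a, ha, hja, hak⟩ := (hl _).1 ((hb _).2 ⟨h1, h2⟩)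
    have hka : k = a := h.wf.inj j hj k a hk hja hak.symm
    subst hka
    rcases (hup k').1 hk' with rfl | hk'
    · exfalso
      exact hnew ((h.cur _).2 ⟨k, ha, hkk⟩)
    · exact h.inj k ha k' hk' hkk
  · intro hag b
    rw [hl]
    constructor
    · rintro ⟨a, ha, hja, rfl⟩
      exact ⟨(hu _).2 (h.wf.mono j hj a hja),
        (hv _).2 ((hi' _).2 (.inr ((h.cur _).2 ⟨a, ha, rfl⟩)))⟩
    · rintro ⟨hub, hvb⟩
      obtain ⟨a, hja, rfl⟩ := h.wf.lift j hj b ((hu b).1 hub)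
      have haA := h.wf.up j hj a hja
      rcases (hi' _).1 ((hv _).1 hvb) with hb | hb
      · have := hag a hja i ((hup i).2 (.inl rfl)) hb
        subst this
        exact absurd haA hi
      · obtain ⟨k, hk, hkb⟩ := (h.cur _).1 hb
        have := hag a hja k ((hup k).2 (.inr hk)) hkb.symm
        subst this
        exact ⟨a, hk, hja, rfl⟩

/-- If `j` owned the pair, it would have an ancestor over the !-box of `i`, equal to `i` by
agreement; but ancestors of `j` are older than `i`. So at the moment of drawing edges only the new
instance can own the pair. -/
theorem not_owns_of_agree {i j : I} (hi : i ∉ A) (hF : F.WF H.le A)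
    (hj : j ∈ A) (hag : F.Agree (F.upper j) (F.upper i)) (hii : F.ile i i) {x y : ℕ}
    (hv : x ∈ H.content (F.box i) ∨ y ∈ H.content (F.box i)) :
    ¬ H.Owns (F.box j) x y := by
  intro ho
  obtain ⟨k, hk, hkb⟩ := hF.lift j hj _ ((ho _).1 hv)
  have := hag k hk i hii hkb
  subst this
  exact hi (hF.up j hj _ hk)

/-- Substitution of a right-hand side that opens an instance. -/
theorem subst_opened (hH : H.IsBounded n N) (h : Explores H n N F om γ A Ω lev s)
    {l : List ℕ} (hm : H.OpenValid n N l s s') {i : I} (hi : i ∉ A)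
    (hup : ∀ j, F.ile i j ↔ j = i ∨ j ∈ Ω) (hbox : F.box i = s'.1)
    (hom : ∀ h, om i h ↔ l.getD h 0 = 1)
    (hγ : ∀ x < n, ∀ a < n, ∀ y < n, H.Owns s'.1 x y → γ i x a y = keyAt s'.2.1 x a y)
    (hlev : ∀ j ∈ A, lev' j = lev j) (hlev' : lev' i = s'.1)
    (hπ : ∀ j ∈ A, π' j = π j) {m : ℕ} (hπ' : π' i = m) (hP : ∀ j ∈ A, π j ∈ P)
    {V U : Type} {K : EGraph NodeLabel EdgeLabel V} {X X' : NodeLabel}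
    (e : V ≃ SententialVertex H F A om)
    (he : ∀ x l y, K.edge x l y ↔ (sentential H F A om γ n lev π X).edge (e x) l (e y))
    (hl : ∀ x, K.label x = (sentential H F A om γ n lev π X).label (e x))
    {v : V} (hv : (e v).1 = none) {D : EGraph NodeLabel EdgeLabel U} {slot : U → Option ℕ}
    (hD : IsOpenRhs H n N P l s' m X' D slot) :
    (K.subst v D).toLGraph.IsIso (sentential H F (insert i A) om γ n lev' π' X') := by
  have hcc : H.le s'.1 s'.1 := (hm.cur _).2 (.inl rfl)
  have hcN := (hH.topped.le_dom _ _ hcc).1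
  have hii : F.ile i i := (hup i).2 (.inl rfl)
  have hem : ∀ u, Emitted H F om u i ↔ H.MoveEmits l s'.1 u := by
    intro u
    simp only [Emitted, MoveEmits, hbox, hom]
  have hsome : ∀ x : {x : V // x ≠ v}, ∃ p, (e x.1).1 = some p := by
    intro x
    rcases hx : (e x.1).1 with _ | p
    · exact absurd (e.injective (Subtype.ext (hx.trans hv.symm))) x.2
    · exact ⟨p, rfl⟩
  have hlt : ∀ {u : ℕ} {j : I}, j ∈ A → Emitted H F om u j → u < n :=
    fun hj hu => hH.vert_lt _ ((hu.1 _).2 (h.dom _ hj))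
  have hlab : ∀ u, H.graph.label u = .N ∨ H.graph.label u = .W := hH.topped.string.label_mem
  have hcnt : ∀ x a y, a < n → x < n → y < n →
      linkCount H F γ i x a i y = moveCount H s' x a y := by
    intro x a y ha hx hy
    unfold linkCount moveCount
    rw [hbox]
    split_ifs with h1
    · exact hγ x hx a ha y hy h1
    · rfl
  -- The older instance does not own the pair, so the number of edges can be read off the target
  -- state of the move.
  have hcnt₁ : ∀ {x a y j}, a < n → x < n → y < n → j ∈ A → F.Agree (F.upper j) (F.upper i) →
      y ∈ H.content s'.1 → linkCount H F γ j x a i y = moveCount H s' x a y := by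
    intro x a y j ha hx hy hj hag hyc
    unfold linkCount moveCount
    rw [hbox, if_neg (not_owns_of_agree hi h.wf hj hag hii (.inr (hbox ▸ hyc)))]
    split_ifs with h1
    · exact hγ x hx a ha y hy h1
    · rfl
  have hcnt₂ : ∀ {x a y j}, a < n → x < n → y < n → j ∈ A → F.Agree (F.upper j) (F.upper i) →
      x ∈ H.content s'.1 → linkCount H F γ i x a j y = moveCount H s' x a y := by
    intro x a y j ha hx hy hj hag hxc
    unfold linkCount moveCount
    rw [hbox, if_neg (not_owns_of_agree hi h.wf hj hag hii (.inl (hbox ▸ hxc)))]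
    split_ifs with h1
    · exact hγ x hx a ha y hy h1
    · rfl
  have hagree := fun {j : I} (hj : j ∈ A) {u w : ℕ} (hu : H.IsLeast u (F.box j))
    (hw : H.IsLeast w (F.box i)) => h.agree_iff hi hup hj hu hw (by rw [hbox]; exact hm.cur) (by rw [hbox]; exact hm.new)
  refine isIso_of_bij (fun z => ⟨match z with
      | .inl x => (e x.1).1
      | .inr x => (slot x).map fun v => (v, i), ?_⟩) ⟨?_, ?_⟩ ?_ ?_
  · intro q hq
    rcases z with x | x
    · exact ⟨.inr ((e x.1).2 q hq).1, ((e x.1).2 q hq).2⟩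
    · obtain ⟨w, hw, rfl⟩ := Option.map_eq_some_iff.1 hq
      exact ⟨.inl rfl, (hem w).2 ((hD.mem _).1 ⟨x, hw⟩ w rfl)⟩
  · rintro (x | x) (y | y) hxy <;> have hxy := congrArg (fun z => z.1) hxy <;> simp only at hxy
    · exact congrArg Sum.inl (Subtype.ext (e.injective (Subtype.ext hxy)))
    · obtain ⟨p, hp⟩ := hsome x
      rw [hp] at hxy
      obtain ⟨w, hw, hwp⟩ := Option.map_eq_some_iff.1 hxy.symm
      have := ((e x.1).2 p hp).1
      rw [← hwp] at this
      exact absurd this hi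
    · obtain ⟨p, hp⟩ := hsome y
      rw [hp] at hxy
      obtain ⟨w, hw, hwp⟩ := Option.map_eq_some_iff.1 hxy
      have := ((e y.1).2 p hp).1
      rw [← hwp] at this
      exact absurd this hi
    · refine congrArg Sum.inr (hD.inj (Option.map_injective ?_ hxy))
      exact fun a b hab => (Prod.mk.inj hab).1
  · rintro ⟨_ | ⟨u, j⟩, hz⟩
    · obtain ⟨x, hx⟩ := (hD.mem none).2 (by simp)
      exact ⟨.inr x, Subtype.ext (by simp only [hx]; rfl)⟩
    · obtain ⟨hj | hj, hu⟩ := hz _ rfl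
      · simp only at hj hu
        subst hj
        obtain ⟨x, hx⟩ := (hD.mem (some u)).2 (by
          intro v' hv'
          cases hv'
          exact (hem u).1 hu)
        exact ⟨.inr x, Subtype.ext (by simp only [hx]; rfl)⟩
      · refine ⟨.inl ⟨e.symm ⟨some (u, j), ?_⟩, ?_⟩, Subtype.ext ?_⟩
        · intro q hq
          cases hq
          exact ⟨hj, hu⟩
        · rintro rfl
          rw [Equiv.apply_symm_apply] at hv
          cases hv
        · simp only [Equiv.apply_symm_apply]
  · rintro (x | x) l' (y | y)
    · obtain ⟨p, hp⟩ := hsome x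
      obtain ⟨q, hq⟩ := hsome y
      simp only [EGraph.subst, he, sentential, hp, hq]
      rfl
    · obtain ⟨⟨u, j⟩, hp⟩ := hsome x
      obtain ⟨hj, hu⟩ := (e x.1).2 _ hp
      have hσ : K.label x.1 = .N ∨ K.label x.1 = .W := by
        rw [hl]
        simp only [sentential, hp]
        exact hlab _
      simp only at hj hu
      simp only [EGraph.subst, he, sentential, hp, hv]
      -- A generated vertex is joined to the nonterminal node by a single label, so only one
      -- connection instruction label has to be considered.
      have key : (∃ β, sententialEdge H F γ n lev π (some (u, j)) β none ∧
          D.conn (K.label x.1) β l' y .inward) ↔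
          D.conn (K.label x.1) (alphaLabel u (lev j) (π j)) l' y .inward := by
        constructor
        · rintro ⟨β, h1, h2⟩
          rw [show β = _ from h1] at h2
          exact h2
        · exact fun h2 => ⟨_, rfl, h2⟩
      rw [key]
      rcases hy : slot y with _ | w
      · rw [hD.conn_none _ hσ u (hlt hj hu) _ (h.level_le j hj) _ (hP j hj) _ _ _ hy]
        simp only [Option.map, sententialEdge, hlev j hj, hπ j hj]
      · have hw := (hD.mem _).1 ⟨y, hy⟩ w rfl
        have hwl : H.IsLeast w (F.box i) := hbox ▸ hw.1
        rw [hD.conn_in _ hσ u (hlt hj hu) _ (h.level_le j hj) _ (hP j hj) _ _ _ hy,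
          hagree hj hu.1 hwl]
        refine and_congr_right fun hag => ?_
        refine or_congr Iff.rfl (and_congr_right fun _ => exists_congr fun a =>
          exists_congr fun k => and_congr_right fun _ => and_congr_right fun ha => ?_)
        rw [hcnt₁ ha (hlt hj hu) (hH.vert_lt _ ((hw.1 _).2 hcN)) hj hag ((hw.1 _).2 hcc)]
    · obtain ⟨⟨u, j⟩, hp⟩ := hsome y
      obtain ⟨hj, hu⟩ := (e y.1).2 _ hp
      have hσ : K.label y.1 = .N ∨ K.label y.1 = .W := by
        rw [hl]
        simp only [sentential, hp]
        exact hlab _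
      simp only at hj hu
      simp only [EGraph.subst, he, sentential, hp, hv]
      have key : (∃ β, sententialEdge H F γ n lev π none β (some (u, j)) ∧
          D.conn (K.label y.1) β l' x .outward) ↔
          D.conn (K.label y.1) (alphaLabel u (lev j) (π j)) l' x .outward := by
        constructor
        · rintro ⟨β, h1, h2⟩
          rw [show β = _ from h1] at h2
          exact h2
        · exact fun h2 => ⟨_, rfl, h2⟩
      rw [key]
      rcases hx : slot x with _ | w
      · rw [hD.conn_none _ hσ u (hlt hj hu) _ (h.level_le j hj) _ (hP j hj) _ _ _ hx]
        simp only [Option.map, sententialEdge, hlev j hj, hπ j hj]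
      · have hw := (hD.mem _).1 ⟨x, hx⟩ w rfl
        have hwl : H.IsLeast w (F.box i) := hbox ▸ hw.1
        rw [hD.conn_out _ hσ u (hlt hj hu) _ (h.level_le j hj) _ (hP j hj) _ _ _ hx,
          hagree hj hu.1 hwl]
        rw [show F.Agree (F.upper j) (F.upper i) ↔ F.Agree (F.upper i) (F.upper j) from
          ⟨fun h => h.symm, fun h => h.symm⟩]
        refine and_congr_right fun hag => ?_
        refine or_congr Iff.rfl (and_congr_right fun _ => exists_congr fun a =>
          exists_congr fun k => and_congr_right fun _ => and_congr_right fun ha => ?_)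
        rw [hcnt₂ ha (hH.vert_lt _ ((hw.1 _).2 hcN)) (hlt hj hu) hj hag.symm ((hw.1 _).2 hcc)]
    · simp only [EGraph.subst, sentential]
      rcases hx : slot x with _ | w <;> rcases hy : slot y with _ | w'
      · have := hD.inj (hx.trans hy.symm)
        subst this
        exact ⟨fun h => D.irrefl _ _ h, fun h => h.elim⟩
      · rw [hD.edge_right _ _ _ _ hx hy]
        simp only [Option.map, sententialEdge, hlev', hπ']
      · rw [hD.edge_left _ _ _ _ hx hy]
        simp only [Option.map, sententialEdge, hlev', hπ']
      · rw [hD.edge _ _ _ _ _ hx hy]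
        have hw := (hD.mem _).1 ⟨x, hx⟩ w rfl
        have hw' := (hD.mem _).1 ⟨y, hy⟩ w' rfl
        have hag : F.Agree (F.upper i) (F.upper i) :=
          (h.opened hH hm hi hup hbox hom hγ hlev hlev').wf.inj i (.inl rfl) |>
            fun h' a ha b hb => h' a b ha hb
        refine Iff.trans ?_ (and_iff_right hag).symm
        refine or_congr Iff.rfl (and_congr_right fun _ => exists_congr fun a =>
          exists_congr fun k => and_congr_right fun _ => and_congr_right fun ha => ?_)
        rw [hcnt _ _ _ ha (hH.vert_lt _ ((hw.1 _).2 hcN)) (hH.vert_lt _ ((hw'.1 _).2 hcN))]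
  · rintro (x | x)
    · obtain ⟨p, hp⟩ := hsome x
      simp only [EGraph.subst, hl, sentential, hp]
      rfl
    · simp only [EGraph.subst, hD.label, sentential]
      rcases slot x with _ | w <;> rfl

/-- Substitution of a right-hand side that closes an instance. -/
theorem subst_closed (h : Explores H n N F om γ A Ω lev s) (hH : H.IsBounded n N)
    (hlev : ∀ j ∈ A, lev' j = if lev j = s.1 then s'.1 else lev j) (hP : ∀ j ∈ A, π j ∈ P)
    {V U : Type} {K : EGraph NodeLabel EdgeLabel V} {X X' : NodeLabel}
    (e : V ≃ SententialVertex H F A om)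
    (he : ∀ x l y, K.edge x l y ↔ (sentential H F A om γ n lev π X).edge (e x) l (e y))
    (hl : ∀ x, K.label x = (sentential H F A om γ n lev π X).label (e x))
    {v : V} (hv : (e v).1 = none) {D : EGraph NodeLabel EdgeLabel U}
    (hD : IsCloseRhs n N P s s' X' D) :
    (K.subst v D).toLGraph.IsIso (sentential H F A om γ n lev' π X') := by
  obtain ⟨z, hz⟩ := hD.unique
  have hsome : ∀ x : {x : V // x ≠ v}, ∃ p, (e x.1).1 = some p := by
    intro x
    rcases hx : (e x.1).1 with _ | p
    · exact absurd (e.injective (Subtype.ext (hx.trans hv.symm))) x.2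
    · exact ⟨p, rfl⟩
  have hlt : ∀ {u : ℕ} {j : I}, j ∈ A → Emitted H F om u j → u < n :=
    fun hj hu => hH.vert_lt _ ((hu.1 _).2 (h.dom _ hj))
  have hlab : ∀ u, H.graph.label u = .N ∨ H.graph.label u = .W := hH.topped.string.label_mem
  refine isIso_of_bij (fun z => ⟨match z with
      | .inl x => (e x.1).1
      | .inr x => none, ?_⟩) ⟨?_, ?_⟩ ?_ ?_
  · intro q hq
    rcases z with x | x
    · exact (e x.1).2 q hq
    · cases hq
  · rintro (x | x) (y | y) hxy <;> have hxy := congrArg (fun z => z.1) hxy <;> simp only at hxy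
    · exact congrArg Sum.inl (Subtype.ext (e.injective (Subtype.ext hxy)))
    · obtain ⟨p, hp⟩ := hsome x
      rw [hp] at hxy
      cases hxy
    · obtain ⟨p, hp⟩ := hsome y
      rw [hp] at hxy
      cases hxy
    · rw [hz x, hz y]
  · rintro ⟨_ | q, hq⟩
    · exact ⟨.inr z, rfl⟩
    · refine ⟨.inl ⟨e.symm ⟨some q, hq⟩, ?_⟩, Subtype.ext ?_⟩
      · rintro rfl
        rw [Equiv.apply_symm_apply] at hv
        cases hv
      · simp only [Equiv.apply_symm_apply]
  · have hconn : ∀ (x : {x : V // x ≠ v}) u j, (e x.1).1 = some (u, j) → ∀ l' y dir,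
        D.conn (K.label x.1) (alphaLabel u (lev j) (π j)) l' y dir ↔
          l' = alphaLabel u (lev' j) (π j) := by
      intro x u j hp l' y dir
      obtain ⟨hj, hu⟩ := (e x.1).2 _ hp
      have hσ : K.label x.1 = .N ∨ K.label x.1 = .W := by
        rw [hl]
        simp only [sentential, hp]
        exact hlab _
      rw [hD.conn _ hσ u (hlt hj hu) _ (h.level_le j hj) _ (hP j hj), hlev j hj]
    rintro (x | x) l' (y | y)
    · obtain ⟨p, hp⟩ := hsome x
      obtain ⟨q, hq⟩ := hsome y
      simp only [EGraph.subst, he, sentential, hp, hq]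
      rfl
    · obtain ⟨⟨u, j⟩, hp⟩ := hsome x
      simp only [EGraph.subst, he, sentential, hp, hv]
      constructor
      · rintro ⟨β, h1, h2⟩
        rw [show β = _ from h1] at h2
        exact (hconn x u j hp _ _ _).1 h2
      · exact fun h2 => ⟨_, rfl, (hconn x u j hp _ _ _).2 h2⟩
    · obtain ⟨⟨u, j⟩, hp⟩ := hsome y
      simp only [EGraph.subst, he, sentential, hp, hv]
      constructor
      · rintro ⟨β, h1, h2⟩
        rw [show β = _ from h1] at h2
        exact (hconn y u j hp _ _ _).1 h2
      · exact fun h2 => ⟨_, rfl, (hconn y u j hp _ _ _).2 h2⟩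
    · rw [hz x, hz y]
      exact ⟨fun h => D.irrefl _ _ h, fun h => h.elim⟩
  · rintro (x | x)
    · obtain ⟨p, hp⟩ := hsome x
      simp only [EGraph.subst, hl, sentential, hp]
      rfl
    · simp only [EGraph.subst, hD.label, sentential]
      rfl

/-- Substitution of the empty graph for the nonterminal node. -/
theorem subst_isEmpty {V U : Type} {K : EGraph NodeLabel EdgeLabel V} {X : NodeLabel}
    (e : V ≃ SententialVertex H F A om)
    (he : ∀ x l y, K.edge x l y ↔ (sentential H F A om γ n lev π X).edge (e x) l (e y))
    (hl : ∀ x, K.label x = (sentential H F A om γ n lev π X).label (e x))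
    {v : V} (hv : (e v).1 = none) [IsEmpty U] (D : EGraph NodeLabel EdgeLabel U) :
    (K.subst v D).toLGraph.IsIso (genGraph H F A om γ n) := by
  refine LGraph.IsIso.symm (isIso_of_bij (fun p => .inl ⟨e.symm ⟨some p.1, ?_⟩, ?_⟩) ⟨?_, ?_⟩ ?_ ?_)
  · intro q hq
    cases hq
    exact p.2
  · rintro rfl
    rw [Equiv.apply_symm_apply] at hv
    cases hv
  · intro p q hpq
    have h1 := congrArg Subtype.val (Sum.inl.inj hpq)
    have h2 := congrArg Subtype.val (e.symm.injective h1)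
    exact Subtype.ext (Option.some.inj h2)
  · rintro (⟨x, hx⟩ | x)
    · rcases hp : (e x).1 with _ | p
      · exact absurd (e.injective (Subtype.ext (hp.trans hv.symm))) hx
      · refine ⟨⟨p, (e x).2 _ hp⟩, congrArg Sum.inl (Subtype.ext ?_)⟩
        rw [Equiv.symm_apply_eq]
        exact Subtype.ext hp.symm
    · exact isEmptyElim x
  · intro p l q
    simp only [EGraph.subst, he, sentential, Equiv.apply_symm_apply]
    rfl
  · intro p
    simp only [EGraph.subst, hl, sentential, Equiv.apply_symm_apply]
    rfl

end BangData

/-! ### Tables, states and productions of the grammar -/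

/-- A table with an entry for every triple of numbers below `n`, with entries at most `n`. -/
def IsTable (n : ℕ) (l : List ℕ) : Prop :=
  l.length = Nat.pair n (Nat.pair n n) ∧ ∀ e ∈ l, e ≤ n

/-- The table with all entries `0`. -/
def zeroTable (n : ℕ) : List ℕ := List.replicate (Nat.pair n (Nat.pair n n)) 0

theorem isTable_zeroTable (n : ℕ) : IsTable n (zeroTable n) :=
  ⟨List.length_replicate, fun e he => by rw [(List.mem_replicate.1 he).2]; exact Nat.zero_le n⟩

theorem IsTable.keyAt_le {n : ℕ} {l : List ℕ} (h : IsTable n l) (x a y : ℕ) : keyAt l x a y ≤ n := by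
  unfold keyAt
  rcases Nat.lt_or_ge (Nat.pair x (Nat.pair y a)) l.length with h' | h'
  · rw [List.getD_eq_getElem _ _ h']
    exact h.2 _ (List.getElem_mem h')
  · rw [List.getD_eq_default _ _ h']
    exact Nat.zero_le n

theorem exists_isTable {n : ℕ} (f : ℕ → ℕ → ℕ → ℕ) (hf : ∀ x a y, f x a y ≤ n) :
    ∃ l, IsTable n l ∧ ∀ x < n, ∀ a < n, ∀ y < n, keyAt l x a y = f x a y := by
  refine ⟨(List.range (Nat.pair n (Nat.pair n n))).map fun k =>
    f k.unpair.1 k.unpair.2.unpair.2 k.unpair.2.unpair.1, ⟨by simp, ?_⟩, ?_⟩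
  · intro e he
    obtain ⟨k, -, rfl⟩ := List.mem_map.1 he
    exact hf _ _ _
  · intro x hx a ha y hy
    have h1 : Nat.pair x (Nat.pair y a) < Nat.pair n (Nat.pair n n) :=
      (Nat.pair_lt_pair_left _ hx).trans (Nat.pair_lt_pair_right _
        ((Nat.pair_lt_pair_left _ hy).trans (Nat.pair_lt_pair_right _ ha)))
    unfold keyAt
    rw [List.getD_eq_getElem _ _ (by simpa using h1)]
    simp

/-- The initial state. -/
def startState (n N : ℕ) : ExpState := (N + 2, zeroTable n, zeroTable n)

/-- The last state. -/
def endState (n N : ℕ) : ExpState := (N + 1, zeroTable n, zeroTable n)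

/-- The states of the grammar. -/
structure IsState (n N : ℕ) (s : ExpState) : Prop where
  le : s.1 ≤ N + 2
  left : IsTable n s.2.1
  right : IsTable n s.2.2

/-- The nonterminal label of a state. -/
def stateLabel (s : ExpState) : NodeLabel := NodeLabel.other (Encodable.encode s)

theorem stateLabel_injective : Function.Injective stateLabel := by
  intro s s' h
  exact Encodable.encode_injective (NodeLabel.other.inj h)

namespace BangData

variable {H : BangData ℕ ℕ} {n N : ℕ}

/-- The moves of the grammar. -/
structure IsMove (H : BangData ℕ ℕ) (n N : ℕ) (m : ExpMove) : Prop where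
  length : m.1.2.length = n
  entry : ∀ e ∈ m.1.2, e ≤ 1
  src : IsState n N m.2.1
  tgt : IsState n N m.2.2
  opens : m.1.1 = true → H.OpenValid n N m.1.2 m.2.1 m.2.2
  -- Closing the last instance resets the tables, so that a single left-hand side, and thus a single
  -- final production, suffices.
  closes : m.1.1 = false → H.CloseValid n N m.2.1 m.2.2 ∧ (m.2.2.1 = N + 1 → m.2.2 = endState n N)

/-- The codes of the moves. -/
def moveCodes (H : BangData ℕ ℕ) (n N : ℕ) : Set ℕ := {k | ∃ m, H.IsMove n N m ∧ Encodable.encode m = k}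

/-- The production `p` performs the move `m`. -/
structure IsProdOf (H : BangData ℕ ℕ) (n N : ℕ) (m : ExpMove) (p : Production NodeLabel EdgeLabel) :
    Prop where
  lhs : p.lhs = stateLabel m.2.1
  opens : m.1.1 = true → ∃ slot, IsOpenRhs H n N (H.moveCodes n N) m.1.2 m.2.2 (Encodable.encode m)
    (stateLabel m.2.2) p.rhs slot
  closes : m.1.1 = false → IsCloseRhs n N (H.moveCodes n N) m.2.1 m.2.2 (stateLabel m.2.2) p.rhs

/-- The grammar explores the families of instances of `H`. -/
structure IsExploration (H : BangData ℕ ℕ) (n N : ℕ) (G : EdNCE NodeLabel EdgeLabel) : Prop where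
  terminals : G.terminals = {.N, .W}
  plain_mem : EdgeLabel.plain ∈ G.finals
  beta_mem : ∀ a < n, ∀ k < n, EdgeLabel.beta (Nat.pair a k) ∈ G.finals
  start : G.start = stateLabel (startState n N)
  sound : ∀ p ∈ G.prods, (p.size = 0 ∧ p.lhs = stateLabel (endState n N)) ∨
    ∃ m, H.IsMove n N m ∧ H.IsProdOf n N m p
  final : ∃ p ∈ G.prods, p.size = 0 ∧ p.lhs = stateLabel (endState n N)
  move : ∀ m, H.IsMove n N m → ∃ p ∈ G.prods, H.IsProdOf n N m p

variable {G : EdNCE NodeLabel EdgeLabel} {I : Type}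

/-- The graph `K` is a sentential form with a nonterminal node. -/
structure IsConfig (H : BangData ℕ ℕ) (n N : ℕ) (F : Amb ℕ I) (om : I → ℕ → Prop)
    (γ : I → ℕ → ℕ → ℕ → ℕ) (A Ω : Set I) (lev π : I → ℕ) (s : ExpState) {V : Type}
    (K : EGraph NodeLabel EdgeLabel V) : Prop where
  explores : H.Explores n N F om γ A Ω lev s
  iso : K.toLGraph.IsIso (sentential H F A om γ n lev π (stateLabel s))
  conn : ∀ σ β δ x d, ¬ K.conn σ β δ x d
  state : IsState n N s
  end_eq : s.1 = N + 1 → s = endState n N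
  code : ∀ j ∈ A, π j ∈ H.moveCodes n N

variable {F : Amb ℕ I} {om : I → ℕ → Prop} {γ : I → ℕ → ℕ → ℕ → ℕ} {A Ω : Set I}
  {lev lev' π π' : I → ℕ} {s s' : ExpState}

theorem isExplores_empty (hH : H.IsBounded n N) (F : Amb ℕ I) (om : I → ℕ → Prop)
    (γ : I → ℕ → ℕ → ℕ → ℕ) (lev : I → ℕ) :
    Explores H n N F om γ ∅ ∅ lev (startState n N) where
  finite := Set.finite_empty
  wf := by constructor <;> exact fun i hi => hi.elim
  dom i hi := hi.elim
  sub := subset_rfl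
  up i hi := hi.elim
  inj i hi := hi.elim
  cur b := by
    constructor
    · intro h
      exact absurd h (Explores.not_le_of_lt hH (by simp [startState]))
    · rintro ⟨i, hi, -⟩
      exact hi.elim
  level i hi := hi.elim
  level_le i hi := hi.elim
  top := .inl ⟨rfl, rfl⟩
  count i hi := hi.elim
  guess i hi := hi.elim
  full i hi := hi.elim

theorem isConfig_start (hH : H.IsBounded n N) (hG : H.IsExploration n N G) (F : Amb ℕ I)
    (om : I → ℕ → Prop) (γ : I → ℕ → ℕ → ℕ → ℕ) (lev π : I → ℕ) :
    IsConfig H n N F om γ ∅ ∅ lev π (startState n N)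
      (EGraph.starting NodeLabel EdgeLabel G.start) where
  explores := isExplores_empty hH F om γ lev
  iso := by
    refine isIso_of_bij (fun _ => ⟨none, fun q hq => by cases hq⟩) ⟨fun _ _ _ => rfl, ?_⟩ ?_ ?_
    · rintro ⟨_ | q, hq⟩
      · exact ⟨(), rfl⟩
      · exact (hq q rfl).1.elim
    · intro x l y
      exact Iff.rfl
    · intro x
      exact hG.start
  conn σ β δ x d h := h
  state := ⟨le_rfl, isTable_zeroTable n, isTable_zeroTable n⟩
  end_eq h := by simp [startState] at h
  code i hi := hi.elim

theorem subst_conn {V U : Type} {K : EGraph NodeLabel EdgeLabel V}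
    (hK : ∀ σ β δ x d, ¬ K.conn σ β δ x d) (v : V) (D : EGraph NodeLabel EdgeLabel U) :
    ∀ σ β δ x d, ¬ (K.subst v D).conn σ β δ x d := by
  rintro σ β δ (x | x) d h
  · exact hK _ _ _ _ _ h
  · obtain ⟨_, h, -⟩ := h
    exact hK _ _ _ _ _ h

theorem IsConfig.opened (hH : H.IsBounded n N) {V : Type} {K : EGraph NodeLabel EdgeLabel V}
    (hc : IsConfig H n N F om γ A Ω lev π s K) {v : V} (hv : K.label v = stateLabel s)
    {m : ExpMove} (hm : H.IsMove n N m) (hms : m.2.1 = s) (hmo : m.1.1 = true)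
    {p : Production NodeLabel EdgeLabel} (hp : H.IsProdOf n N m p) {i : I} (hi : i ∉ A)
    (hup : ∀ j, F.ile i j ↔ j = i ∨ j ∈ Ω) (hbox : F.box i = m.2.2.1)
    (hom : ∀ h, om i h ↔ m.1.2.getD h 0 = 1)
    (hγ : ∀ x < n, ∀ a < n, ∀ y < n, H.Owns m.2.2.1 x y → γ i x a y = keyAt m.2.2.2.1 x a y)
    (hlev : ∀ j ∈ A, lev' j = lev j) (hlev' : lev' i = m.2.2.1)
    (hπ : ∀ j ∈ A, π' j = π j) (hπ' : π' i = Encodable.encode m) :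
    IsConfig H n N F om γ (insert i A) (insert i Ω) lev' π' m.2.2 (K.subst v p.rhs) := by
  subst hms
  obtain ⟨e, he, hl⟩ := hc.iso
  have hev : (e v).1 = none := by
    rcases h : (e v).1 with _ | q
    · rfl
    · rw [hl] at hv
      simp only [sentential, h] at hv
      rcases hH.topped.string.label_mem q.1 with h' | h' <;> rw [Option.elim, h'] at hv <;> cases hv
  obtain ⟨slot, hslot⟩ := hp.opens hmo
  have hmv := hm.opens hmo
  refine ⟨hc.explores.opened hH hmv hi hup hbox hom hγ hlev hlev',
    subst_opened hH hc.explores hmv hi hup hbox hom hγ hlev hlev' hπ hπ' hc.code e he hl hev hslot,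
    subst_conn hc.conn _ _, hm.tgt, fun h => ?_, ?_⟩
  · have := hmv.cur_le
    omega
  · rintro j (rfl | hj)
    · exact ⟨m, hm, hπ'.symm⟩
    · rw [hπ j hj]
      exact hc.code j hj

theorem IsConfig.closed (hH : H.IsBounded n N) {V : Type} {K : EGraph NodeLabel EdgeLabel V}
    (hc : IsConfig H n N F om γ A Ω lev π s K) {v : V} (hv : K.label v = stateLabel s)
    {m : ExpMove} (hm : H.IsMove n N m) (hms : m.2.1 = s) (hmo : m.1.1 = false)
    {p : Production NodeLabel EdgeLabel} (hp : H.IsProdOf n N m p) {i : I} (hi : i ∈ Ω)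
    (hbox : F.box i = s.1) (hlev : ∀ j ∈ A, lev' j = if lev j = s.1 then m.2.2.1 else lev j) :
    IsConfig H n N F om γ A (Ω \ {i}) lev' π m.2.2 (K.subst v p.rhs) := by
  subst hms
  obtain ⟨e, he, hl⟩ := hc.iso
  have hev : (e v).1 = none := by
    rcases h : (e v).1 with _ | q
    · rfl
    · rw [hl] at hv
      simp only [sentential, h] at hv
      rcases hH.topped.string.label_mem q.1 with h' | h' <;> rw [Option.elim, h'] at hv <;> cases hv
  have hmv := hm.closes hmo
  exact ⟨hc.explores.closed hH hmv.1 hi hbox hlev,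
    subst_closed hc.explores hH hlev hc.code e he hl hev (hp.closes hmo),
    subst_conn hc.conn _ _, hm.tgt, hmv.2, hc.code⟩

theorem IsConfig.final (hH : H.IsBounded n N) {V : Type} {K : EGraph NodeLabel EdgeLabel V}
    (hc : IsConfig H n N F om γ A Ω lev π s K) {v : V} (hv : K.label v = stateLabel s)
    {p : Production NodeLabel EdgeLabel} (hp : p.size = 0) :
    (K.subst v p.rhs).toLGraph.IsIso (genGraph H F A om γ n) := by
  obtain ⟨e, he, hl⟩ := hc.iso
  have hev : (e v).1 = none := by
    rcases h : (e v).1 with _ | q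
    · rfl
    · rw [hl] at hv
      simp only [sentential, h] at hv
      rcases hH.topped.string.label_mem q.1 with h' | h' <;> rw [Option.elim, h'] at hv <;> cases hv
  have : IsEmpty (Fin p.size) := by rw [hp]; infer_instance
  exact subst_isEmpty e he hl hev p.rhs

theorem IsConfig.label_eq (hH : H.IsBounded n N) {V : Type} {K : EGraph NodeLabel EdgeLabel V}
    (hc : IsConfig H n N F om γ A Ω lev π s K) {v : V} {s' : ExpState}
    (hv : K.label v = stateLabel s') : s' = s := by
  obtain ⟨e, he, hl⟩ := hc.iso
  rw [hl] at hv
  rcases h : (e v).1 with _ | q <;> simp only [sentential, h] at hv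
  · exact (stateLabel_injective hv).symm
  · rcases hH.topped.string.label_mem q.1 with h' | h' <;> rw [Option.elim, h'] at hv <;> cases hv

/-! ### Soundness: derivations explore families of instances -/

/-- The selection of encoded links given by the moves that open the instances. -/
abbrev PathInst : Type := List (ExpMove × ℕ)

/-- The instances are the paths of moves that open instances. -/
def pathAmb (N : ℕ) : Amb ℕ PathInst where
  box i := i.head?.elim (N + 1) fun m => m.1.2.2.1
  ile i j := j ≠ [] ∧ j <:+ i

def pathOm (i : PathInst) (h : ℕ) : Prop := i.head?.elim False fun m => m.1.1.2.getD h 0 = 1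

/-- Outside the range of the tables there are no links, so the count is set to `0`. -/
def pathCount (n : ℕ) (i : PathInst) (x a y : ℕ) : ℕ :=
  if x < n ∧ a < n ∧ y < n then i.head?.elim 0 fun m => keyAt m.1.2.2.2.1 x a y else 0

def pathCode (i : PathInst) : ℕ := i.head?.elim 0 fun m => Encodable.encode m.1

/-- The sentential forms of the grammar. -/
theorem sentential_cases (hH : H.IsBounded n N) (hG : H.IsExploration n N G) {V : Type}
    {K : EGraph NodeLabel EdgeLabel V} (hK : G.Sentential K) :
    ∃ A : Set PathInst, (∀ i ∈ A, ∃ m k i', i = (m, k) :: i' ∧ H.IsMove n N m) ∧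
    ((∃ (o : PathInst) (lev : PathInst → ℕ) (s : ExpState),
      IsConfig H n N (pathAmb N) pathOm (pathCount n) A {j | j ≠ [] ∧ j <:+ o} lev pathCode s K) ∨
    (A.Finite ∧ (pathAmb N).WF H.le A ∧ (∀ i ∈ A, H.le ((pathAmb N).box i) N) ∧
      (∃ τ ∈ A, (pathAmb N).box τ = N ∧ ∀ i ∈ A, (pathAmb N).ile i τ) ∧
      IsConsistent H (pathAmb N) A pathOm (pathCount n) n ∧
      (∀ σ β δ x d, ¬ K.conn σ β δ x d) ∧
      K.toLGraph.IsIso (genGraph H (pathAmb N) A pathOm (pathCount n) n))) := by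
  induction hK with
  | start =>
    refine ⟨∅, fun i hi => hi.elim, .inl ⟨[], fun _ => 0, startState n N, ?_⟩⟩
    have : {j : PathInst | j ≠ [] ∧ j <:+ []} = ∅ := by
      ext j
      simp
    rw [this]
    exact isConfig_start hH hG _ _ _ _ _
  | @step V K v p hp hv hK ih =>
    obtain ⟨A, hA, ⟨o, lev, s, hc⟩ | ⟨-, -, -, -, -, -, hiso⟩⟩ := ih
    swap
    · exfalso
      -- After the final production no nonterminal node is left, so no further step is possible.
      obtain ⟨e, he, hl⟩ := hiso
      have h1 := hG.sound p hp
      have h2 : ∃ s, p.lhs = stateLabel s := by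
        rcases h1 with ⟨-, h⟩ | ⟨m, -, h⟩
        · exact ⟨_, h⟩
        · exact ⟨_, h.lhs⟩
      obtain ⟨s, hs⟩ := h2
      rw [hs, hl] at hv
      simp only [genGraph] at hv
      rcases hH.topped.string.label_mem (e v).1.1 with h' | h' <;> rw [h'] at hv <;> cases hv
    have he := hc.explores
    rcases hG.sound p hp with ⟨hp0, hps⟩ | ⟨m, hm, hpm⟩
    · rw [hps] at hv
      have hs := hc.label_eq hH hv
      subst hs
      have htop := he.top.resolve_left (by simp [endState])
      refine ⟨A, hA, .inr ⟨he.finite, he.wf, he.dom, htop.2, ?_, subst_conn hc.conn _ _,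
        hc.final hH hv hp0⟩⟩
      refine he.isConsistent hH (by simp [endState]) ?_ ?_
      · intro i hi x a y
        obtain ⟨m, k, i', rfl, hm⟩ := hA i hi
        unfold pathCount
        split_ifs
        · exact hm.tgt.left.keyAt_le _ _ _
        · exact Nat.zero_le n
      · intro i hi x a y hk
        exact if_neg hk
    · rw [hpm.lhs] at hv
      have hs := hc.label_eq hH hv
      rw [hs] at hv
      rcases hmo : m.1.1 with _ | _
      · have hmv := (hm.closes hmo).1
        rw [hs] at hmv
        have hsN := (hH.box_iff _).2 hmv.src_le
        have hss := hH.topped.le_refl _ hsN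
        obtain ⟨i, ⟨hi0, hio⟩, his⟩ := (he.cur _).1 hss
        rcases o with _ | ⟨q, o⟩
        · exact absurd (List.suffix_nil.1 hio) hi0
        · have hoΩ : (q :: o) ∈ {j : PathInst | j ≠ [] ∧ j <:+ q :: o} :=
            ⟨by simp, List.suffix_rfl⟩
          -- The whole stack is the innermost open instance; closing it removes the last entry.
          have hob : (pathAmb N).box (q :: o) = s.1 := by
            refine hH.topped.le_antisymm _ _ ?_ ((he.cur _).2 ⟨_, hoΩ, rfl⟩)
            rw [← his]
            exact he.wf.mono _ (he.sub hoΩ) i ⟨hi0, hio⟩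
          have hΩ : {j : PathInst | j ≠ [] ∧ j <:+ q :: o} \ {q :: o} =
              {j : PathInst | j ≠ [] ∧ j <:+ o} := by
            ext j
            simp only [Set.mem_sdiff, Set.mem_ofPred_eq, Set.mem_singleton_iff, List.suffix_cons_iff]
            constructor
            · rintro ⟨⟨h1, h2⟩, h3⟩
              exact ⟨h1, h2.resolve_left h3⟩
            · rintro ⟨h1, h2⟩
              refine ⟨⟨h1, .inr h2⟩, ?_⟩
              rintro rfl
              have := h2.length_le
              simp at this
          have := hc.closed hH hv hm hs hmo hpm hoΩ hob
            (lev' := fun j => if lev j = s.1 then m.2.2.1 else lev j) (fun _ _ => rfl)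
          rw [hΩ] at this
          exact ⟨A, hA, .inl ⟨o, _, _, this⟩⟩
      -- An unused number distinguishes the new instance from those opened earlier by the same move
      -- under the same parent.
      · obtain ⟨k, hk⟩ : ∃ k : ℕ, ((m, k) :: o) ∉ A := by
          by_contra hall
          push Not at hall
          refine Set.infinite_of_injective_forall_mem (f := fun k : ℕ => (m, k) :: o) ?_ hall
            he.finite
          intro k k' h
          simpa using h
        classical
        have := hc.opened hH hv hm hs hmo hpm hk (π' := pathCode)
          (lev' := fun j => if j = (m, k) :: o then m.2.2.1 else lev j) ?_ rfl (fun h => Iff.rfl)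
          ?_ ?_ (if_pos rfl) (fun _ _ => rfl) rfl
        · have hΩ : insert ((m, k) :: o) {j : PathInst | j ≠ [] ∧ j <:+ o} =
              {j : PathInst | j ≠ [] ∧ j <:+ (m, k) :: o} := by
            ext j
            simp only [Set.mem_insert_iff, Set.mem_ofPred_eq, List.suffix_cons_iff]
            constructor
            · rintro (rfl | ⟨h1, h2⟩)
              · exact ⟨by simp, .inl rfl⟩
              · exact ⟨h1, .inr h2⟩
            · rintro ⟨h1, rfl | h2⟩
              · exact .inl rfl
              · exact .inr ⟨h1, h2⟩
          rw [hΩ] at this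
          refine ⟨_, ?_, .inl ⟨_, _, _, this⟩⟩
          rintro j (rfl | hj)
          · exact ⟨m, k, o, rfl, hm⟩
          · exact hA j hj
        · intro j
          simp only [pathAmb, Set.mem_ofPred_eq, List.suffix_cons_iff]
          constructor
          · rintro ⟨h1, rfl | h2⟩
            · exact .inl rfl
            · exact .inr ⟨h1, h2⟩
          · rintro (rfl | ⟨h1, h2⟩)
            · exact ⟨by simp, .inl rfl⟩
            · exact ⟨h1, .inr h2⟩
        · intro x hx a ha y hy _
          exact if_pos ⟨hx, ha, hy⟩
        · intro j hj
          refine if_neg ?_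
          rintro rfl
          exact hk hj

end BangData

/-! ### Completeness: every family of instances is derived -/

namespace BangData
variable {H : BangData ℕ ℕ} {n N : ℕ} {G : EdNCE NodeLabel EdgeLabel} {I : Type}
  {F : Amb ℕ I} {om : I → ℕ → Prop} {γ : I → ℕ → ℕ → ℕ → ℕ} {A Ω : Set I}
  {lev lev' π π' : I → ℕ} {s s' : ExpState}

/-- Open instances have distinct !-boxes and a pair of vertices has at most one owner, so one table
indexed by triples serves all open instances at once. -/
theorem exists_table (hH : H.IsBounded n N) (hinj : ∀ i ∈ Ω, ∀ j ∈ Ω, F.box i = F.box j → i = j)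
    (hdom : ∀ i ∈ Ω, H.le (F.box i) N) (f : I → ℕ → ℕ → ℕ → ℕ) (hf : ∀ i x a y, f i x a y ≤ n) :
    ∃ l, IsTable n l ∧ ∀ i ∈ Ω, ∀ x < n, ∀ a < n, ∀ y < n, H.Owns (F.box i) x y →
      keyAt l x a y = f i x a y := by
  classical
  obtain ⟨l, hl, hl'⟩ := exists_isTable (n := n) (fun x a y =>
    if h : ∃ i ∈ Ω, H.Owns (F.box i) x y then f h.choose x a y else 0) (by
      intro x a y
      split_ifs
      · exact hf _ _ _ _
      · exact Nat.zero_le n)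
  refine ⟨l, hl, fun i hi x hx a ha y hy ho => ?_⟩
  have h : ∃ i ∈ Ω, H.Owns (F.box i) x y := ⟨i, hi, ho⟩
  rw [hl' x hx a ha y hy, dif_pos h]
  have hs := h.choose_spec
  rw [hinj _ hs.1 i hi (hs.2.unique hH ho (hdom _ hs.1) (hdom i hi))]

/-- The hypotheses on a family of instances for the existence of a derivation. -/
structure IsTarget (H : BangData ℕ ℕ) (n N : ℕ) (F : Amb ℕ I) (om : I → ℕ → Prop)
    (γ : I → ℕ → ℕ → ℕ → ℕ) : Prop where
  finite : Finite I
  wf : F.WF H.le Set.univ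
  top : ∃ τ, F.box τ = N ∧ ∀ i, F.ile i τ
  chain : ∀ i j k, F.ile i j → F.ile i k → F.ile j k ∨ F.ile k j
  consistent : IsConsistent H F Set.univ om γ n
  om_lt : ∀ i h, om i h → h < n
  count_le : ∀ i x a y, γ i x a y ≤ n

namespace IsTarget

theorem dom (hH : H.IsBounded n N) (hF : IsTarget H n N F om γ) (i : I) : H.le (F.box i) N := by
  obtain ⟨τ, hτ, hall⟩ := hF.top
  rw [← hτ]
  exact hF.wf.mono i trivial τ (hall i)

theorem antisymm (hH : H.IsBounded n N) (hF : IsTarget H n N F om γ) {i j : I} (h : F.ile i j)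
    (h' : F.ile j i) : i = j :=
  hF.wf.antisymm hH.topped.le_antisymm trivial h h'

theorem ncard_le (hH : H.IsBounded n N) (hF : IsTarget H n N F om γ) (B : Set I) {i : I}
    {x a y : ℕ} (ho : H.Owns (F.box i) x y) :
    H.tightCount x a y + Set.ncard {q | q ∈ looseSet H F B i x a y ∧ om q.2 q.1} ≤ γ i x a y := by
  have := hF.finite
  rw [hF.consistent.count i trivial x a y ho]
  refine Nat.add_le_add_left (Set.ncard_le_ncard ?_ ?_) _
  · rintro q ⟨hq, h⟩
    exact ⟨⟨trivial, hq.2⟩, h⟩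
  · exact (finite_looseSet hH.topped Set.finite_univ i x a y).subset fun q hq => hq.1

/-- An instance can be opened if the instances containing it are those that are open. -/
theorem exists_open (hH : H.IsBounded n N) (hF : IsTarget H n N F om γ)
    (h : Explores H n N F om γ A Ω lev s) (hs : IsState n N s) (hne : s.1 ≠ N + 1) {i : I}
    (hi : i ∉ A) (hup : ∀ j, F.ile i j ↔ j = i ∨ j ∈ Ω) :
    ∃ m, H.IsMove n N m ∧ m.2.1 = s ∧ m.1.1 = true ∧ m.2.2.1 = F.box i ∧
      (∀ h, om i h ↔ m.1.2.getD h 0 = 1) ∧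
      ∀ x < n, ∀ a < n, ∀ y < n, H.Owns (F.box i) x y → γ i x a y = keyAt m.2.2.2.1 x a y := by
  classical
  have hcur : ∀ b, H.le (F.box i) b ↔ b = F.box i ∨ H.le s.1 b := by
    intro b
    rw [h.cur]
    constructor
    · intro hb
      obtain ⟨j, hj, rfl⟩ := hF.wf.lift i trivial b hb
      rcases (hup j).1 hj with rfl | hj
      · exact .inl rfl
      · exact .inr ⟨j, hj, rfl⟩
    · rintro (rfl | ⟨j, hj, rfl⟩)
      · exact hH.topped.le_refl _ (hF.dom hH i)
      · exact hF.wf.mono i trivial j ((hup j).2 (.inr hj))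
  have hnew : ¬ H.le s.1 (F.box i) := by
    intro hle
    obtain ⟨j, hj, hji⟩ := (h.cur _).1 hle
    have := hF.wf.inj i trivial i j ((hup i).2 (.inl rfl)) ((hup j).2 (.inr hj)) hji.symm
    subst this
    exact hi (h.sub hj)
  have hinj : ∀ j ∈ insert i Ω, ∀ k ∈ insert i Ω, F.box j = F.box k → j = k :=
    fun j hj k hk => hF.wf.inj i trivial j k ((hup j).2 hj) ((hup k).2 hk)
  -- The guesses are the true counts of the target.
  obtain ⟨g, hg, hgv⟩ := exists_table hH hinj (fun j _ => hF.dom hH j) γ hF.count_le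
  -- The remaining numbers are what is left of these counts after the tight links and the links
  -- selected so far, including by `i`.
  obtain ⟨r, hr, hrv⟩ := exists_table hH hinj (fun j _ => hF.dom hH j)
    (fun j x a y => γ j x a y - (H.tightCount x a y +
      Set.ncard {q | q ∈ looseSet H F (insert i A) j x a y ∧ om q.2 q.1}))
    (fun j x a y => (Nat.sub_le _ _).trans (hF.count_le j x a y))
  let l : List ℕ := (List.range n).map fun h => if om i h then 1 else 0
  have hl : ∀ h, om i h ↔ l.getD h 0 = 1 := by
    intro h
    rcases Nat.lt_or_ge h n with hh | hh
    · simp only [l]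
      rw [List.getD_eq_getElem _ _ (by simpa using hh)]
      simp
    · rw [List.getD_eq_default _ _ (by simpa [l] using hh)]
      constructor
      · intro h'
        have := hF.om_lt i h h'
        omega
      · intro h'
        simp at h'
  refine ⟨((true, l), s, (F.box i, g, r)), ⟨by simp [l], ?_, hs, ⟨?_, hg, hr⟩, fun _ => ?_,
    fun h => by cases h⟩, rfl, rfl, rfl, hl, ?_⟩
  · intro e he
    obtain ⟨h, -, rfl⟩ := List.mem_map.1 he
    split_ifs <;> omega
  · exact ((hH.box_iff _).1 (hF.dom hH i)).trans (by omega)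
  · refine ⟨hne, (hH.box_iff _).1 (hF.dom hH i), hcur, hnew, ?_, ?_⟩
    · intro x hx a ha y hy ho
      simp only at ho ⊢
      rw [hgv i (.inl rfl) x hx a ha y hy ho, hrv i (.inl rfl) x hx a ha y hy ho]
      have := hF.ncard_le hH (insert i A) (a := a) ho
      have h0 := ncard_looseSet_insert_self (F := F) (x := x) (a := a) (y := y) hH hi h.wf ho
      rw [h0] at this ⊢
      simp only [Set.mem_empty_iff_false, false_and, Set.ofPred_false, Set.ncard_empty] at this ⊢
      omega
    · intro b hb x hx a ha y hy ho
      obtain ⟨j, hj, rfl⟩ := (h.cur b).1 hb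
      simp only
      obtain ⟨ρ, hρ, -, hc⟩ := h.count j (h.sub hj) x hx a ha y hy ho
      have hins := ncard_looseSet_insert hH h.finite hi ((hup j).2 (.inr hj)) hl x a y
      have hle := hF.ncard_le hH (insert i A) (a := a) ho
      rw [hgv j (.inr hj) x hx a ha y hy ho, hrv j (.inr hj) x hx a ha y hy ho,
        ← h.guess j hj x hx a ha y hy ho]
      refine ⟨rfl, ?_, ?_⟩
      · rw [← hρ hj]
        omega
      · intro h' hlink ht hleast hno
        exact hF.consistent.full j trivial x a y ho (h', i)
          ⟨trivial, (hup j).2 (.inr hj), hlink, ht, hleast⟩ fun ho' => hno ((hl _).1 ho')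
  · intro x hx a ha y hy ho
    exact (hgv i (.inl rfl) x hx a ha y hy ho).symm

/-- The current instance can be closed if the instances nested in it have been opened. -/
theorem exists_close (hH : H.IsBounded n N) (hF : IsTarget H n N F om γ)
    (h : Explores H n N F om γ A Ω lev s) (hs : IsState n N s) {o : I} (ho : o ∈ Ω)
    (hbox : F.box o = s.1) (hΩ : ∀ j, j ∈ Ω ↔ F.ile o j) (hdone : ∀ j, F.ile j o → j ∈ A) :
    ∃ m, H.IsMove n N m ∧ m.2.1 = s ∧ m.1.1 = false := by
  have hle : ∀ j ∈ Ω, H.le s.1 (F.box j) := fun j hj => (h.cur _).2 ⟨j, hj, rfl⟩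
  -- Everything nested in `o` has been opened, so its selected links have all been met.
  have hown : ∀ x < n, ∀ a < n, ∀ y < n, H.Owns s.1 x y → keyAt s.2.2 x a y = 0 := by
    intro x hx a ha y hy how
    rw [← hbox] at how
    obtain ⟨r, hr, -, hc⟩ := h.count o (h.sub ho) x hx a ha y hy how
    have hfin := hF.consistent.count o trivial x a y how
    have : looseSet H F A o x a y = looseSet H F Set.univ o x a y := by
      ext q
      constructor
      · exact fun hq => ⟨trivial, hq.2⟩
      · exact fun hq => ⟨hdone _ hq.2.1, hq.2⟩
    rw [this] at hc
    have := hr ho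
    omega
  have hsN : s.1 ≤ N := (hH.box_iff _).1 (hbox ▸ hF.dom hH o)
  -- The next current !-box is that of the parent: among the other open instances, which form a
  -- chain, the one with the fewest instances nested in it. If there is none, the exploration ends
  -- with `N + 1`.
  have hor : ∃ p, (p = N + 1 ∨ p ≤ N) ∧ ∀ b, H.le p b ↔ H.le s.1 b ∧ b ≠ s.1 := by
    by_cases hp : ∃ j ∈ Ω, j ≠ o
    · have := hF.finite
      obtain ⟨j, ⟨hj, hjo⟩, hmin⟩ := Set.exists_min_image {j | j ∈ Ω ∧ j ≠ o}
        (fun j => Set.ncard {k | F.ile k j}) (Set.toFinite _) hp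
      refine ⟨F.box j, .inr ((hH.box_iff _).1 (hF.dom hH j)), fun b => ?_⟩
      constructor
      · intro hb
        refine ⟨hH.topped.le_trans _ _ _ (hle j hj) hb, ?_⟩
        rintro rfl
        refine hjo (h.inj j hj o ho ?_)
        rw [hbox]
        exact hH.topped.le_antisymm _ _ hb (hle j hj)
      · rintro ⟨hb, hbs⟩
        obtain ⟨k, hk, rfl⟩ := (h.cur b).1 hb
        refine hF.wf.mono j trivial k ?_
        rcases hF.chain o j k ((hΩ j).1 hj) ((hΩ k).1 hk) with h' | h'
        · exact h'
        · have hko : k ≠ o := by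
            rintro rfl
            exact hbs hbox
          have hsub : {l | F.ile l k} ⊆ {l | F.ile l j} :=
            fun l hl => hF.wf.trans l trivial k j hl h'
          have heq := Set.eq_of_subset_of_ncard_le hsub (hmin k ⟨hk, hko⟩) (Set.toFinite _)
          have : j ∈ {l | F.ile l k} := by
            rw [heq]
            exact hF.wf.refl j trivial
          exact this
    · refine ⟨N + 1, .inl rfl, fun b => ?_⟩
      constructor
      · intro hb
        exact absurd hb (Explores.not_le_of_lt hH (by omega))
      · rintro ⟨hb, hbs⟩
        obtain ⟨k, hk, rfl⟩ := (h.cur b).1 hb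
        refine absurd ⟨k, hk, ?_⟩ hp
        rintro rfl
        exact hbs hbox
  obtain ⟨p, hpN | hpN, hp⟩ := hor
  · subst hpN
    refine ⟨((false, List.replicate n 0), s, endState n N), ⟨by simp, ?_, hs,
      ⟨by simp [endState], isTable_zeroTable n, isTable_zeroTable n⟩, (fun h => by cases h),
      fun _ => ⟨⟨hsN, by simp [endState], hp, hown, ?_⟩, fun _ => rfl⟩⟩, rfl, rfl⟩
    · intro e he
      simp only [List.mem_replicate] at he
      omega
    · intro b hb
      exact absurd hb (Explores.not_le_of_lt hH (by simp [endState]))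
  · refine ⟨((false, List.replicate n 0), s, (p, s.2)), ⟨by simp, ?_, hs,
      ⟨by simp only; omega, hs.left, hs.right⟩, (fun h => by cases h),
      fun _ => ⟨⟨hsN, by simp only; omega, hp, hown, fun b hb x hx a ha y hy ho => ⟨rfl, rfl⟩⟩,
        fun h' => ?_⟩⟩, rfl, rfl⟩
    · intro e he
      simp only [List.mem_replicate] at he
      omega
    · simp only at h'
      omega

/-- The family of instances is generated by the grammar. -/
theorem exists_derivation (hH : H.IsBounded n N) (hG : H.IsExploration n N G)
    (hF : IsTarget H n N F om γ) (d : ℕ) : ∀ {A Ω : Set I} {lev π : I → ℕ} {s : ExpState}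
    {V : Type} {K : EGraph NodeLabel EdgeLabel V}, G.Sentential K →
    IsConfig H n N F om γ A Ω lev π s K →
    (∀ i ∈ A, ∀ j, F.ile j i → i ∉ Ω → j ∈ A) →
    (Ω = ∅ ∧ A = ∅ ∧ s.1 = N + 2 ∨ Ω = ∅ ∧ A = Set.univ ∧ s.1 = N + 1 ∨
      ∃ o ∈ Ω, F.box o = s.1 ∧ ∀ j, j ∈ Ω ↔ F.ile o j) →
    2 * Set.ncard Aᶜ + Set.ncard Ω = d →
    ∃ (V : Type) (K : EGraph NodeLabel EdgeLabel V), G.Sentential K ∧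
      (∀ σ β δ x d, ¬ K.conn σ β δ x d) ∧ K.toLGraph.IsIso (genGraph H F Set.univ om γ n) := by
  have := hF.finite
  -- Opening lowers the number of unopened instances by one and raises that of the open ones by one;
  -- closing lowers the latter. Weight `2` on unopened instances makes both decrease the measure.
  induction d using Nat.strong_induction_on with
  | _ d ih =>
  intro A Ω lev π s V K hK hc hdone hcase hd
  have he := hc.explores
  obtain ⟨v, hv⟩ : ∃ v, K.label v = stateLabel s := by
    obtain ⟨e, -, hl⟩ := hc.iso
    refine ⟨e.symm ⟨none, fun q hq => by cases hq⟩, ?_⟩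
    rw [hl, Equiv.apply_symm_apply]
    rfl
  have hopen : ∀ i, i ∉ A → (∀ j, F.ile i j ↔ j = i ∨ j ∈ Ω) → s.1 ≠ N + 1 →
      ∃ (V : Type) (K : EGraph NodeLabel EdgeLabel V), G.Sentential K ∧
      (∀ σ β δ x d, ¬ K.conn σ β δ x d) ∧ K.toLGraph.IsIso (genGraph H F Set.univ om γ n) := by
    classical
    intro i hi hup hne
    obtain ⟨m, hm, hms, hmo, hbox, hom, hγ⟩ := hF.exists_open hH he hc.state hne hi hup
    obtain ⟨p, hp, hpm⟩ := hG.move m hm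
    have hv' : K.label v = p.lhs := by rw [hv, hpm.lhs, hms]
    have hne' : ∀ j ∈ A, j ≠ i := by
      rintro j hj rfl
      exact hi hj
    have hc' := hc.opened hH hv hm hms hmo hpm hi hup hbox.symm hom (by rwa [hbox])
      (lev' := fun j => if j = i then m.2.2.1 else lev j)
      (π' := fun j => if j = i then Encodable.encode m else π j)
      (fun j hj => if_neg (hne' j hj)) (if_pos rfl)
      (fun j hj => if_neg (hne' j hj)) (if_pos rfl)
    have hiΩ : i ∉ Ω := fun h => hi (he.sub h)
    refine ih _ ?_ (hK.step v p hp hv') hc' ?_ (.inr (.inr ⟨i, .inl rfl, hbox.symm, ?_⟩)) rfl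
    · have h1 : Aᶜ = insert i (insert i A)ᶜ := by
        ext j
        simp only [Set.mem_compl_iff, Set.mem_insert_iff]
        by_cases hj : j = i
        · simp [hj, hi]
        · simp [hj]
      have h2 : Set.ncard Aᶜ = Set.ncard (insert i A)ᶜ + 1 := by
        rw [h1, Set.ncard_insert_of_notMem (by simp) (Set.toFinite _)]
      have h3 := Set.ncard_insert_of_notMem hiΩ (Set.toFinite _)
      omega
    · rintro j (rfl | hj) k hk hjΩ
      · exact absurd (.inl rfl) hjΩ
      · exact .inr (hdone j hj k hk fun h => hjΩ (.inr h))
    · intro j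
      exact (hup j).symm
  rcases hcase with ⟨rfl, rfl, hs⟩ | ⟨rfl, rfl, hs⟩ | ⟨o, ho, hbox, hΩ⟩
  · obtain ⟨τ, hτ, hall⟩ := hF.top
    refine hopen τ (fun h => h) ?_ (by omega)
    intro j
    constructor
    · intro hj
      exact .inl (hF.antisymm hH (hall j) hj)
    · rintro (rfl | h)
      · exact hF.wf.refl j trivial
      · exact h.elim
  · have hs' := hc.end_eq hs
    subst hs'
    obtain ⟨p, hp, hp0, hpl⟩ := hG.final
    exact ⟨_, _, hK.step v p hp (hv.trans hpl.symm), subst_conn hc.conn _ _, hc.final hH hv hp0⟩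
  · have hsN : s.1 ≤ N := (hH.box_iff _).1 (hbox ▸ hF.dom hH o)
    by_cases hex : ∃ i, i ∉ A ∧ F.ile i o
    -- Among the unopened instances nested in `o`, one with the most instances nested in it has only
    -- open proper ancestors: an unopened one between it and `o` would contradict maximality, and a
    -- closed one would have had all its nested instances opened.
    · obtain ⟨i, ⟨hi, hio⟩, hmax⟩ := Set.exists_max_image {i | i ∉ A ∧ F.ile i o}
        (fun i => Set.ncard {k | F.ile k i}) (Set.toFinite _) hex
      refine hopen i hi (fun j => ⟨fun hij => ?_, ?_⟩) (by omega)
      · by_contra hno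
        rw [not_or, hΩ] at hno
        have hjo : F.ile j o := (hF.chain i j o hij hio).resolve_right hno.2
        by_cases hjA : j ∈ A
        · refine hi (hdone j hjA i hij fun hj => hno.2 ((hΩ j).1 hj))
        · have hsub : {k | F.ile k i} ⊆ {k | F.ile k j} :=
            fun k hk => hF.wf.trans k trivial i j hk hij
          have heq := Set.eq_of_subset_of_ncard_le hsub (hmax j ⟨hjA, hjo⟩) (Set.toFinite _)
          have : j ∈ {k | F.ile k i} := by
            rw [heq]
            exact hF.wf.refl j trivial
          exact hno.1 (hF.antisymm hH this hij)
      · rintro (rfl | hj)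
        · exact hF.wf.refl j trivial
        · exact hF.wf.trans i trivial o j hio ((hΩ j).1 hj)
    · push Not at hex
      have hall : ∀ j, F.ile j o → j ∈ A := fun j hj => by
        by_contra hjA
        exact hex j hjA hj
      obtain ⟨m, hm, hms, hmo⟩ := hF.exists_close hH he hc.state ho hbox hΩ hall
      obtain ⟨p, hp, hpm⟩ := hG.move m hm
      have hv' : K.label v = p.lhs := by rw [hv, hpm.lhs, hms]
      have hc' := hc.closed hH hv hm hms hmo hpm ho hbox
        (lev' := fun j => if lev j = s.1 then m.2.2.1 else lev j) (fun _ _ => rfl)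
      have he' := hc'.explores
      refine ih _ ?_ (hK.step v p hp hv') hc' ?_ ?_ rfl
      · have := Set.ncard_sdiff_singleton_lt_of_mem ho (Set.toFinite _)
        omega
      · intro i hi j hji hiΩ
        by_cases hio : i = o
        · subst hio
          exact hall j hji
        · exact hdone i hi j hji fun h => hiΩ ⟨h, hio⟩
      · have hcl := (hm.closes hmo).1
        right
        rcases Nat.lt_or_ge N m.2.2.1 with hlt | hle
        · left
          have hemp : Ω \ {o} = ∅ := by
            rw [Set.eq_empty_iff_forall_notMem]
            intro j hj
            exact Explores.not_le_of_lt hH hlt ((he'.cur _).2 ⟨j, hj, rfl⟩)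
          refine ⟨hemp, ?_, ?_⟩
          · obtain ⟨τ, -, hτ⟩ := hF.top
            have hτo : τ = o := by
              by_contra hne
              have : τ ∈ Ω \ {o} := ⟨(hΩ τ).2 (hτ o), hne⟩
              rw [hemp] at this
              exact this
            rw [Set.eq_univ_iff_forall]
            exact fun j => hall j (hτo ▸ hτ j)
          · have := hcl.tgt_le
            omega
        · right
          have hmm := hH.topped.le_refl _ ((hH.box_iff _).2 hle)
          obtain ⟨p', hp', hpb⟩ := (he'.cur _).1 hmm
          refine ⟨p', hp', hpb, fun j => ⟨fun hj => ?_, fun hj => he'.up p' hp' j hj⟩⟩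
          obtain ⟨k, hk, hkj⟩ := hF.wf.lift p' trivial (F.box j)
            (hpb ▸ (he'.cur _).2 ⟨j, hj, rfl⟩)
          rw [← he'.inj k (he'.up p' hp' k hk) j hj hkj]
          exact hk

theorem exists_sentential (hH : H.IsBounded n N) (hG : H.IsExploration n N G)
    (hF : IsTarget H n N F om γ) :
    ∃ (V : Type) (K : EGraph NodeLabel EdgeLabel V), G.Sentential K ∧
      (∀ σ β δ x d, ¬ K.conn σ β δ x d) ∧ K.toLGraph.IsIso (genGraph H F Set.univ om γ n) :=
  exists_derivation hH hG hF _ .start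
    (isConfig_start hH hG F om γ (fun _ => 0) (fun _ => 0)) (fun i hi => hi.elim)
    (.inl ⟨rfl, rfl, rfl⟩) rfl

end IsTarget

end BangData

/-! ### Adding an outermost !-box to a described !-graph -/

theorem LGraph.exists_run_of_isChain {V : Type} {D : LGraph NodeLabel EdgeLabel V} {h y : V}
    (ws : List V) : ∀ {u : V} {p : ℕ}, D.Run h p u →
    List.IsChain (fun u v => D.edge u EdgeLabel.plain v) (u :: (ws ++ [y])) →
    (∀ w ∈ ws, D.label w = .W) →
    (∃ a z, D.Run h a z ∧ D.edge z EdgeLabel.plain y) ∧ ∀ w ∈ ws, ∃ q, D.Run h q w := by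
  induction ws with
  | nil =>
    intro u p r hc _
    simp only [List.nil_append, List.isChain_cons_cons] at hc
    exact ⟨⟨p, u, r, hc.1⟩, fun w hw => by simp at hw⟩
  | cons v ws ih =>
    intro u p r hc hw
    simp only [List.cons_append, List.isChain_cons_cons] at hc
    have r' := LGraph.Run.succ r hc.1 (hw v (by simp))
    obtain ⟨h1, h2⟩ := ih r' hc.2 fun w h => hw w (by simp [h])
    refine ⟨h1, fun w h => ?_⟩
    rcases List.mem_cons.1 h with rfl | h
    · exact ⟨_, r'⟩
    · exact h2 w h

/-- Passes from the closed wires in the definition of trivial overlap to links and positions on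
them. -/
theorem LGraph.IsClosedWire.exists_link {V : Type} {D : LGraph NodeLabel EdgeLabel V} {x y w : V}
    {ws : List V} (hc : D.IsClosedWire x ws y) (hx : D.label x = .N) (hy : D.label y = .N)
    (hxy : x ≠ y) (hw : w ∈ ws) : ∃ h a p, D.IsLink x h a y ∧ D.Run h p w := by
  rcases ws with _ | ⟨h, ws⟩
  · simp at hw
  · have hch := hc.2.2.2.2
    simp only [List.cons_append, List.isChain_cons_cons] at hch
    have r : D.Run h 0 h := .zero (hc.2.2.1 h (by simp))
    obtain ⟨⟨a, z, hz, e⟩, h2⟩ := exists_run_of_isChain ws r hch.2 fun w h =>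
      hc.2.2.1 w (by simp [h])
    have hl : D.IsLink x h a y := ⟨hx, hy, hxy, hch.1, z, hz, e⟩
    rcases List.mem_cons.1 hw with rfl | hw
    · exact ⟨_, a, 0, hl, r⟩
    · obtain ⟨q, hq⟩ := h2 w hw
      exact ⟨h, a, q, hl, hq⟩

namespace BangCode

/-- Whether there is an edge from `u` to `v`. -/
def edgeB (c : BangCode) (u v : ℕ) : Bool :=
  decide (u < c.labels.length) && (decide (v < c.labels.length) && (!decide (u = v) &&
    c.edges.any fun e => decide (e = (u, v))))

/-- The nesting relation, with an additional outermost !-box. -/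
def leB (c : BangCode) (a b : ℕ) : Bool :=
  decide (a ≤ c.boxes) && (decide (b = c.boxes) || (decide (a < c.boxes) &&
    (decide (b < c.boxes) && c.nested.any fun e => decide (e = (a, b)))))

/-- Whether `v` is in the !-box `b`. -/
def insideB (c : BangCode) (b v : ℕ) : Bool :=
  decide (v < c.labels.length) && (decide (b = c.boxes) || (decide (b < c.boxes) &&
    c.inside.any fun e => decide (e = (b, v))))

/-- The label of `v`. -/
def labelAt (c : BangCode) (v : ℕ) : NodeLabel := c.labels.getD v .W

/-- The described !-graph with an additional outermost !-box. -/
def topped (c : BangCode) : BangData ℕ ℕ where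
  graph :=
    { edge := fun u γ v => γ = .plain ∧ c.edgeB u v = true
      irrefl := fun u γ h => by simp [edgeB] at h
      label := c.labelAt }
  le a b := c.leB a b = true
  content b := {v | c.insideB b v = true}

theorem edgeB_iff (c : BangCode) (u v : ℕ) : c.edgeB u v = true ↔
    u < c.labels.length ∧ v < c.labels.length ∧ u ≠ v ∧ (u, v) ∈ c.edges := by
  simp [edgeB]

theorem leB_iff (c : BangCode) (a b : ℕ) : c.leB a b = true ↔
    a ≤ c.boxes ∧ (b = c.boxes ∨ a < c.boxes ∧ b < c.boxes ∧ (a, b) ∈ c.nested) := by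
  simp [leB]

theorem insideB_iff (c : BangCode) (b v : ℕ) : c.insideB b v = true ↔
    v < c.labels.length ∧ (b = c.boxes ∨ b < c.boxes ∧ (b, v) ∈ c.inside) := by
  simp [insideB]

end BangCode

namespace BangData

variable {V B : Type} {H : BangData V B} {c : BangCode}

/-- By the in-degree condition `u` is the only predecessor of `v`. If `v` were outside `b`, removing
`b` would make `v` an input, which it is not in the whole graph; this contradicts openness. -/
theorem IsBangGraph.content_of_edge (hH : H.IsBangGraph) {b : B} {u v : V} {γ : EdgeLabel}
    (e : H.graph.edge u γ v) (hv : H.graph.label v = .W) (hu : u ∈ H.content b) :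
    v ∈ H.content b := by
  by_contra hvb
  have h := (hH.content_open b).1 v ⟨hvb, hv, fun x δ hx e' =>
    hx (hH.string.in_degree v hv _ _ _ _ e e' ▸ hu)⟩
  exact h.2.2 u γ (fun h => h) e

theorem IsBangGraph.content_of_edge' (hH : H.IsBangGraph) {b : B} {u v : V} {γ : EdgeLabel}
    (e : H.graph.edge u γ v) (hu : H.graph.label u = .W) (hv : v ∈ H.content b) :
    u ∈ H.content b := by
  by_contra hub
  have h := (hH.content_open b).2 u ⟨hub, hu, fun x δ hx e' =>
    hx (hH.string.out_degree u hu _ _ _ _ e e' ▸ hv)⟩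
  exact h.2.2 v γ (fun h => h) e

theorem IsBangGraph.isNested (hH : H.IsBangGraph) : H.IsNested :=
  ⟨hH.le_refl, hH.le_trans, hH.le_antisymm, hH.content_mono⟩

/-- The correspondence between a !-graph and the one with an additional outermost !-box. -/
structure IsCorrespondence (H : BangData V B) (c : BangCode) (e : V ≃ Fin c.labels.length)
    (d : B ≃ Fin c.boxes) : Prop where
  label : ∀ v, H.graph.label v = c.topped.graph.label (e v).val
  edge : ∀ x γ y, H.graph.edge x γ y ↔ c.topped.graph.edge (e x).val γ (e y).val
  le : ∀ a b, H.le a b ↔ c.topped.le (d a).val (d b).val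
  mem : ∀ b v, v ∈ H.content b ↔ (e v).val ∈ c.topped.content (d b).val

theorem isCorrespondence (hH : H.IsBangGraph) {e : V ≃ Fin c.labels.length} {d : B ≃ Fin c.boxes}
    (h1 : ∀ v, H.graph.label v = c.labels.get (e v))
    (h2 : ∀ x y, H.graph.edge x EdgeLabel.plain y ↔ ((e x).val, (e y).val) ∈ c.edges)
    (h3 : ∀ a b, H.le a b ↔ ((d a).val, (d b).val) ∈ c.nested)
    (h4 : ∀ b v, v ∈ H.content b ↔ ((d b).val, (e v).val) ∈ c.inside) :
    H.IsCorrespondence c e d where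
  label v := by
    rw [h1]
    simp [BangCode.topped, BangCode.labelAt]
  edge x γ y := by
    change _ ↔ γ = .plain ∧ _
    rw [BangCode.edgeB_iff, ← h2]
    constructor
    · intro h
      have := hH.string.edge_plain _ _ _ h
      subst this
      refine ⟨rfl, (e x).2, (e y).2, fun hxy => ?_, h⟩
      have := e.injective (Fin.ext hxy)
      subst this
      exact H.graph.irrefl _ _ h
    · rintro ⟨rfl, -, -, -, h⟩
      exact h
  le a b := by
    change _ ↔ c.leB _ _ = true
    rw [BangCode.leB_iff, h3]
    have ha := (d a).2
    have hb := (d b).2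
    constructor
    · exact fun h => ⟨ha.le, .inr ⟨ha, hb, h⟩⟩
    · rintro ⟨-, h | h⟩
      · omega
      · exact h.2.2
  mem b v := by
    change _ ↔ c.insideB _ _ = true
    rw [BangCode.insideB_iff, h4]
    have hb := (d b).2
    constructor
    · exact fun h => ⟨(e v).2, .inr ⟨hb, h⟩⟩
    · rintro ⟨-, h | h⟩
      · omega
      · exact h.2

namespace IsCorrespondence

variable {e : V ≃ Fin c.labels.length} {d : B ≃ Fin c.boxes}

theorem exists_vertex {u : ℕ} (e : V ≃ Fin c.labels.length) (hu : u < c.labels.length) :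
    ∃ v, (e v).val = u := ⟨e.symm ⟨u, hu⟩, by simp⟩

theorem le_top_iff (a : ℕ) : c.topped.le a c.boxes ↔ a ≤ c.boxes := by
  change c.leB _ _ = true ↔ _
  rw [BangCode.leB_iff]
  simp

theorem mem_top_iff (v : ℕ) : v ∈ c.topped.content c.boxes ↔ v < c.labels.length := by
  change c.insideB _ _ = true ↔ _
  rw [BangCode.insideB_iff]
  simp

theorem le_cases (d : B ≃ Fin c.boxes) {a b : ℕ} (h : c.topped.le a b) :
    b = c.boxes ∨ ∃ a' b', (d a').val = a ∧ (d b').val = b := by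
  change c.leB _ _ = true at h
  rw [BangCode.leB_iff] at h
  exact h.2.imp id fun h => ⟨d.symm ⟨a, h.1⟩, d.symm ⟨b, h.2.1⟩, by simp, by simp⟩

theorem mem_cases (e : V ≃ Fin c.labels.length) (d : B ≃ Fin c.boxes) {b v : ℕ}
    (h : v ∈ c.topped.content b) :
    ∃ v', (e v').val = v ∧ (b = c.boxes ∨ ∃ b', (d b').val = b) := by
  change c.insideB _ _ = true at h
  rw [BangCode.insideB_iff] at h
  exact ⟨e.symm ⟨v, h.1⟩, by simp, h.2.imp id fun h => ⟨d.symm ⟨b, h.1⟩, by simp⟩⟩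

theorem edge_cases (e : V ≃ Fin c.labels.length) {u v : ℕ} {γ : EdgeLabel}
    (h : c.topped.graph.edge u γ v) : ∃ u' v', (e u').val = u ∧ (e v').val = v := by
  have h := (BangCode.edgeB_iff _ _ _).1 h.2
  exact ⟨e.symm ⟨u, h.1⟩, e.symm ⟨v, h.2.1⟩, by simp, by simp⟩

/-- The added !-box is above all others, so it creates no incomparable pair and the overlap
conditions are those of `H`. The propagation of membership along edges is the openness of the
contents. -/
theorem isBounded (hc : H.IsCorrespondence c e d) (hH : H.IsBangGraph)
    (ht : H.HasTrivialOverlap) : c.topped.IsBounded c.labels.length c.boxes := by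
  have hinj : ∀ {x y : V}, (e x).val = (e y).val → x = y := fun h => e.injective (Fin.ext h)
  have dinj : ∀ {x y : B}, (d x).val = (d y).val → x = y := fun h => d.injective (Fin.ext h)
  have dlt : ∀ b : B, (d b).val < c.boxes := fun b => (d b).2
  have hcont : ∀ {b v}, v ∈ c.topped.content b → v < c.labels.length := by
    intro b v h
    obtain ⟨v, rfl, -⟩ := mem_cases e d h
    exact (e v).2
  have htop : ∀ a b : ℕ, c.topped.le a b → a ≤ c.boxes ∧ b ≤ c.boxes := by
    intro a b h
    rcases le_cases d h with rfl | ⟨a, b, rfl, rfl⟩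
    · exact ⟨(le_top_iff _).1 h, le_rfl⟩
    · exact ⟨(dlt a).le, (dlt b).le⟩
  have hle : ∀ b : ℕ, ∀ v, v ∈ c.topped.content b → b ≤ c.boxes := by
    intro b v h
    obtain ⟨v, rfl, rfl | ⟨b, rfl⟩⟩ := mem_cases e d h
    · exact le_rfl
    · exact (dlt b).le
  refine ⟨⟨?_, ?_, ?_, ?_, ?_, ?_, ?_, ?_, ?_, ?_, ?_, ?_, ?_, ?_, ?_⟩, le_top_iff,
    fun v => hcont⟩
  · refine ⟨?_, fun x γ y h => h.1, ?_, ?_, ?_⟩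
    · intro v
      rcases Nat.lt_or_ge v c.labels.length with h | h
      · obtain ⟨v, rfl⟩ := exists_vertex e h
        rw [← hc.label]
        exact hH.string.label_mem v
      · exact .inr (List.getD_eq_default _ _ h)
    · intro x γ y h
      obtain ⟨x, y, rfl, rfl⟩ := edge_cases e h
      rw [← hc.label, ← hc.label]
      exact hH.string.not_node_node x γ y ((hc.edge _ _ _).2 h)
    · intro w hw x y γ δ h h'
      obtain ⟨x, w, rfl, rfl⟩ := edge_cases e h
      obtain ⟨y, w', rfl, hw'⟩ := edge_cases e h'
      have := hinj hw'
      subst this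
      rw [← hc.label] at hw
      rw [hH.string.in_degree w' hw x y γ δ ((hc.edge _ _ _).2 h) ((hc.edge _ _ _).2 h')]
    · intro w hw x y γ δ h h'
      obtain ⟨w, x, rfl, rfl⟩ := edge_cases e h
      obtain ⟨w', y, hw', rfl⟩ := edge_cases e h'
      have := hinj hw'
      subst this
      rw [← hc.label] at hw
      rw [hH.string.out_degree w' hw x y γ δ ((hc.edge _ _ _).2 h) ((hc.edge _ _ _).2 h')]
  · intro b hb
    rcases Nat.lt_or_ge b c.boxes with h | h
    · obtain ⟨b, rfl⟩ : ∃ b', (d b').val = b := ⟨d.symm ⟨b, h⟩, by simp⟩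
      exact (hc.le _ _).1 (hH.le_refl b)
    · have : b = c.boxes := le_antisymm ((le_top_iff _).1 hb) h
      rw [this]
      exact (le_top_iff _).2 le_rfl
  · exact fun a b h => ⟨(le_top_iff _).2 (htop a b h).1, (le_top_iff _).2 (htop a b h).2⟩
  · intro x y z h h'
    rcases le_cases d h' with rfl | ⟨y, z, rfl, rfl⟩
    · exact (le_top_iff _).2 (htop _ _ h).1
    · rcases le_cases d h with h'' | ⟨x, y', rfl, hy⟩
      · exact absurd h'' (dlt y).ne
      · have := dinj hy
        subst this
        exact (hc.le _ _).1 (hH.le_trans _ _ _ ((hc.le _ _).2 h) ((hc.le _ _).2 h'))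
  · intro x y h h'
    rcases le_cases d h with rfl | ⟨x, y, rfl, rfl⟩
    · rcases le_cases d h' with rfl | ⟨y', x', hy, rfl⟩
      · rfl
      · exact absurd hy (dlt y').ne
    · rw [hH.le_antisymm _ _ ((hc.le _ _).2 h) ((hc.le _ _).2 h')]
  · exact (Set.finite_Iic c.boxes).subset fun b hb => (le_top_iff _).1 hb
  · intro x y h v hv
    rcases le_cases d h with rfl | ⟨x, y, rfl, rfl⟩
    · exact (mem_top_iff _).2 (hcont hv)
    · obtain ⟨v, rfl, -⟩ := mem_cases e d hv
      exact (hc.mem _ _).1 (hH.content_mono _ _ ((hc.le _ _).2 h) ((hc.mem _ _).2 hv))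
  · exact fun b v h => (le_top_iff _).2 (hle b v h)
  · exact (Set.finite_Iio c.labels.length).subset fun v hv => (mem_top_iff _).1 hv
  · intro u γ v h
    obtain ⟨u, v, rfl, rfl⟩ := edge_cases e h
    exact ⟨(mem_top_iff _).2 (e u).2, (mem_top_iff _).2 (e v).2⟩
  · intro u γ v b h hl hu
    obtain ⟨u, v, rfl, rfl⟩ := edge_cases e h
    obtain ⟨-, -, rfl | ⟨b, rfl⟩⟩ := mem_cases e d hu
    · exact (mem_top_iff _).2 (e v).2
    · rw [← hc.edge] at h
      rw [← hc.label] at hl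
      have hv : H.graph.label v = .W :=
        (hH.string.label_mem v).resolve_left fun hv => hH.string.not_node_node _ _ _ h ⟨hl, hv⟩
      exact (hc.mem _ _).1 (hH.content_of_edge h hv ((hc.mem _ _).2 hu))
  · intro u γ v b h hl hu
    obtain ⟨u, v, rfl, rfl⟩ := edge_cases e h
    obtain ⟨-, -, rfl | ⟨b, rfl⟩⟩ := mem_cases e d hu
    · exact (mem_top_iff _).2 (e u).2
    · rw [← hc.edge] at h
      rw [← hc.label] at hl
      have hv : H.graph.label u = .W :=
        (hH.string.label_mem u).resolve_left fun hv => hH.string.not_node_node _ _ _ h ⟨hv, hl⟩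
      exact (hc.mem _ _).1 (hH.content_of_edge' h hv ((hc.mem _ _).2 hu))
  · intro u γ v b h hl hl'
    obtain ⟨u, v, rfl, rfl⟩ := edge_cases e h
    rw [← hc.edge] at h
    rw [← hc.label] at hl hl'
    constructor
    · intro hu
      obtain ⟨-, -, rfl | ⟨b, rfl⟩⟩ := mem_cases e d hu
      · exact (mem_top_iff _).2 (e v).2
      · exact (hc.mem _ _).1 (hH.content_of_edge h hl' ((hc.mem _ _).2 hu))
    · intro hv
      obtain ⟨-, -, rfl | ⟨b, rfl⟩⟩ := mem_cases e d hv
      · exact (mem_top_iff _).2 (e u).2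
      · exact (hc.mem _ _).1 (hH.content_of_edge' h hl ((hc.mem _ _).2 hv))
  · rintro x y z h h' ⟨v, hv⟩
    rcases le_cases d h with rfl | ⟨z₁, x, rfl, rfl⟩
    · exact .inr ((le_top_iff _).2 (htop _ _ h').2)
    · rcases le_cases d h' with rfl | ⟨z₂, y, hz, rfl⟩
      · exact .inl ((le_top_iff _).2 (htop _ _ h).2)
      · have := dinj hz
        subst this
        by_contra hno
        rw [not_or, ← hc.le, ← hc.le] at hno
        have := (ht x y hno.1 hno.2).2 z₂ ((hc.le _ _).2 h) ((hc.le _ _).2 h')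
        obtain ⟨v, rfl, -⟩ := mem_cases e d hv
        rw [← hc.mem, this] at hv
        exact hv
  · intro x y v h h'
    obtain ⟨v, rfl, rfl | ⟨x, rfl⟩⟩ := mem_cases e d h
    · exact .inr (.inl ((le_top_iff _).2 (hle _ _ h')))
    · obtain ⟨-, -, rfl | ⟨y, rfl⟩⟩ := mem_cases e d h'
      · exact .inl ((le_top_iff _).2 (dlt x).le)
      · rw [← hc.mem] at h h'
        by_cases hxy : H.le x y
        · exact .inl ((hc.le _ _).1 hxy)
        by_cases hyx : H.le y x
        · exact .inr (.inl ((hc.le _ _).1 hyx))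
        obtain ⟨p, ws, q, hw, hv, -, hp, hq, hpq⟩ := (ht x y hxy hyx).1 v ⟨h, h'⟩
        -- Each endpoint lies in exactly one of the two !-boxes, and not in the same one.
        have hne : p ≠ q := by
          rintro rfl
          rcases hpq with hpq | hpq
          · exact hpq.1.2 hpq.2.1
          · exact hpq.1.2 hpq.2.1
        obtain ⟨z, a, k, hl, hr⟩ := hw.exists_link hp hq hne hv
        refine .inr (.inr ⟨e p, e z, a, e q, k,
          hl.map (fun v => (e v).val) (fun x y h => hinj h) hc.label fun u v => (hc.edge u _ v).1,
          hr.map (fun v => (e v).val) hc.label fun u v => (hc.edge u _ v).1, ?_⟩)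
        simp only [← hc.mem]
        rcases hpq with ⟨⟨h1, h2⟩, h3, h4⟩ | ⟨⟨h1, h2⟩, h3, h4⟩
        · exact .inl ⟨h1, h2, h3, h4⟩
        · exact .inr ⟨h1, h2, h3, h4⟩

end IsCorrespondence

end BangData
-- The language in terms of the outermost !-box
namespace BangData

namespace IsCorrespondence
variable {V B : Type} {H : BangData V B} {c : BangCode} {e : V ≃ Fin c.labels.length}
  {d : B ≃ Fin c.boxes}

/-- Every vertex lies in the outermost !-box, which has the single instance `τ`. So every section
contains `τ`, and adjoining or deleting it relates the two kinds of sections. -/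
theorem conc_iso_tconc (hc : H.IsCorrespondence c e d) {I J : Type} {F : Amb ℕ I} {F' : Amb B J}
    (hF : F.WF c.topped.le Set.univ) {τ : I} (hτ : F.box τ = c.boxes)
    (htop : ∀ i, F.ile i τ) (ι : J → I) (hι : Function.Injective ι)
    (hrange : ∀ i, i = τ ∨ ∃ j, ι j = i) (hbox : ∀ j, F.box (ι j) = d (F'.box j))
    (hile : ∀ i j, F'.ile i j ↔ F.ile (ι i) (ι j)) :
    (conc H F' Set.univ Set.univ).IsIso (tconc c.topped c.boxes F Set.univ) := by
  have hne : ∀ j, ι j ≠ τ := by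
    intro j hj
    have h1 := hbox j
    have h2 := (d (F'.box j)).2
    rw [hj, hτ] at h1
    omega
  refine conc_iso (fun v => (e v).val) (fun x y h => e.injective (Fin.ext h)) ?_
    (fun u γ v => hc.edge u γ v) (fun v _ => hc.label v) ι hι {τ} hne ?_ ?_ ?_ ?_
  · intro v
    rw [mem_top_iff]
    constructor
    · intro hv
      obtain ⟨u, hu⟩ := exists_vertex e hv
      exact ⟨u, trivial, hu⟩
    · rintro ⟨u, -, rfl⟩
      exact (e u).2
  · intro i j
    rw [hbox, hbox, ← Fin.ext_iff, d.apply_eq_iff_eq]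
  · rintro i r rfl h
    have h1 := hbox i
    have h2 := (d (F'.box i)).2
    rw [h, hτ] at h1
    omega
  · rintro r rfl s rfl _
    rfl
  · intro v _ S'
    have hτS : ∀ {S'}, IsSec c.topped F Set.univ (e v).val S' → τ ∈ S' := by
      intro S' h
      obtain ⟨i, hi, hib⟩ := h.ex c.boxes ((mem_top_iff _).2 (e v).2)
      have := hF.inj i trivial i τ (hF.refl i trivial) (htop i) (hib.trans hτ.symm)
      rwa [← this]
    constructor
    · intro h
      refine ⟨ι ⁻¹' S', ⟨fun _ _ => trivial, ?_, ?_, ?_, ?_⟩, ?_⟩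
      · exact fun i hi j hij => h.up _ hi _ ((hile i j).1 hij)
      · intro i hi
        rw [hc.mem, ← hbox]
        exact h.mem _ hi
      · intro b hb
        obtain ⟨i, hi, hib⟩ := h.ex _ ((hc.mem b v).1 hb)
        rcases hrange i with rfl | ⟨j, rfl⟩
        · have := (d b).2
          omega
        · exact ⟨j, hi, d.injective (Fin.ext ((hbox j).symm.trans hib))⟩
      · intro i hi j hj hij
        exact hι (h.inj _ hi _ hj (by rw [hbox, hbox, hij]))
      · ext i
        constructor
        · intro hi
          rcases hrange i with rfl | ⟨j, rfl⟩
          · exact .inr rfl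
          · exact .inl ⟨j, hi, rfl⟩
        · rintro (⟨j, hj, rfl⟩ | rfl)
          · exact hj
          · exact hτS h
    · rintro ⟨S, hS, rfl⟩
      refine ⟨fun _ _ => trivial, ?_, ?_, ?_, ?_⟩
      · rintro _ (⟨i, hi, rfl⟩ | hi) j hij
        · rcases hrange j with rfl | ⟨j, rfl⟩
          · exact .inr rfl
          · exact .inl ⟨j, hS.up i hi j ((hile i j).2 hij), rfl⟩
        · rw [Set.mem_singleton_iff] at hi
          subst hi
          right
          refine hF.inj j trivial j _ (hF.refl j trivial) (htop j) ?_
          have h1 := hF.mono _ trivial j hij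
          rw [hτ] at h1 ⊢
          rcases le_cases d h1 with h2 | ⟨a, b, ha, -⟩
          · exact h2
          · exact absurd ha (d a).2.ne
      · rintro _ (⟨i, hi, rfl⟩ | rfl)
        · rw [hbox, ← hc.mem]
          exact hS.mem i hi
        · rw [hτ]
          exact (mem_top_iff _).2 (e v).2
      · intro b hb
        obtain ⟨-, -, rfl | ⟨b, rfl⟩⟩ := mem_cases e d hb
        · exact ⟨τ, .inr rfl, hτ⟩
        · obtain ⟨i, hi, rfl⟩ := hS.ex b ((hc.mem b v).2 hb)
          exact ⟨ι i, .inl ⟨i, hi, rfl⟩, hbox i⟩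
      · rintro _ (⟨i, hi, rfl⟩ | hi) _ (⟨j, hj, rfl⟩ | hj) hij
        · rw [hbox, hbox, ← Fin.ext_iff, d.apply_eq_iff_eq] at hij
          rw [hS.inj i hi j hj hij]
        · rw [Set.mem_singleton_iff] at hj
          have := (d (F'.box i)).2
          rw [hj, hbox, hτ] at hij
          omega
        · rw [Set.mem_singleton_iff] at hi
          have := (d (F'.box j)).2
          rw [hi, hbox, hτ] at hij
          omega
        · rw [Set.mem_singleton_iff] at hi hj
          rw [hi, hj]

/-- Instances of the !-graph with an outermost !-box yield graphs of the language. -/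
theorem mem_language_of_tconc [Finite B] (hc : H.IsCorrespondence c e d) (hH : H.IsBangGraph)
    {I : Type} [Finite I] {F : Amb ℕ I} (hF : F.WF c.topped.le Set.univ) {τ : I}
    (hτ : F.box τ = c.boxes) (htop : ∀ i, F.ile i τ) {C : IsoClass NodeLabel EdgeLabel}
    (hC : IsClassOf C (tconc c.topped c.boxes F Set.univ)) : C ∈ H.language := by
  have hlt : ∀ j : {i // i ≠ τ}, F.box j.1 < c.boxes := by
    intro j
    have h1 := hF.mono j.1 trivial τ (htop j.1)
    rw [hτ, le_top_iff] at h1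
    refine lt_of_le_of_ne h1 fun h => j.2 ?_
    exact hF.inj j.1 trivial j.1 τ (hF.refl _ trivial) (htop _) (h.trans hτ.symm)
  let F' : Amb B {i // i ≠ τ} :=
    ⟨fun j => d.symm ⟨F.box j.1, hlt j⟩, fun i j => F.ile i.1 j.1⟩
  have hbox : ∀ j : {i // i ≠ τ}, F.box j.1 = d (F'.box j) := by
    intro j
    simp [F']
  have hF' : F'.WF H.le Set.univ := by
    refine ⟨fun i _ => hF.refl i.1 trivial, fun _ _ _ _ => trivial,
      fun i _ j k => hF.trans i.1 trivial j.1 k.1, ?_, ?_, ?_⟩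
    · intro i _ j hij
      rw [hc.le, ← hbox, ← hbox]
      exact hF.mono i.1 trivial j.1 hij
    · intro i _ b hb
      rw [hc.le, ← hbox] at hb
      obtain ⟨j, hij, hj⟩ := hF.lift i.1 trivial _ hb
      have hjτ : j ≠ τ := by
        rintro rfl
        have := (d b).2
        omega
      exact ⟨⟨j, hjτ⟩, hij, d.injective (Fin.ext ((hbox ⟨j, hjτ⟩).symm.trans hj))⟩
    · intro i _ j k hij hik hjk
      exact Subtype.ext (hF.inj i.1 trivial j.1 k.1 hij hik (by rw [hbox, hbox, hjk]))
  obtain ⟨K, hK, hiso⟩ := hC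
  rw [mem_language_iff hH.isNested]
  refine ⟨_, inferInstance, F', hF', K, hK, LGraph.IsIso.trans ?_ hiso⟩
  refine hc.conc_iso_tconc hF hτ htop Subtype.val Subtype.val_injective ?_ hbox fun i j => Iff.rfl
  intro i
  by_cases h : i = τ
  · exact .inl h
  · exact .inr ⟨⟨i, h⟩, rfl⟩

/-- The graphs of the language are given by instances of the !-graph with an outermost !-box. -/
theorem exists_tconc [Finite B] (hc : H.IsCorrespondence c e d) (hH : H.IsBangGraph)
    (ht : H.HasTrivialOverlap) {C : IsoClass NodeLabel EdgeLabel} (hC : C ∈ H.language) :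
    ∃ (I : Type) (_ : Finite I) (F : Amb ℕ I) (τ : I), F.WF c.topped.le Set.univ ∧
      F.box τ = c.boxes ∧ (∀ i, F.ile i τ) ∧
      (∀ i j k, F.ile i j → F.ile i k → F.ile j k ∨ F.ile k j) ∧
      IsClassOf C (tconc c.topped c.boxes F Set.univ) := by
  rw [mem_language_iff hH.isNested] at hC
  obtain ⟨I, fin, F, hF, K, hK, hiso⟩ := hC
  -- Instances of !-boxes without contents occur in no section and are dropped. For the others,
  -- trivial overlap makes the ancestors a chain.
  let J := {i : I // (H.content (F.box i)).Nonempty}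
  let F₁ : Amb B J := ⟨fun i => F.box i.1, fun i j => F.ile i.1 j.1⟩
  let F' : Amb ℕ (Option J) := ⟨fun i => i.elim c.boxes fun i => d (F.box i.1),
    fun i j => match i, j with
      | some i, some j => F.ile i.1 j.1
      | _, none => True
      | none, some _ => False⟩
  have hF' : F'.WF c.topped.le Set.univ := by
    refine ⟨?_, fun _ _ _ _ => trivial, ?_, ?_, ?_, ?_⟩
    · rintro (_ | i) _
      · trivial
      · exact hF.refl i.1 trivial
    · rintro (_ | i) _ (_ | j) (_ | k) h h' <;> first | trivial | exact h.elim | exact h'.elim | skip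
      exact hF.trans i.1 trivial j.1 k.1 h h'
    · rintro (_ | i) _ (_ | j) h
      · exact (le_top_iff _).2 le_rfl
      · exact h.elim
      · exact (le_top_iff _).2 (d (F.box i.1)).2.le
      · exact (hc.le _ _).1 (hF.mono i.1 trivial j.1 h)
    · rintro (_ | i) _ b hb
      · refine ⟨none, trivial, ?_⟩
        rcases le_cases d hb with rfl | ⟨a, b', ha, -⟩
        · rfl
        · exact absurd ha (d a).2.ne
      · rcases le_cases d hb with rfl | ⟨a, b, ha, rfl⟩
        · exact ⟨none, trivial, rfl⟩
        · have : a = F.box i.1 := d.injective (Fin.ext ha)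
          subst this
          have hb := (hc.le _ _).2 hb
          obtain ⟨j, hij, rfl⟩ := hF.lift i.1 trivial b hb
          exact ⟨some ⟨j, i.2.mono (hH.content_mono _ _ hb)⟩, hij, rfl⟩
    · rintro (_ | i) _ (_ | j) (_ | k) h h' hjk
      · rfl
      · exact h'.elim
      · exact h.elim
      · exact h.elim
      · rfl
      · exact absurd hjk.symm (d (F.box k.1)).2.ne
      · exact absurd hjk (d (F.box j.1)).2.ne
      · exact congrArg some (Subtype.ext (hF.inj i.1 trivial j.1 k.1 h h'
          (d.injective (Fin.ext hjk))))
  refine ⟨Option J, inferInstance, F', none, hF', rfl, ?_, ?_, K, hK, ?_⟩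
  · rintro (_ | i) <;> trivial
  · rintro (_ | i) (_ | j) (_ | k) h h'
    · exact .inl trivial
    · exact h'.elim
    · exact h.elim
    · exact h.elim
    · exact .inl trivial
    · exact .inr trivial
    · exact .inl trivial
    · have h1 := hF.mono i.1 trivial j.1 h
      have h2 := hF.mono i.1 trivial k.1 h'
      -- The order of two ancestors of one instance is that of their !-boxes, since ancestors are
      -- determined by !-boxes.
      have key : ∀ j k : I, F.ile i.1 j → F.ile i.1 k → H.le (F.box j) (F.box k) → F.ile j k := by
        intro j k h h' hjk
        obtain ⟨l, hl, hlk⟩ := hF.lift j trivial _ hjk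
        rwa [← hF.inj i.1 trivial l k (hF.trans i.1 trivial j l h hl) h' hlk]
      by_cases hjk : H.le (F.box j.1) (F.box k.1)
      · exact .inl (key _ _ h h' hjk)
      · by_cases hkj : H.le (F.box k.1) (F.box j.1)
        · exact .inr (key _ _ h' h hkj)
        · have := (ht _ _ hjk hkj).2 _ h1 h2
          exact absurd i.2 (by rw [this]; exact Set.not_nonempty_empty)
  · have h1 : (conc H F₁ Set.univ Set.univ).IsIso (tconc c.topped c.boxes F' Set.univ) := by
      refine hc.conc_iso_tconc hF' (τ := none) rfl (by rintro (_ | i) <;> trivial) some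
        (Option.some_injective _) ?_ (fun j => rfl) (fun i j => Iff.rfl)
      rintro (_ | i)
      · exact .inl rfl
      · exact .inr ⟨i, rfl⟩
    have h2 : (conc H F₁ Set.univ Set.univ).IsIso (conc H F Set.univ Set.univ) := by
      refine conc_iso id Function.injective_id (fun v => ⟨fun _ => ⟨v, trivial, rfl⟩,
        fun _ => trivial⟩) (fun _ _ _ => Iff.rfl) (fun _ _ => rfl) Subtype.val
        Subtype.val_injective ∅ (fun _ h => h) (fun _ _ => Iff.rfl) (fun _ r hr => hr.elim)
        (fun r hr => hr.elim) ?_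
      intro v _ S'
      constructor
      · intro h
        refine ⟨Subtype.val ⁻¹' S', ⟨fun _ _ => trivial, fun i hi j hij => h.up _ hi _ hij,
          fun i hi => h.mem _ hi, ?_, fun i hi j hj hij => Subtype.ext (h.inj _ hi _ hj hij)⟩, ?_⟩
        · intro b hb
          obtain ⟨i, hi, rfl⟩ := h.ex b hb
          exact ⟨⟨i, ⟨v, hb⟩⟩, hi, rfl⟩
        · ext i
          rw [Set.union_empty]
          constructor
          · exact fun hi => ⟨⟨i, ⟨v, h.mem i hi⟩⟩, hi, rfl⟩
          · rintro ⟨j, hj, rfl⟩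
            exact hj
      · rintro ⟨S, hS, rfl⟩
        rw [Set.union_empty]
        refine ⟨fun _ _ => trivial, ?_, ?_, ?_, ?_⟩
        · rintro _ ⟨i, hi, rfl⟩ j hij
          have hj : (H.content (F.box j)).Nonempty :=
            i.2.mono (hH.content_mono _ _ (hF.mono i.1 trivial j hij))
          exact ⟨⟨j, hj⟩, hS.up i hi ⟨j, hj⟩ hij, rfl⟩
        · rintro _ ⟨i, hi, rfl⟩
          exact hS.mem i hi
        · intro b hb
          obtain ⟨i, hi, hib⟩ := hS.ex b hb
          exact ⟨i.1, ⟨i, hi, rfl⟩, hib⟩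
        · rintro _ ⟨i, hi, rfl⟩ _ ⟨j, hj, rfl⟩ hij
          rw [hS.inj i hi j hj hij]
    exact h1.symm.trans (h2.trans hiso)

end IsCorrespondence

end BangData

/-! ### The bijection between the two languages -/

theorem IsClassOf.iso {S Γ V V' : Type} {C : IsoClass S Γ} {G : LGraph S Γ V} {G' : LGraph S Γ V'}
    (h : IsClassOf C G) (h' : IsClassOf C G') : G.IsIso G' := by
  obtain ⟨K, hK, e⟩ := h
  obtain ⟨K', hK', e'⟩ := h'
  have : K.graph.IsIso K'.graph := Quotient.exact (hK.trans hK'.symm)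
  exact (e.trans this).trans e'.symm

theorem IsClassOf.congr {S Γ V V' : Type} {C : IsoClass S Γ} {G : LGraph S Γ V}
    {G' : LGraph S Γ V'} (h : IsClassOf C G) (e : G'.IsIso G) : IsClassOf C G' := by
  obtain ⟨K, hK, e'⟩ := h
  exact ⟨K, hK, e.trans e'⟩

theorem IsClassOf.eq {S Γ V V' : Type} {C C' : IsoClass S Γ} {G : LGraph S Γ V}
    {G' : LGraph S Γ V'} (h : IsClassOf C G) (h' : IsClassOf C' G') (e : G.IsIso G') : C = C' := by
  obtain ⟨K, rfl, hK⟩ := h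
  obtain ⟨K', rfl, hK'⟩ := h'
  exact Quotient.sound ((hK.symm.trans e).trans hK')

theorem exists_isClassOf {S Γ V : Type} [Finite V] (G : LGraph S Γ V) :
    ∃ C : IsoClass S Γ, IsClassOf C G :=
  ⟨_, ⟨V, inferInstance, G⟩, rfl, LGraph.IsIso.refl G⟩

/-- Replacing edges by wires is invariant under isomorphism. -/
theorem wireExpand_iso {V V' : Type} (len : ℕ → ℕ) {D : LGraph NodeLabel EdgeLabel V}
    {D' : LGraph NodeLabel EdgeLabel V'} (h : D.IsIso D') :
    (wireExpand len D).IsIso (wireExpand len D') := by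
  obtain ⟨e, he, hl⟩ := h
  refine isIso_of_bij (Sum.map e fun s => ⟨e s.src, s.idx, e s.tgt, s.pos, (he _ _ _).1 s.isEdge,
    s.pos_lt⟩) ⟨?_, ?_⟩ ?_ ?_
  · rintro (x | ⟨x, k, y, p, h1, h2⟩) (x' | ⟨x', k', y', p', h1', h2'⟩) h
    · exact congrArg Sum.inl (e.injective (Sum.inl.inj h))
    · cases h
    · cases h
    · have h := Sum.inr.inj h
      simp only [WireSlot.mk.injEq, e.apply_eq_iff_eq] at h
      obtain ⟨rfl, rfl, rfl, rfl⟩ := h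
      rfl
  · rintro (x | ⟨x, k, y, p, h1, h2⟩)
    · exact ⟨.inl (e.symm x), by simp⟩
    · refine ⟨.inr ⟨e.symm x, k, e.symm y, p, ?_, h2⟩, by simp⟩
      rw [he]
      simpa using h1
  · rintro (x | s) γ (y | s')
    · simp [wireExpand, he]
    · simp [wireExpand]
    · simp [wireExpand]
    · simp [wireExpand]
  · rintro (x | s)
    · exact hl x
    · rfl

namespace BangData

section

variable {H : BangData ℕ ℕ} {n N : ℕ} {I : Type} {F : Amb ℕ I} {A : Set I}

theorem tightCount_le (hH : H.IsBounded n N) (x a y : ℕ) : H.tightCount x a y ≤ n := by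
  have hsub : {h | H.graph.IsLink x h a y ∧ H.IsTight x h y} ⊆ Set.Iio n :=
    fun h hh => hH.vert_lt _ (hH.topped.edge_dom _ _ _ hh.1.2.2.2.1).2
  have := Set.ncard_le_ncard hsub (Set.finite_Iio n)
  rwa [Set.ncard_Iio_nat] at this

/-- There is a canonical selection of encoded links. -/
theorem exists_isConsistent (hH : H.IsBounded n N) [Finite I] (hF : F.WF H.le Set.univ)
    (hdom : ∀ i, H.le (F.box i) N) :
    ∃ om γ, IsConsistent H F Set.univ om γ n ∧ (∀ i h, om i h → h < n) ∧
      ∀ i x a y, γ i x a y ≤ n := by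
  classical
  -- Tight links are always encoded, so at most `n - tightCount` loose links are added.
  have hex : ∀ i x a y, ∃ S ⊆ looseSet H F Set.univ i x a y,
      S.ncard = min (n - H.tightCount x a y) (looseSet H F Set.univ i x a y).ncard :=
    fun i x a y => Set.exists_subset_card_eq (min_le_right _ _)
  choose S hS hcard using hex
  have hfin := fun i x a y => finite_looseSet (F := F) hH.topped Set.finite_univ i x a y
  let om : I → ℕ → Prop := fun i h => ∃ j x a y, H.Owns (F.box j) x y ∧ (h, i) ∈ S j x a y
  -- A loose link determines its endpoints, its length and the instance owning them, so choices made
  -- for different owners do not interfere.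
  have hom : ∀ i x a y, H.Owns (F.box i) x y →
      {q | q ∈ looseSet H F Set.univ i x a y ∧ om q.2 q.1} = S i x a y := by
    intro i x a y ho
    ext q
    constructor
    · rintro ⟨hq, j, x', a', y', ho', hq'⟩
      have hq'' := hS _ _ _ _ hq'
      obtain ⟨rfl, rfl, rfl⟩ := hq.2.2.1.unique hH.topped.string hq''.2.2.1
      have hb := ho.unique hH ho' (hdom _) (hdom _)
      rw [hF.inj q.2 trivial i j hq.2.1 hq''.2.1 hb]
      exact hq'
    · exact fun hq => ⟨hS _ _ _ _ hq, i, x, a, y, ho, hq⟩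
  have hT := fun x a y => tightCount_le hH x a y
  refine ⟨om, fun i x a y => if H.Owns (F.box i) x y then
    H.tightCount x a y + (S i x a y).ncard else 0, ⟨?_, ?_, ?_⟩, ?_, ?_⟩
  · intro i _ x a y ho
    simp only [if_pos ho, hom i x a y ho]
  · intro i _ x a y ho
    simp only [if_pos ho]
    have := hcard i x a y
    have := hT x a y
    omega
  · intro i _ x a y ho q hq hno
    simp only [if_pos ho]
    have hlt : (S i x a y).ncard < (looseSet H F Set.univ i x a y).ncard := by
      refine Set.ncard_lt_ncard ⟨hS i x a y, fun hsub => hno ?_⟩ (hfin i x a y)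
      exact ⟨i, x, a, y, ho, hsub hq⟩
    have := hcard i x a y
    have := hT x a y
    omega
  · rintro i h ⟨j, x, a, y, -, hq⟩
    exact hH.vert_lt _ (hH.topped.edge_dom _ _ _ (hS _ _ _ _ hq).2.2.1.2.2.2.1).2
  · intro i x a y
    beta_reduce
    split_ifs
    · have := hcard i x a y
      have := hT x a y
      omega
    · exact Nat.zero_le n

/-- Restriction of a family to the instances in `A`. -/
theorem tconc_subtype (hF : F.WF H.le A) :
    Amb.WF (I := A) ⟨fun i => F.box i.1, fun i j => F.ile i.1 j.1⟩ H.le Set.univ ∧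
    (tconc H N ⟨fun i : A => F.box i.1, fun i j => F.ile i.1 j.1⟩ Set.univ).IsIso
      (tconc H N F A) := by
  constructor
  · refine ⟨fun i _ => hF.refl i.1 i.2, fun _ _ _ _ => trivial,
      fun i _ j k => hF.trans i.1 i.2 j.1 k.1, fun i _ j => hF.mono i.1 i.2 j.1, ?_, ?_⟩
    · intro i _ b hb
      obtain ⟨j, hj, hjb⟩ := hF.lift i.1 i.2 b hb
      exact ⟨⟨j, hF.up i.1 i.2 j hj⟩, hj, hjb⟩
    · exact fun i _ j k h h' hjk => Subtype.ext (hF.inj i.1 i.2 j.1 k.1 h h' hjk)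
  · refine conc_iso id Function.injective_id (fun v => ⟨fun h => ⟨v, h, rfl⟩, ?_⟩)
      (fun _ _ _ => Iff.rfl) (fun _ _ => rfl) Subtype.val
      Subtype.val_injective ∅ (fun _ h => h) (fun _ _ => Iff.rfl) (fun _ r hr => hr.elim)
      (fun r hr => hr.elim) ?_
    · rintro ⟨u, hu, rfl⟩
      exact hu
    intro v _ S'
    constructor
    · intro h
      refine ⟨Subtype.val ⁻¹' S', ⟨fun _ _ => trivial, fun i hi j hij => h.up _ hi _ hij,
        fun i hi => h.mem _ hi, ?_, fun i hi j hj hij => Subtype.ext (h.inj _ hi _ hj hij)⟩, ?_⟩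
      · intro b hb
        obtain ⟨i, hi, rfl⟩ := h.ex b hb
        exact ⟨⟨i, h.sub hi⟩, hi, rfl⟩
      · ext i
        rw [Set.union_empty]
        constructor
        · exact fun hi => ⟨⟨i, h.sub hi⟩, hi, rfl⟩
        · rintro ⟨j, hj, rfl⟩
          exact hj
    · rintro ⟨S, hS, rfl⟩
      rw [Set.union_empty]
      refine ⟨?_, ?_, ?_, ?_, ?_⟩
      · rintro _ ⟨i, -, rfl⟩
        exact i.2
      · rintro _ ⟨i, hi, rfl⟩ j hij
        exact ⟨⟨j, hF.up i.1 i.2 j hij⟩, hS.up i hi ⟨j, hF.up i.1 i.2 j hij⟩ hij, rfl⟩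
      · rintro _ ⟨i, hi, rfl⟩
        exact hS.mem i hi
      · intro b hb
        obtain ⟨i, hi, hib⟩ := hS.ex b hb
        exact ⟨i.1, ⟨i, hi, rfl⟩, hib⟩
      · rintro _ ⟨i, hi, rfl⟩ _ ⟨j, hj, rfl⟩ hij
        rw [hS.inj i hi j hj hij]

end

/-- `C` is the class of a canonical encoding of a graph of class `D`. -/
def IsEncodingOf (H : BangData ℕ ℕ) (n N : ℕ) (C D : IsoClass NodeLabel EdgeLabel) : Prop :=
  ∃ (I : Type) (F : Amb ℕ I) (A : Set I) (O : Set (CV H F A (H.content N))),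
    A.Finite ∧ (tconc H N F A).IsCanonical n O ∧ IsClassOf C ((tconc H N F A).encode O) ∧
    IsClassOf D (tconc H N F A)

section

variable {H : BangData ℕ ℕ} {n N : ℕ} {C C' D D' : IsoClass NodeLabel EdgeLabel}

theorem IsEncodingOf.isWireEncoding (hH : H.IsBounded n N) (h : H.IsEncodingOf n N C D) :
    IsWireEncoding LGraph.wireLen C D := by
  obtain ⟨I, F, A, O, hA, hO, hC, hD⟩ := h
  have := finite_tconc (F := F) hH.topped hA
  have hs := tconc_isStringGraph (F := F) (A := A) hH.topped
  obtain ⟨K, hK, e⟩ := hC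
  refine ⟨⟨_, inferInstance, (tconc H N F A).encode O⟩, ?_, ?_, ?_⟩
  · rw [← hK]
    exact Quotient.sound e
  · rintro x k y (h | ⟨a, t, -, h⟩)
    · have := hs.edge_plain _ _ _ h
      cases this
    · obtain ⟨z, -, l⟩ := Set.nonempty_of_ncard_ne_zero
        (Nat.ne_of_gt (lt_of_le_of_lt (Nat.zero_le t) h))
      exact ⟨l.1, l.2.1⟩
  · exact hD.congr (LGraph.wireExpand_encode hs O hO.1)

/-- Here canonicity is needed: isomorphic graphs may come from different families and selections. -/
theorem IsEncodingOf.injective (hH : H.IsBounded n N) (h : H.IsEncodingOf n N C D)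
    (h' : H.IsEncodingOf n N C' D) : C = C' := by
  obtain ⟨I, F, A, O, hA, hO, hC, hD⟩ := h
  obtain ⟨I', F', A', O', hA', hO', hC', hD'⟩ := h'
  have := finite_tconc (F := F) hH.topped hA
  exact hC.eq hC' (LGraph.encode_iso_of_canonical (tconc_isStringGraph hH.topped) (hD.iso hD')
    hO hO')

/-- Decoding respects isomorphism and recovers the graph, for any selection. -/
theorem IsEncodingOf.unique (hH : H.IsBounded n N) (h : H.IsEncodingOf n N C D)
    (h' : H.IsEncodingOf n N C D') : D = D' := by
  obtain ⟨I, F, A, O, hA, hO, hC, hD⟩ := h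
  obtain ⟨I', F', A', O', hA', hO', hC', hD'⟩ := h'
  have := finite_tconc (F := F) hH.topped hA
  have := finite_tconc (F := F') hH.topped hA'
  refine hD.eq hD' (((LGraph.wireExpand_encode (tconc_isStringGraph hH.topped) O hO.1).symm.trans
    (wireExpand_iso _ (hC.iso hC'))).trans
      (LGraph.wireExpand_encode (tconc_isStringGraph hH.topped) O' hO'.1))

end

/-- The language of a grammar that explores the instances is the language of the !-graph, up to
wire-encoding. -/
theorem IsCorrespondence.eqUpToWireEncoding {V B : Type} [Finite B] {H : BangData V B}
    {c : BangCode} {e : V ≃ Fin c.labels.length} {d : B ≃ Fin c.boxes}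
    (hc : H.IsCorrespondence c e d) (hH : H.IsBangGraph) (ht : H.HasTrivialOverlap)
    {G : EdNCE NodeLabel EdgeLabel} (hG : c.topped.IsExploration c.labels.length c.boxes G) :
    EqUpToWireEncoding G.language H.language := by
  have hb := hc.isBounded hH ht
  have hex : ∀ C : G.language, ∃ D : H.language,
      c.topped.IsEncodingOf c.labels.length c.boxes C.1 D.1 := by
    rintro ⟨C, V', K, hK, hover, hconn, hC⟩
    obtain ⟨A, hA, ⟨o, lev, s, hcfg⟩ | ⟨hfin, hwf, hdom, ⟨τ, hτA, hτ, htop⟩, hcon, -, hiso⟩⟩ :=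
      sentential_cases hb hG hK
    · exfalso
      obtain ⟨f, -, hl⟩ := hcfg.iso
      have h1 := hover.1 (f.symm ⟨none, fun q hq => by cases hq⟩)
      rw [hl, Equiv.apply_symm_apply, hG.terminals] at h1
      rcases h1 with h1 | h1 <;> cases h1
    · have hiso' := genGraph_iso hb.topped hwf hfin hdom hcon fun x h a y l => (hb.link_lt l).2.1
      obtain ⟨hwf', hsub⟩ := tconc_subtype (N := c.boxes) hwf
      have := finite_tconc (F := pathAmb c.boxes) hb.topped hfin
      obtain ⟨D, hD⟩ := exists_isClassOf (tconc c.topped c.boxes (pathAmb c.boxes) A)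
      have : Finite A := hfin
      refine ⟨⟨D, hc.mem_language_of_tconc hH hwf' (τ := ⟨τ, hτA⟩) hτ
        (fun i => htop i.1 i.2) (hD.congr hsub)⟩, _, _, _, _, hfin,
        encodedHeads_isCanonical hb.topped hwf hfin hcon (tightCount_le hb),
        hC.congr (hiso.trans hiso').symm, hD⟩
  choose f hf using hex
  refine ⟨LGraph.wireLen, fun k => Nat.succ_pos _, Equiv.ofBijective f ⟨?_, ?_⟩,
    fun C => (hf C).isWireEncoding hb⟩
  · intro C C' h
    have h' := hf C'
    rw [← h] at h'
    exact Subtype.ext ((hf C).injective hb h')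
  · rintro ⟨D, hD⟩
    obtain ⟨I, fin, F, τ, hF, hτ, htop, hch, hDF⟩ := hc.exists_tconc hH ht hD
    have hdom : ∀ i, c.topped.le (F.box i) c.boxes := by
      intro i
      rw [← hτ]
      exact hF.mono i trivial τ (htop i)
    obtain ⟨om, γ, hcon, hom, hγ⟩ := exists_isConsistent hb hF hdom
    obtain ⟨V', K, hK, hconn, hiso⟩ := IsTarget.exists_sentential hb hG
      ⟨fin, hF, ⟨τ, hτ, htop⟩, hch, hcon, hom, hγ⟩
    have hiso' := genGraph_iso hb.topped hF Set.finite_univ (fun i _ => hdom i) hcon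
      fun x h a y l => (hb.link_lt l).2.1
    have hfc := finite_tconc (F := F) hb.topped Set.finite_univ
    obtain ⟨C, hC⟩ := exists_isClassOf ((tconc c.topped c.boxes F Set.univ).encode
      (encodedHeads c.topped c.boxes F Set.univ om))
    have hCK := hC.congr (hiso.trans hiso')
    -- All counts are at most `n`, so only labels `β ⟨a, k⟩` with `a` and `k` below `n` occur.
    have hover : K.IsOver G.terminals G.finals := by
      obtain ⟨g, hg, hl⟩ := hiso
      constructor
      · intro v
        rw [hl, hG.terminals]
        exact hb.topped.string.label_mem _
      · intro x l y h
        rw [hg] at h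
        rcases h.2 with h | ⟨-, a, k, rfl, ha, hk⟩
        · rw [hb.topped.string.edge_plain _ _ _ h]
          exact hG.plain_mem
        · refine hG.beta_mem a ha k (lt_of_lt_of_le hk ?_)
          unfold linkCount
          split_ifs
          · exact hγ _ _ _ _
          · exact hγ _ _ _ _
          · exact tightCount_le hb _ _ _
    refine ⟨⟨C, V', K, hK, hover, hconn, hCK⟩, Subtype.ext ?_⟩
    exact (hf _).unique hb ⟨I, F, Set.univ, _, Set.finite_univ,
      encodedHeads_isCanonical hb.topped hF Set.finite_univ hcon (tightCount_le hb), hC, hDF⟩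

end BangData

/-! ### Boolean tests on descriptions -/

/-- The lists of length `k` with entries at most `j`. -/
def boundedLists (j : ℕ) : ℕ → List (List ℕ)
  | 0 => [[]]
  | k + 1 => (boundedLists j k).flatMap fun l => (List.range (j + 1)).map fun e => e :: l

theorem mem_boundedLists {j k : ℕ} {l : List ℕ} :
    l ∈ boundedLists j k ↔ l.length = k ∧ ∀ e ∈ l, e ≤ j := by
  induction k generalizing l with
  | zero =>
    simp only [boundedLists, List.mem_singleton, List.length_eq_zero_iff]
    constructor
    · rintro rfl
      simp
    · exact fun h => h.1
  | succ k ih =>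
    simp only [boundedLists, List.mem_flatMap, List.mem_map, List.mem_range, ih]
    constructor
    · rintro ⟨l, ⟨h1, h2⟩, e, he, rfl⟩
      refine ⟨by simp [h1], fun e' he' => ?_⟩
      rcases List.mem_cons.1 he' with rfl | he'
      · omega
      · exact h2 e' he'
    · rintro ⟨h1, h2⟩
      rcases l with _ | ⟨e, l⟩
      · simp at h1
      · exact ⟨l, ⟨by simpa using h1, fun e' he' => h2 e' (by simp [he'])⟩, e,
          Nat.lt_succ_of_le (h2 e (by simp)), rfl⟩

theorem ncard_eq_length_filter {n : ℕ} {P : ℕ → Prop} {p : ℕ → Bool} (h : ∀ v, P v ↔ p v = true)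
    (hlt : ∀ v, P v → v < n) : Set.ncard {v | P v} = ((List.range n).filter p).length := by
  have : {v | P v} = ↑((List.range n).filter p).toFinset := by
    ext v
    simp only [Set.mem_ofPred_eq, List.coe_toFinset, List.mem_filter, List.mem_range, h]
    exact ⟨fun hv => ⟨hlt v ((h v).2 hv), hv⟩, fun hv => hv.2⟩
  rw [this, Set.ncard_coe_finset, List.toFinset_card_of_nodup (List.nodup_range.filter _)]

namespace BangCode

variable (c : BangCode)

/-- The vertices reached from `h` by `p` edges. -/
def runList (h : ℕ) : ℕ → List ℕ
  | 0 => bif decide (c.labelAt h = .W) then [h] else []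
  | p + 1 => (List.range c.labels.length).filter fun v =>
      decide (c.labelAt v = .W) && (runList h p).any fun u => c.edgeB u v

def runB (h p v : ℕ) : Bool := (c.runList h p).any fun u => decide (u = v)

def linkB (x h a y : ℕ) : Bool :=
  decide (c.labelAt x = .N) && (decide (c.labelAt y = .N) && (!decide (x = y) && (c.edgeB x h &&
    (List.range c.labels.length).any fun u => c.runB h a u && c.edgeB u y)))

def leastB (v a : ℕ) : Bool :=
  (List.range (c.boxes + 1)).all fun b => decide (c.insideB b v = c.leB a b)

def ownsB (a x y : ℕ) : Bool :=
  (List.range (c.boxes + 1)).all fun b => decide ((c.insideB b x || c.insideB b y) = c.leB a b)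

def tightB (x h y : ℕ) : Bool :=
  (List.range (c.boxes + 1)).all fun b =>
    decide (c.insideB b h = (c.insideB b x || c.insideB b y))

def tightNum (x a y : ℕ) : ℕ :=
  ((List.range c.labels.length).filter fun h => c.linkB x h a y && c.tightB x h y).length

def looseB (b x h a y : ℕ) : Bool := c.linkB x h a y && (!c.tightB x h y && c.leastB h b)

def looseNum (om : List ℕ) (b x a y : ℕ) : ℕ :=
  ((List.range c.labels.length).filter fun h =>
    c.looseB b x h a y && decide (om.getD h 0 = 1)).length

def emitsB (om : List ℕ) (b v : ℕ) : Bool :=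
  c.leastB v b && (List.range c.labels.length).all fun x =>
    (List.range c.labels.length).all fun h => (List.range c.labels.length).all fun a =>
      (List.range c.labels.length).all fun y => (List.range c.labels.length).all fun p =>
        !(c.linkB x h a y && c.runB h p v) || (!c.tightB x h y && !decide (om.getD h 0 = 1))

/-- All triples of numbers below the number of vertices satisfy `p`. -/
def allKeys (p : ℕ → ℕ → ℕ → Bool) : Bool :=
  (List.range c.labels.length).all fun x => (List.range c.labels.length).all fun a =>
    (List.range c.labels.length).all fun y => p x a y

def openB (om : List ℕ) (s s' : ExpState) : Bool :=
  !decide (s.1 = c.boxes + 1) && (decide (s'.1 ≤ c.boxes) &&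
  (((List.range (c.boxes + 1)).all fun b =>
    decide (c.leB s'.1 b = (decide (b = s'.1) || c.leB s.1 b))) && (!c.leB s.1 s'.1 &&
  ((c.allKeys fun x a y => !c.ownsB s'.1 x y ||
    decide (keyAt s'.2.1 x a y = c.tightNum x a y + keyAt s'.2.2 x a y)) &&
  (List.range (c.boxes + 1)).all fun b => c.allKeys fun x a y =>
    !(c.leB s.1 b && c.ownsB b x y) || (decide (keyAt s'.2.1 x a y = keyAt s.2.1 x a y) &&
      (decide (keyAt s'.2.2 x a y + c.looseNum om s'.1 x a y = keyAt s.2.2 x a y) &&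
      (List.range c.labels.length).all fun h => !c.looseB s'.1 x h a y ||
        (decide (om.getD h 0 = 1) || decide (keyAt s.2.1 x a y = c.labels.length))))))))

def closeB (s s' : ExpState) : Bool :=
  decide (s.1 ≤ c.boxes) && (decide (s'.1 ≤ c.boxes + 1) &&
  (((List.range (c.boxes + 1)).all fun b =>
    decide (c.leB s'.1 b = (c.leB s.1 b && !decide (b = s.1)))) &&
  ((c.allKeys fun x a y => !c.ownsB s.1 x y || decide (keyAt s.2.2 x a y = 0)) &&
  (List.range (c.boxes + 1)).all fun b => c.allKeys fun x a y =>
    !(c.leB s'.1 b && c.ownsB b x y) || (decide (keyAt s'.2.1 x a y = keyAt s.2.1 x a y) &&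
      decide (keyAt s'.2.2 x a y = keyAt s.2.2 x a y)))))

def tableList : List (List ℕ) :=
  boundedLists c.labels.length
    (Nat.pair c.labels.length (Nat.pair c.labels.length c.labels.length))

/-- The current !-box runs up to `N + 2`: the values `N + 1` and `N + 2` are those of the end and
the start. -/
def stateList : List ExpState :=
  (List.range (c.boxes + 3)).flatMap fun q => c.tableList.flatMap fun g =>
    c.tableList.map fun r => (q, g, r)

def moveB (m : ExpMove) : Bool :=
  bif m.1.1 then c.openB m.1.2 m.2.1 m.2.2 else c.closeB m.2.1 m.2.2 &&
    (!decide (m.2.2.1 = c.boxes + 1) || decide (m.2.2 = endState c.labels.length c.boxes))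

def moveList : List ExpMove :=
  ([true, false].flatMap fun o => (boundedLists 1 c.labels.length).flatMap fun om =>
    c.stateList.flatMap fun s => c.stateList.map fun s' => ((o, om), s, s')).filter c.moveB

variable {c}

theorem runB_iff {h p v : ℕ} : c.topped.graph.Run h p v ↔ c.runB h p v = true := by
  have key : ∀ p v, c.topped.graph.Run h p v ↔ v ∈ c.runList h p := by
    intro p
    induction p with
    | zero =>
      intro v
      constructor
      · intro r
        cases r with
        | zero hl =>
          have hl' : c.labelAt h = .W := hl
          simp [runList, hl']
      · intro hv
        by_cases hl : c.labelAt h = .W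
        · simp only [runList, hl, decide_true, cond_true, List.mem_singleton] at hv
          subst hv
          exact .zero hl
        · simp [runList, hl] at hv
    | succ p ih =>
      intro v
      simp only [runList, List.mem_filter, List.mem_range, Bool.and_eq_true, decide_eq_true_eq,
        List.any_eq_true]
      constructor
      · intro r
        cases r with
        | succ r e hl => exact ⟨((edgeB_iff _ _ _).1 e.2).2.1, hl, _, (ih _).1 r, e.2⟩
      · rintro ⟨-, hl, u, hu, e⟩
        exact .succ ((ih u).2 hu) ⟨rfl, e⟩ hl
  rw [key, runB]
  simp

theorem linkB_iff {x h a y : ℕ} : c.topped.graph.IsLink x h a y ↔ c.linkB x h a y = true := by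
  simp only [linkB, Bool.and_eq_true, decide_eq_true_eq, Bool.not_eq_true', decide_eq_false_iff_not,
    List.any_eq_true, List.mem_range, ← runB_iff]
  constructor
  · rintro ⟨h1, h2, h3, h4, u, h5, h6⟩
    exact ⟨h1, h2, h3, h4.2, u, ((edgeB_iff _ _ _).1 h6.2).1, h5, h6.2⟩
  · rintro ⟨h1, h2, h3, h4, u, -, h5, h6⟩
    exact ⟨h1, h2, h3, ⟨rfl, h4⟩, u, h5, rfl, h6⟩

theorem link_lt {x h a y : ℕ} (l : c.topped.graph.IsLink x h a y) : h < c.labels.length :=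
  ((edgeB_iff _ _ _).1 l.2.2.2.1.2).2.1

theorem leB_right_le {a b : ℕ} (h : c.leB a b = true) : b ≤ c.boxes := by
  rw [leB_iff] at h
  omega

theorem insideB_le {b v : ℕ} (h : c.insideB b v = true) : b ≤ c.boxes := by
  rw [insideB_iff] at h
  omega

/-- Both predicates fail beyond the outermost !-box, so a finite test decides their equality. -/
theorem forall_box_iff {p q : ℕ → Bool} (hp : ∀ b, p b = true → b ≤ c.boxes)
    (hq : ∀ b, q b = true → b ≤ c.boxes) :
    (∀ b, p b = true ↔ q b = true) ↔
      ((List.range (c.boxes + 1)).all fun b => decide (p b = q b)) = true := by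
  rw [List.all_eq_true]
  simp only [List.mem_range, decide_eq_true_eq, Nat.lt_succ_iff]
  exact ⟨fun h b _ => Bool.eq_iff_iff.2 (h b), fun h b =>
    ⟨fun hb => h b (hp b hb) ▸ hb, fun hb => (h b (hq b hb)).symm ▸ hb⟩⟩

theorem or_le {b x y : ℕ} (h : (c.insideB b x || c.insideB b y) = true) : b ≤ c.boxes := by
  rcases Bool.or_eq_true_iff.1 h with h | h
  · exact insideB_le h
  · exact insideB_le h

theorem leastB_iff {v a : ℕ} : c.topped.IsLeast v a ↔ c.leastB v a = true :=
  forall_box_iff (fun _ => insideB_le) fun _ => leB_right_le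

theorem ownsB_iff {a x y : ℕ} : c.topped.Owns a x y ↔ c.ownsB a x y = true := by
  refine Iff.trans ?_ (forall_box_iff (fun _ => or_le) fun _ => leB_right_le)
  simp only [Bool.or_eq_true]
  exact Iff.rfl

theorem tightB_iff {x h y : ℕ} : c.topped.IsTight x h y ↔ c.tightB x h y = true := by
  refine Iff.trans ?_ (forall_box_iff (fun _ => insideB_le) fun _ => or_le)
  simp only [Bool.or_eq_true]
  exact Iff.rfl

theorem tightNum_eq (x a y : ℕ) : c.topped.tightCount x a y = c.tightNum x a y := by
  refine ncard_eq_length_filter (fun h => ?_) fun h hh => link_lt hh.1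
  rw [Bool.and_eq_true, linkB_iff, tightB_iff]

theorem looseB_iff {b x h a y : ℕ} : (c.topped.graph.IsLink x h a y ∧ ¬ c.topped.IsTight x h y ∧
    c.topped.IsLeast h b) ↔ c.looseB b x h a y = true := by
  simp only [looseB, Bool.and_eq_true, linkB_iff, tightB_iff, leastB_iff, Bool.not_eq_true',
    Bool.not_eq_true]

theorem looseNum_eq (om : List ℕ) (b x a y : ℕ) :
    c.topped.looseCount (fun h => om.getD h 0 = 1) b x a y = c.looseNum om b x a y := by
  refine ncard_eq_length_filter (fun h => ?_) fun h hh => link_lt hh.1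
  rw [Bool.and_eq_true, ← looseB_iff, decide_eq_true_eq, and_assoc, and_assoc]

theorem allKeys_iff {p : ℕ → ℕ → ℕ → Bool} : c.allKeys p = true ↔
    ∀ x < c.labels.length, ∀ a < c.labels.length, ∀ y < c.labels.length, p x a y = true := by
  simp only [allKeys, List.all_eq_true, List.mem_range]

theorem emitsB_iff (hc : c.topped.IsBounded c.labels.length c.boxes) {om : List ℕ} {b v : ℕ} :
    c.topped.MoveEmits om b v ↔ c.emitsB om b v = true := by
  simp only [emitsB, Bool.and_eq_true, List.all_eq_true, List.mem_range, Bool.or_eq_true,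
    Bool.not_eq_true', Bool.and_eq_false_iff, ← leastB_iff, decide_eq_false_iff_not]
  refine and_congr_right fun _ => ?_
  constructor
  · intro h x hx h' hh a ha y hy p hp
    by_cases hl : c.linkB x h' a y = true
    · by_cases hr : c.runB h' p v = true
      · obtain ⟨h1, h2⟩ := h x h' a y p (linkB_iff.2 hl) (runB_iff.2 hr)
        rw [tightB_iff, Bool.not_eq_true] at h1
        exact .inr ⟨h1, h2⟩
      · exact .inl (.inr (by simpa using hr))
    · exact .inl (.inl (by simpa using hl))
  -- The bounded search is exhaustive: endpoints, heads and lengths of links are below `n`, and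
  -- positions are at most `a`.
  · intro h x h' a y p hl hr
    obtain ⟨hx, ha, hy⟩ := hc.link_lt hl
    have hp := hl.pos_le hc.topped.string hr
    rcases h x hx h' (link_lt hl) a ha y hy p (by omega) with (h1 | h1) | ⟨h1, h2⟩
    · rw [linkB_iff, h1] at hl
      cases hl
    · rw [runB_iff, h1] at hr
      cases hr
    · rw [tightB_iff, h1]
      exact ⟨by simp, h2⟩

theorem not_or_iff {p q : Bool} : (!p || q) = true ↔ (p = true → q = true) := by
  cases p <;> cases q <;> simp

theorem openB_iff (hc : c.topped.IsBounded c.labels.length c.boxes) {om : List ℕ}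
    {s s' : ExpState} :
    c.topped.OpenValid c.labels.length c.boxes om s s' ↔ c.openB om s s' = true := by
  have hcur : s'.1 ≤ c.boxes → ((∀ b, c.topped.le s'.1 b ↔ b = s'.1 ∨ c.topped.le s.1 b) ↔
      ((List.range (c.boxes + 1)).all fun b =>
        decide (c.leB s'.1 b = (decide (b = s'.1) || c.leB s.1 b))) = true) := by
    intro hs
    refine Iff.trans ?_ (forall_box_iff (fun _ => leB_right_le) fun b hb => ?_)
    · simp only [Bool.or_eq_true, decide_eq_true_eq]
      exact Iff.rfl
    · simp only [Bool.or_eq_true, decide_eq_true_eq] at hb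
      rcases hb with rfl | hb
      · exact hs
      · exact leB_right_le hb
  simp only [openB, Bool.and_eq_true, decide_eq_true_eq, Bool.not_eq_true', allKeys_iff,
    not_or_iff, decide_eq_false_iff_not, ← ownsB_iff, ← tightNum_eq, ← looseNum_eq,
    List.all_eq_true (p := fun b => c.allKeys _), List.mem_range]
  constructor
  · intro h
    refine ⟨h.ne_end, h.cur_le, (hcur h.cur_le).1 h.cur, Bool.eq_false_iff.2 h.new, h.own, ?_⟩
    rintro b hb x hx a ha y hy ⟨hsb, ho⟩
    obtain ⟨h1, h2, h3⟩ := h.keep b hsb x hx a ha y hy ho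
    refine ⟨h1, h2, ?_⟩
    rw [List.all_eq_true]
    intro h' _
    rw [not_or_iff, ← looseB_iff, Bool.or_eq_true, decide_eq_true_eq, decide_eq_true_eq]
    rintro ⟨l1, l2, l3⟩
    by_cases hom : om.getD h' 0 = 1
    · exact .inl hom
    · exact .inr (h3 h' l1 l2 l3 hom)
  · rintro ⟨h1, h2, h3, h4, h5, h6⟩
    refine ⟨h1, h2, (hcur h2).2 h3, fun h => ?_, h5, ?_⟩
    · have : c.leB s.1 s'.1 = true := h
      rw [h4] at this
      cases this
    · intro b hsb x hx a ha y hy ho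
      obtain ⟨k1, k2, k3⟩ := h6 b (Nat.lt_succ_of_le (leB_right_le hsb)) x hx a ha y hy ⟨hsb, ho⟩
      refine ⟨k1, k2, fun h' l1 l2 l3 hom => ?_⟩
      rw [List.all_eq_true] at k3
      have := k3 h' (List.mem_range.2 (link_lt l1))
      rw [not_or_iff, ← looseB_iff, Bool.or_eq_true, decide_eq_true_eq, decide_eq_true_eq] at this
      exact (this ⟨l1, l2, l3⟩).resolve_left hom

theorem closeB_iff {s s' : ExpState} :
    c.topped.CloseValid c.labels.length c.boxes s s' ↔ c.closeB s s' = true := by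
  have hcur : (∀ b, c.topped.le s'.1 b ↔ c.topped.le s.1 b ∧ b ≠ s.1) ↔
      ((List.range (c.boxes + 1)).all fun b =>
        decide (c.leB s'.1 b = (c.leB s.1 b && !decide (b = s.1)))) = true := by
    refine Iff.trans ?_ (forall_box_iff (fun _ => leB_right_le) fun b hb => ?_)
    · simp only [Bool.and_eq_true, Bool.not_eq_true', decide_eq_false_iff_not]
      exact Iff.rfl
    · exact leB_right_le (Bool.and_eq_true_iff.1 hb).1
  simp only [closeB, Bool.and_eq_true, decide_eq_true_eq, allKeys_iff,
    not_or_iff, ← ownsB_iff, List.all_eq_true (p := fun b => c.allKeys _), List.mem_range]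
  rw [← hcur]
  constructor
  · intro h
    refine ⟨h.src_le, h.tgt_le, h.cur, h.own, ?_⟩
    rintro b hb x hx a ha y hy ⟨hsb, ho⟩
    exact h.keep b hsb x hx a ha y hy ho
  · rintro ⟨h1, h2, h3, h4, h5⟩
    exact ⟨h1, h2, h3, h4, fun b hsb x hx a ha y hy ho =>
      h5 b (Nat.lt_succ_of_le (leB_right_le hsb)) x hx a ha y hy ⟨hsb, ho⟩⟩

theorem mem_tableList {l : List ℕ} : l ∈ c.tableList ↔ IsTable c.labels.length l :=
  mem_boundedLists

theorem mem_stateList {s : ExpState} :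
    s ∈ c.stateList ↔ IsState c.labels.length c.boxes s := by
  simp only [stateList, List.mem_flatMap, List.mem_map, List.mem_range, mem_tableList]
  constructor
  · rintro ⟨q, hq, g, hg, r, hr, rfl⟩
    exact ⟨Nat.lt_succ_iff.1 hq, hg, hr⟩
  · rintro ⟨h1, h2, h3⟩
    exact ⟨s.1, Nat.lt_succ_of_le h1, s.2.1, h2, s.2.2, h3, rfl⟩

theorem mem_moveList (hc : c.topped.IsBounded c.labels.length c.boxes) {m : ExpMove} :
    m ∈ c.moveList ↔ c.topped.IsMove c.labels.length c.boxes m := by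
  simp only [moveList, List.mem_filter, List.mem_flatMap, List.mem_map, mem_boundedLists,
    mem_stateList]
  constructor
  · rintro ⟨⟨o, -, om, ⟨h1, h2⟩, s, hs, s', hs', rfl⟩, hm⟩
    refine ⟨h1, h2, hs, hs', ?_, ?_⟩
    · rintro ho
      simp only at ho
      subst ho
      exact (openB_iff hc).2 hm
    · rintro ho
      simp only at ho
      subst ho
      simp only [moveB, cond_false, Bool.and_eq_true, not_or_iff, decide_eq_true_eq] at hm
      exact ⟨closeB_iff.2 hm.1, hm.2⟩
  · intro h
    obtain ⟨⟨o, om⟩, s, s'⟩ := m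
    refine ⟨⟨o, by cases o <;> simp, om, ⟨h.length, h.entry⟩, s, h.src, s', h.tgt, rfl⟩, ?_⟩
    rcases o with _ | _
    · simp only [moveB, cond_false, Bool.and_eq_true, not_or_iff, decide_eq_true_eq]
      exact ⟨closeB_iff.1 (h.closes rfl).1, (h.closes rfl).2⟩
    · exact (openB_iff hc).1 (h.opens rfl)

end BangCode

/-! ### The grammar as a finite code -/

namespace BangCode
variable (c : BangCode)

def moveNum (s : ExpState) (x a y : ℕ) : ℕ :=
  bif c.ownsB s.1 x y then keyAt s.2.1 x a y else c.tightNum x a y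

def moveEdgeB (s : ExpState) (x : ℕ) (l : EdgeLabel) (y : ℕ) : Bool :=
  (decide (l = .plain) && c.edgeB x y) || (!decide (x = y) &&
    (List.range c.labels.length).any fun a => (List.range c.labels.length).any fun k =>
      decide (l = .beta (Nat.pair a k)) && decide (k < c.moveNum s x a y))

/-- The nodes of the right-hand side for the move `m`: the nonterminal node `0`, and the node
`v + 1` for every vertex `v` generated by the move. -/
def slots (m : ExpMove) : List ℕ :=
  0 :: bif m.1.1 then
    ((List.range c.labels.length).filter fun v => c.emitsB m.1.2 m.2.2.1 v).map Nat.succ else []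

def slotLabel (m : ExpMove) (k : ℕ) : NodeLabel :=
  bif decide (k = 0) then stateLabel m.2.2 else c.labelAt k.pred

def rhsEdgeB (m : ExpMove) (k : ℕ) (l : EdgeLabel) (k' : ℕ) : Bool :=
  bif decide (k = 0) then
    !decide (k' = 0) && decide (l = alphaLabel k'.pred m.2.2.1 (Encodable.encode m))
  else bif decide (k' = 0) then decide (l = alphaLabel k.pred m.2.2.1 (Encodable.encode m))
  else c.moveEdgeB m.2.2 k.pred l k'.pred

/-- The level after the move `m` of a vertex with level `d` before. -/
def nextLevel (m : ExpMove) (d : ℕ) : ℕ :=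
  bif !m.1.1 && decide (d = m.2.1.1) then m.2.2.1 else d

/-- The label `β` is first decomposed into a vertex `u`, a level `d` and a move. The nonterminal
node receives the same label with the level updated. A generated vertex receives its edges to `u`
only if `d` shows that the sections agree. -/
def connB (m : ExpMove) (β γ : EdgeLabel) (k : ℕ) (dir : Dir) : Bool :=
  (List.range c.labels.length).any fun u => (List.range (c.boxes + 2)).any fun d =>
    c.moveList.any fun p => decide (β = alphaLabel u d (Encodable.encode p)) &&
      bif decide (k = 0) then decide (γ = alphaLabel u (nextLevel m d) (Encodable.encode p))
      else ((List.range (c.boxes + 1)).all fun b =>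
        decide (c.leB d b = (c.insideB b u && c.insideB b k.pred))) &&
        bif decide (dir = .inward) then c.moveEdgeB m.2.2 u γ k.pred
        else c.moveEdgeB m.2.2 k.pred γ u

def finalLabels : List EdgeLabel :=
  .plain :: (List.range c.labels.length).flatMap fun a =>
    (List.range c.labels.length).map fun k => .beta (Nat.pair a k)

def edgeLabelList : List EdgeLabel :=
  c.finalLabels ++ (List.range c.labels.length).flatMap fun u =>
    (List.range (c.boxes + 2)).flatMap fun d =>
      c.moveList.map fun p => alphaLabel u d (Encodable.encode p)

def slotAt (m : ExpMove) (i : ℕ) : ℕ := (c.slots m).getD i 0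

def rhsEdges (m : ExpMove) : List (ℕ × EdgeLabel × ℕ) :=
  ((List.range (c.slots m).length).flatMap fun i => c.edgeLabelList.flatMap fun l =>
    (List.range (c.slots m).length).map fun j => (i, l, j)).filter fun e =>
      c.rhsEdgeB m (c.slotAt m e.1) e.2.1 (c.slotAt m e.2.2)

def rhsConn (m : ExpMove) : List (NodeLabel × EdgeLabel × EdgeLabel × ℕ × Dir) :=
  ([NodeLabel.N, NodeLabel.W].flatMap fun σ => c.edgeLabelList.flatMap fun β =>
    c.edgeLabelList.flatMap fun γ => (List.range (c.slots m).length).flatMap fun i =>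
      [Dir.inward, Dir.outward].map fun dir => (σ, β, γ, i, dir)).filter fun e =>
        c.connB m e.2.1 e.2.2.1 (c.slotAt m e.2.2.2.1) e.2.2.2.2

/-- The production for a move. -/
def prodCode (m : ExpMove) : ProdCode :=
  ⟨stateLabel m.2.1, (c.slots m).map (c.slotLabel m), c.rhsEdges m, c.rhsConn m⟩

/-- The final production. -/
def finalCode : ProdCode := ⟨stateLabel (endState c.labels.length c.boxes), [], [], []⟩

/-- The grammar of the described !-graph. -/
def grammarCode : GrammarCode :=
  ⟨.N :: .W :: c.stateList.map stateLabel, [.N, .W], c.edgeLabelList, c.finalLabels,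
    c.finalCode :: c.moveList.map c.prodCode, stateLabel (startState c.labels.length c.boxes)⟩

variable {c}

theorem mem_finalLabels {l : EdgeLabel} : l ∈ c.finalLabels ↔ l = .plain ∨
    ∃ a < c.labels.length, ∃ k < c.labels.length, l = .beta (Nat.pair a k) := by
  simp only [finalLabels, List.mem_cons, List.mem_flatMap, List.mem_map, List.mem_range, eq_comm]

theorem mem_edgeLabelList (hc : c.topped.IsBounded c.labels.length c.boxes) {l : EdgeLabel} :
    l ∈ c.edgeLabelList ↔ l ∈ c.finalLabels ∨ ∃ u < c.labels.length, ∃ d ≤ c.boxes + 1,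
      ∃ p ∈ c.topped.moveCodes c.labels.length c.boxes, l = alphaLabel u d p := by
  simp only [edgeLabelList, List.mem_append, List.mem_flatMap, List.mem_map, List.mem_range,
    mem_moveList hc, BangData.moveCodes, Set.mem_ofPred_eq, Nat.lt_succ_iff]
  refine or_congr Iff.rfl ⟨?_, ?_⟩
  · rintro ⟨u, hu, d, hd, m, hm, rfl⟩
    exact ⟨u, hu, d, hd, _, ⟨m, hm, rfl⟩, rfl⟩
  · rintro ⟨u, hu, d, hd, _, ⟨m, hm, rfl⟩, rfl⟩
    exact ⟨u, hu, d, hd, m, hm, rfl⟩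

theorem moveNum_eq (s : ExpState) (x a y : ℕ) :
    c.topped.moveCount s x a y = c.moveNum s x a y := by
  unfold BangData.moveCount moveNum
  by_cases h : c.topped.Owns s.1 x y
  · rw [if_pos h, ownsB_iff.1 h, cond_true]
  · rw [if_neg h, tightNum_eq, Bool.eq_false_iff.2 fun h' => h (ownsB_iff.2 h'), cond_false]

/-- The search for `k` may stop at `n`, since no count of a state exceeds `n`. -/
theorem moveEdgeB_iff (hc : c.topped.IsBounded c.labels.length c.boxes) {s : ExpState}
    (hs : IsTable c.labels.length s.2.1) {x : ℕ} {l : EdgeLabel} {y : ℕ} :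
    c.topped.moveEdge c.labels.length s x l y ↔ c.moveEdgeB s x l y = true := by
  simp only [moveEdgeB, Bool.or_eq_true, Bool.and_eq_true, decide_eq_true_eq, Bool.not_eq_true',
    decide_eq_false_iff_not, List.any_eq_true, List.mem_range, ← moveNum_eq]
  refine or_congr Iff.rfl (and_congr_right fun _ => ⟨?_, ?_⟩)
  · rintro ⟨a, k, rfl, ha, hk⟩
    refine ⟨a, ha, k, lt_of_lt_of_le hk ?_, rfl, hk⟩
    unfold BangData.moveCount
    split_ifs
    · exact hs.keyAt_le _ _ _
    · exact BangData.tightCount_le hc _ _ _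
  · rintro ⟨a, ha, k, -, rfl, hk⟩
    exact ⟨a, k, rfl, ha, hk⟩

theorem moveEdgeB_mem (hc : c.topped.IsBounded c.labels.length c.boxes) {s : ExpState} {x : ℕ}
    {l : EdgeLabel} {y : ℕ} (h : c.moveEdgeB s x l y = true) : l ∈ c.edgeLabelList := by
  simp only [moveEdgeB, Bool.or_eq_true, Bool.and_eq_true, decide_eq_true_eq,
    List.any_eq_true, List.mem_range] at h
  rw [mem_edgeLabelList hc, mem_finalLabels]
  left
  rcases h with ⟨h, -⟩ | ⟨-, a, ha, k, hk, rfl, -⟩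
  · exact .inl h
  · exact .inr ⟨a, ha, k, hk, rfl⟩

theorem mem_slots (hc : c.topped.IsBounded c.labels.length c.boxes) {m : ExpMove} {k : ℕ} :
    k ∈ c.slots m ↔ k = 0 ∨
      ∃ v, k = v + 1 ∧ m.1.1 = true ∧ c.topped.MoveEmits m.1.2 m.2.2.1 v ∧
        v < c.labels.length := by
  obtain ⟨⟨o, om⟩, s, s'⟩ := m
  rcases o with _ | _
  · simp [slots]
  · simp only [slots, cond_true, List.mem_cons, List.mem_map, List.mem_filter, List.mem_range,
      ← emitsB_iff hc, true_and]
    refine or_congr Iff.rfl ⟨?_, ?_⟩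
    · rintro ⟨v, ⟨h1, h2⟩, rfl⟩
      exact ⟨v, rfl, h2, h1⟩
    · rintro ⟨v, rfl, h2, h1⟩
      exact ⟨v, ⟨h1, h2⟩, rfl⟩

theorem nodup_slots (m : ExpMove) : (c.slots m).Nodup := by
  obtain ⟨⟨o, om⟩, s, s'⟩ := m
  rcases o with _ | _
  · simp [slots]
  · simp only [slots, cond_true, List.nodup_cons, List.mem_map, not_exists]
    refine ⟨fun v h => Nat.succ_ne_zero v h.2, ?_⟩
    exact (List.nodup_range.filter _).map Nat.succ_injective

theorem slotAt_mem {m : ExpMove} {i : ℕ} (hi : i < (c.slots m).length) :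
    c.slotAt m i ∈ c.slots m := by
  rw [slotAt, List.getD_eq_getElem _ _ hi]
  exact List.getElem_mem hi

theorem slotAt_inj {m : ExpMove} {i j : ℕ} (hi : i < (c.slots m).length)
    (hj : j < (c.slots m).length) (h : c.slotAt m i = c.slotAt m j) : i = j := by
  rw [slotAt, slotAt, List.getD_eq_getElem _ _ hi, List.getD_eq_getElem _ _ hj] at h
  exact (nodup_slots m).getElem_inj_iff.1 h

theorem exists_slotAt {m : ExpMove} {k : ℕ} (hk : k ∈ c.slots m) :
    ∃ i < (c.slots m).length, c.slotAt m i = k := by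
  obtain ⟨i, hi, h⟩ := List.getElem_of_mem hk
  exact ⟨i, hi, by rw [slotAt, List.getD_eq_getElem _ _ hi, h]⟩

/-- The vertex generated as the node `k` of a right-hand side. -/
def slotVertex : ℕ → Option ℕ
  | 0 => none
  | v + 1 => some v

theorem slotVertex_eq_none {k : ℕ} : slotVertex k = none ↔ k = 0 := by
  cases k <;> simp [slotVertex]

theorem slotVertex_eq_some {k v : ℕ} : slotVertex k = some v ↔ k = v + 1 := by
  cases k <;> simp [slotVertex]

theorem slotVertex_injective : Function.Injective slotVertex := by
  rintro (_ | k) (_ | k') h <;> simp [slotVertex] at h ⊢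
  exact h

section

variable {m : ExpMove}

theorem lt_length (x : Fin (c.prodCode m).toProduction.size) : x.val < (c.slots m).length := by
  have := x.2
  simpa [prodCode, ProdCode.toProduction] using this

theorem prodCode_label (x : Fin (c.prodCode m).toProduction.size) :
    (c.prodCode m).toProduction.rhs.label x = c.slotLabel m (c.slotAt m x) := by
  have h : (c.prodCode m).toProduction.rhs.label x =
      ((c.slots m).map (c.slotLabel m))[x.val]'(by simpa using lt_length x) := rfl
  rw [h, List.getElem_map, slotAt, List.getD_eq_getElem _ _ (lt_length x)]

theorem prodCode_edge {x y : Fin (c.prodCode m).toProduction.size} {l : EdgeLabel} :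
    (c.prodCode m).toProduction.rhs.edge x l y ↔ x ≠ y ∧ l ∈ c.edgeLabelList ∧
      c.rhsEdgeB m (c.slotAt m x) l (c.slotAt m y) = true := by
  have h : (c.prodCode m).toProduction.rhs.edge x l y ↔
      x ≠ y ∧ (x.val, l, y.val) ∈ c.rhsEdges m := Iff.rfl
  rw [h]
  simp only [rhsEdges, List.mem_filter, List.mem_flatMap, List.mem_map, List.mem_range]
  refine and_congr_right fun _ => ⟨?_, ?_⟩
  · rintro ⟨⟨i, hi, l', hl, j, hj, heq⟩, h⟩
    cases heq
    exact ⟨hl, h⟩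
  · rintro ⟨hl, h⟩
    exact ⟨⟨_, lt_length x, l, hl, _, lt_length y, rfl⟩, h⟩

theorem prodCode_conn {σ : NodeLabel} {β γ : EdgeLabel}
    {x : Fin (c.prodCode m).toProduction.size} {dir : Dir} :
    (c.prodCode m).toProduction.rhs.conn σ β γ x dir ↔ (σ = .N ∨ σ = .W) ∧
      β ∈ c.edgeLabelList ∧ γ ∈ c.edgeLabelList ∧
      c.connB m β γ (c.slotAt m x) dir = true := by
  have h : (c.prodCode m).toProduction.rhs.conn σ β γ x dir ↔
      (σ, β, γ, x.val, dir) ∈ c.rhsConn m := Iff.rfl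
  rw [h]
  simp only [rhsConn, List.mem_filter, List.mem_flatMap, List.mem_map, List.mem_range]
  constructor
  · rintro ⟨⟨σ', hσ, β', hβ, γ', hγ, i, hi, dir', hd, heq⟩, h⟩
    cases heq
    exact ⟨by simpa using hσ, hβ, hγ, h⟩
  · rintro ⟨hσ, hβ, hγ, h⟩
    exact ⟨⟨σ, by simpa using hσ, β, hβ, γ, hγ, _, lt_length x, dir, by cases dir <;> simp, rfl⟩, h⟩

theorem connB_iff (hc : c.topped.IsBounded c.labels.length c.boxes) {u d p : ℕ}
    (hu : u < c.labels.length) (hd : d ≤ c.boxes + 1)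
    (hp : p ∈ c.topped.moveCodes c.labels.length c.boxes) {γ : EdgeLabel} {k : ℕ} {dir : Dir} :
    c.connB m (alphaLabel u d p) γ k dir = true ↔
      (bif decide (k = 0) then decide (γ = alphaLabel u (nextLevel m d) p)
      else ((List.range (c.boxes + 1)).all fun b =>
        decide (c.leB d b = (c.insideB b u && c.insideB b k.pred))) &&
        bif decide (dir = .inward) then c.moveEdgeB m.2.2 u γ k.pred
        else c.moveEdgeB m.2.2 k.pred γ u) = true := by
  unfold connB
  rw [List.any_eq_true]
  constructor
  · rintro ⟨u', -, h⟩
    rw [List.any_eq_true] at h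
    obtain ⟨d', -, h⟩ := h
    rw [List.any_eq_true] at h
    obtain ⟨p', -, h⟩ := h
    rw [Bool.and_eq_true, decide_eq_true_eq, alphaLabel_inj] at h
    obtain ⟨⟨rfl, rfl, rfl⟩, h⟩ := h
    exact h
  · intro h
    obtain ⟨m', hm', rfl⟩ := hp
    refine ⟨u, List.mem_range.2 hu, ?_⟩
    rw [List.any_eq_true]
    refine ⟨d, List.mem_range.2 (by omega), ?_⟩
    rw [List.any_eq_true]
    refine ⟨m', (mem_moveList hc).2 hm', ?_⟩
    rw [Bool.and_eq_true, decide_eq_true_eq]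
    exact ⟨rfl, h⟩

theorem nextLevel_le (hm : c.topped.IsMove c.labels.length c.boxes m) {d : ℕ}
    (hd : d ≤ c.boxes + 1) : nextLevel m d ≤ c.boxes + 1 := by
  unfold nextLevel
  rcases ho : m.1.1 with _ | _
  · simp only [Bool.not_false, Bool.true_and]
    by_cases h : d = m.2.1.1
    · rw [decide_eq_true h, cond_true]
      exact (hm.closes ho).1.tgt_le
    · rw [decide_eq_false h, cond_false]
      exact hd
  · simpa using hd

theorem isProdOf (hc : c.topped.IsBounded c.labels.length c.boxes)
    (hm : c.topped.IsMove c.labels.length c.boxes m) :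
    c.topped.IsProdOf c.labels.length c.boxes m (c.prodCode m).toProduction where
  lhs := rfl
  opens := by
    intro ho
    have hcode : Encodable.encode m ∈ c.topped.moveCodes c.labels.length c.boxes := ⟨m, hm, rfl⟩
    have hov := hm.opens ho
    have halpha : ∀ v < c.labels.length,
        alphaLabel v m.2.2.1 (Encodable.encode m) ∈ c.edgeLabelList := fun v hv =>
      (mem_edgeLabelList hc).2 (.inr ⟨v, hv, _, hov.cur_le.trans (Nat.le_succ _), _, hcode, rfl⟩)
    have halpha' : ∀ {u d p}, u < c.labels.length → d ≤ c.boxes + 1 →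
        p ∈ c.topped.moveCodes c.labels.length c.boxes → alphaLabel u d p ∈ c.edgeLabelList :=
      fun hu hd hp => (mem_edgeLabelList hc).2 (.inr ⟨_, hu, _, hd, _, hp, rfl⟩)
    have hlt : ∀ (x : Fin (c.prodCode m).toProduction.size) v, c.slotAt m x = v + 1 →
        v < c.labels.length := by
      intro x v hx
      have := slotAt_mem (c := c) (m := m) (lt_length x)
      rw [mem_slots hc, hx] at this
      rcases this with h | ⟨v', h, -, -, hv⟩
      · omega
      · have : v = v' := by omega
        omega
    have hnext : ∀ d, nextLevel m d = d := fun d => by simp [nextLevel, ho]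
    have hne : ∀ (x y : Fin (c.prodCode m).toProduction.size), c.slotAt m x ≠ c.slotAt m y →
        x ≠ y := by
      rintro x _ h rfl
      exact h rfl
    have hand : ∀ {d u v : ℕ}, ((List.range (c.boxes + 1)).all fun b =>
        decide (c.leB d b = (c.insideB b u && c.insideB b v))) = true ↔
        ∀ b, c.topped.le d b ↔ u ∈ c.topped.content b ∧ v ∈ c.topped.content b := by
      intro d u v
      refine Iff.trans (forall_box_iff (fun _ => leB_right_le) fun b hb =>
        insideB_le (Bool.and_eq_true_iff.1 hb).1).symm ?_
      simp only [Bool.and_eq_true]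
      exact Iff.rfl
    refine ⟨fun x => slotVertex (c.slotAt m x), ?_, ?_, ?_, ?_, ?_, ?_, ?_, ?_, ?_⟩
    · intro x y h
      exact Fin.ext (slotAt_inj (lt_length x) (lt_length y) (slotVertex_injective h))
    · intro o
      have key : ∀ k, k ∈ c.slots m → slotVertex k = o →
          ∃ x : Fin (c.prodCode m).toProduction.size, slotVertex (c.slotAt m x) = o := by
        intro k hk hko
        obtain ⟨i, hi, h⟩ := exists_slotAt hk
        exact ⟨⟨i, by simpa [prodCode, ProdCode.toProduction] using hi⟩, by rw [h, hko]⟩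
      constructor
      · rintro ⟨x, hx⟩ v rfl
        have := slotAt_mem (c := c) (m := m) (lt_length x)
        rw [slotVertex_eq_some] at hx
        rw [mem_slots hc, hx] at this
        rcases this with h | ⟨v', h, -, hv, -⟩
        · omega
        · rwa [show v = v' by omega]
      · intro h
        rcases o with _ | v
        · exact key 0 ((mem_slots hc).2 (.inl rfl)) rfl
        · refine key (v + 1) ((mem_slots hc).2 (.inr ⟨v, rfl, ho, h v rfl, ?_⟩)) rfl
          exact hc.vert_lt _ (((h v rfl).1 _).2 ((hc.box_iff _).2 hov.cur_le))
    · intro x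
      rw [prodCode_label]
      cases c.slotAt m x <;> rfl
    · intro x y v u l hx hy
      rw [slotVertex_eq_some] at hx hy
      rw [prodCode_edge, hx, hy, moveEdgeB_iff hc hm.tgt.left]
      simp only [rhsEdgeB, Nat.succ_ne_zero, decide_false, cond_false, Nat.pred_succ]
      constructor
      · exact fun h => h.2.2
      · intro h
        refine ⟨?_, moveEdgeB_mem hc h, h⟩
        rintro rfl
        have hvu : v = u := by omega
        subst hvu
        rw [← moveEdgeB_iff hc hm.tgt.left] at h
        rcases h with h | h
        · exact c.topped.graph.irrefl _ _ h
        · exact h.1 rfl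
    · intro x y v l hx hy
      rw [slotVertex_eq_some] at hx
      rw [slotVertex_eq_none] at hy
      rw [prodCode_edge, hx, hy]
      simp only [rhsEdgeB, Nat.succ_ne_zero, decide_false, cond_false, Nat.pred_succ,
        decide_true, cond_true, decide_eq_true_eq]
      constructor
      · exact fun h => h.2.2
      · rintro rfl
        exact ⟨hne x y (by omega), halpha v (hlt x v hx), rfl⟩
    · intro x y v l hx hy
      rw [slotVertex_eq_none] at hx
      rw [slotVertex_eq_some] at hy
      rw [prodCode_edge, hx, hy]
      simp only [rhsEdgeB, Nat.succ_ne_zero, decide_false, Nat.pred_succ,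
        decide_true, cond_true, decide_eq_true_eq, Bool.not_false, Bool.true_and]
      constructor
      · exact fun h => h.2.2
      · rintro rfl
        exact ⟨hne x y (by omega), halpha v (hlt y v hy), rfl⟩
    · intro σ hσ u hu d hd p hp l x dir hx
      rw [slotVertex_eq_none] at hx
      rw [prodCode_conn, hx, connB_iff hc hu hd hp]
      simp only [decide_true, cond_true, decide_eq_true_eq, hnext]
      constructor
      · exact fun h => h.2.2.2
      · rintro rfl
        exact ⟨hσ, halpha' hu hd hp, halpha' hu hd hp, rfl⟩
    · intro σ hσ u hu d hd p hp l x v hx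
      rw [slotVertex_eq_some] at hx
      rw [prodCode_conn, hx, connB_iff hc hu hd hp, moveEdgeB_iff hc hm.tgt.left]
      simp only [Nat.succ_ne_zero, decide_false, cond_false, Nat.pred_succ, Bool.and_eq_true,
        decide_true, cond_true, hand]
      constructor
      · exact fun h => h.2.2.2
      · exact fun h => ⟨hσ, halpha' hu hd hp, moveEdgeB_mem hc h.2, h⟩
    · intro σ hσ u hu d hd p hp l x v hx
      rw [slotVertex_eq_some] at hx
      rw [prodCode_conn, hx, connB_iff hc hu hd hp, moveEdgeB_iff hc hm.tgt.left]
      simp only [Nat.succ_ne_zero, decide_false, cond_false, Nat.pred_succ, Bool.and_eq_true,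
        reduceCtorEq, hand]
      constructor
      · exact fun h => h.2.2.2
      · exact fun h => ⟨hσ, halpha' hu hd hp, moveEdgeB_mem hc h.2, h⟩
  closes := by
    intro ho
    have hs : c.slots m = [0] := by simp [slots, ho]
    have hx : ∀ x : Fin (c.prodCode m).toProduction.size, x.val = 0 ∧ c.slotAt m x = 0 := by
      intro x
      have := lt_length x
      rw [hs] at this
      have h0 : x.val = 0 := by simpa using this
      exact ⟨h0, by rw [h0, slotAt, hs]; rfl⟩
    have hnext : ∀ d, nextLevel m d = if d = m.2.1.1 then m.2.2.1 else d := by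
      intro d
      by_cases h : d = m.2.1.1 <;> simp [nextLevel, ho, h]
    refine ⟨⟨⟨0, by simp [prodCode, ProdCode.toProduction, hs]⟩, fun y => Fin.ext (hx y).1⟩, ?_, ?_⟩
    · intro x
      rw [prodCode_label, (hx x).2]
      rfl
    · intro σ hσ u hu d hd p hp l x dir
      rw [prodCode_conn, (hx x).2, connB_iff hc hu hd hp]
      simp only [decide_true, cond_true, decide_eq_true_eq, ← hnext]
      constructor
      · exact fun h => h.2.2.2
      · rintro rfl
        exact ⟨hσ, (mem_edgeLabelList hc).2 (.inr ⟨_, hu, _, hd, _, hp, rfl⟩),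
          (mem_edgeLabelList hc).2 (.inr ⟨_, hu, _, nextLevel_le hm hd, _, hp, rfl⟩), rfl⟩

end

end BangCode
-- The grammar is in !-linear form
namespace BangCode

variable {c : BangCode} {m : ExpMove}

theorem labelAt_mem (hc : c.topped.IsBounded c.labels.length c.boxes) (v : ℕ) :
    c.labelAt v = .N ∨ c.labelAt v = .W :=
  hc.topped.string.label_mem v

theorem slotLabel_cases (hc : c.topped.IsBounded c.labels.length c.boxes) (k : ℕ) :
    k = 0 ∧ c.slotLabel m k = stateLabel m.2.2 ∨
      k ≠ 0 ∧ (c.slotLabel m k = .N ∨ c.slotLabel m k = .W) := by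
  rcases k with _ | k
  · exact .inl ⟨rfl, rfl⟩
  · exact .inr ⟨Nat.succ_ne_zero k, labelAt_mem hc k⟩

theorem slot_eq_zero (hc : c.topped.IsBounded c.labels.length c.boxes)
    {x : Fin (c.prodCode m).toProduction.size}
    (h : ¬ ((c.prodCode m).toProduction.rhs.label x = .N ∨
      (c.prodCode m).toProduction.rhs.label x = .W)) : c.slotAt m x = 0 := by
  rw [prodCode_label] at h
  rcases slotLabel_cases (m := m) hc (c.slotAt m x) with h' | h'
  · exact h'.1
  · exact absurd h'.2 h

theorem slot_ne_zero (hc : c.topped.IsBounded c.labels.length c.boxes)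
    {x : Fin (c.prodCode m).toProduction.size}
    (h : (c.prodCode m).toProduction.rhs.label x = .N ∨
      (c.prodCode m).toProduction.rhs.label x = .W) : c.slotAt m x ≠ 0 := by
  rw [prodCode_label] at h
  rcases slotLabel_cases (m := m) hc (c.slotAt m x) with h' | h'
  · rw [h'.2] at h
    rcases h with h | h <;> cases h
  · exact h'.1

theorem mem_prods {p : Production NodeLabel EdgeLabel}
    (hp : ∃ q ∈ c.grammarCode.prods, q.toProduction = p) :
    p = c.finalCode.toProduction ∨ ∃ m ∈ c.moveList, p = (c.prodCode m).toProduction := by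
  obtain ⟨q, hq, rfl⟩ := hp
  rcases List.mem_cons.1 hq with rfl | hq
  · exact .inl rfl
  · obtain ⟨m, hm, rfl⟩ := List.mem_map.1 hq
    exact .inr ⟨m, hm, rfl⟩

theorem mem_nodeLabels {σ : NodeLabel} : σ ∈ c.grammarCode.nodeLabels ↔
    σ = .N ∨ σ = .W ∨ ∃ s, IsState c.labels.length c.boxes s ∧ stateLabel s = σ := by
  simp only [grammarCode, List.mem_cons, List.mem_map, mem_stateList]

theorem mem_terminals {σ : NodeLabel} : σ ∈ c.grammarCode.terminals ↔ σ = .N ∨ σ = .W := by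
  simp [grammarCode]

theorem isState_endState (n N : ℕ) : IsState n N (endState n N) :=
  ⟨Nat.le_succ _, isTable_zeroTable n, isTable_zeroTable n⟩

theorem isState_startState (n N : ℕ) : IsState n N (startState n N) :=
  ⟨le_rfl, isTable_zeroTable n, isTable_zeroTable n⟩

theorem stateLabel_mem {s : ExpState} (hs : IsState c.labels.length c.boxes s) :
    stateLabel s ∈ {σ | σ ∈ c.grammarCode.nodeLabels} \ {σ | σ ∈ c.grammarCode.terminals} := by
  refine ⟨mem_nodeLabels.2 (.inr (.inr ⟨s, hs, rfl⟩)), fun h => ?_⟩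
  rcases mem_terminals.1 h with h | h <;> cases h

/-- The grammar of the described !-graph. -/
def grammar (hc : c.topped.IsBounded c.labels.length c.boxes) : EdNCE NodeLabel EdgeLabel where
  nodeLabels := {σ | σ ∈ c.grammarCode.nodeLabels}
  terminals := {σ | σ ∈ c.grammarCode.terminals}
  edgeLabels := {γ | γ ∈ c.grammarCode.edgeLabels}
  finals := {γ | γ ∈ c.grammarCode.finals}
  prods := {p | ∃ q ∈ c.grammarCode.prods, q.toProduction = p}
  start := c.grammarCode.start
  nodeLabels_finite := List.finite_toSet _
  edgeLabels_finite := List.finite_toSet _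
  prods_finite := (List.finite_toSet c.grammarCode.prods).image ProdCode.toProduction
  terminals_subset σ hσ := by
    rcases mem_terminals.1 hσ with h | h
    · exact mem_nodeLabels.2 (.inl h)
    · exact mem_nodeLabels.2 (.inr (.inl h))
  finals_subset γ hγ := (mem_edgeLabelList hc).2 (.inl hγ)
  start_mem := stateLabel_mem (isState_startState _ _)
  lhs_mem p hp := by
    rcases mem_prods hp with rfl | ⟨m, hm, rfl⟩
    · exact stateLabel_mem (isState_endState _ _)
    · exact stateLabel_mem ((mem_moveList hc).1 hm).src
  rhs_over p hp := by
    rcases mem_prods hp with rfl | ⟨m, hm, rfl⟩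
    · exact ⟨fun x => x.elim0, fun x => x.elim0⟩
    · constructor
      · intro x
        rw [prodCode_label]
        rcases slotLabel_cases (m := m) hc (c.slotAt m x) with h | h
        · rw [h.2]
          exact (stateLabel_mem ((mem_moveList hc).1 hm).tgt).1
        · rcases h.2 with h | h
          · exact mem_nodeLabels.2 (.inl h)
          · exact mem_nodeLabels.2 (.inr (.inl h))
      · intro x γ y h
        exact (prodCode_edge.1 h).2.1
  conn_over p hp := by
    rcases mem_prods hp with rfl | ⟨m, hm, rfl⟩
    · exact fun σ β γ x => x.elim0
    · intro σ β γ x d h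
      obtain ⟨h1, h2, h3, -⟩ := prodCode_conn.1 h
      refine ⟨?_, h2, h3⟩
      rcases h1 with h | h
      · exact mem_nodeLabels.2 (.inl h)
      · exact mem_nodeLabels.2 (.inr (.inl h))

theorem describes (hc : c.topped.IsBounded c.labels.length c.boxes) :
    c.grammarCode.Describes (grammar hc) :=
  ⟨rfl, rfl, rfl, rfl, rfl, rfl⟩

theorem alpha_notMem_finals (hc : c.topped.IsBounded c.labels.length c.boxes) (i : ℕ) :
    EdgeLabel.alpha i ∉ (grammar hc).finals := by
  intro h
  rcases mem_finalLabels.1 h with h | ⟨a, -, k, -, h⟩ <;> cases h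

theorem isExploration (hc : c.topped.IsBounded c.labels.length c.boxes) :
    c.topped.IsExploration c.labels.length c.boxes (grammar hc) where
  terminals := Set.ext fun _ => mem_terminals
  plain_mem := mem_finalLabels.2 (.inl rfl)
  beta_mem a ha k hk := mem_finalLabels.2 (.inr ⟨a, ha, k, hk, rfl⟩)
  start := rfl
  sound p hp := by
    rcases mem_prods hp with rfl | ⟨m, hm, rfl⟩
    · exact .inl ⟨rfl, rfl⟩
    · have := (mem_moveList hc).1 hm
      exact .inr ⟨m, this, isProdOf hc this⟩
  final := ⟨_, ⟨c.finalCode, by simp [grammarCode], rfl⟩, rfl, rfl⟩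
  move m hm := by
    refine ⟨_, ⟨c.prodCode m, ?_, rfl⟩, isProdOf hc hm⟩
    exact List.mem_cons_of_mem _ (List.mem_map.2 ⟨m, (mem_moveList hc).2 hm, rfl⟩)

theorem isLinear (hc : c.topped.IsBounded c.labels.length c.boxes) : (grammar hc).IsLinear := by
  intro p hp x y hx hy
  rcases mem_prods hp with rfl | ⟨m, hm, rfl⟩
  · exact x.elim0
  · have h1 := slot_eq_zero hc fun h => hx (mem_terminals.2 h)
    have h2 := slot_eq_zero hc fun h => hy (mem_terminals.2 h)
    exact Fin.ext (slotAt_inj (lt_length x) (lt_length y) (h1.trans h2.symm))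

/-- The edges between generated vertices carry plain or `β` labels, so an `α` edge leads to the
nonterminal node, and its label names the vertex, its !-box and the move. -/
theorem alphaLabel_of_edge (hc : c.topped.IsBounded c.labels.length c.boxes) {i : ℕ}
    {x : Fin (c.prodCode m).toProduction.size}
    (hx : (c.prodCode m).toProduction.rhs.label x ∈ (grammar hc).terminals)
    (h : ∃ u, (c.prodCode m).toProduction.rhs.edge x (EdgeLabel.alpha i) u ∨
      (c.prodCode m).toProduction.rhs.edge u (EdgeLabel.alpha i) x) :
    EdgeLabel.alpha i = alphaLabel (c.slotAt m x).pred m.2.2.1 (Encodable.encode m) := by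
  have hx0 := slot_ne_zero hc (mem_terminals.1 hx)
  have hno : ∀ k k', c.moveEdgeB m.2.2 k (EdgeLabel.alpha i) k' ≠ true := by
    intro k k' h
    simp [moveEdgeB] at h
  obtain ⟨u, h | h⟩ := h
  · have h := (prodCode_edge.1 h).2.2
    rw [rhsEdgeB, decide_eq_false hx0, cond_false] at h
    by_cases hu : c.slotAt m u = 0
    · rw [decide_eq_true hu, cond_true, decide_eq_true_eq] at h
      exact h
    · rw [decide_eq_false hu, cond_false] at h
      exact absurd h (hno _ _)
  · have h := (prodCode_edge.1 h).2.2
    rw [rhsEdgeB, decide_eq_false hx0] at h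
    by_cases hu : c.slotAt m u = 0
    · rw [decide_eq_true hu, cond_true, Bool.and_eq_true, decide_eq_true_eq] at h
      exact h.2
    · rw [decide_eq_false hu, cond_false, cond_false] at h
      exact absurd h (hno _ _)

/-- By `sentential_cases` a sentential form with a nonterminal node is that of an exploration, where
each generated vertex is joined to it by exactly one label in each direction. -/
theorem connected_alpha (hc : c.topped.IsBounded c.labels.length c.boxes) {V : Type}
    {K : EGraph NodeLabel EdgeLabel V} (hK : (grammar hc).Sentential K) {x y : V}
    (hx : K.label x ∉ (grammar hc).terminals) (hy : K.label y ∈ (grammar hc).terminals) :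
    ∃ i, ∀ γ, (K.edge x γ y ↔ γ = EdgeLabel.alpha i) ∧ (K.edge y γ x ↔ γ = EdgeLabel.alpha i) := by
  have hx' := fun h => hx (mem_terminals.2 h)
  have hy' := mem_terminals.1 hy
  obtain ⟨A, -, ⟨o, lev, s, hcfg⟩ | ⟨-, -, -, -, -, -, e, -, hl⟩⟩ :=
    BangData.sentential_cases hc (isExploration hc) hK
  · obtain ⟨e, he, hl⟩ := hcfg.iso
    rw [hl] at hx' hy'
    rcases hex : (e x).1 with _ | p
    · rcases hey : (e y).1 with _ | ⟨u, j⟩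
      · simp only [BangData.sentential, hey, Option.elim] at hy'
        rcases hy' with h | h <;> cases h
      · refine ⟨Nat.pair u (Nat.pair (lev j) (BangData.pathCode j)), fun γ => ?_⟩
        rw [he, he]
        simp only [BangData.sentential, hex, hey]
        exact ⟨Iff.rfl, Iff.rfl⟩
    · simp only [BangData.sentential, hex] at hx'
      exact absurd (hc.topped.string.label_mem _) hx'
  · rw [hl] at hx'
    exact absurd (hc.topped.string.label_mem _) hx'

/-- Uniqueness of `α` labels holds because they contain the code of the move and the vertex; they
are passed on with the same vertex and move and a possibly changed level, the same in both
directions. -/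
theorem isBangLinear (hc : c.topped.IsBounded c.labels.length c.boxes) :
    (grammar hc).IsBangLinear where
  alpha_not_final := alpha_notMem_finals hc
  linear := isLinear hc
  final_unique := by
    refine ⟨c.finalCode.toProduction, ⟨⟨c.finalCode, by simp [grammarCode], rfl⟩,
      fun x => x.elim0⟩, ?_⟩
    rintro p ⟨hp, hall⟩
    rcases mem_prods hp with rfl | ⟨m, hm, rfl⟩
    · rfl
    · exfalso
      -- Slot `0`, the nonterminal node, is present for every move, so the production of a move is
      -- never final.
      obtain ⟨i, hi, h0⟩ := exists_slotAt (m := m) ((mem_slots hc).2 (.inl rfl))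
      exact slot_ne_zero hc (x := ⟨i, by simpa [prodCode, ProdCode.toProduction] using hi⟩)
        (mem_terminals.1 (hall _)) h0
  final_empty p hp := by
    obtain ⟨hp, hall⟩ := hp
    rcases mem_prods hp with rfl | ⟨m, hm, rfl⟩
    · rfl
    · exfalso
      obtain ⟨i, hi, h0⟩ := exists_slotAt (m := m) ((mem_slots hc).2 (.inl rfl))
      exact slot_ne_zero hc (x := ⟨i, by simpa [prodCode, ProdCode.toProduction] using hi⟩)
        (mem_terminals.1 (hall _)) h0
  connected V K hK x y hx hy := by
    obtain ⟨i, hi⟩ := connected_alpha hc hK hx hy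
    exact ⟨i, (hi _).1.2 rfl, (hi _).2.2 rfl⟩
  connected_label V K hK x y γ hx hy h := by
    obtain ⟨i, hi⟩ := connected_alpha hc hK hx hy
    exact ⟨i, h.elim (hi _).1.1 (hi _).2.1⟩
  passes p hp x hx σ hσ i hi := by
    rcases mem_prods hp with rfl | ⟨m, hm, rfl⟩
    · exact x.elim0
    · have h0 := slot_eq_zero hc fun h => hx (mem_terminals.2 h)
      rcases (mem_edgeLabelList hc).1 hi with h | ⟨u, hu, d, hd, k, hk, h⟩
      · exact absurd h (alpha_notMem_finals hc i)
      · have hd' := nextLevel_le ((mem_moveList hc).1 hm) hd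
        refine ⟨_, fun dir => prodCode_conn.2 ⟨mem_terminals.1 hσ, hi,
          (mem_edgeLabelList hc).2 (.inr ⟨u, hu, nextLevel m d, hd', k, hk, rfl⟩), ?_⟩⟩
        rw [h, connB_iff hc hu hd hk, h0]
        exact decide_eq_true rfl
  alpha_unique p hp q hq i x y hx hy hex hey := by
    rcases mem_prods hp with rfl | ⟨m, hm, rfl⟩
    · exact x.elim0
    rcases mem_prods hq with rfl | ⟨m', hm', rfl⟩
    · exact y.elim0
    have h1 := alphaLabel_of_edge hc hx hex
    have h2 := alphaLabel_of_edge hc hy hey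
    rw [h1, alphaLabel_inj] at h2
    have hmm := Encodable.encode_injective h2.2.2
    subst hmm
    have h3 := slot_ne_zero hc (mem_terminals.1 hx)
    have h4 := slot_ne_zero hc (mem_terminals.1 hy)
    refine ⟨rfl, slotAt_inj (lt_length x) (lt_length y) ?_⟩
    exact Nat.pred_inj (Nat.pos_of_ne_zero h3) (Nat.pos_of_ne_zero h4) h2.1

/-- Every finite !-graph has a description. -/
theorem exists_describes {V B : Type} [Finite V] [Finite B] (H : BangData V B) :
    ∃ c : BangCode, c.Describes H := by
  obtain ⟨n, ⟨e⟩⟩ := Finite.exists_equiv_fin V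
  obtain ⟨N, ⟨d⟩⟩ := Finite.exists_equiv_fin B
  have hpairs : ∀ {k l : ℕ} (R : Fin k → Fin l → Prop), ∃ L : List (ℕ × ℕ),
      ∀ x y, R x y ↔ (x.val, y.val) ∈ L := by
    intro k l R
    have hfin : {q : Fin k × Fin l | R q.1 q.2}.Finite := Set.toFinite _
    refine ⟨hfin.toFinset.toList.map fun q => (q.1.val, q.2.val), fun x y => ?_⟩
    simp only [List.mem_map, Finset.mem_toList, Set.Finite.mem_toFinset, Set.mem_ofPred_eq,
      Prod.mk.injEq, Prod.exists]
    constructor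
    · exact fun h => ⟨x, y, h, rfl, rfl⟩
    · rintro ⟨x', y', h, h1, h2⟩
      rwa [← Fin.ext h1, ← Fin.ext h2]
  obtain ⟨E, hE⟩ := hpairs fun x y => H.graph.edge (e.symm x) .plain (e.symm y)
  obtain ⟨L, hL⟩ := hpairs fun a b => H.le (d.symm a) (d.symm b)
  obtain ⟨S, hS⟩ := hpairs fun b v => e.symm v ∈ H.content (d.symm b)
  refine ⟨⟨List.ofFn fun v => H.graph.label (e.symm v), E, N, L, S⟩,
    e.trans (finCongr (by simp)), d, ?_, ?_, ?_, ?_⟩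
  · intro v
    simp
  · intro x y
    simpa using hE (e x) (e y)
  · intro a b
    simpa using hL (d a) (d b)
  · intro b v
    simpa using hS (d b) (e v)

end BangCode

/-- The grammar of a !-graph with trivial overlap. -/
theorem exists_grammar {V B : Type} [Finite B] {H : BangData V B} (hH : H.IsBangGraph)
    (ht : H.HasTrivialOverlap) {c : BangCode} (hc : c.Describes H) :
    ∃ G : EdNCE NodeLabel EdgeLabel, c.grammarCode.Describes G ∧ G.IsLinear ∧ G.IsBangLinear ∧
      EqUpToWireEncoding G.language H.language := by
  obtain ⟨e, d, h1, h2, h3, h4⟩ := hc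
  have hcor := BangData.isCorrespondence hH h1 h2 h3 h4
  have hb := hcor.isBounded hH ht
  exact ⟨BangCode.grammar hb, BangCode.describes hb, BangCode.isLinear hb, BangCode.isBangLinear hb,
    hcor.eqUpToWireEncoding hH ht (BangCode.isExploration hb)⟩

-- The grammar code is a primitive recursive function of the description

attribute [fun_prop] Primrec

namespace PrimrecComp

variable {α β γ σ : Type} [Primcodable α] [Primcodable β] [Primcodable γ] [Primcodable σ]

@[fun_prop] theorem id : Primrec fun x : α => x := Primrec.id

@[fun_prop] theorem const (y : β) : Primrec fun _ : α => y := Primrec.const y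

@[fun_prop] theorem comp {f : β → γ} {g : α → β} (hf : Primrec f) (hg : Primrec g) :
    Primrec fun x => f (g x) := hf.comp hg

@[fun_prop] theorem fst {f : α → β × γ} (hf : Primrec f) : Primrec fun x => (f x).1 :=
  Primrec.fst.comp hf

@[fun_prop] theorem snd {f : α → β × γ} (hf : Primrec f) : Primrec fun x => (f x).2 :=
  Primrec.snd.comp hf

@[fun_prop] theorem prodMk {f : α → β} {g : α → γ} (hf : Primrec f) (hg : Primrec g) :
    Primrec fun x => (f x, g x) := hf.pair hg

@[fun_prop] theorem and {f g : α → Bool} (hf : Primrec f) (hg : Primrec g) :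
    Primrec fun x => f x && g x := Primrec.and.comp hf hg

@[fun_prop] theorem or {f g : α → Bool} (hf : Primrec f) (hg : Primrec g) :
    Primrec fun x => f x || g x := Primrec.or.comp hf hg

@[fun_prop] theorem not {f : α → Bool} (hf : Primrec f) : Primrec fun x => !f x :=
  Primrec.not.comp hf

@[fun_prop] theorem cond {p : α → Bool} {f g : α → β} (hp : Primrec p) (hf : Primrec f)
    (hg : Primrec g) : Primrec fun x => bif p x then f x else g x := Primrec.cond hp hf hg

@[fun_prop] theorem decide_eq {f g : α → β} {d : DecidableEq β} (hf : Primrec f)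
    (hg : Primrec g) : Primrec fun x => decide (f x = g x) := by
  have : PrimrecPred fun x => f x = g x := Primrec.eq.comp hf hg
  obtain ⟨h, hp⟩ := this
  exact hp.of_eq fun x => by congr

@[fun_prop] theorem decide_le {f g : α → ℕ} (hf : Primrec f) (hg : Primrec g) :
    Primrec fun x => decide (f x ≤ g x) := by
  have : PrimrecPred fun x => f x ≤ g x := Primrec.nat_le.comp hf hg
  obtain ⟨h, hp⟩ := this
  exact hp.of_eq fun x => by congr

@[fun_prop] theorem succ {f : α → ℕ} (hf : Primrec f) : Primrec fun x => Nat.succ (f x) :=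
  Primrec.succ.comp hf

@[fun_prop] theorem pred {f : α → ℕ} (hf : Primrec f) : Primrec fun x => Nat.pred (f x) :=
  Primrec.pred.comp hf

@[fun_prop] theorem add {f g : α → ℕ} (hf : Primrec f) (hg : Primrec g) :
    Primrec fun x => f x + g x := Primrec.nat_add.comp hf hg

@[fun_prop] theorem natPair {f g : α → ℕ} (hf : Primrec f) (hg : Primrec g) :
    Primrec fun x => Nat.pair (f x) (g x) := Primrec₂.natPair.comp hf hg

@[fun_prop] theorem encode {f : α → β} (hf : Primrec f) :
    Primrec fun x => Encodable.encode (f x) := Primrec.encode.comp hf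

@[fun_prop] theorem range {f : α → ℕ} (hf : Primrec f) : Primrec fun x => List.range (f x) :=
  Primrec.list_range.comp hf

@[fun_prop] theorem cons {f : α → β} {l : α → List β} (hf : Primrec f) (hl : Primrec l) :
    Primrec fun x => f x :: l x := Primrec.list_cons.comp hf hl

@[fun_prop] theorem append {l l' : α → List β} (hl : Primrec l) (hl' : Primrec l') :
    Primrec fun x => l x ++ l' x := Primrec.list_append.comp hl hl'

@[fun_prop] theorem length {l : α → List β} (hl : Primrec l) : Primrec fun x => (l x).length :=
  Primrec.list_length.comp hl

@[fun_prop] theorem getD {l : α → List β} {f : α → ℕ} (y : β) (hl : Primrec l)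
    (hf : Primrec f) : Primrec fun x => (l x).getD (f x) y :=
  (Primrec.list_getD y).comp hl hf

@[fun_prop] theorem map {l : α → List β} {f : α → β → γ} (hl : Primrec l)
    (hf : Primrec fun p : α × β => f p.1 p.2) : Primrec fun x => (l x).map fun y => f x y :=
  Primrec.list_map hl hf

@[fun_prop] theorem flatMap {l : α → List β} {f : α → β → List γ} (hl : Primrec l)
    (hf : Primrec fun p : α × β => f p.1 p.2) : Primrec fun x => (l x).flatMap fun y => f x y :=
  Primrec.list_flatMap hl hf

@[fun_prop] theorem filter {l : α → List β} {f : α → β → Bool} (hl : Primrec l)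
    (hf : Primrec fun p : α × β => f p.1 p.2) : Primrec fun x => (l x).filter fun y => f x y := by
  refine (flatMap (f := fun x y => bif f x y then [y] else []) hl (by fun_prop)).of_eq fun x => ?_
  induction l x with
  | nil => rfl
  | cons y l ih => cases h : f x y <;> simp [h, ih]

@[fun_prop] theorem any {l : α → List β} {f : α → β → Bool} (hl : Primrec l)
    (hf : Primrec fun p : α × β => f p.1 p.2) : Primrec fun x => (l x).any fun y => f x y := by
  refine Primrec.of_eq (f := fun x => !decide (((l x).filter fun y => f x y).length = 0))
    (by fun_prop) fun x => ?_
  induction l x with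
  | nil => rfl
  | cons y l ih => cases h : f x y <;> simp_all

@[fun_prop] theorem all {l : α → List β} {f : α → β → Bool} (hl : Primrec l)
    (hf : Primrec fun p : α × β => f p.1 p.2) : Primrec fun x => (l x).all fun y => f x y := by
  refine Primrec.of_eq (f := fun x => !((l x).any fun y => !f x y)) (by fun_prop) fun x => ?_
  simp [List.all_eq_not_any_not]

/-! ### Labels and codes -/

@[fun_prop] theorem other {f : α → ℕ} (hf : Primrec f) : Primrec fun x => NodeLabel.other (f x) :=
  (Primrec.of_equiv_symm (e := NodeLabel.equivSum)).comp (Primrec.sumInr.comp hf)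

@[fun_prop] theorem alpha {f : α → ℕ} (hf : Primrec f) : Primrec fun x => EdgeLabel.alpha (f x) :=
  (Primrec.of_equiv_symm (e := EdgeLabel.equivSum)).comp
    (Primrec.sumInr.comp (Primrec.sumInl.comp hf))

@[fun_prop] theorem beta {f : α → ℕ} (hf : Primrec f) : Primrec fun x => EdgeLabel.beta (f x) :=
  (Primrec.of_equiv_symm (e := EdgeLabel.equivSum)).comp
    (Primrec.sumInr.comp (Primrec.sumInr.comp hf))

theorem bangCode_equivProd {c : α → BangCode} (hc : Primrec c) :
    Primrec fun x => BangCode.equivProd (c x) := Primrec.of_equiv.comp hc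

@[fun_prop] theorem labels {c : α → BangCode} (hc : Primrec c) : Primrec fun x => (c x).labels :=
  Primrec.fst.comp (bangCode_equivProd hc)

@[fun_prop] theorem edges {c : α → BangCode} (hc : Primrec c) : Primrec fun x => (c x).edges :=
  (Primrec.fst.comp Primrec.snd).comp (bangCode_equivProd hc)

@[fun_prop] theorem boxes {c : α → BangCode} (hc : Primrec c) : Primrec fun x => (c x).boxes :=
  (Primrec.fst.comp (Primrec.snd.comp Primrec.snd)).comp (bangCode_equivProd hc)

@[fun_prop] theorem nested {c : α → BangCode} (hc : Primrec c) : Primrec fun x => (c x).nested :=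
  (Primrec.fst.comp (Primrec.snd.comp (Primrec.snd.comp Primrec.snd))).comp (bangCode_equivProd hc)

@[fun_prop] theorem inside {c : α → BangCode} (hc : Primrec c) : Primrec fun x => (c x).inside :=
  (Primrec.snd.comp (Primrec.snd.comp (Primrec.snd.comp Primrec.snd))).comp (bangCode_equivProd hc)

@[fun_prop] theorem prodCode_mk {a : α → NodeLabel} {l : α → List NodeLabel}
    {e : α → List (ℕ × EdgeLabel × ℕ)}
    {k : α → List (NodeLabel × EdgeLabel × EdgeLabel × ℕ × Dir)}
    (ha : Primrec a) (hl : Primrec l) (he : Primrec e) (hk : Primrec k) :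
    Primrec fun x => ProdCode.mk (a x) (l x) (e x) (k x) :=
  (Primrec.of_equiv_symm (e := ProdCode.equivProd)).comp (ha.pair (hl.pair (he.pair hk)))

@[fun_prop] theorem grammarCode_mk {n t : α → List NodeLabel} {l f : α → List EdgeLabel}
    {p : α → List ProdCode} {s : α → NodeLabel}
    (hn : Primrec n) (ht : Primrec t) (hl : Primrec l) (hf : Primrec f) (hp : Primrec p)
    (hs : Primrec s) :
    Primrec fun x => GrammarCode.mk (n x) (t x) (l x) (f x) (p x) (s x) :=
  (Primrec.of_equiv_symm (e := GrammarCode.equivProd)).comp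
    (hn.pair (ht.pair (hl.pair (hf.pair (hp.pair hs)))))

/-! ### Tables and states -/

@[fun_prop] theorem keyAt {l : α → List ℕ} {u a v : α → ℕ} (hl : Primrec l) (hu : Primrec u)
    (ha : Primrec a) (hv : Primrec v) :
    Primrec fun x => BangGraphs.keyAt (l x) (u x) (a x) (v x) := by
  unfold BangGraphs.keyAt
  fun_prop

@[fun_prop] theorem alphaLabel {u a v : α → ℕ} (hu : Primrec u)
    (ha : Primrec a) (hv : Primrec v) :
    Primrec fun x => BangGraphs.alphaLabel (u x) (a x) (v x) := by
  unfold BangGraphs.alphaLabel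
  fun_prop

@[fun_prop] theorem stateLabel {s : α → ExpState} (hs : Primrec s) :
    Primrec fun x => BangGraphs.stateLabel (s x) := by
  unfold BangGraphs.stateLabel
  fun_prop

@[fun_prop] theorem zeroTable {n : α → ℕ} (hn : Primrec n) :
    Primrec fun x => BangGraphs.zeroTable (n x) := by
  refine Primrec.of_eq
    (f := fun x => (List.range (Nat.pair (n x) (Nat.pair (n x) (n x)))).map fun _ => 0)
    (by fun_prop) fun x => ?_
  simp [BangGraphs.zeroTable, List.map_const']

@[fun_prop] theorem startState {n k : α → ℕ} (hn : Primrec n) (hk : Primrec k) :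
    Primrec fun x => BangGraphs.startState (n x) (k x) := by
  unfold BangGraphs.startState
  fun_prop

@[fun_prop] theorem endState {n k : α → ℕ} (hn : Primrec n) (hk : Primrec k) :
    Primrec fun x => BangGraphs.endState (n x) (k x) := by
  unfold BangGraphs.endState
  fun_prop

@[fun_prop] theorem boundedLists {j k : α → ℕ} (hj : Primrec j) (hk : Primrec k) :
    Primrec fun x => BangGraphs.boundedLists (j x) (k x) := by
  have h : Primrec fun p : (α × ℕ × List (List ℕ)) =>
      p.2.2.flatMap fun l => (List.range (j p.1 + 1)).map fun e => e :: l := by fun_prop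
  refine (Primrec.nat_rec' hk (Primrec.const [[]]) h.to₂).of_eq fun x => ?_
  induction k x with
  | zero => rfl
  | succ k ih => simp only [BangGraphs.boundedLists, ← ih]

end PrimrecComp

namespace PrimrecComp

variable {α : Type} [Primcodable α] {c : α → BangCode}

@[fun_prop] theorem edgeB {u v : α → ℕ} (hc : Primrec c) (hu : Primrec u) (hv : Primrec v) :
    Primrec fun x => (c x).edgeB (u x) (v x) := by
  unfold BangCode.edgeB
  fun_prop

@[fun_prop] theorem leB {a b : α → ℕ} (hc : Primrec c) (ha : Primrec a) (hb : Primrec b) :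
    Primrec fun x => (c x).leB (a x) (b x) := by
  unfold BangCode.leB
  fun_prop

@[fun_prop] theorem insideB {b v : α → ℕ} (hc : Primrec c) (hb : Primrec b) (hv : Primrec v) :
    Primrec fun x => (c x).insideB (b x) (v x) := by
  unfold BangCode.insideB
  fun_prop

@[fun_prop] theorem labelAt {v : α → ℕ} (hc : Primrec c) (hv : Primrec v) :
    Primrec fun x => (c x).labelAt (v x) := by
  unfold BangCode.labelAt
  fun_prop

@[fun_prop] theorem runList {h p : α → ℕ} (hc : Primrec c) (hh : Primrec h) (hp : Primrec p) :
    Primrec fun x => (c x).runList (h x) (p x) := by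
  have h0 : Primrec fun x => bif decide ((c x).labelAt (h x) = .W) then [h x] else [] := by
    fun_prop
  have h1 : Primrec fun p : α × ℕ × List ℕ =>
      (List.range (c p.1).labels.length).filter fun v =>
        decide ((c p.1).labelAt v = .W) && p.2.2.any fun u => (c p.1).edgeB u v := by fun_prop
  refine (Primrec.nat_rec' hp h0 h1.to₂).of_eq fun x => ?_
  induction p x with
  | zero => rfl
  | succ k ih => simp only [BangCode.runList, ← ih]

@[fun_prop] theorem runB {h p v : α → ℕ} (hc : Primrec c) (hh : Primrec h) (hp : Primrec p)
    (hv : Primrec v) :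
    Primrec fun x => (c x).runB (h x) (p x) (v x) := by
  unfold BangCode.runB
  fun_prop

@[fun_prop] theorem linkB {u h a v : α → ℕ} (hc : Primrec c) (hu : Primrec u) (hh : Primrec h)
    (ha : Primrec a) (hv : Primrec v) :
    Primrec fun x => (c x).linkB (u x) (h x) (a x) (v x) := by
  unfold BangCode.linkB
  fun_prop

@[fun_prop] theorem leastB {v a : α → ℕ} (hc : Primrec c) (hv : Primrec v) (ha : Primrec a) :
    Primrec fun x => (c x).leastB (v x) (a x) := by
  unfold BangCode.leastB
  fun_prop

@[fun_prop] theorem ownsB {a u v : α → ℕ} (hc : Primrec c) (ha : Primrec a) (hu : Primrec u)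
    (hv : Primrec v) :
    Primrec fun x => (c x).ownsB (a x) (u x) (v x) := by
  unfold BangCode.ownsB
  fun_prop

@[fun_prop] theorem tightB {u h v : α → ℕ} (hc : Primrec c) (hu : Primrec u) (hh : Primrec h)
    (hv : Primrec v) :
    Primrec fun x => (c x).tightB (u x) (h x) (v x) := by
  unfold BangCode.tightB
  fun_prop

@[fun_prop] theorem tightNum {u a v : α → ℕ} (hc : Primrec c) (hu : Primrec u) (ha : Primrec a)
    (hv : Primrec v) :
    Primrec fun x => (c x).tightNum (u x) (a x) (v x) := by
  unfold BangCode.tightNum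
  fun_prop

@[fun_prop] theorem looseB {b u h a v : α → ℕ} (hc : Primrec c) (hb : Primrec b) (hu : Primrec u)
    (hh : Primrec h) (ha : Primrec a) (hv : Primrec v) :
    Primrec fun x => (c x).looseB (b x) (u x) (h x) (a x) (v x) := by
  unfold BangCode.looseB
  fun_prop

@[fun_prop] theorem looseNum {l : α → List ℕ} {b u a v : α → ℕ} (hc : Primrec c) (hl : Primrec l)
    (hb : Primrec b) (hu : Primrec u) (ha : Primrec a) (hv : Primrec v) :
    Primrec fun x => (c x).looseNum (l x) (b x) (u x) (a x) (v x) := by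
  unfold BangCode.looseNum
  fun_prop

@[fun_prop] theorem emitsB {l : α → List ℕ} {b v : α → ℕ} (hc : Primrec c) (hl : Primrec l)
    (hb : Primrec b) (hv : Primrec v) :
    Primrec fun x => (c x).emitsB (l x) (b x) (v x) := by
  unfold BangCode.emitsB
  -- Each of the five nested searches adds one component to the environment; the projections below
  -- name the original argument and the five bound variables.
  have hn : Primrec fun x => List.range (c x).labels.length := by fun_prop
  have h1 : Primrec fun q : ((((α × ℕ) × ℕ) × ℕ) × ℕ) × ℕ => q.1.1.1.1.1 := by fun_prop
  have h2 : Primrec fun q : ((((α × ℕ) × ℕ) × ℕ) × ℕ) × ℕ => q.1.1.1.1.2 := by fun_prop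
  have h3 : Primrec fun q : ((((α × ℕ) × ℕ) × ℕ) × ℕ) × ℕ => q.1.1.1.2 := by fun_prop
  have h4 : Primrec fun q : ((((α × ℕ) × ℕ) × ℕ) × ℕ) × ℕ => q.1.1.2 := by fun_prop
  have h5 : Primrec fun q : ((((α × ℕ) × ℕ) × ℕ) × ℕ) × ℕ => q.1.2 := by fun_prop
  have h6 : Primrec fun q : ((((α × ℕ) × ℕ) × ℕ) × ℕ) × ℕ => q.2 := by fun_prop
  have hc' := hc.comp h1
  refine and (leastB hc hv hb) (all hn (all (hn.comp (fst id)) (all (hn.comp (fst (fst id)))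
    (all (hn.comp (fst (fst (fst id)))) (all (hn.comp (fst (fst (fst (fst id)))))
    (or (not (and (linkB hc' h2 h3 h4 h5) (runB hc' h3 h6 (hv.comp h1))))
      (and (not (tightB hc' h2 h3 h5)) (not (decide_eq (getD 0 (hl.comp h1) h3)
        (Primrec.const 1))))))))))

@[fun_prop] theorem allKeys {p : α → ℕ → ℕ → ℕ → Bool} (hc : Primrec c)
    (hp : Primrec fun q : α × ℕ × ℕ × ℕ => p q.1 q.2.1 q.2.2.1 q.2.2.2) :
    Primrec fun x => (c x).allKeys fun u a v => p x u a v := by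
  unfold BangCode.allKeys
  -- Regroups the arguments from the product in the hypothesis to the nesting produced by the three
  -- searches.
  have h : Primrec fun q : ((α × ℕ) × ℕ) × ℕ => p q.1.1.1 q.1.1.2 q.1.2 q.2 :=
    hp.comp (f := fun q : α × ℕ × ℕ × ℕ => p q.1 q.2.1 q.2.2.1 q.2.2.2)
      (g := fun q : ((α × ℕ) × ℕ) × ℕ => (q.1.1.1, q.1.1.2, q.1.2, q.2)) (by fun_prop)
  fun_prop

@[fun_prop] theorem openB {l : α → List ℕ} {s t : α → ExpState} (hc : Primrec c) (hl : Primrec l)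
    (hs : Primrec s) (ht : Primrec t) :
    Primrec fun x => (c x).openB (l x) (s x) (t x) := by
  unfold BangCode.openB
  fun_prop

@[fun_prop] theorem closeB {s t : α → ExpState} (hc : Primrec c) (hs : Primrec s) (ht : Primrec t) :
    Primrec fun x => (c x).closeB (s x) (t x) := by
  unfold BangCode.closeB
  fun_prop

@[fun_prop] theorem tableList (hc : Primrec c) :
    Primrec fun x => (c x).tableList := by
  unfold BangCode.tableList
  fun_prop

@[fun_prop] theorem stateList (hc : Primrec c) :
    Primrec fun x => (c x).stateList := by
  unfold BangCode.stateList
  fun_prop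

@[fun_prop] theorem moveB {m : α → ExpMove} (hc : Primrec c) (hm : Primrec m) :
    Primrec fun x => (c x).moveB (m x) := by
  unfold BangCode.moveB
  fun_prop

@[fun_prop] theorem moveList (hc : Primrec c) :
    Primrec fun x => (c x).moveList := by
  unfold BangCode.moveList
  fun_prop

@[fun_prop] theorem moveNum {s : α → ExpState} {u a v : α → ℕ} (hc : Primrec c) (hs : Primrec s)
    (hu : Primrec u) (ha : Primrec a) (hv : Primrec v) :
    Primrec fun x => (c x).moveNum (s x) (u x) (a x) (v x) := by
  unfold BangCode.moveNum
  fun_prop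

@[fun_prop] theorem moveEdgeB {s : α → ExpState} {u v : α → ℕ} {l : α → EdgeLabel}
    (hc : Primrec c) (hs : Primrec s) (hu : Primrec u) (hl : Primrec l) (hv : Primrec v) :
    Primrec fun x => (c x).moveEdgeB (s x) (u x) (l x) (v x) := by
  unfold BangCode.moveEdgeB
  fun_prop

@[fun_prop] theorem slots {m : α → ExpMove} (hc : Primrec c) (hm : Primrec m) :
    Primrec fun x => (c x).slots (m x) := by
  unfold BangCode.slots
  fun_prop

@[fun_prop] theorem slotLabel {m : α → ExpMove} {k : α → ℕ} (hc : Primrec c) (hm : Primrec m)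
    (hk : Primrec k) :
    Primrec fun x => (c x).slotLabel (m x) (k x) := by
  unfold BangCode.slotLabel
  fun_prop

@[fun_prop] theorem rhsEdgeB {m : α → ExpMove} {k j : α → ℕ} {l : α → EdgeLabel} (hc : Primrec c)
    (hm : Primrec m) (hk : Primrec k) (hl : Primrec l) (hj : Primrec j) :
    Primrec fun x => (c x).rhsEdgeB (m x) (k x) (l x) (j x) := by
  unfold BangCode.rhsEdgeB
  fun_prop

@[fun_prop] theorem nextLevel {m : α → ExpMove} {d : α → ℕ} (hm : Primrec m) (hd : Primrec d) :
    Primrec fun x => BangCode.nextLevel (m x) (d x) := by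
  unfold BangCode.nextLevel
  fun_prop

@[fun_prop] theorem connB {m : α → ExpMove} {l l' : α → EdgeLabel} {k : α → ℕ} {d : α → Dir}
    (hc : Primrec c) (hm : Primrec m) (hl : Primrec l) (hl' : Primrec l') (hk : Primrec k)
    (hd : Primrec d) :
    Primrec fun x => (c x).connB (m x) (l x) (l' x) (k x) (d x) := by
  unfold BangCode.connB
  have h1 : Primrec fun q : ((α × ℕ) × ℕ) × ExpMove => q.1.1.1 := by fun_prop
  have h2 : Primrec fun q : ((α × ℕ) × ℕ) × ExpMove => q.1.1.2 := by fun_prop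
  have h3 : Primrec fun q : ((α × ℕ) × ℕ) × ExpMove => q.1.2 := by fun_prop
  have h4 : Primrec fun q : ((α × ℕ) × ℕ) × ExpMove => Encodable.encode q.2 := by fun_prop
  have hs : Primrec fun x => (m x).2.2 := by fun_prop
  have hk' : Primrec fun x => (k x).pred := by fun_prop
  have hin : Primrec fun x => decide (d x = .inward) := by fun_prop
  have hk0 : Primrec fun x => decide (k x = 0) := by fun_prop
  have hb : Primrec fun x => List.range ((c x).boxes + 1) := by fun_prop
  refine any (by fun_prop) (any (by fun_prop) (any (moveList (hc.comp (fst (fst id))))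
    (and (decide_eq (hl.comp h1) (alphaLabel h2 h3 h4)) (cond (hk0.comp h1)
      (decide_eq (hl'.comp h1) (alphaLabel h2 (nextLevel (hm.comp h1) h3) h4))
      (and (all (hb.comp h1) ?_) (cond (hin.comp h1)
        (moveEdgeB (hc.comp h1) (hs.comp h1) h2 (hl'.comp h1) (hk'.comp h1))
        (moveEdgeB (hc.comp h1) (hs.comp h1) (hk'.comp h1) (hl'.comp h1) h2)))))))
  have h5 := h1.comp (fst (β := ((α × ℕ) × ℕ) × ExpMove) (γ := ℕ) id)
  have h6 : Primrec fun q : (((α × ℕ) × ℕ) × ExpMove) × ℕ => q.2 := by fun_prop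
  exact decide_eq (leB (hc.comp h5) (h3.comp (fst id)) h6)
    (and (insideB (hc.comp h5) h6 (h2.comp (fst id))) (insideB (hc.comp h5) h6 (hk'.comp h5)))

@[fun_prop] theorem finalLabels (hc : Primrec c) :
    Primrec fun x => (c x).finalLabels := by
  unfold BangCode.finalLabels
  fun_prop

@[fun_prop] theorem edgeLabelList (hc : Primrec c) :
    Primrec fun x => (c x).edgeLabelList := by
  unfold BangCode.edgeLabelList
  fun_prop

@[fun_prop] theorem slotAt {m : α → ExpMove} {i : α → ℕ} (hc : Primrec c) (hm : Primrec m)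
    (hi : Primrec i) :
    Primrec fun x => (c x).slotAt (m x) (i x) := by
  unfold BangCode.slotAt
  fun_prop

@[fun_prop] theorem rhsEdges {m : α → ExpMove} (hc : Primrec c) (hm : Primrec m) :
    Primrec fun x => (c x).rhsEdges (m x) := by
  unfold BangCode.rhsEdges
  fun_prop

@[fun_prop] theorem rhsConn {m : α → ExpMove} (hc : Primrec c) (hm : Primrec m) :
    Primrec fun x => (c x).rhsConn (m x) := by
  unfold BangCode.rhsConn
  fun_prop

@[fun_prop] theorem prodCode {m : α → ExpMove} (hc : Primrec c) (hm : Primrec m) :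
    Primrec fun x => (c x).prodCode (m x) := by
  unfold BangCode.prodCode
  fun_prop

@[fun_prop] theorem finalCode (hc : Primrec c) :
    Primrec fun x => (c x).finalCode := by
  unfold BangCode.finalCode
  fun_prop

@[fun_prop] theorem grammarCode (hc : Primrec c) :
    Primrec fun x => (c x).grammarCode := by
  unfold BangCode.grammarCode
  fun_prop

end PrimrecComp

end BangGraphs
theorem mainTheorem1 :
    (∃ f : BangGraphs.BangCode → BangGraphs.GrammarCode, Computable f ∧
      ∀ (V B : Type) [Finite V] [Finite B] (H : BangGraphs.BangData V B),
        H.IsBangGraph → H.HasTrivialOverlap →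
          (∃ c : BangGraphs.BangCode, c.Describes H) ∧
          ∀ c : BangGraphs.BangCode, c.Describes H →
            ∃ G : BangGraphs.EdNCE BangGraphs.NodeLabel BangGraphs.EdgeLabel,
              (f c).Describes G ∧ G.IsLinear ∧ G.IsBangLinear ∧
              BangGraphs.EqUpToWireEncoding G.language H.language) ∧
    (∀ L ∈ BangGraphs.BGTO, ∃ M ∈ BangGraphs.LINedNCE,
      BangGraphs.EqUpToWireEncoding M L) := by
  refine ⟨⟨BangGraphs.BangCode.grammarCode,
    (BangGraphs.PrimrecComp.grammarCode Primrec.id).to_comp, fun V B _ _ H hH ht =>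
      ⟨BangGraphs.BangCode.exists_describes H, fun c hc =>
        BangGraphs.exists_grammar hH ht hc⟩⟩, ?_⟩
  rintro L ⟨V, B, _, _, H, hH, ht, rfl⟩
  obtain ⟨c, hc⟩ := BangGraphs.BangCode.exists_describes H
  obtain ⟨G, -, hl, -, he⟩ := BangGraphs.exists_grammar hH ht hc
  exact ⟨G.language, ⟨G, hl, rfl⟩, he⟩
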